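/- Let $m,N\ge 1$ be integers and $\ell\in\mathbb C$. **Affine Lie algebra.** Let $\mathfrak g=\mathfrak{sl}_m(\mathbb C)\otimes\mathbb C[t^{\pm1}]\oplus\mathbb Cc_{\mathfrak g}\oplus\mathbb Cd_{\mathfrak g}$ with $c_{\mathfrak g}$ central, $[X\otimes f,Y\otimes g]=[X,Y]\otimes fg+\operatorname{tr}(XY)\operatorname{Res}_{t=0}\!\big(\tfrac{df}{dt}g\,dt\big)c_{\mathfrak g}$ and $[d_{\mathfrak g},X\otimes f]=X\otimes t\tfrac{df}{dt}$. Put $\mathfrak g'=\mathfrak{sl}_m\otimes\mathbb C[t^{\pm1}]\oplus\mathbb Cc_{\mathfrak g}$. Let $\bar{\mathfrak h}$ be the diagonal matrices in $\mathfrak{sl}_m$, $\bar{\mathfrak n}_\pm$ the strictly upper/lower triangular matrices, $\mathfrak h=\bar{\mathfrak h}\oplus\mathbb Cc_{\mathfrak g}\oplus\mathbb Cd_{\mathfrak g}$ and $\mathfrak n_\pm=\bar{\mathfrak n}_\pm\oplus\mathfrak{sl}_m\otimes t^{\pm1}\mathbb C[t^{\pm1}]$ (only powers $t^{n}$ with $\pm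 n\ge 1$ occurring in the last summand). For $\lambda\in\mathfrak h^*$ let $\bar\lambda=\lambda|_{\bar{\mathfrak h}}$; let $M(\lambda)$ be the highest weight Verma module of highest weight $\lambda$ with generator $v(\lambda)$, and $M^\dagger(\lambda)$ the lowest weight Verma module of lowest weight $-\lambda$ with generator $v^\dagger(\lambda)$. Let $V=\mathbb C^m$ with basis $u_1,\dots,u_m$ of weights $\bar e_1,\dots,\bar e_m\in\bar{\mathfrak h}^*$. **The algebra $\mathcal H$.** Let $\bar P=\bigoplus_{i=1}^N\mathbb Z\epsilon_i$, $W=S_N\ltimes\bar P$ with $wt_\eta w^{-1}=t_{w(\eta)}$, and $\mathfrak t'=\bar{\mathfrak t}\oplus\mathbb Cc$ with $\bar{\mathfrak t}=\bigoplus_i\mathbb C\epsilon_i^\vee$. The group $W$ acts on $\mathfrak t'$: $S_N$ permutes the $\epsilon_i^\vee$ and fixes $c$, and $t_\eta(\bar\xi+kc)=\bar\xi+(k-\eta(\bar\xi))c$. Let $s_i=(i\ i{+}1)$ and $\alpha_i=\epsilon_i-\epsilon_{i+1}$ for $1\le i<N$, $s_0=t_{\epsilon_1-\epsilon_N}(1\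 N)$, $\alpha_0=-(\epsilon_1-\epsilon_N)$ on $\mathfrak t'$ (all $\alpha_i$ vanish on $c$), and $\pi=t_{\epsilon_1}s_1\cdots s_{N-1}$. The degenerate double affine Hecke algebra $\mathcal H$ is the unital associative $\mathbb C$-algebra generated by $\mathbb C[W]$ and $S[\mathfrak t']$ with the relations $s_i\xi-s_i(\xi)s_i=-\alpha_i(\xi)$ $(0\le i<N)$ and $\pi\xi=\pi(\xi)\pi$ for $\xi\in\mathfrak t'$. For $\beta=(\beta_1,\dots,\beta_m)\in\mathbb Z_{\ge0}^m$ with $\sum_a\beta_a=N$ let $S_\beta=S_{\beta_1}\times\dots\times S_{\beta_m}\subset S_N$. For $\zeta\in(\mathfrak t')^*$ with $\zeta(\epsilon_i^\vee-\epsilon_{i+1}^\vee)=-1$ whenever $s_i\in S_\beta$, let $\mathcal Y_\beta(\zeta)=\mathcal H\otimes_{\mathcal H_\beta}\mathbb C1_\zeta$, where $\mathcal H_\beta\subset\mathcal H$ is generated by $\mathfrak t'$ and $S_\beta$, $S_\beta$ fixes $1_\zeta$, and $\xi1_\zeta=\zeta(\xi)1_\zeta$ for $\xi\in\mathfrak t'$.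 Write $\mathbf 1_\zeta=1\otimes1_\zeta$. **The module $\mathcal M(\lambda,\mu)$.** For $A=M(\mu)$ and $B=M^\dagger(\lambda)$ with $\lambda(c_{\mathfrak g})=\mu(c_{\mathfrak g})=\ell$, put $$\mathcal M(\lambda,\mu)=\mathcal F(A,B)=\mathcal T/\mathfrak g'\mathcal T,\qquad \mathcal T=A\otimes\mathbb C[z_1^{\pm1},\dots,z_N^{\pm1}]\otimes V^{\otimes N}\otimes B .$$ Here $\mathfrak g$ acts diagonally through its actions $\theta_0$ on $A$, $\theta_{N+1}$ on $B$ and, for $1\le i\le N$, $\theta_i(X\otimes f)=f(z_i)\otimes X_{(i)}$ ($X_{(i)}$ being $X$ on the $i$-th tensor factor), $\theta_i(c_{\mathfrak g})=0$, $\theta_i(d_{\mathfrak g})=z_i\partial/\partial z_i$. With $E_{pq}$ the matrix units, $\{H_a\}$ and $\{J_k\}$ bases of $\bar{\mathfrak h}$ and $\mathfrak{sl}_m$ orthonormal for the trace form, let $$\bar r=\tfrac12\sum_aH_a\otimes H_a+\sum_{p<q}E_{pq}\otimes E_{qp},\qquad \Omega=\sum_kJ_k\otimes J_k,$$ $$r=\bar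 r+\tfrac12(c_{\mathfrak g}\otimes d_{\mathfrak g}+d_{\mathfrak g}\otimes c_{\mathfrak g})+\sum_{n\ge1}\sum_k(J_k\otimes t^n)\otimes(J_k\otimes t^{-n}).$$ Put $\theta_{ij}=\theta_i\otimes\theta_j$; $r_{(0i)}=\theta_{0,i}(r)$ and $r_{(i,N+1)}=\theta_{i,N+1}(r)$ for $1\le i\le N$; $r_{(ij)}=\theta_{ij}(\bar r)+\frac{z_i/z_j}{1-z_i/z_j}\theta_{ij}(\Omega)$ for $1\le i<j\le N$. Let $\rho^\vee=\bar\rho^\vee+m\,d_{\mathfrak g}$, where $\bar\rho^\vee$ is half the sum of the positive coroots of $\mathfrak{sl}_m$, and for $1\le i\le N$ let $$\nabla_i=\sum_{0\le j<i}r_{(ji)}-\sum_{i<j\le N+1}r_{(ij)}+\theta_i(\rho^\vee).$$ Let $\tau(w)$, $w\in S_N$, permute the variables $z_i$ and the factors of $V^{\otimes N}$ simultaneously ($z_i\mapsto z_{w(i)}$, and the $i$-th factor is moved to place $w(i)$). For $\xi=\sum_i\xi_i\epsilon_i^\vee\in\bar{\mathfrak t}$ let $$\mathcal D_\xi=\sum_i\xi_i\nabla_i+\sum_{i<j}(\xi_i-\xi_j)\frac{1-\tau((i\,j))}{1-z_j/z_i}-\tfrac12\sum_{i<j}(\xi_i-\xi_j)-\frac{m-1}{2m}\,\partial_\xi\log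 G,$$ where $G=\prod_{i\ne j}(1-z_j/z_i)$ and $\partial_\xi=\sum_i\xi_iz_i\partial/\partial z_i$. Individual terms have coefficients in $\mathbb C(z_1,\dots,z_N)$. **Statement.** Let $\lambda,\mu\in\mathfrak h^*$ with $\lambda(c_{\mathfrak g})=\mu(c_{\mathfrak g})=\ell$. (0) Each $\mathcal D_\xi$ maps $\mathcal T$ to $\mathcal T$, and there is a unique $\mathcal H$-module structure on $\mathcal M(\lambda,\mu)$ in which $c$ acts as $\ell+m$, $w\in S_N$ as $\tau(w)$, $t_\eta$ as multiplication by $z_1^{\eta_1}\cdots z_N^{\eta_N}$, and $\xi\in\bar{\mathfrak t}$ as $\mathcal D_\xi$. (1) Suppose that $\bar\lambda-\bar\mu$ is a weight of the $\mathfrak{sl}_m$-module $V^{\otimes N}$. Then there is a unique $\beta=(\beta_1,\dots,\beta_m)\in\mathbb Z_{\ge0}^m$ with $\sum_a\beta_a=N$ and $\bar\lambda-\bar\mu=\sum_a\beta_a\bar e_a$; denote it by $\beta_{\lambda,\mu}$. Put $\mu_a=(\bar\mu,\bar e_a)$ (the form dual to the trace form) and let $\zeta_{\lambda,\mu}\in(\mathfrak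 t')^*$ be defined by $\zeta_{\lambda,\mu}(c)=\ell+m$ and $$\zeta_{\lambda,\mu}(\epsilon_k^\vee)=\mu_a+q-a+\frac{m^2-N}{2m}\quad\text{if }k=\beta_1+\dots+\beta_{a-1}+q,\ 1\le q\le\beta_a .$$ Then $\mathcal Y_{\beta_{\lambda,\mu}}(\zeta_{\lambda,\mu})$ is defined, that is, $\zeta_{\lambda,\mu}(\epsilon_i^\vee-\epsilon_{i+1}^\vee)=-1$ whenever $s_i\in S_{\beta_{\lambda,\mu}}$, and there is a unique isomorphism of $\mathcal H$-modules $\mathcal M(\lambda,\mu)\cong\mathcal Y_{\beta_{\lambda,\mu}}(\zeta_{\lambda,\mu})$ which sends the class of $u_{\lambda,\mu}=v(\mu)\otimes 1\otimes u_1^{\otimes\beta_1}\otimes\cdots\otimes u_m^{\otimes\beta_m}\otimes v^\dagger(\lambda)$ to $\mathbf 1_{\zeta_{\lambda,\mu}}$. (2) If $\bar\lambda-\bar\mu$ is not a weight of $V^{\otimes N}$, then $\mathcal M(\lambda,\mu)=0$. -/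

import Mathlib

open scoped TensorProduct

noncomputable section

namespace KZHecke

/-- For an additive `χ`, the operator `e^η ↦ χ(η) e^η` on a group algebra. -/
def monomialDer {M : Type} [AddCommGroup M] (χ : M →+ ℂ) :
    AddMonoidAlgebra ℂ M →ₗ[ℂ] AddMonoidAlgebra ℂ M :=
  (AddMonoidAlgebra.basis M ℂ).constr ℂ fun η => AddMonoidAlgebra.single η (χ η)

theorem monomialDer_single {M : Type} [AddCommGroup M] (χ : M →+ ℂ) (η : M) (a : ℂ) :
    monomialDer χ (AddMonoidAlgebra.single η a) = AddMonoidAlgebra.single η (a * χ η) := by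
  have h := (AddMonoidAlgebra.basis M ℂ).constr_basis ℂ
    (fun η => AddMonoidAlgebra.single η (χ η)) η
  have h1 : AddMonoidAlgebra.single η a = a • (AddMonoidAlgebra.basis M ℂ η) := by
    simp
  rw [h1, map_smul, monomialDer, h]
  simp

theorem monomialDer_mul {M : Type} [AddCommGroup M] (χ : M →+ ℂ) (f g : AddMonoidAlgebra ℂ M) :
    monomialDer χ (f * g) = monomialDer χ f * g + f * monomialDer χ g := by
  induction f using AddMonoidAlgebra.induction_linear with
  | zero => simp
  | add f₁ f₂ h₁ h₂ => rw [add_mul, map_add, h₁, h₂, map_add]; ring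
  | single a r =>
    induction g using AddMonoidAlgebra.induction_linear with
    | zero => simp
    | add f₁ f₂ h₁ h₂ => rw [mul_add, map_add, h₁, h₂, map_add]; ring
    | single b s =>
      rw [AddMonoidAlgebra.single_mul_single, monomialDer_single, monomialDer_single,
        monomialDer_single, AddMonoidAlgebra.single_mul_single, AddMonoidAlgebra.single_mul_single,
        ← AddMonoidAlgebra.single_add, map_add]
      congr 1
      ring

/-- `ℂ[t, t⁻¹]`; the monomial `t^n` is `single n 1`. -/
abbrev Laurent : Type := AddMonoidAlgebra ℂ ℤ

/-- The derivation `t d/dt`. -/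
def tDer : Laurent →ₗ[ℂ] Laurent := monomialDer (Int.castAddHom ℂ)

/-- The constant term of a Laurent polynomial: `Res_{t=0} f dt/t`. -/
def constTerm : Laurent →ₗ[ℂ] ℂ := (AddMonoidAlgebra.basis ℤ ℂ).coord 0

theorem constTerm_tDer (f : Laurent) : constTerm (tDer f) = 0 := by
  induction f using AddMonoidAlgebra.induction_linear with
  | zero => simp
  | add f g hf hg => rw [map_add, map_add, hf, hg, add_zero]
  | single a r =>
    rw [tDer, monomialDer_single, constTerm, Module.Basis.coord_apply]
    by_cases h : a = 0
    · simp [h]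
    · have h1 : AddMonoidAlgebra.single a (r * (Int.castAddHom ℂ) a) =
        (r * (Int.castAddHom ℂ) a) • (AddMonoidAlgebra.basis ℤ ℂ a) := by
        rw [AddMonoidAlgebra.basis_apply, AddMonoidAlgebra.smul_single, smul_eq_mul, mul_one]
      rw [h1, map_smul, Module.Basis.repr_self]
      simp [h]

/-- `sl_m ⊗ ℂ[t, t⁻¹]`: the trace-zero matrices with Laurent polynomial entries. -/
abbrev LoopSl (m : ℕ) : Type := LieAlgebra.SpecialLinear.sl (Fin m) Laurent

theorem trace_loop {m : ℕ} (x : LoopSl m) : Matrix.trace x.val = 0 := x.property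

/-- `t d/dt` applied to the entries of a matrix. -/
def matDer (m : ℕ) : Matrix (Fin m) (Fin m) Laurent →ₗ[ℂ] Matrix (Fin m) (Fin m) Laurent :=
  tDer.mapMatrix

theorem matDer_mul (m : ℕ) (x y : Matrix (Fin m) (Fin m) Laurent) :
    matDer m (x * y) = matDer m x * y + x * matDer m y := by
  ext i j : 1
  simp [matDer, Matrix.mul_apply, tDer, monomialDer_mul, Finset.sum_add_distrib]

theorem trace_matDer (m : ℕ) (x : Matrix (Fin m) (Fin m) Laurent) :
    Matrix.trace (matDer m x) = tDer (Matrix.trace x) := by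
  simp [matDer, Matrix.trace]

/-- `X ⊗ f ↦ X ⊗ t df/dt`. -/
def loopDer (m : ℕ) : LoopSl m →ₗ[ℂ] LoopSl m where
  toFun x := ⟨matDer m x.val, by
    change Matrix.trace (matDer m x.val) = 0
    rw [trace_matDer, trace_loop, map_zero]⟩
  map_add' x y := Subtype.ext (by simp)
  map_smul' a x := Subtype.ext (by simp)

/-- The cocycle `(X ⊗ f, Y ⊗ g) ↦ tr(XY) Res_{t=0} (df/dt) g dt`. -/
def loopCocycle {m : ℕ} (x y : LoopSl m) : ℂ :=
  constTerm (Matrix.trace (matDer m x.val * y.val))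

theorem constTerm_trace_matDer {m : ℕ} (x : Matrix (Fin m) (Fin m) Laurent) :
    constTerm (Matrix.trace (matDer m x)) = 0 := by
  rw [trace_matDer, constTerm_tDer]

/-- The affine Lie algebra `𝔤 = sl_m ⊗ ℂ[t, t⁻¹] ⊕ ℂ c ⊕ ℂ d`. -/
@[ext]
structure AffineSl (m : ℕ) : Type where
  loop : LoopSl m
  c : ℂ
  d : ℂ

namespace AffineSl

variable {m : ℕ}

/-- The underlying vector space. -/
def toProd (m : ℕ) : AffineSl m ≃ LoopSl m × ℂ × ℂ where
  toFun x := (x.loop, x.c, x.d)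
  invFun p := ⟨p.1, p.2.1, p.2.2⟩
  left_inv _ := rfl
  right_inv _ := rfl

instance : AddCommGroup (AffineSl m) := (toProd m).addCommGroup

instance : Module ℂ (AffineSl m) := (toProd m).module ℂ

@[simp] theorem zero_loop : (0 : AffineSl m).loop = 0 := rfl
@[simp] theorem zero_c : (0 : AffineSl m).c = 0 := rfl
@[simp] theorem zero_d : (0 : AffineSl m).d = 0 := rfl
@[simp] theorem add_loop (x y : AffineSl m) : (x + y).loop = x.loop + y.loop := rfl
@[simp] theorem add_c (x y : AffineSl m) : (x + y).c = x.c + y.c := rfl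
@[simp] theorem add_d (x y : AffineSl m) : (x + y).d = x.d + y.d := rfl
@[simp] theorem smul_loop (a : ℂ) (x : AffineSl m) : (a • x).loop = a • x.loop := rfl
@[simp] theorem smul_c (a : ℂ) (x : AffineSl m) : (a • x).c = a * x.c := rfl
@[simp] theorem smul_d (a : ℂ) (x : AffineSl m) : (a • x).d = a * x.d := rfl

/-- `[X ⊗ f, Y ⊗ g] = [X, Y] ⊗ fg + tr(XY) Res((df/dt) g dt) c`, `[d, X ⊗ f] = X ⊗ t df/dt`,
`c` central. -/
instance : Bracket (AffineSl m) (AffineSl m) where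
  bracket x y :=
    ⟨⁅x.loop, y.loop⁆ + x.d • loopDer m y.loop - y.d • loopDer m x.loop,
      loopCocycle x.loop y.loop, 0⟩

theorem lie_def (x y : AffineSl m) :
    ⁅x, y⁆ = ⟨⁅x.loop, y.loop⁆ + x.d • loopDer m y.loop - y.d • loopDer m x.loop,
      loopCocycle x.loop y.loop, 0⟩ := rfl

theorem ext_val {x y : AffineSl m} (h1 : x.loop.val = y.loop.val) (h2 : x.c = y.c)
    (h3 : x.d = y.d) : x = y := AffineSl.ext (Subtype.ext h1) h2 h3

theorem lie_loop_val (x y : AffineSl m) :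
    ⁅x, y⁆.loop.val = x.loop.val * y.loop.val - y.loop.val * x.loop.val +
      x.d • matDer m y.loop.val - y.d • matDer m x.loop.val := rfl

theorem lie_c (x y : AffineSl m) :
    ⁅x, y⁆.c = constTerm (Matrix.trace (matDer m x.loop.val * y.loop.val)) := rfl

theorem lie_d (x y : AffineSl m) : ⁅x, y⁆.d = 0 := rfl

theorem add_loop_val (x y : AffineSl m) : (x + y).loop.val = x.loop.val + y.loop.val := rfl
theorem smul_loop_val (a : ℂ) (x : AffineSl m) : (a • x).loop.val = a • x.loop.val := rfl
theorem zero_loop_val : (0 : AffineSl m).loop.val = 0 := rfl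

theorem jacobi_c (m : ℕ) (x y z : Matrix (Fin m) (Fin m) Laurent) (a b e : ℂ) :
    constTerm (Matrix.trace (matDer m x * (y * z - z * y + b • matDer m z - e • matDer m y))) =
    constTerm (Matrix.trace (matDer m (x * y - y * x + a • matDer m y - b • matDer m x) * z)) +
    constTerm (Matrix.trace (matDer m y * (x * z - z * x + a • matDer m z - e • matDer m x))) := by
  have h1 := constTerm_trace_matDer (matDer m y * z)
  have h2 := constTerm_trace_matDer (matDer m x * z)
  rw [matDer_mul, Matrix.trace_add, map_add] at h1 h2
  have h3 : Matrix.trace (matDer m x * (z * y)) = Matrix.trace (y * (matDer m x * z)) := by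
    rw [← mul_assoc, Matrix.trace_mul_comm]
  have h4 : Matrix.trace (x * (matDer m y * z)) = Matrix.trace (matDer m y * (z * x)) := by
    rw [Matrix.trace_mul_comm, mul_assoc]
  have h5 : Matrix.trace (matDer m y * matDer m x) = Matrix.trace (matDer m x * matDer m y) :=
    Matrix.trace_mul_comm _ _
  simp only [map_add, map_sub, map_smul, matDer_mul, mul_add, add_mul, mul_sub, sub_mul,
    mul_assoc, Matrix.mul_smul, Matrix.smul_mul, Matrix.trace_add, Matrix.trace_sub,
    Matrix.trace_smul, smul_eq_mul, h3, h4, h5]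
  linear_combination b * h2 - a * h1

instance : LieRing (AffineSl m) where
  add_lie x y z := by
    refine ext_val ?_ ?_ ?_
    · simp only [lie_loop_val, add_loop_val, add_d, map_add, add_mul, mul_add]
      module
    · simp only [lie_c, add_c, add_loop_val, map_add, add_mul, Matrix.trace_add]
    · simp only [lie_d, add_d, add_zero]
  lie_add x y z := by
    refine ext_val ?_ ?_ ?_
    · simp only [lie_loop_val, add_loop_val, add_d, map_add, add_mul, mul_add]
      module
    · simp only [lie_c, add_c, add_loop_val, map_add, mul_add, Matrix.trace_add]
    · simp only [lie_d, add_d, add_zero]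
  lie_self x := by
    refine ext_val ?_ ?_ ?_
    · simp only [lie_loop_val, zero_loop_val]
      abel
    · have h := constTerm_trace_matDer (x.loop.val * x.loop.val)
      rw [matDer_mul, Matrix.trace_add, map_add, Matrix.trace_mul_comm x.loop.val] at h
      simp only [lie_c, zero_c]
      linear_combination h / 2
    · simp only [lie_d, zero_d]
  leibniz_lie x y z := by
    refine ext_val ?_ ?_ ?_
    · simp only [lie_loop_val, lie_d, add_loop_val, map_add, map_sub, map_smul, matDer_mul, mul_add,
        add_mul, mul_sub, sub_mul, smul_add, smul_sub, mul_assoc, Matrix.mul_smul, Matrix.smul_mul]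
      module
    · simp only [lie_c, add_c, lie_loop_val]
      exact jacobi_c m _ _ _ _ _ _
    · simp only [lie_d, add_d, add_zero]

instance : LieAlgebra ℂ (AffineSl m) where
  lie_smul a x y := by
    refine ext_val ?_ ?_ ?_
    · simp only [lie_loop_val, smul_loop_val, smul_d, map_smul, Matrix.mul_smul, Matrix.smul_mul]
      module
    · simp only [lie_c, smul_c, smul_loop_val, Matrix.mul_smul, Matrix.trace_smul, map_smul,
        smul_eq_mul]
    · simp only [lie_d, smul_d, mul_zero]

end AffineSl

/-- The trace-zero part of the matrix unit `E_pq`. For `p ≠ q` it is the root vector `E_pq`; for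
`p = q` it is `E_pp - 1/m`, the element of the Cartan subalgebra dual to the weight of the `p`-th
basis vector of `ℂ^m`. -/
def slUnit {m : ℕ} (p q : Fin m) : LieAlgebra.SpecialLinear.sl (Fin m) ℂ :=
  ⟨Matrix.single p q 1 - if p = q then (1 / (m : ℂ)) • (1 : Matrix (Fin m) (Fin m) ℂ) else 0, by
    change Matrix.trace (Matrix.single p q (1 : ℂ) -
      if p = q then (1 / (m : ℂ)) • (1 : Matrix (Fin m) (Fin m) ℂ) else 0) = 0
    have hm : (m : ℂ) ≠ 0 := Nat.cast_ne_zero.mpr (Nat.pos_iff_ne_zero.mp p.pos)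
    rw [Matrix.trace_sub]
    split_ifs with h
    · subst h
      simp [hm]
    · simp [h]⟩

namespace AffineSl

variable {m : ℕ}

/-- The element `x ⊗ t^n`. -/
def tmul (n : ℤ) (x : LieAlgebra.SpecialLinear.sl (Fin m) ℂ) : AffineSl m :=
  ⟨⟨x.val.map (AddMonoidAlgebra.singleAddHom n), by
    change Matrix.trace (x.val.map (AddMonoidAlgebra.singleAddHom n)) = 0
    have hx : Matrix.trace x.val = 0 := x.property
    rw [← AddMonoidHom.map_trace (AddMonoidAlgebra.singleAddHom n) x.val, hx, map_zero]⟩, 0, 0⟩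

/-- The central element `c`. -/
def central : AffineSl m := ⟨0, 1, 0⟩

/-- The degree element `d`. -/
def degree : AffineSl m := ⟨0, 0, 1⟩

/-- `e_pq ⊗ t^n`, where `e_pq` is the trace-zero part of the matrix unit `E_pq`. -/
def unit (n : ℤ) (p q : Fin m) : AffineSl m := tmul n (slUnit p q)

end AffineSl

/-- The diagonal Cartan subalgebra of `sl_m`. -/
def CartanBar (m : ℕ) : Submodule ℂ (LieAlgebra.SpecialLinear.sl (Fin m) ℂ) where
  carrier := {x | x.val.IsDiag}
  add_mem' hx hy := hx.add hy
  zero_mem' := Matrix.isDiag_zero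
  smul_mem' a _ hx := hx.smul a

/-- The Cartan subalgebra `𝔥 = 𝔥bar ⊕ ℂ c ⊕ ℂ d` of the affine Lie algebra. -/
abbrev Cartan (m : ℕ) : Type := CartanBar m × ℂ × ℂ

/-- The inclusion of the Cartan subalgebra. -/
def Cartan.incl {m : ℕ} (h : Cartan m) : AffineSl m :=
  AffineSl.tmul 0 h.1.val + h.2.1 • AffineSl.central + h.2.2 • AffineSl.degree

/-- Weights: elements of `𝔥^*`. -/
abbrev Weight (m : ℕ) : Type := Module.Dual ℂ (Cartan m)

/-- The value of a weight at `c`. -/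
def Weight.level {m : ℕ} (lam : Weight m) : ℂ := lam (0, 1, 0)

/-- The classical part of a weight: its restriction to `𝔥bar`. -/
def Weight.bar {m : ℕ} (lam : Weight m) : Module.Dual ℂ (CartanBar m) :=
  lam ∘ₗ LinearMap.inl ℂ (CartanBar m) (ℂ × ℂ)

/-- `𝔫_+ = 𝔫bar_+ ⊕ sl_m ⊗ t ℂ[t]`. -/
def nPos (m : ℕ) : Submodule ℂ (AffineSl m) :=
  Submodule.span ℂ ({y | ∃ p q : Fin m, p < q ∧ y = AffineSl.unit 0 p q} ∪
    {y | ∃ (n : ℤ) (x : LieAlgebra.SpecialLinear.sl (Fin m) ℂ), 0 < n ∧ y = AffineSl.tmul n x})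

/-- `𝔫_- = 𝔫bar_- ⊕ sl_m ⊗ t⁻¹ ℂ[t⁻¹]`. -/
def nNeg (m : ℕ) : Submodule ℂ (AffineSl m) :=
  Submodule.span ℂ ({y | ∃ p q : Fin m, q < p ∧ y = AffineSl.unit 0 p q} ∪
    {y | ∃ (n : ℤ) (x : LieAlgebra.SpecialLinear.sl (Fin m) ℂ), n < 0 ∧ y = AffineSl.tmul n x})

/-- The universal enveloping algebra of the affine Lie algebra. -/
abbrev UAffine (m : ℕ) : Type := UniversalEnvelopingAlgebra ℂ (AffineSl m)

/-- The left ideal of the enveloping algebra generated by `n` and the elements `h - χ(h)` with `h`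
in the Cartan subalgebra. -/
def vermaIdeal {m : ℕ} (n : Submodule ℂ (AffineSl m)) (χ : Weight m) :
    Submodule (UAffine m) (UAffine m) :=
  Submodule.span (UAffine m)
    ({u | ∃ y ∈ n, u = UniversalEnvelopingAlgebra.ι ℂ y} ∪
      {u | ∃ h : Cartan m, u = UniversalEnvelopingAlgebra.ι ℂ h.incl -
        algebraMap ℂ (UAffine m) (χ h)})

/-- The module generated by one vector of weight `χ` annihilated by `n`: for `n = 𝔫_+`
(resp. `n = 𝔫_-`) the highest (resp. lowest) weight Verma module with highest (resp. lowest)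
weight `χ`. -/
def VermaModule {m : ℕ} (n : Submodule ℂ (AffineSl m)) (χ : Weight m) : Type :=
  UAffine m ⧸ vermaIdeal n χ

namespace VermaModule

variable {m : ℕ} (n : Submodule ℂ (AffineSl m)) (χ : Weight m)

instance : AddCommGroup (VermaModule n χ) :=
  inferInstanceAs (AddCommGroup (UAffine m ⧸ vermaIdeal n χ))

instance : Module (UAffine m) (VermaModule n χ) :=
  inferInstanceAs (Module (UAffine m) (UAffine m ⧸ vermaIdeal n χ))

instance : Module ℂ (VermaModule n χ) :=
  inferInstanceAs (Module ℂ (UAffine m ⧸ vermaIdeal n χ))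

instance : IsScalarTower ℂ (UAffine m) (VermaModule n χ) :=
  inferInstanceAs (IsScalarTower ℂ (UAffine m) (UAffine m ⧸ vermaIdeal n χ))

instance : LieRingModule (AffineSl m) (VermaModule n χ) where
  bracket y v := UniversalEnvelopingAlgebra.ι ℂ y • v
  add_lie x y v := by
    change UniversalEnvelopingAlgebra.ι ℂ (x + y) • v = _ • v + _ • v
    rw [map_add, add_smul]
  lie_add x v w := smul_add _ v w
  leibniz_lie x y v := by
    change UniversalEnvelopingAlgebra.ι ℂ x • UniversalEnvelopingAlgebra.ι ℂ y • v =
      UniversalEnvelopingAlgebra.ι ℂ ⁅x, y⁆ • v +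
        UniversalEnvelopingAlgebra.ι ℂ y • UniversalEnvelopingAlgebra.ι ℂ x • v
    let _ : LieRing (UAffine m) := LieRing.ofAssociativeRing
    let _ : LieAlgebra ℂ (UAffine m) := LieAlgebra.ofAssociativeAlgebra
    rw [LieHom.map_lie, LieRing.of_associative_ring_bracket, sub_smul, mul_smul, mul_smul,
      sub_add_cancel]

instance : LieModule ℂ (AffineSl m) (VermaModule n χ) where
  smul_lie a x v := by
    change UniversalEnvelopingAlgebra.ι ℂ (a • x) • v = a • UniversalEnvelopingAlgebra.ι ℂ x • v
    rw [map_smul, smul_assoc]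
  lie_smul a x v := by
    change UniversalEnvelopingAlgebra.ι ℂ x • a • v = a • UniversalEnvelopingAlgebra.ι ℂ x • v
    rw [← algebraMap_smul (UAffine m) a v, ← algebraMap_smul (UAffine m) a
      (UniversalEnvelopingAlgebra.ι ℂ x • v), ← mul_smul, ← mul_smul, Algebra.commutes]

/-- The generating vector. -/
def vac : VermaModule n χ := (vermaIdeal n χ).mkQ 1

end VermaModule

/-- The highest weight Verma module `M(μ)` with highest weight `μ`. -/
abbrev HighestVerma {m : ℕ} (mu : Weight m) : Type := VermaModule (nPos m) mu

/-- The lowest weight Verma module `M†(λ)` with lowest weight `-λ`. -/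
abbrev LowestVerma {m : ℕ} (lam : Weight m) : Type := VermaModule (nNeg m) (-lam)

section Tensor

/-- `ℂ[Pbar]`, the Laurent polynomials in `z_1, …, z_N`; the monomial `e^η` is `single η 1`. -/
abbrev MultiLaurent (N : ℕ) : Type := AddMonoidAlgebra ℂ (Fin N → ℤ)

/-- The rational functions in `z_1, …, z_N`. -/
abbrev RatFun (N : ℕ) : Type := FractionRing (MultiLaurent N)

/-- The monomial `e^η`. -/
def expMon {N : ℕ} (η : Fin N → ℤ) : MultiLaurent N := AddMonoidAlgebra.single η 1

/-- The `i`-th coordinate `z_i` as a rational function. -/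
def zVar {N : ℕ} (i : Fin N) : RatFun N :=
  algebraMap (MultiLaurent N) (RatFun N) (expMon (Pi.single i 1))

/-- The derivation `∂_ξ` of `ℂ[Pbar]`, `∂_ξ e^η = η(ξ) e^η`. -/
def partialXi {N : ℕ} (ξ : Fin N → ℂ) : MultiLaurent N →ₗ[ℂ] MultiLaurent N :=
  monomialDer
    { toFun := fun η => ∑ i, (η i : ℂ) * ξ i
      map_zero' := by simp
      map_add' := fun η θ => by simp [add_mul, Finset.sum_add_distrib] }

/-- The substitution `f(t) ↦ f(z_i)`. -/
def evalVar {N : ℕ} (i : Fin N) : Laurent →ₐ[ℂ] MultiLaurent N :=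
  AddMonoidAlgebra.mapDomainAlgHom ℂ ℂ (AddMonoidHom.single (fun _ : Fin N => ℤ) i)

/-- `(ℂ^m)^{⊗N}`. -/
abbrev TensorPow (N m : ℕ) : Type := ⨂[ℂ] _ : Fin N, (Fin m → ℂ)

/-- A matrix acting on the `i`-th factor of `(ℂ^m)^{⊗N}`. -/
def slotAct {N m : ℕ} (i : Fin N) (x : Matrix (Fin m) (Fin m) ℂ) :
    TensorPow N m →ₗ[ℂ] TensorPow N m :=
  PiTensorProduct.map (Function.update (fun _ => LinearMap.id) i (Matrix.toLin' x))

/-- The set of weights of the `sl_m`-module `(ℂ^m)^{⊗N}`. -/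
def wtTensorPow (N m : ℕ) : Set (Module.Dual ℂ (CartanBar m)) :=
  {χ | ∃ v : TensorPow N m, v ≠ 0 ∧
    ∀ h : CartanBar m, (∑ i : Fin N, slotAct i h.val.val) v = χ h • v}

/-- The weight `ebar_a` of the `a`-th basis vector of `ℂ^m`. -/
def eBar {m : ℕ} (a : Fin m) : Module.Dual ℂ (CartanBar m) where
  toFun h := h.val.val a a
  map_add' _ _ := rfl
  map_smul' _ _ := rfl

/-- The action of a permutation on the weight lattice `Pbar = ℤ^N`, `w(ε_i) = ε_{w(i)}`. -/
def permLattice {N : ℕ} (w : Equiv.Perm (Fin N)) : (Fin N → ℤ) ≃+ (Fin N → ℤ) where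
  toFun η := η ∘ w.symm
  invFun η := η ∘ w
  left_inv η := by ext i; simp
  right_inv η := by ext i; simp
  map_add' _ _ := rfl

variable (N : ℕ) {m : ℕ} (A B : Type)
  [AddCommGroup A] [Module ℂ A] [LieRingModule (AffineSl m) A] [LieModule ℂ (AffineSl m) A]
  [AddCommGroup B] [Module ℂ B] [LieRingModule (AffineSl m) B] [LieModule ℂ (AffineSl m) B]

/-- `A ⊗ ℂ[Pbar] ⊗ (ℂ^m)^{⊗N} ⊗ B`, with the factor `ℂ[Pbar]` written first. -/
abbrev BigSpace (m : ℕ) (A B : Type) [AddCommGroup A] [Module ℂ A] [AddCommGroup B]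
    [Module ℂ B] : Type :=
  MultiLaurent N ⊗[ℂ] (A ⊗[ℂ] (TensorPow N m ⊗[ℂ] B))

/-- The same space with rational functions in place of Laurent polynomials. -/
abbrev BigSpaceRat (m : ℕ) (A B : Type) [AddCommGroup A] [Module ℂ A] [AddCommGroup B]
    [Module ℂ B] : Type :=
  RatFun N ⊗[ℂ] (A ⊗[ℂ] (TensorPow N m ⊗[ℂ] B))

/-- The inclusion of `BigSpace` in `BigSpaceRat`. -/
def toRat (m : ℕ) (A B : Type) [AddCommGroup A] [Module ℂ A] [AddCommGroup B] [Module ℂ B] :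
    BigSpace N m A B →ₗ[ℂ] BigSpaceRat N m A B :=
  (IsScalarTower.toAlgHom ℂ (MultiLaurent N) (RatFun N)).toLinearMap.rTensor _

/-- `θ_0`: the action on the factor `A`. -/
def thetaA (y : AffineSl m) : Module.End ℂ (BigSpace N m A B) :=
  ((LieModule.toEnd ℂ (AffineSl m) A y).rTensor (TensorPow N m ⊗[ℂ] B)).lTensor (MultiLaurent N)

/-- `θ_{N+1}`: the action on the factor `B`. -/
def thetaB (y : AffineSl m) : Module.End ℂ (BigSpace N m A B) :=
  (((LieModule.toEnd ℂ (AffineSl m) B y).lTensor (TensorPow N m)).lTensor A).lTensor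
    (MultiLaurent N)

variable {N}

/-- `θ_i` for `1 ≤ i ≤ N`: the action on the evaluation module `ℂ[z_i, z_i⁻¹] ⊗ ℂ^m`, where
`X ⊗ f(t)` acts as `f(z_i) ⊗ X`, `c` acts as `0` and `d` acts as `z_i ∂/∂z_i`. -/
def theta (i : Fin N) (y : AffineSl m) : Module.End ℂ (BigSpace N m A B) :=
  (∑ p : Fin m, ∑ q : Fin m,
    TensorProduct.map (LinearMap.mulLeft ℂ (evalVar i (y.loop.val p q)))
      (((slotAct i (Matrix.single p q 1)).rTensor B).lTensor A)) +
    y.d • (partialXi (Pi.single i 1)).rTensor _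

variable (N)

/-- The diagonal action of the affine Lie algebra. -/
def thetaDiag (y : AffineSl m) : Module.End ℂ (BigSpace N m A B) :=
  thetaA N A B y + ∑ i : Fin N, theta A B i y + thetaB N A B y

/-- `𝔤' · (A ⊗ ℂ[Pbar] ⊗ (ℂ^m)^{⊗N} ⊗ B)`, where `𝔤' = sl_m ⊗ ℂ[t, t⁻¹] ⊕ ℂ c`. -/
def coinvSub : Submodule ℂ (BigSpace N m A B) :=
  Submodule.span ℂ {v | ∃ (y : AffineSl m) (u : BigSpace N m A B), y.d = 0 ∧
    v = thetaDiag N A B y u}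

/-- The space of coinvariants `F(A, B)`. -/
abbrev Coinv : Type := BigSpace N m A B ⧸ coinvSub (m := m) N A B

variable {N A B}

/-- The class in `F(A, B)` of a vector. -/
def coinvMk (v : BigSpace N m A B) : Coinv (m := m) N A B := (coinvSub N A B).mkQ v

variable (A B)

/-- The action `τ` of a permutation, permuting simultaneously the variables `z_i` and the tensor
factors `ℂ^m`. -/
def tau (m : ℕ) (A B : Type) [AddCommGroup A] [Module ℂ A] [AddCommGroup B] [Module ℂ B]
    (w : Equiv.Perm (Fin N)) : Module.End ℂ (BigSpace N m A B) :=
  TensorProduct.map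
    (AddMonoidAlgebra.mapDomainAlgHom ℂ ℂ (permLattice w).toAddMonoidHom).toLinearMap
    (((PiTensorProduct.reindex ℂ (fun _ : Fin N => Fin m → ℂ) w).toLinearMap.rTensor B).lTensor A)

variable {A B}

section Operators

variable {E : Type} [AddCommGroup E] [Module ℂ E] {m : ℕ}

/-- The tensor `rbar = ½ ∑ H_a ⊗ H_a + ∑_{γ > 0} E_γ ⊗ E_{-γ}`, acting through `f` in the first
factor and `g` in the second. Here `∑ H_a ⊗ H_a`, for an orthonormal basis of the Cartan
subalgebra, is written as the equal tensor `∑_p e_pp ⊗ e_pp`. -/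
def rBarOp (f g : AffineSl m → Module.End ℂ E) : Module.End ℂ E :=
  (1 / 2 : ℂ) • (∑ p : Fin m, f (AffineSl.unit 0 p p) * g (AffineSl.unit 0 p p)) +
    ∑ p : Fin m, ∑ q : Fin m,
      if p < q then f (AffineSl.unit 0 p q) * g (AffineSl.unit 0 q p) else 0

/-- The tensor `∑_k (J_k ⊗ t^n) ⊗ (J_k ⊗ t^{-n})` for an orthonormal basis `J_k` of `sl_m`, written
as the equal tensor `∑_{p,q} (e_pq ⊗ t^n) ⊗ (e_qp ⊗ t^{-n})`. For `n = 0` this is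
`Ω = rbar + T(rbar)`. -/
def casimirOp (n : ℤ) (f g : AffineSl m → Module.End ℂ E) : Module.End ℂ E :=
  ∑ p : Fin m, ∑ q : Fin m, f (AffineSl.unit n p q) * g (AffineSl.unit (-n) q p)

/-- The universal classical `r`-matrix
`rbar + ½ (c ⊗ d + d ⊗ c) + ∑_{n ≥ 1} ∑_k (J_k ⊗ t^n) ⊗ (J_k ⊗ t^{-n})`, acting through `f` and `g`
on a vector on which all but finitely many terms of the sum over `n` vanish. -/
def rUnivOp (f g : AffineSl m → Module.End ℂ E) (v : E) : E :=
  rBarOp f g v +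
    (1 / 2 : ℂ) • (f AffineSl.central (g AffineSl.degree v) +
      f AffineSl.degree (g AffineSl.central v)) +
    ∑ᶠ n : ℕ, casimirOp ((n : ℤ) + 1) f g v

end Operators

/-- `ρ^∨ = ρbar^∨ + m d`, where `ρbar^∨` is half the sum of the positive coroots of `sl_m`. -/
def rhoCheck (m : ℕ) : AffineSl m :=
  (1 / 2 : ℂ) • (∑ p : Fin m, ∑ q : Fin m,
    if p < q then AffineSl.unit 0 p p - AffineSl.unit 0 q q else 0) + (m : ℂ) • AffineSl.degree

variable (m)

/-- `r_(ij) = θ_ij(rbar) + (z_i/z_j)/(1 - z_i/z_j) θ_ij(Ω)` for `1 ≤ i < j ≤ N`. -/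
def rRatOp (i j : Fin N) (v : BigSpace N m A B) : BigSpaceRat N m A B :=
  toRat N m A B (rBarOp (theta (m := m) A B i) (theta A B j) v) +
    ((zVar i / zVar j) / (1 - zVar i / zVar j)) •
      toRat N m A B (casimirOp 0 (theta (m := m) A B i) (theta A B j) v)

/-- The Knizhnik-Zamolodchikov connection
`∇_i = ∑_{0 ≤ j < i} r_(ji) - ∑_{i < j ≤ N+1} r_(ij) + θ_i(ρ^∨)`, on vectors with Laurent polynomial
coefficients. -/
def nabla (i : Fin N) (v : BigSpace N m A B) : BigSpaceRat N m A B :=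
  toRat N m A B (rUnivOp (thetaA (m := m) N A B) (theta A B i) v) +
    (∑ j : Fin N, if j < i then rRatOp m j i v else 0) -
    (∑ j : Fin N, if i < j then rRatOp m i j v else 0) -
    toRat N m A B (rUnivOp (theta (m := m) A B i) (thetaB N A B) v) +
    toRat N m A B (theta A B i (rhoCheck m) v)

/-- `G = ∏_{α} (1 - e^{-α})`, the product over all roots `α = ε_i - ε_j` of `gl_N`. -/
def bigG (N : ℕ) : MultiLaurent N :=
  ∏ i : Fin N, ∏ j : Fin N,
    if i = j then 1 else 1 - expMon (Pi.single j 1 - Pi.single i 1)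

/-- The generalized Cherednik-Dunkl operator
`D_ξ = ∇_ξ + ∑_{α > 0} α(ξ) (1 - τ(s_α)) / (1 - e^{-α}) - ρbar(ξ) - (m-1)/(2m) ∂_ξ log G`,
on vectors with Laurent polynomial coefficients; for `α = ε_i - ε_j`, `e^{-α} = z_j/z_i`. -/
def dunkl (ξ : Fin N → ℂ) (v : BigSpace N m A B) : BigSpaceRat N m A B :=
  (∑ i : Fin N, ξ i • nabla m i v) +
    (∑ i : Fin N, ∑ j : Fin N, if i < j then
      (ξ i - ξ j) • ((1 - zVar j / zVar i)⁻¹ •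
        toRat N m A B (v - tau m A B (Equiv.swap i j) v)) else 0) -
    ((1 / 2 : ℂ) * ∑ i : Fin N, ∑ j : Fin N, if i < j then ξ i - ξ j else 0) • toRat N m A B v -
    (((m : ℂ) - 1) / (2 * m)) •
      ((algebraMap (MultiLaurent N) (RatFun N) (partialXi ξ (bigG N)) /
        algebraMap (MultiLaurent N) (RatFun N) (bigG N)) • toRat N m A B v)

end Tensor

/-! ### The degenerate double affine Hecke algebra -/

section Hecke

variable (N : ℕ)

/-- The action of the symmetric group on the weight lattice, written multiplicatively. -/
def permMulAut : Equiv.Perm (Fin N) →* MulAut (Multiplicative (Fin N → ℤ)) where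
  toFun w := AddEquiv.toMultiplicative (permLattice w)
  map_one' := rfl
  map_mul' _ _ := rfl

/-- The extended affine Weyl group `W = Wbar ⋉ Pbar` of `gl_N`, with `w t_η w⁻¹ = t_{w(η)}`. -/
abbrev AffWeyl : Type :=
  Multiplicative (Fin N → ℤ) ⋊[permMulAut N] Equiv.Perm (Fin N)

/-- `𝔱' = 𝔱bar ⊕ ℂ c`: the pair `(x, k)` is `∑ x_i ε_i^∨ + k c`. -/
abbrev TPrime : Type := (Fin N → ℂ) × ℂ

variable {N}

/-- The translation `t_η`. -/
def AffWeyl.transl (η : Fin N → ℤ) : AffWeyl N := SemidirectProduct.inl (Multiplicative.ofAdd η)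

/-- A permutation as an element of `W`. -/
def AffWeyl.perm (w : Equiv.Perm (Fin N)) : AffWeyl N := SemidirectProduct.inr w

/-- The action of `W` on `𝔱'`: permutations permute the `ε_i^∨` and fix `c`, and
`t_η(ξ) = ξ - η(ξ) c`. -/
def AffWeyl.act (x : AffWeyl N) (ξ : TPrime N) : TPrime N :=
  (ξ.1 ∘ x.right.symm,
    ξ.2 - ∑ j : Fin N, (Multiplicative.toAdd x.left j : ℂ) * ξ.1 (x.right.symm j))

/-- The affine reflection `s_0 = t_{ε_1 - ε_N} s_{ε_1 - ε_N}`, for `f` and `l` the first and the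
last index. -/
def AffWeyl.sZero (f l : Fin N) : AffWeyl N :=
  AffWeyl.transl (Pi.single f 1 - Pi.single l 1) * AffWeyl.perm (Equiv.swap f l)

/-- `π = t_{ε_1} s_1 ⋯ s_{N-1}`, for `f` the first index; `s_1 ⋯ s_{N-1}` is the cycle
`i ↦ i + 1`. -/
def AffWeyl.piElt (f : Fin N) : AffWeyl N :=
  AffWeyl.transl (Pi.single f 1) * AffWeyl.perm (finRotate N)

/-- Generators of the degenerate double affine Hecke algebra: the elements of `W` and of `𝔱'`. -/
abbrev HeckeFree (N : ℕ) : Type := FreeAlgebra ℂ (AffWeyl N ⊕ TPrime N)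

/-- The generator attached to an element of `W`. -/
def HeckeFree.w (x : AffWeyl N) : HeckeFree N := FreeAlgebra.ι ℂ (Sum.inl x)

/-- The generator attached to an element of `𝔱'`. -/
def HeckeFree.t (ξ : TPrime N) : HeckeFree N := FreeAlgebra.ι ℂ (Sum.inr ξ)

open HeckeFree in
/-- The relations of the degenerate double affine Hecke algebra: those of the group algebra `ℂ[W]`,
those of the symmetric algebra `S[𝔱']`, the relations `s_i ξ - s_i(ξ) s_i = -α_i(ξ)` for
`i = 1, …, N-1` and for `i = 0` (where `α_0 = δ - (ε_1 - ε_N)` and `δ` vanishes on `𝔱'`), and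
`π ξ = π(ξ) π`. -/
inductive HeckeRel : HeckeFree N → HeckeFree N → Prop
  | w_one : HeckeRel (w 1) 1
  | w_mul (x y : AffWeyl N) : HeckeRel (w (x * y)) (w x * w y)
  | t_add (ξ η : TPrime N) : HeckeRel (t (ξ + η)) (t ξ + t η)
  | t_smul (a : ℂ) (ξ : TPrime N) : HeckeRel (t (a • ξ)) (a • t ξ)
  | t_comm (ξ η : TPrime N) : HeckeRel (t ξ * t η) (t η * t ξ)
  | simple (i j : Fin N) (hij : i.val + 1 = j.val) (ξ : TPrime N) :
      HeckeRel
        (w (AffWeyl.perm (Equiv.swap i j)) * t ξ -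
          t ((AffWeyl.perm (Equiv.swap i j)).act ξ) * w (AffWeyl.perm (Equiv.swap i j)))
        (algebraMap ℂ (HeckeFree N) (-(ξ.1 i - ξ.1 j)))
  | affine (f l : Fin N) (hf : f.val = 0) (hl : l.val + 1 = N) (ξ : TPrime N) :
      HeckeRel
        (w (AffWeyl.sZero f l) * t ξ - t ((AffWeyl.sZero f l).act ξ) * w (AffWeyl.sZero f l))
        (algebraMap ℂ (HeckeFree N) (-(-(ξ.1 f - ξ.1 l))))
  | pi (f : Fin N) (hf : f.val = 0) (ξ : TPrime N) :
      HeckeRel (w (AffWeyl.piElt f) * t ξ)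
        (t ((AffWeyl.piElt f).act ξ) * w (AffWeyl.piElt f))

/-- The degenerate double affine Hecke algebra `H` of `gl_N`. -/
abbrev DDAHA (N : ℕ) : Type := RingQuot (HeckeRel (N := N))

/-- The image in `H` of an element of `W`. -/
def DDAHA.w (x : AffWeyl N) : DDAHA N := RingQuot.mkAlgHom ℂ HeckeRel (HeckeFree.w x)

/-- The image in `H` of an element of `𝔱'`. -/
def DDAHA.t (ξ : TPrime N) : DDAHA N := RingQuot.mkAlgHom ℂ HeckeRel (HeckeFree.t ξ)

/-- The start of the `a`-th block of the ordered partition `β`. -/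
def blockStart {m : ℕ} (β : Fin m → ℕ) (a : Fin m) : ℕ := ∑ b : Fin m, if b < a then β b else 0

/-- Membership (with indices starting at `0`) in the `a`-th block `I_β^{(a)}` of the ordered
partition `β`, in which zeros are allowed. -/
def InBlock {m : ℕ} (β : Fin m → ℕ) (a : Fin m) (k : Fin N) : Prop :=
  blockStart β a ≤ k.val ∧ k.val < blockStart β a + β a

/-- `(i, j)` is such that `ε_i - ε_j` is a simple root in `Π_β`. -/
def IsBetaSimple {m : ℕ} (β : Fin m → ℕ) (i j : Fin N) : Prop :=
  i.val + 1 = j.val ∧ ∃ a, InBlock β a i ∧ InBlock β a j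

/-- The parabolic subgroup `Wbar_β`. -/
def parabolic {m : ℕ} (N : ℕ) (β : Fin m → ℕ) : Subgroup (Equiv.Perm (Fin N)) :=
  Subgroup.closure {s | ∃ i j, IsBetaSimple β i j ∧ s = Equiv.swap i j}

/-- `(𝔱')^*_β`: the functionals taking the value `-1` on the coroots of the simple roots in
`Π_β`. -/
def dualBeta {m : ℕ} (N : ℕ) (β : Fin m → ℕ) : Set (Module.Dual ℂ (TPrime N)) :=
  {ζ | ∀ i j, IsBetaSimple β i j → ζ (Pi.single i 1 - Pi.single j 1, 0) = -1}

/-- The left ideal of `H` generated by `w - 1`, `w ∈ Wbar_β`, and `ξ - ζ(ξ)`, `ξ ∈ 𝔱'`, that is, by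
the annihilator of `1_ζ` in the parabolic subalgebra `H_β`. -/
def inducedIdeal {m : ℕ} (β : Fin m → ℕ) (ζ : Module.Dual ℂ (TPrime N)) :
    Submodule (DDAHA N) (DDAHA N) :=
  Submodule.span (DDAHA N)
    ({h | ∃ w ∈ parabolic N β, h = DDAHA.w (AffWeyl.perm w) - 1} ∪
      {h | ∃ ξ : TPrime N, h = DDAHA.t ξ - algebraMap ℂ (DDAHA N) (ζ ξ)})

/-- The induced module `Y_β(ζ) = H ⊗_{H_β} ℂ 1_ζ`, as the quotient of `H` by the left ideal
generated by the annihilator of `1_ζ` in `H_β`. -/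
abbrev InducedModule {m : ℕ} (β : Fin m → ℕ) (ζ : Module.Dual ℂ (TPrime N)) : Type :=
  DDAHA N ⧸ inducedIdeal β ζ

/-- The cyclic vector `1_ζ`. -/
def InducedModule.one {m : ℕ} (β : Fin m → ℕ) (ζ : Module.Dual ℂ (TPrime N)) :
    InducedModule β ζ := (inducedIdeal β ζ).mkQ 1

end Hecke

/-! ### The objects attached to a pair of weights -/

section Pair

variable {N m : ℕ}

/-- `ρ` is the action of `H` on `F(A, B)`, for `A` of level `ℓ` and `B` of level `-ℓ`: `c` acts as
`ℓ + m`, `w ∈ Wbar` as `τ(w)`, `e^η` by multiplication and `ξ ∈ 𝔱bar` by the operator `D_ξ`, which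
maps vectors with Laurent polynomial coefficients to such vectors. -/
structure IsHeckeAction (ℓ : ℂ) (A B : Type)
    [AddCommGroup A] [Module ℂ A] [LieRingModule (AffineSl m) A] [LieModule ℂ (AffineSl m) A]
    [AddCommGroup B] [Module ℂ B] [LieRingModule (AffineSl m) B] [LieModule ℂ (AffineSl m) B]
    (ρ : DDAHA N →ₐ[ℂ] Module.End ℂ (Coinv (m := m) N A B)) : Prop where
  central : ρ (DDAHA.t (0, 1)) = (ℓ + m) • LinearMap.id
  perm : ∀ (w : Equiv.Perm (Fin N)) (v : BigSpace N m A B),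
    ρ (DDAHA.w (AffWeyl.perm w)) (coinvMk v) = coinvMk (tau m A B w v)
  transl : ∀ (η : Fin N → ℤ) (v : BigSpace N m A B),
    ρ (DDAHA.w (AffWeyl.transl η)) (coinvMk v) = coinvMk (expMon η • v)
  dunkl : ∀ (ξ : Fin N → ℂ) (v : BigSpace N m A B), ∃ u : BigSpace N m A B,
    toRat N m A B u = dunkl m ξ v ∧ ρ (DDAHA.t (ξ, 0)) (coinvMk v) = coinvMk u

/-- `β` is an ordered partition of `N` (with zeros allowed) such that the classical parts satisfy
`λbar - μbar = ∑_a β_a ebar_a`. -/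
def IsBeta (N : ℕ) (lam mu : Weight m) (β : Fin m → ℕ) : Prop :=
  ∑ a, β a = N ∧ lam.bar - mu.bar = ∑ a, (β a : ℂ) • eBar a

/-- `(μ, ebar_a)`: the value of `μ` at the element of the Cartan subalgebra dual to `ebar_a`. -/
def Weight.coord (mu : Weight m) (a : Fin m) : ℂ :=
  mu.bar ⟨slUnit a a, by
    intro i j hij
    rcases eq_or_ne a i with rfl | h
    · simp [slUnit, hij, Matrix.single]
    · simp [slUnit, hij, Matrix.single, h]⟩

/-- The coordinates of `ζbar_{λ,μ}`: the cell `(a, p) = (a, μ_a + q)`, `1 ≤ q ≤ β_a`, contributes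
`p - a` at the index `T_0(a, p) = β_1 + … + β_{a-1} + q`, and `(m² - N)/(2m)` is added. (Here `a`, `q`
and the indices start at `0`.) -/
def zetaBar (N : ℕ) (mu : Weight m) (β : Fin m → ℕ) (k : Fin N) : ℂ :=
  (∑ a : Fin m, ∑ q ∈ Finset.range (β a), if blockStart β a + q = k.val then
    (mu.coord a + ((q : ℂ) + 1)) - ((a.val : ℂ) + 1) else 0) +
    ((m : ℂ) ^ 2 - N) / (2 * m)

/-- `ζ_{λ,μ} = ζbar_{λ,μ} + κ c^*` with `κ = ℓ + m`. -/
def zeta (N : ℕ) (ℓ : ℂ) (mu : Weight m) (β : Fin m → ℕ) : Module.Dual ℂ (TPrime N) where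
  toFun ξ := ∑ k, zetaBar N mu β k * ξ.1 k + (ℓ + m) * ξ.2
  map_add' ξ η := by
    simp only [Prod.fst_add, Prod.snd_add, Pi.add_apply, mul_add, Finset.sum_add_distrib]
    ring
  map_smul' a ξ := by
    simp only [Prod.smul_fst, Prod.smul_snd, Pi.smul_apply, smul_eq_mul, RingHom.id_apply, mul_add,
      Finset.mul_sum]
    congr 1
    · exact Finset.sum_congr rfl fun k _ => by ring
    · ring

open Classical in
/-- `u_1 ⊗ ⋯ ⊗ u_1 ⊗ u_2 ⊗ ⋯ ⊗ u_m`, with `u_a` repeated `β_a` times. -/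
def blockVector (N : ℕ) (β : Fin m → ℕ) : TensorPow N m :=
  PiTensorProduct.tprod ℂ fun k : Fin N => fun a : Fin m => if InBlock β a k then (1 : ℂ) else 0

/-- `M(λ, μ) = F(M(μ), M†(λ))`. -/
abbrev MModule (N : ℕ) (lam mu : Weight m) : Type :=
  Coinv (m := m) N (HighestVerma mu) (LowestVerma lam)

/-- The class in `M(λ, μ)` of
`u_{λ,μ} = v(μ) ⊗ u_1^{⊗ β_1} ⊗ ⋯ ⊗ u_m^{⊗ β_m} ⊗ v†(λ)`. -/
def uVector (N : ℕ) (lam mu : Weight m) (β : Fin m → ℕ) : MModule N lam mu :=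
  coinvMk ((1 : MultiLaurent N) ⊗ₜ[ℂ] (VermaModule.vac (nPos m) mu ⊗ₜ[ℂ]
    (blockVector N β ⊗ₜ[ℂ] VermaModule.vac (nNeg m) (-lam))))

end Pair

end KZHecke

end

open scoped TensorProduct

noncomputable section

namespace KZHecke

-- Two facts are proved: the Dunkl operators give a representation of the Hecke algebra on the
-- coinvariants, and this representation is induced.
--
-- Cross relations. The poles of the connection along `z_i = z_j` cancel against the reflection
-- terms. What a pair `i, j` leaves behind is the polynomial operator `exchange`, namely the
-- classical `r`-matrix on the two tensor factors minus a divided difference times the flip. The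
-- term `∂ log G` and the constant `1/2` absorb the traces by which `gl_m` matrix units differ from
-- elements of `sl_m` (`toRat_exchange`). Hence the `i`-th Dunkl operator is `eOp i + ∑_{j<i} (i
-- j)`, with `eOp` equivariant under permutations, and only the ordering in the last sum breaks
-- equivariance. This gives the relation with simple reflections. Multiplication by `z_i` shifts the
-- one-point part by `ℓ + m`: each end of the tensor product contributes `ℓ/2` through the term `c ⊗
-- d`, and `ρ^∨` contributes `m` (`pmul_mul_zOp`). Together with the behaviour of `exchange` under
-- multiplication this gives the relation with `π`; the one for `s_0` follows since `s_0 = π s_{N-1}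
-- π⁻¹`.
--
-- Descent to coinvariants. The derived algebra is generated by `c` and the `x ⊗ t^{±1}`. The
-- commutators of such an element with the universal `r`-matrix, with `exchange` and with `ρ^∨` are
-- all values of one cobracket (`commutator_rUnivLin`, `commutator_exchange`, `deltaOp_self`). They
-- add up to the cobracket with the diagonal action in its first leg (`diag_commutator_eOp`), whose
-- image lies in the subspace divided out.
--
-- Commutativity. No Yang-Baxter computation is needed. The cross relations alone make the
-- commutators of Dunkl operators equivariant under `W` (`HeckePair.commutator_mul_W`), so they
-- vanish on everything generated under `W` by joint eigenvectors. On `v(μ) ⊗ 1 ⊗ e_J ⊗ v†(λ)` with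
-- `J` nondecreasing almost all terms vanish or cancel, so these vectors are joint eigenvectors
-- (`dOp_inc`), and the classes of their `W`-translates span the coinvariants.
--
-- Structure of the module. The classes of `v(μ) ⊗ z^η ⊗ e_J ⊗ v†(λ)` span, because invariance moves
-- `𝔫_+` off the lowest weight module and then `𝔫_-` off the highest weight module; the Cartan
-- subalgebra kills the classes with `J` of the wrong weight. The others are independent: each
-- coordinate functional extends to an invariant trilinear form (`exists_invariant_form`). The
-- extension uses a map from the lowest weight Verma module to `U(𝔫_+)`, obtained by making `U(𝔫_+)`
-- a module over the whole Lie algebra (`exists_induced_action`), and then the universal property of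
-- the highest weight Verma module. No PBW theorem enters.
--
-- Comparison. The induced module maps onto the coinvariants. It is spanned by the `t_η w 1_ζ`,
-- which depend on `w` only through the rearrangement of the block function; their images are the
-- independent classes just found. So the map is bijective, and no PBW theorem for the Hecke algebra
-- is needed either.

local notation "𝔰" m => LieAlgebra.SpecialLinear.sl (Fin m) ℂ

/-! ### Matrices and permutations acting on tensor powers -/

section SlotOperators

variable {N m : ℕ}

/-- The action of matrices on the `i`-th tensor factor, as an algebra homomorphism. -/
def slotHom (i : Fin N) : Matrix (Fin m) (Fin m) ℂ →ₐ[ℂ] Module.End ℂ (TensorPow N m) :=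
  AlgHom.ofLinearMap
    { toFun := fun x => slotAct i x
      map_add' := fun x y => by
        simp only [slotAct, map_add]
        exact PiTensorProduct.map_update_add (R := ℂ) _ i _ _
      map_smul' := fun c x => by
        simp only [slotAct, map_smul]
        exact PiTensorProduct.map_update_smul (R := ℂ) _ i _ _ }
    (by
      change PiTensorProduct.map _ = 1
      rw [Matrix.toLin'_one]
      convert PiTensorProduct.map_one (R := ℂ) (s := fun _ : Fin N => Fin m → ℂ) using 2
      exact Function.update_eq_self i _)
    (fun x y => by
      change PiTensorProduct.map _ = PiTensorProduct.map _ * PiTensorProduct.map _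
      rw [← PiTensorProduct.map_mul]
      congr 1
      funext k
      rcases eq_or_ne k i with rfl | hk
      · simp [Matrix.toLin'_mul, Module.End.mul_eq_comp]
      · simp only [Function.update_of_ne hk]; rfl)

theorem slotHom_apply (i : Fin N) (x : Matrix (Fin m) (Fin m) ℂ) : slotHom i x = slotAct i x := rfl

theorem slotHom_tprod (i : Fin N) (x : Matrix (Fin m) (Fin m) ℂ) (v : Fin N → Fin m → ℂ) :
    slotHom i x (PiTensorProduct.tprod ℂ v) =
      PiTensorProduct.tprod ℂ (Function.update v i (x.mulVec (v i))) := by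
  rw [slotHom_apply, slotAct, PiTensorProduct.map_tprod]
  congr 1
  funext k
  rcases eq_or_ne k i with rfl | hk
  · simp
  · simp [Function.update_of_ne hk]

theorem slotHom_commute {i j : Fin N} (hij : i ≠ j) (x y : Matrix (Fin m) (Fin m) ℂ) :
    Commute (slotHom i x) (slotHom j y) := by
  change PiTensorProduct.map _ * PiTensorProduct.map _ =
    PiTensorProduct.map _ * PiTensorProduct.map _
  rw [← PiTensorProduct.map_mul, ← PiTensorProduct.map_mul]
  congr 1
  funext k
  rcases eq_or_ne k i with rfl | hk
  · simp only [Function.update_self, Function.update_of_ne hij]; rfl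
  · simp only [Function.update_of_ne hk]; rfl

/-- The permutation of the tensor factors. -/
def permHom (w : Equiv.Perm (Fin N)) : Module.End ℂ (TensorPow N m) :=
  (PiTensorProduct.reindex ℂ (fun _ : Fin N => Fin m → ℂ) w).toLinearMap

theorem permHom_tprod (w : Equiv.Perm (Fin N)) (v : Fin N → Fin m → ℂ) :
    permHom w (PiTensorProduct.tprod ℂ v) = PiTensorProduct.tprod ℂ (fun k => v (w.symm k)) :=
  PiTensorProduct.reindex_tprod w v

theorem permHom_one : permHom (m := m) (1 : Equiv.Perm (Fin N)) = 1 := by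
  refine PiTensorProduct.ext (MultilinearMap.ext fun v => ?_)
  exact permHom_tprod 1 v

theorem permHom_mul (w w' : Equiv.Perm (Fin N)) :
    permHom (m := m) (w * w') = permHom w * permHom w' := by
  refine PiTensorProduct.ext (MultilinearMap.ext fun v => ?_)
  change permHom _ (PiTensorProduct.tprod ℂ v) = permHom _ (permHom _ (PiTensorProduct.tprod ℂ v))
  rw [permHom_tprod, permHom_tprod, permHom_tprod]
  rfl

theorem permHom_mul_slotHom (w : Equiv.Perm (Fin N)) (i : Fin N)
    (x : Matrix (Fin m) (Fin m) ℂ) :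
    permHom w * slotHom i x = slotHom (w i) x * permHom w := by
  refine PiTensorProduct.ext (MultilinearMap.ext fun v => ?_)
  change permHom w (slotHom i x (PiTensorProduct.tprod ℂ v)) =
    slotHom (w i) x (permHom w (PiTensorProduct.tprod ℂ v))
  rw [permHom_tprod, slotHom_tprod, slotHom_tprod, permHom_tprod]
  congr 1
  funext k
  rcases eq_or_ne k (w i) with rfl | hk
  · simp
  · rw [Function.update_of_ne hk, Function.update_of_ne]
    rintro h
    exact hk (by rw [← h]; simp)

theorem single_mulVec_single (p q r : Fin m) :
    (Matrix.single p q (1 : ℂ)).mulVec (Pi.single r 1) = if q = r then Pi.single p 1 else 0 := by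
  ext k
  rw [Matrix.mulVec_single_one, Matrix.col_apply, Matrix.single_apply]
  by_cases h : q = r
  · simp [h, Pi.single_apply, eq_comm]
  · simp [h]

/-- The flip of two tensor factors in terms of matrix units. -/
theorem permHom_swap {i j : Fin N} (hij : i ≠ j) :
    permHom (m := m) (Equiv.swap i j) =
      ∑ p : Fin m, ∑ q : Fin m,
        slotHom i (Matrix.single p q 1) * slotHom j (Matrix.single q p 1) := by
  refine (Basis.piTensorProduct (fun _ : Fin N => Pi.basisFun ℂ (Fin m))).ext fun J => ?_
  rw [Basis.piTensorProduct_apply, permHom_tprod]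
  simp only [LinearMap.sum_apply, Module.End.mul_apply, slotHom_tprod, Pi.basisFun_apply]
  -- The factor `E_qp` at place `j` forces `p = J j`, then `E_pq` at place `i` forces `q = J i`; the
  -- surviving term exchanges the two basis vectors.
  rw [Finset.sum_eq_single (J j), Finset.sum_eq_single (J i)]
  · congr 1
    funext k
    rcases eq_or_ne k i with rfl | hki
    · simp only [Function.update_self, Function.update_of_ne hij, single_mulVec_single, if_true]
      simp
    · rcases eq_or_ne k j with rfl | hkj
      · rw [Function.update_of_ne hki, Function.update_self, single_mulVec_single]
        simp
      · rw [Function.update_of_ne hki, Function.update_of_ne hkj, Equiv.symm_swap,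
          Equiv.swap_apply_of_ne_of_ne hki hkj]
  · intro q _ hq
    apply (PiTensorProduct.tprod ℂ).map_coord_zero i
    rw [Function.update_self, Function.update_of_ne hij, single_mulVec_single, if_neg hq]
  · simp
  · intro p _ hp
    refine Finset.sum_eq_zero fun q _ => ?_
    apply (PiTensorProduct.tprod ℂ).map_coord_zero j
    rw [Function.update_of_ne hij.symm, Function.update_self, single_mulVec_single, if_neg hp]
  · simp

end SlotOperators

/-! ### Multiplication and Euler derivations on Laurent polynomials -/

section Multiplication

variable {N : ℕ}

theorem expMon_zero : expMon (0 : Fin N → ℤ) = 1 := rfl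

theorem expMon_add (η θ : Fin N → ℤ) : expMon (η + θ) = expMon η * expMon θ := by
  simp [expMon, AddMonoidAlgebra.single_mul_single]

/-- The power `z_i^n`. -/
def zPow (i : Fin N) (n : ℤ) : MultiLaurent N := expMon (Pi.single i n)

theorem zPow_zero (i : Fin N) : zPow i 0 = 1 := by rw [zPow, Pi.single_zero, expMon_zero]

theorem zPow_add (i : Fin N) (a b : ℤ) : zPow i (a + b) = zPow i a * zPow i b := by
  rw [zPow, Pi.single_add, expMon_add]; rfl

theorem evalVar_single (i : Fin N) (n : ℤ) (a : ℂ) :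
    evalVar i (AddMonoidAlgebra.single n a) = a • zPow i n := by
  change AddMonoidAlgebra.mapDomain _ (AddMonoidAlgebra.single n a) = _
  rw [AddMonoidAlgebra.mapDomain_single, zPow, expMon, AddMonoidAlgebra.smul_single, smul_eq_mul,
    mul_one]
  rfl

theorem partialXi_mul (ξ : Fin N → ℂ) (f g : MultiLaurent N) :
    partialXi ξ (f * g) = partialXi ξ f * g + f * partialXi ξ g := monomialDer_mul _ f g

theorem partialXi_expMon (ξ : Fin N → ℂ) (η : Fin N → ℤ) :
    partialXi ξ (expMon η) = (∑ i, (η i : ℂ) * ξ i) • expMon η := by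
  simp [partialXi, expMon, monomialDer_single]

theorem partialXi_evalVar (i : Fin N) (f : Laurent) :
    partialXi (Pi.single i 1) (evalVar i f) = evalVar i (tDer f) := by
  induction f using AddMonoidAlgebra.induction_linear with
  | zero => simp
  | add f g hf hg => simp only [map_add, hf, hg]
  | single n a =>
    rw [evalVar_single, map_smul, zPow, partialXi_expMon, tDer, monomialDer_single, evalVar_single,
      smul_smul, zPow]
    congr 2
    rw [Finset.sum_eq_single i]
    · simp
    · intro j _ hj; simp [hj]
    · simp

theorem partialXi_evalVar_of_ne {i j : Fin N} (hij : i ≠ j) (f : Laurent) :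
    partialXi (Pi.single i 1) (evalVar j f) = 0 := by
  induction f using AddMonoidAlgebra.induction_linear with
  | zero => simp
  | add f g hf hg => simp only [map_add, hf, hg, add_zero]
  | single n a =>
    rw [evalVar_single, map_smul, zPow, partialXi_expMon, Finset.sum_eq_zero]
    · simp
    · intro k _
      rcases eq_or_ne k i with rfl | hk
      · simp [hij]
      · simp [hk]

/-- Multiplication operators. -/
abbrev mulP : MultiLaurent N →ₐ[ℂ] Module.End ℂ (MultiLaurent N) := Algebra.lmul ℂ (MultiLaurent N)

theorem partialXi_mulP (ξ : Fin N → ℂ) (f : MultiLaurent N) :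
    partialXi ξ * mulP f = mulP f * partialXi ξ + mulP (partialXi ξ f) := by
  refine LinearMap.ext fun g => ?_
  change partialXi ξ (f * g) = f * partialXi ξ g + partialXi ξ f * g
  rw [partialXi_mul, add_comm]

theorem mulP_commute (f g : MultiLaurent N) : Commute (mulP f) (mulP g) := by
  rw [Commute, SemiconjBy, ← map_mul, ← map_mul, mul_comm]

theorem partialXi_commute (ξ ξ' : Fin N → ℂ) :
    Commute (partialXi ξ : Module.End ℂ (MultiLaurent N)) (partialXi ξ') := by
  refine (AddMonoidAlgebra.basis (Fin N → ℤ) ℂ).ext fun η => ?_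
  rw [AddMonoidAlgebra.basis_apply]
  change partialXi ξ (partialXi ξ' (expMon η)) = partialXi ξ' (partialXi ξ (expMon η))
  simp only [partialXi_expMon, map_smul, smul_smul, mul_comm]

end Multiplication

/-! ### Evaluation modules, for commuting actions of polynomial and tensor operators on any space -/

section Evaluation

variable {N m : ℕ} {R : Type} [Ring R] [Algebra ℂ R]
  (P : Module.End ℂ (MultiLaurent N) →ₐ[ℂ] R) (S : Module.End ℂ (TensorPow N m) →ₐ[ℂ] R)

/-- A matrix of Laurent polynomials in `z_i`, acting on the `i`-th factor. -/
def loopAct (i : Fin N) : Matrix (Fin m) (Fin m) Laurent →ₗ[ℂ] R where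
  toFun x := ∑ p : Fin m, ∑ q : Fin m,
    P (mulP (evalVar i (x p q))) * S (slotHom i (Matrix.single p q 1))
  map_add' x y := by
    simp only [Matrix.add_apply, map_add, add_mul, Finset.sum_add_distrib]
  map_smul' a x := by
    simp only [Matrix.smul_apply, map_smul, smul_mul_assoc, Finset.smul_sum, RingHom.id_apply]

/-- The operator `θ_i(y)` built from an action of operators on polynomials and on tensors. -/
def evalAct (i : Fin N) : AffineSl m →ₗ[ℂ] R where
  toFun y := loopAct P S i y.loop.val + y.d • P (partialXi (Pi.single i 1))
  map_add' x y := by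
    rw [AffineSl.add_loop_val, map_add, AffineSl.add_d, add_smul]; abel
  map_smul' a x := by
    rw [AffineSl.smul_loop_val, map_smul, AffineSl.smul_d, smul_add, smul_smul]; rfl

theorem evalAct_apply (i : Fin N) (y : AffineSl m) :
    evalAct P S i y = loopAct P S i y.loop.val + y.d • P (partialXi (Pi.single i 1)) := rfl

theorem loopAct_map_single (i : Fin N) (n : ℤ) (x : Matrix (Fin m) (Fin m) ℂ) :
    loopAct P S i (x.map (AddMonoidAlgebra.singleAddHom n)) =
      P (mulP (zPow i n)) * S (slotHom i x) := by
  have hx : x = ∑ p : Fin m, ∑ q : Fin m, x p q • Matrix.single p q (1 : ℂ) := by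
    conv_lhs => rw [Matrix.matrix_eq_sum_single x]
    simp
  conv_rhs => rw [hx]
  simp only [map_sum, map_smul, Finset.mul_sum]
  simp only [loopAct, LinearMap.coe_mk, AddHom.coe_mk]
  refine Finset.sum_congr rfl fun p _ => Finset.sum_congr rfl fun q _ => ?_
  rw [Matrix.map_apply, AddMonoidAlgebra.singleAddHom_apply, evalVar_single, map_smul, map_smul,
    smul_mul_assoc, mul_smul_comm]

theorem evalAct_tmul (i : Fin N) (n : ℤ) (x : LieAlgebra.SpecialLinear.sl (Fin m) ℂ) :
    evalAct P S i (AffineSl.tmul n x) = P (mulP (zPow i n)) * S (slotHom i x.val) := by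
  have h : (AffineSl.tmul n x).d = 0 := rfl
  rw [evalAct_apply, h, zero_smul, add_zero]
  exact loopAct_map_single P S i n x.val

theorem evalAct_central (i : Fin N) : evalAct P S i (AffineSl.central : AffineSl m) = 0 := by
  have h : (AffineSl.central : AffineSl m).d = 0 := rfl
  have h' : (AffineSl.central : AffineSl m).loop.val = 0 := rfl
  rw [evalAct_apply, h, h', map_zero, zero_smul, add_zero]

theorem evalAct_degree (i : Fin N) :
    evalAct P S i (AffineSl.degree : AffineSl m) = P (partialXi (Pi.single i 1)) := by
  have h : (AffineSl.degree : AffineSl m).d = 1 := rfl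
  have h' : (AffineSl.degree : AffineSl m).loop.val = 0 := rfl
  rw [evalAct_apply, h, h', map_zero, one_smul, zero_add]

variable {P S} (hPS : ∀ f g, Commute (P f) (S g))
include hPS

theorem loopAct_mul (i : Fin N) (x y : Matrix (Fin m) (Fin m) Laurent) :
    loopAct P S i (x * y) = loopAct P S i x * loopAct P S i y := by
  have key : ∀ p r s q : Fin m,
      P (mulP (evalVar i (x p r))) * S (slotHom i (Matrix.single p r 1)) *
        (P (mulP (evalVar i (y s q))) * S (slotHom i (Matrix.single s q 1))) =
      if r = s then P (mulP (evalVar i (x p r * y s q))) *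
        S (slotHom i (Matrix.single p q 1)) else 0 := by
    intro p r s q
    rw [mul_assoc, ← mul_assoc (S _), ← (hPS _ _).eq, mul_assoc (P _), ← mul_assoc, ← map_mul,
      ← map_mul, ← map_mul, ← map_mul S, ← map_mul]
    split_ifs with h
    · subst h; simp
    · rw [Matrix.single_mul_single_of_ne _ _ _ _ h]; simp
  simp only [loopAct, LinearMap.coe_mk, AddHom.coe_mk]
  rw [Finset.sum_mul]
  refine Finset.sum_congr rfl fun p _ => ?_
  rw [Finset.sum_mul_sum]
  simp only [Finset.mul_sum, key, Matrix.mul_apply, map_sum, Finset.sum_mul]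
  rw [Finset.sum_comm]
  refine Finset.sum_congr rfl fun r _ => ?_
  rw [Finset.sum_comm]
  refine Finset.sum_congr rfl fun q _ => ?_
  rw [Finset.sum_ite_eq, if_pos (Finset.mem_univ _)]

theorem partialXi_loopAct (i : Fin N) (x : Matrix (Fin m) (Fin m) Laurent) :
    P (partialXi (Pi.single i 1)) * loopAct P S i x =
      loopAct P S i x * P (partialXi (Pi.single i 1)) + loopAct P S i (matDer m x) := by
  simp only [loopAct, LinearMap.coe_mk, AddHom.coe_mk, Finset.sum_mul, Finset.mul_sum, ← Finset.sum_add_distrib]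
  refine Finset.sum_congr rfl fun p _ => Finset.sum_congr rfl fun q _ => ?_
  rw [← mul_assoc, ← map_mul, partialXi_mulP, map_add, map_mul, add_mul, mul_assoc, mul_assoc,
    (hPS _ _).eq, partialXi_evalVar]
  rfl

theorem evalAct_lie (i : Fin N) (x y : AffineSl m) :
    evalAct P S i ⁅x, y⁆ =
      evalAct P S i x * evalAct P S i y - evalAct P S i y * evalAct P S i x := by
  simp only [evalAct_apply, AffineSl.lie_loop_val, AffineSl.lie_d, map_add, map_sub, map_smul,
    loopAct_mul hPS, zero_smul, add_zero, add_mul, mul_add, smul_mul_assoc, mul_smul_comm,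
    partialXi_loopAct hPS]
  module

theorem loopAct_commute {i j : Fin N} (hij : i ≠ j) (x y : Matrix (Fin m) (Fin m) Laurent) :
    Commute (loopAct P S i x) (loopAct P S j y) := by
  simp only [loopAct, LinearMap.coe_mk, AddHom.coe_mk]
  refine Commute.sum_left _ _ _ fun p _ => Commute.sum_left _ _ _ fun q _ =>
    Commute.sum_right _ _ _ fun p' _ => Commute.sum_right _ _ _ fun q' _ => ?_
  refine Commute.mul_left (Commute.mul_right ?_ (hPS _ _)) (Commute.mul_right (hPS _ _).symm ?_)
  · exact (mulP_commute _ _).map P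
  · exact (slotHom_commute hij _ _).map S

theorem partialXi_loopAct_commute {i j : Fin N} (hij : i ≠ j)
    (x : Matrix (Fin m) (Fin m) Laurent) :
    Commute (P (partialXi (Pi.single i 1))) (loopAct P S j x) := by
  simp only [loopAct, LinearMap.coe_mk, AddHom.coe_mk]
  refine Commute.sum_right _ _ _ fun p' _ => Commute.sum_right _ _ _ fun q' _ => ?_
  refine Commute.mul_right ?_ (hPS _ _)
  rw [Commute, SemiconjBy, ← map_mul, partialXi_mulP, partialXi_evalVar_of_ne hij, map_zero,
    add_zero, map_mul]

theorem evalAct_commute {i j : Fin N} (hij : i ≠ j) (x y : AffineSl m) :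
    Commute (evalAct P S i x) (evalAct P S j y) := by
  rw [evalAct_apply, evalAct_apply]
  refine Commute.add_left (Commute.add_right (loopAct_commute hPS hij _ _) ?_)
    (Commute.add_right ?_ ?_)
  · exact (partialXi_loopAct_commute hPS hij.symm _).symm.smul_right _
  · exact (partialXi_loopAct_commute hPS hij _).smul_left _
  · exact (((partialXi_commute _ _).map P).smul_right _).smul_left _

end Evaluation

/-! ### Divided differences of Laurent polynomials -/

section DividedDifference

variable {N : ℕ}

/-- The permutation of the variables. -/
def permPoly (w : Equiv.Perm (Fin N)) : MultiLaurent N →ₐ[ℂ] MultiLaurent N :=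
  AddMonoidAlgebra.mapDomainAlgHom ℂ ℂ (permLattice w).toAddMonoidHom

theorem permPoly_expMon (w : Equiv.Perm (Fin N)) (η : Fin N → ℤ) :
    permPoly w (expMon η) = expMon (permLattice w η) := by
  change AddMonoidAlgebra.mapDomain _ (AddMonoidAlgebra.single η 1) = _
  rw [AddMonoidAlgebra.mapDomain_single]; rfl

theorem permLattice_single (w : Equiv.Perm (Fin N)) (i : Fin N) (n : ℤ) :
    permLattice w (Pi.single i n) = Pi.single (w i) n := by
  ext k
  change Pi.single (M := fun _ => ℤ) i n (w.symm k) = _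
  rw [Pi.single_apply, Pi.single_apply]
  simp [Equiv.symm_apply_eq]

theorem permPoly_zPow (w : Equiv.Perm (Fin N)) (i : Fin N) (n : ℤ) :
    permPoly w (zPow i n) = zPow (w i) n := by
  rw [zPow, permPoly_expMon, permLattice_single]; rfl

theorem multiLaurent_linearMap_ext {E : Type} [AddCommGroup E] [Module ℂ E]
    {f g : MultiLaurent N →ₗ[ℂ] E} (h : ∀ η, f (expMon η) = g (expMon η)) : f = g :=
  (AddMonoidAlgebra.basis (Fin N → ℤ) ℂ).ext fun η => by
    rw [AddMonoidAlgebra.basis_apply]; exact h η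

theorem permPoly_one (f : MultiLaurent N) : permPoly 1 f = f := by
  have : (permPoly (1 : Equiv.Perm (Fin N))).toLinearMap = LinearMap.id :=
    multiLaurent_linearMap_ext fun η => by
      rw [AlgHom.toLinearMap_apply, permPoly_expMon]; rfl
  exact LinearMap.congr_fun this f

theorem permPoly_mul (w w' : Equiv.Perm (Fin N)) (f : MultiLaurent N) :
    permPoly (w * w') f = permPoly w (permPoly w' f) := by
  have : (permPoly (w * w')).toLinearMap = (permPoly w).toLinearMap ∘ₗ (permPoly w').toLinearMap :=
    multiLaurent_linearMap_ext fun η => by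
      simp only [AlgHom.toLinearMap_apply, LinearMap.comp_apply, permPoly_expMon]; rfl
  exact LinearMap.congr_fun this f

theorem permPoly_evalVar (w : Equiv.Perm (Fin N)) (i : Fin N) (f : Laurent) :
    permPoly w (evalVar i f) = evalVar (w i) f := by
  induction f using AddMonoidAlgebra.induction_linear with
  | zero => simp
  | add f g hf hg => simp only [map_add, hf, hg]
  | single n a => rw [evalVar_single, evalVar_single, map_smul, permPoly_zPow]

theorem permPoly_partialXi (w : Equiv.Perm (Fin N)) (ξ : Fin N → ℂ) (f : MultiLaurent N) :
    permPoly w (partialXi ξ f) = partialXi (ξ ∘ w.symm) (permPoly w f) := by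
  have : (permPoly w).toLinearMap ∘ₗ partialXi ξ =
      partialXi (ξ ∘ w.symm) ∘ₗ (permPoly w).toLinearMap :=
    multiLaurent_linearMap_ext fun η => by
      simp only [AlgHom.toLinearMap_apply, LinearMap.comp_apply, permPoly_expMon, partialXi_expMon,
        map_smul]
      congr 1
      exact (Equiv.sum_comp w.symm fun i => (η i : ℂ) * ξ i).symm
  exact LinearMap.congr_fun this f

/-- The monomial `z_j / z_i`. -/
def ratio (i j : Fin N) : MultiLaurent N := expMon (Pi.single j 1 - Pi.single i 1)

theorem ratio_mul_zPow (i j : Fin N) (n : ℤ) :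
    ratio i j * zPow i (n + 1) = zPow i n * zPow j 1 := by
  rw [ratio, zPow, zPow, zPow, ← expMon_add, ← expMon_add, Pi.single_add]
  congr 1; abel

theorem ratio_mul_ratio (i j : Fin N) : ratio i j * ratio j i = 1 := by
  rw [ratio, ratio, ← expMon_add, ← expMon_zero]
  congr 1; abel

theorem permPoly_ratio (w : Equiv.Perm (Fin N)) (i j : Fin N) :
    permPoly w (ratio i j) = ratio (w i) (w j) := by
  rw [ratio, permPoly_expMon, map_sub, permLattice_single, permLattice_single]; rfl

theorem one_sub_ratio_ne_zero {i j : Fin N} (hij : i ≠ j) : 1 - ratio i j ≠ 0 := by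
  rw [sub_ne_zero, ← expMon_zero, ratio, expMon, expMon]
  intro h
  have h1 := AddMonoidAlgebra.single_left_injective (R := ℂ) (one_ne_zero) h
  have h2 := congrFun h1 j
  simp [hij.symm] at h2

/-- On a monomial the transposition multiplies by an integral power of `z_j / z_i`, so divisibility
reduces to that of `1 - x^n` by `1 - x`. -/
theorem one_sub_ratio_dvd (i j : Fin N) (f : MultiLaurent N) :
    1 - ratio i j ∣ f - permPoly (Equiv.swap i j) f := by
  induction f using AddMonoidAlgebra.induction_linear with
  | zero => simp
  | add f g hf hg =>
    rw [map_add, add_sub_add_comm]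
    exact dvd_add hf hg
  | single η a =>
    have ha : AddMonoidAlgebra.single η a = a • expMon η := by simp [expMon]
    rw [ha, map_smul, ← smul_sub]
    rw [Algebra.smul_def]
    refine Dvd.dvd.mul_left ?_ _
    rw [permPoly_expMon]
    have hpow : ∀ (n : ℕ) (k : Fin N → ℤ), 1 - ratio i j ∣
        expMon k - expMon (k + (n : ℤ) • (Pi.single j 1 - Pi.single i 1)) := by
      intro n k
      have h1 : expMon (k + (n : ℤ) • (Pi.single j 1 - Pi.single i 1)) =
          expMon k * ratio i j ^ n := by
        rw [expMon_add]
        congr 1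
        rw [ratio, expMon, expMon, AddMonoidAlgebra.single_pow]
        simp
      rw [h1, ← mul_one_sub]
      exact Dvd.dvd.mul_left (one_sub_dvd_one_sub_pow _ _) _
    have hs : permLattice (Equiv.swap i j) η =
        η + (η i - η j) • (Pi.single j 1 - Pi.single i 1) := by
      ext k
      change η ((Equiv.swap i j).symm k) = _
      rw [Equiv.symm_swap]
      rcases eq_or_ne i j with rfl | hij
      · simp
      rcases eq_or_ne k i with rfl | hki
      · simp [hij]
      · rcases eq_or_ne k j with rfl | hkj
        · simp [hij.symm]
        · simp [Equiv.swap_apply_of_ne_of_ne hki hkj, hki, hkj]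
    -- For a negative exponent the roles of the monomial and its image are exchanged, so that only
    -- natural powers of the ratio occur.
    rcases le_total 0 (η i - η j) with h | h
    · obtain ⟨n, hn⟩ := Int.eq_ofNat_of_zero_le h
      rw [hs, hn]
      exact hpow n η
    · obtain ⟨n, hn⟩ := Int.eq_ofNat_of_zero_le (neg_nonneg.mpr h)
      rw [← dvd_neg, neg_sub, hs]
      convert hpow n (η + (η i - η j) • (Pi.single j 1 - Pi.single i 1)) using 2
      rw [show η i - η j = -(n : ℤ) by omega, neg_smul, neg_add_cancel_right]

theorem exists_divDiff (i j : Fin N) (f : MultiLaurent N) :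
    ∃ g, (1 - ratio i j) * g = f - permPoly (Equiv.swap i j) f := by
  obtain ⟨g, hg⟩ := one_sub_ratio_dvd i j f
  exact ⟨g, hg.symm⟩

/-- The divided difference `(1 - s_ij) / (1 - z_j / z_i)`. -/
def divDiff (i j : Fin N) : MultiLaurent N →ₗ[ℂ] MultiLaurent N :=
  if h : i ≠ j then
    { toFun := fun f => (exists_divDiff i j f).choose
      map_add' := fun f g => by
        apply mul_left_cancel₀ (one_sub_ratio_ne_zero h)
        rw [mul_add, (exists_divDiff i j _).choose_spec, (exists_divDiff i j _).choose_spec,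
          (exists_divDiff i j _).choose_spec, map_add]
        abel
      map_smul' := fun a f => by
        apply mul_left_cancel₀ (one_sub_ratio_ne_zero h)
        rw [RingHom.id_apply, mul_smul_comm, (exists_divDiff i j _).choose_spec,
          (exists_divDiff i j _).choose_spec, map_smul, smul_sub] }
  else 0

theorem one_sub_ratio_mul_divDiff {i j : Fin N} (hij : i ≠ j) (f : MultiLaurent N) :
    (1 - ratio i j) * divDiff i j f = f - permPoly (Equiv.swap i j) f := by
  rw [divDiff, dif_pos hij]
  exact (exists_divDiff i j f).choose_spec

theorem divDiff_eq_of_mul {i j : Fin N} (hij : i ≠ j) {f g : MultiLaurent N}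
    (h : (1 - ratio i j) * g = f - permPoly (Equiv.swap i j) f) : divDiff i j f = g :=
  mul_left_cancel₀ (one_sub_ratio_ne_zero hij) ((one_sub_ratio_mul_divDiff hij f).trans h.symm)

/-- This is `1/(1 - x) + 1/(1 - x⁻¹) = 1` with `x = z_j / z_i`. -/
theorem divDiff_add_divDiff {i j : Fin N} (hij : i ≠ j) (f : MultiLaurent N) :
    divDiff i j f + divDiff j i f = f - permPoly (Equiv.swap i j) f := by
  have h1 := one_sub_ratio_mul_divDiff hij f
  have h2 := one_sub_ratio_mul_divDiff hij.symm f
  rw [Equiv.swap_comm] at h2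
  apply mul_left_cancel₀ (one_sub_ratio_ne_zero hij)
  have h3 := ratio_mul_ratio i j
  linear_combination h1 - ratio i j * h2 - divDiff j i f * h3

theorem permPoly_divDiff (w : Equiv.Perm (Fin N)) {i j : Fin N} (hij : i ≠ j)
    (f : MultiLaurent N) :
    permPoly w (divDiff i j f) = divDiff (w i) (w j) (permPoly w f) := by
  refine (divDiff_eq_of_mul (w.injective.ne hij) ?_).symm
  have h := congrArg (permPoly w) (one_sub_ratio_mul_divDiff hij f)
  rw [map_mul, map_sub, map_one, permPoly_ratio, map_sub, ← permPoly_mul] at h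
  rw [h, ← permPoly_mul, Equiv.swap_apply_apply, mul_assoc, mul_assoc, inv_mul_cancel, mul_one]

/-- Twisted Leibniz rule: it controls every commutation of a divided difference with a
multiplication operator below. -/
theorem divDiff_mul {i j : Fin N} (hij : i ≠ j) (f g : MultiLaurent N) :
    divDiff i j (f * g) =
      permPoly (Equiv.swap i j) f * divDiff i j g + divDiff i j f * g := by
  refine divDiff_eq_of_mul hij ?_
  have h1 := one_sub_ratio_mul_divDiff hij f
  have h2 := one_sub_ratio_mul_divDiff hij g
  rw [map_mul]
  linear_combination permPoly (Equiv.swap i j) f * h2 + g * h1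

theorem divDiff_zPow_left {i j : Fin N} (hij : i ≠ j) : divDiff i j (zPow i 1) = zPow i 1 := by
  refine divDiff_eq_of_mul hij ?_
  have h := ratio_mul_zPow i j 0
  rw [zPow_zero, zero_add] at h
  rw [permPoly_zPow, Equiv.swap_apply_left]
  linear_combination -h

theorem divDiff_zPow_right {i j : Fin N} (hij : i ≠ j) : divDiff i j (zPow j 1) = - zPow i 1 := by
  refine divDiff_eq_of_mul hij ?_
  have h := ratio_mul_zPow i j 0
  rw [zPow_zero, zero_add] at h
  rw [permPoly_zPow, Equiv.swap_apply_right]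
  linear_combination h

theorem ratio_mul_zPow_neg_one (i j : Fin N) : ratio i j * zPow j (-1) = zPow i (-1) := by
  rw [ratio, zPow, zPow, ← expMon_add]
  congr 1
  rw [Pi.single_neg, Pi.single_neg]; abel

theorem divDiff_zPow_neg_right {i j : Fin N} (hij : i ≠ j) :
    divDiff i j (zPow j (-1)) = zPow j (-1) := by
  refine divDiff_eq_of_mul hij ?_
  have h := ratio_mul_zPow_neg_one i j
  rw [permPoly_zPow, Equiv.swap_apply_right]
  linear_combination -h

theorem divDiff_zPow_neg_left {i j : Fin N} (hij : i ≠ j) :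
    divDiff i j (zPow i (-1)) = - zPow j (-1) := by
  refine divDiff_eq_of_mul hij ?_
  have h := ratio_mul_zPow_neg_one i j
  rw [permPoly_zPow, Equiv.swap_apply_left]
  linear_combination h

theorem divDiff_zPow_of_ne {i j k : Fin N} (hij : i ≠ j) (hki : k ≠ i) (hkj : k ≠ j) (n : ℤ) :
    divDiff i j (zPow k n) = 0 := by
  refine divDiff_eq_of_mul hij ?_
  rw [permPoly_zPow, Equiv.swap_apply_of_ne_of_ne hki hkj, sub_self, mul_zero]

theorem divDiff_one {i j : Fin N} (hij : i ≠ j) : divDiff i j (1 : MultiLaurent N) = 0 := by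
  refine divDiff_eq_of_mul hij ?_
  rw [map_one, sub_self, mul_zero]

/-- Carrying `z_i` across the divided difference costs exactly one transposition. This is the source
of the transpositions that appear when Dunkl operators are conjugated by `π`. -/
theorem zPow_mul_divDiff {i j : Fin N} (hij : i ≠ j) (f : MultiLaurent N) :
    zPow i 1 * (divDiff i j f + permPoly (Equiv.swap i j) f) = divDiff i j (zPow i 1 * f) := by
  rw [divDiff_mul hij, divDiff_zPow_left hij, permPoly_zPow, Equiv.swap_apply_left]
  have h1 := one_sub_ratio_mul_divDiff hij f
  have h := ratio_mul_zPow i j 0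
  rw [zPow_zero, zero_add] at h
  linear_combination zPow i 1 * h1 + h * divDiff i j f

theorem zPow_mul_divDiff' {i j : Fin N} (hij : i ≠ j) (f : MultiLaurent N) :
    zPow j 1 * divDiff i j f = divDiff i j (zPow j 1 * f) +
      permPoly (Equiv.swap i j) (zPow j 1 * f) := by
  rw [divDiff_mul hij, divDiff_zPow_right hij, map_mul, permPoly_zPow, Equiv.swap_apply_right]
  have h1 := one_sub_ratio_mul_divDiff hij f
  have h := ratio_mul_zPow i j 0
  rw [zPow_zero, zero_add] at h
  linear_combination -zPow i 1 * h1 - h * divDiff i j f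

end DividedDifference

/-- The coefficients of the classical `r`-matrix: `1` above the diagonal, `1/2` on the diagonal and
`0` below. -/
def rCoeff {m : ℕ} (p q : Fin m) : ℂ := if p < q then 1 else if p = q then 1 / 2 else 0

theorem rCoeff_add {m : ℕ} (p q : Fin m) : rCoeff p q + rCoeff q p = 1 := by
  unfold rCoeff
  rcases lt_trichotomy p q with h | h | h
  · simp [h, h.not_gt, h.ne']
  · simp [h]; norm_num
  · simp [h, h.not_gt, h.ne']

/-! ### The regularised two-point operators -/

section Exchange

variable {N m : ℕ} {R : Type} [Ring R] [Algebra ℂ R]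
  (P : Module.End ℂ (MultiLaurent N) →ₐ[ℂ] R) (S : Module.End ℂ (TensorPow N m) →ₐ[ℂ] R)

/-- The simultaneous permutation of the variables and of the tensor factors. -/
def tauOp (w : Equiv.Perm (Fin N)) : R := P (permPoly w).toLinearMap * S (permHom w)

/-- `∑ c_pq E_pq^(i) E_qp^(j)`, where `c` is the matrix of coefficients of the classical
`r`-matrix. -/
def rSlot (i j : Fin N) : Module.End ℂ (TensorPow N m) :=
  ∑ p : Fin m, ∑ q : Fin m,
    rCoeff p q • (slotHom i (Matrix.single p q 1) * slotHom j (Matrix.single q p 1))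

/-- The regularised two-point operator. -/
def exchange (i j : Fin N) : R :=
  S (rSlot i j) - P (divDiff i j) * S (permHom (Equiv.swap i j))

theorem rSlot_add {i j : Fin N} (hij : i ≠ j) :
    rSlot i j + rSlot j i = permHom (m := m) (Equiv.swap i j) := by
  rw [permHom_swap hij]
  conv_lhs => rw [rSlot, rSlot, Finset.sum_comm (f := fun p q => rCoeff p q •
    (slotHom j (Matrix.single p q 1) * slotHom i (Matrix.single q p 1)))]
  simp only [← Finset.sum_add_distrib]
  refine Finset.sum_congr rfl fun p _ => Finset.sum_congr rfl fun q _ => ?_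
  rw [(slotHom_commute hij.symm _ _).eq, ← add_smul, rCoeff_add, one_smul]

theorem permHom_mul_rSlot (w : Equiv.Perm (Fin N)) (i j : Fin N) :
    permHom (m := m) w * rSlot i j = rSlot (w i) (w j) * permHom w := by
  simp only [rSlot, Finset.mul_sum, Finset.sum_mul]
  refine Finset.sum_congr rfl fun p _ => Finset.sum_congr rfl fun q _ => ?_
  rw [mul_smul_comm, smul_mul_assoc, ← mul_assoc, permHom_mul_slotHom, mul_assoc,
    permHom_mul_slotHom, ← mul_assoc]

theorem tauOp_one : tauOp P S 1 = 1 := by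
  have h : (permPoly (1 : Equiv.Perm (Fin N))).toLinearMap = (1 : Module.End ℂ _) :=
    LinearMap.ext fun f => permPoly_one f
  rw [tauOp, permHom_one, h, map_one, map_one, one_mul]

/-- The two `r`-matrices add up to the flip `P`, and the two divided differences to `1 - s`; so `P -
(1 - s) P = s P` is the simultaneous permutation. -/
theorem exchange_add {i j : Fin N} (hij : i ≠ j) :
    exchange P S i j + exchange P S j i = tauOp P S (Equiv.swap i j) := by
  have h : divDiff i j + divDiff j i =
      (1 - (permPoly (Equiv.swap i j)).toLinearMap : Module.End ℂ _) :=
    LinearMap.ext fun f => divDiff_add_divDiff hij f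
  have h1 : exchange P S i j + exchange P S j i =
      S (rSlot i j + rSlot j i) - P (divDiff i j + divDiff j i) * S (permHom (Equiv.swap i j)) := by
    rw [exchange, exchange, Equiv.swap_comm j i, map_add, map_add, add_mul]; abel
  rw [h1, h, rSlot_add hij, map_sub, map_one, tauOp, sub_mul, one_mul, sub_sub_cancel]

variable {P S} (hPS : ∀ f g, Commute (P f) (S g))
include hPS

theorem tauOp_mul (w w' : Equiv.Perm (Fin N)) : tauOp P S (w * w') = tauOp P S w * tauOp P S w' := by
  have h : (permPoly (w * w')).toLinearMap =
      ((permPoly w).toLinearMap * (permPoly w').toLinearMap : Module.End ℂ _) :=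
    LinearMap.ext fun f => permPoly_mul w w' f
  rw [tauOp, tauOp, tauOp, permHom_mul, h, map_mul, map_mul, mul_assoc, mul_assoc,
    ← mul_assoc (S _) (P _), ← (hPS _ _).eq, mul_assoc]

theorem tauOp_mul_exchange (w : Equiv.Perm (Fin N)) {i j : Fin N} (hij : i ≠ j) :
    tauOp P S w * exchange P S i j = exchange P S (w i) (w j) * tauOp P S w := by
  have h : ((permPoly w).toLinearMap * divDiff i j : Module.End ℂ _) =
      divDiff (w i) (w j) * (permPoly w).toLinearMap :=
    LinearMap.ext fun f => permPoly_divDiff w hij f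
  have h2 : permHom (m := m) w * permHom (Equiv.swap i j) =
      permHom (Equiv.swap (w i) (w j)) * permHom w := by
    rw [← permHom_mul, ← permHom_mul, Equiv.swap_apply_apply, mul_assoc, mul_assoc, inv_mul_cancel,
      mul_one]
  rw [exchange, exchange, tauOp, mul_sub, sub_mul]
  congr 1
  · rw [mul_assoc, ← map_mul, permHom_mul_rSlot, map_mul, ← mul_assoc, (hPS _ _).eq, mul_assoc]
  · rw [mul_assoc, ← mul_assoc (S _), ← (hPS _ _).eq, mul_assoc (P _), ← map_mul, h2, map_mul,
      ← mul_assoc, ← map_mul, h, map_mul, mul_assoc, mul_assoc, ← mul_assoc (S _) (P _),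
      ← (hPS _ _).eq, mul_assoc]

theorem tauOp_mul_mulP (w : Equiv.Perm (Fin N)) (f : MultiLaurent N) :
    tauOp P S w * P (mulP f) = P (mulP (permPoly w f)) * tauOp P S w := by
  have h : ((permPoly w).toLinearMap * mulP f : Module.End ℂ _) =
      mulP (permPoly w f) * (permPoly w).toLinearMap :=
    LinearMap.ext fun g => map_mul (permPoly w) f g
  rw [tauOp, mul_assoc, ← (hPS _ _).eq, ← mul_assoc, ← map_mul, h, map_mul, mul_assoc]

theorem tauOp_mul_slot (w : Equiv.Perm (Fin N)) (i : Fin N) (x : Matrix (Fin m) (Fin m) ℂ) :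
    tauOp P S w * S (slotHom i x) = S (slotHom (w i) x) * tauOp P S w := by
  rw [tauOp, mul_assoc, ← map_mul, permHom_mul_slotHom, map_mul, ← mul_assoc, (hPS _ _).eq,
    mul_assoc]

theorem tauOp_mul_evalAct (w : Equiv.Perm (Fin N)) (i : Fin N) (y : AffineSl m) :
    tauOp P S w * evalAct P S i y = evalAct P S (w i) y * tauOp P S w := by
  have h : ((permPoly w).toLinearMap * partialXi (Pi.single i 1) : Module.End ℂ _) =
      partialXi (Pi.single (w i) 1) * (permPoly w).toLinearMap :=
    LinearMap.ext fun f => by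
      have h1 : (Pi.single i 1 : Fin N → ℂ) ∘ w.symm = Pi.single (w i) 1 := by
        ext k
        rw [Function.comp_apply, Pi.single_apply, Pi.single_apply]
        simp [Equiv.symm_apply_eq]
      have h2 := permPoly_partialXi w (Pi.single i 1) f
      rw [h1] at h2
      exact h2
  have h3 : tauOp P S w * P (partialXi (Pi.single i 1)) =
      P (partialXi (Pi.single (w i) 1)) * tauOp P S w := by
    rw [tauOp, mul_assoc, ← (hPS _ _).eq, ← mul_assoc, ← map_mul, h, map_mul, mul_assoc]
  rw [evalAct_apply, evalAct_apply, mul_add, add_mul, mul_smul_comm, smul_mul_assoc, h3]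
  congr 1
  simp only [loopAct, LinearMap.coe_mk, AddHom.coe_mk, Finset.mul_sum, Finset.sum_mul]
  refine Finset.sum_congr rfl fun p _ => Finset.sum_congr rfl fun q _ => ?_
  rw [← mul_assoc, tauOp_mul_mulP hPS, mul_assoc, tauOp_mul_slot hPS, permPoly_evalVar,
    mul_assoc]

theorem expMon_mul_evalAct (η : Fin N → ℤ) (i : Fin N) (y : AffineSl m) :
    P (mulP (expMon η)) * evalAct P S i y = evalAct P S i y * P (mulP (expMon η)) -
      (y.d * η i) • P (mulP (expMon η)) := by
  have h : (mulP (expMon η) * partialXi (Pi.single i 1) : Module.End ℂ (MultiLaurent N)) =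
      partialXi (Pi.single i 1) * mulP (expMon η) - (η i : ℂ) • mulP (expMon η) := by
    have h1 : partialXi (Pi.single i 1) (expMon η) = (η i : ℂ) • expMon η := by
      rw [partialXi_expMon, Finset.sum_eq_single i]
      · simp
      · intro j _ hj; simp [hj]
      · simp
    rw [partialXi_mulP, h1, map_smul, add_sub_cancel_right]
  have h2 : P (mulP (expMon η)) * loopAct P S i y.loop.val =
      loopAct P S i y.loop.val * P (mulP (expMon η)) := by
    simp only [loopAct, LinearMap.coe_mk, AddHom.coe_mk]
    refine Commute.sum_right _ _ _ fun p _ => Commute.sum_right _ _ _ fun q _ => ?_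
    exact ((mulP_commute _ _).map P).mul_right (hPS _ _)
  rw [evalAct_apply, mul_add, add_mul, mul_smul_comm, smul_mul_assoc, ← map_mul, h, h2, map_sub,
    map_smul, map_mul, smul_sub, smul_smul]
  abel

theorem zPow_commute_exchange {i j k : Fin N} (hij : i ≠ j) (hki : k ≠ i) (hkj : k ≠ j) :
    P (mulP (zPow k 1)) * exchange P S i j = exchange P S i j * P (mulP (zPow k 1)) := by
  have h : (mulP (zPow k 1) * divDiff i j : Module.End ℂ (MultiLaurent N)) =
      divDiff i j * mulP (zPow k 1) := LinearMap.ext fun f => by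
    change zPow k 1 * divDiff i j f = divDiff i j (zPow k 1 * f)
    rw [divDiff_mul hij, divDiff_zPow_of_ne hij hki hkj, permPoly_zPow,
      Equiv.swap_apply_of_ne_of_ne hki hkj, zero_mul, add_zero]
  rw [exchange, mul_sub, sub_mul, (hPS _ _).eq, ← mul_assoc, ← map_mul, h, map_mul, mul_assoc,
    (hPS _ _).eq, mul_assoc]

/-- Conjugation by the second variable of the pair removes a permutation from `exchange`; for the
first variable, below, it adds one back. The asymmetry comes from the choice of denominator `1 - z_j
/ z_i`. -/
theorem zPow_mul_exchange_right {i j : Fin N} (hij : i ≠ j) :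
    P (mulP (zPow j 1)) * exchange P S i j =
      (exchange P S i j - tauOp P S (Equiv.swap i j)) * P (mulP (zPow j 1)) := by
  have h : (mulP (zPow j 1) * divDiff i j : Module.End ℂ (MultiLaurent N)) =
      (divDiff i j + (permPoly (Equiv.swap i j)).toLinearMap) * mulP (zPow j 1) :=
    LinearMap.ext fun f => zPow_mul_divDiff' hij f
  rw [exchange, tauOp, mul_sub, sub_mul, sub_mul, (hPS _ _).eq, ← mul_assoc, ← map_mul, h,
    map_mul, map_add, mul_assoc, (hPS _ _).eq, add_mul, mul_assoc, mul_assoc]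
  abel

theorem zPow_mul_exchange_left {i j : Fin N} (hij : i ≠ j) :
    P (mulP (zPow i 1)) * (exchange P S i j - tauOp P S (Equiv.swap i j)) =
      exchange P S i j * P (mulP (zPow i 1)) := by
  have h : (mulP (zPow i 1) * (divDiff i j + (permPoly (Equiv.swap i j)).toLinearMap) :
      Module.End ℂ (MultiLaurent N)) = divDiff i j * mulP (zPow i 1) :=
    LinearMap.ext fun f => zPow_mul_divDiff hij f
  have h1 : exchange P S i j - tauOp P S (Equiv.swap i j) = S (rSlot i j) -
      P (divDiff i j + (permPoly (Equiv.swap i j)).toLinearMap) *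
        S (permHom (Equiv.swap i j)) := by
    rw [exchange, tauOp, map_add, add_mul]; abel
  rw [h1, exchange, mul_sub, sub_mul, (hPS _ _).eq, ← mul_assoc, ← map_mul, h, map_mul, mul_assoc,
    (hPS _ _).eq, mul_assoc]

end Exchange

/-! ### Trace-zero matrix units and the Casimir tensor -/

section SpecialLinear

variable {m : ℕ}

theorem slUnit_val (p q : Fin m) : (slUnit p q).val =
    Matrix.single p q 1 - if p = q then (1 / (m : ℂ)) • (1 : Matrix (Fin m) (Fin m) ℂ) else 0 := rfl

theorem sl_trace (x : 𝔰 m) : Matrix.trace x.val = 0 := x.property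

theorem sl_lie_val (x y : 𝔰 m) : ⁅x, y⁆.val = x.val * y.val - y.val * x.val := rfl

theorem lie_slUnit_val (x : 𝔰 m) (p q : Fin m) : ⁅x, slUnit p q⁆.val =
    x.val * Matrix.single p q 1 - Matrix.single p q 1 * x.val := by
  rw [sl_lie_val, slUnit_val]
  split_ifs
  · rw [mul_sub, sub_mul, Matrix.mul_smul, Matrix.smul_mul, mul_one, one_mul]; abel
  · rw [sub_zero]

theorem trace_mul_slUnit (x : 𝔰 m) (p q : Fin m) :
    Matrix.trace (x.val * (slUnit p q).val) = x.val q p := by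
  rw [slUnit_val, mul_sub, Matrix.trace_sub, Matrix.trace_mul_single]
  split_ifs
  · rw [Matrix.mul_smul, mul_one, Matrix.trace_smul, sl_trace]; simp
  · simp

theorem sum_slUnit_diag : ∑ p : Fin m, slUnit p p = 0 := by
  apply Subtype.ext
  rcases Nat.eq_zero_or_pos m with rfl | hm
  · ext i; exact i.elim0
  have hm' : (m : ℂ) ≠ 0 := by exact_mod_cast hm.ne'
  rw [AddSubmonoidClass.coe_finsetSum]
  simp only [slUnit_val, if_true, Finset.sum_sub_distrib, Finset.sum_const, Finset.card_univ,
    Fintype.card_fin]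
  rw [← Nat.cast_smul_eq_nsmul ℂ, smul_smul, mul_one_div_cancel hm', one_smul]
  ext i j
  rcases eq_or_ne i j with rfl | h
  · simp [Matrix.sum_apply, Matrix.single_apply]
  · simp only [Matrix.sub_apply, Matrix.sum_apply, Matrix.single_apply, Matrix.one_apply_ne h,
      sub_zero]
    refine Finset.sum_eq_zero fun k _ => if_neg ?_
    rintro ⟨rfl, rfl⟩; exact h rfl

/-- The scalar corrections in the diagonal units add up to a multiple of the trace of `x`. Thus the
`m²` elements `slUnit p q` behave like a basis in all formulas, although the diagonal ones are
dependent. -/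
theorem sl_eq_sum (x : 𝔰 m) : x = ∑ p : Fin m, ∑ q : Fin m, x.val p q • slUnit p q := by
  apply Subtype.ext
  have h1 : (∑ p : Fin m, ∑ q : Fin m, x.val p q • slUnit p q).val =
      ∑ p : Fin m, ∑ q : Fin m, x.val p q • (slUnit p q).val := by
    simp
  rw [h1]
  simp only [slUnit_val, smul_sub, Finset.sum_sub_distrib, smul_ite, smul_zero,
    Finset.sum_ite_eq, Finset.mem_univ, if_true, ← Finset.sum_smul]
  have h2 : ∑ p : Fin m, x.val p p = 0 := sl_trace x
  rw [h2, zero_smul, sub_zero]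
  conv_lhs => rw [Matrix.matrix_eq_sum_single x.val]
  simp

theorem lie_slUnit (x : 𝔰 m) (p q : Fin m) : ⁅x, slUnit p q⁆ =
    ∑ k : Fin m, x.val k p • slUnit k q - ∑ k : Fin m, x.val q k • slUnit p k := by
  apply Subtype.ext
  have h1 : (∑ k : Fin m, x.val k p • slUnit k q - ∑ k : Fin m, x.val q k • slUnit p k).val =
      ∑ k : Fin m, x.val k p • (slUnit k q).val - ∑ k : Fin m, x.val q k • (slUnit p k).val := by
    simp
  rw [h1, lie_slUnit_val]
  simp only [slUnit_val, smul_sub, Finset.sum_sub_distrib, smul_ite, smul_zero,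
    Finset.sum_ite_eq, Finset.sum_ite_eq', Finset.mem_univ, if_true]
  have h2 : x.val * Matrix.single p q 1 = ∑ k : Fin m, x.val k p • Matrix.single k q (1 : ℂ) := by
    ext i j
    simp only [Matrix.sum_apply, Matrix.smul_apply, Matrix.single_apply, smul_eq_mul]
    by_cases hj : q = j
    · subst hj; simp
    · simp [Matrix.mul_apply, hj]
  have h3 : Matrix.single p q 1 * x.val = ∑ k : Fin m, x.val q k • Matrix.single p k (1 : ℂ) := by
    ext i j
    simp only [Matrix.sum_apply, Matrix.smul_apply, Matrix.single_apply, smul_eq_mul]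
    by_cases hi : p = i
    · subst hi; simp
    · simp [Matrix.mul_apply, hi]
  rw [h2, h3]; abel

/-- The invariance of the Casimir tensor. -/
theorem casimir_invariant {E : Type} [AddCommGroup E] [Module ℂ E]
    (F : (𝔰 m) →ₗ[ℂ] (𝔰 m) →ₗ[ℂ] E) (x : 𝔰 m) :
    (∑ p : Fin m, ∑ q : Fin m, F ⁅x, slUnit p q⁆ (slUnit q p)) +
      ∑ p : Fin m, ∑ q : Fin m, F (slUnit p q) ⁅x, slUnit q p⁆ = 0 := by
  simp only [lie_slUnit, map_sub, map_sum, map_smul, LinearMap.sub_apply, LinearMap.sum_apply,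
    LinearMap.smul_apply, Finset.sum_sub_distrib]
  have h1 : ∑ p : Fin m, ∑ q : Fin m, ∑ k : Fin m, x.val k p • F (slUnit k q) (slUnit q p) =
      ∑ p : Fin m, ∑ q : Fin m, ∑ k : Fin m, x.val p k • F (slUnit p q) (slUnit q k) := by
    calc _ = ∑ p : Fin m, ∑ k : Fin m, ∑ q : Fin m, x.val k p • F (slUnit k q) (slUnit q p) :=
          Finset.sum_congr rfl fun p _ => Finset.sum_comm
      _ = ∑ k : Fin m, ∑ p : Fin m, ∑ q : Fin m, x.val k p • F (slUnit k q) (slUnit q p) :=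
          Finset.sum_comm
      _ = _ := Finset.sum_congr rfl fun p _ => Finset.sum_comm
  have h2 : ∑ p : Fin m, ∑ q : Fin m, ∑ k : Fin m, x.val q k • F (slUnit p k) (slUnit q p) =
      ∑ p : Fin m, ∑ q : Fin m, ∑ k : Fin m, x.val k q • F (slUnit p q) (slUnit k p) :=
    Finset.sum_congr rfl fun p _ => Finset.sum_comm
  rw [h1, h2]; abel

end SpecialLinear

/-! ### Brackets of homogeneous elements of the affine algebra -/

namespace AffineSl

variable {m : ℕ}

/-- `x ↦ x ⊗ t^n` as a linear map. -/
def tmulHom (n : ℤ) : (𝔰 m) →ₗ[ℂ] AffineSl m where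
  toFun := tmul n
  map_add' x y := by
    refine ext_val ?_ (by simp [tmul]) (by simp [tmul])
    exact Matrix.map_add _ (map_add (AddMonoidAlgebra.singleAddHom n)) x.val y.val
  map_smul' a x := by
    refine ext_val ?_ (by simp [tmul]) (by simp [tmul])
    ext1 i j
    change AddMonoidAlgebra.single n (a * x.val i j) = a • AddMonoidAlgebra.single n (x.val i j)
    rw [AddMonoidAlgebra.smul_single, smul_eq_mul]

theorem tmulHom_apply (n : ℤ) (x : 𝔰 m) : tmulHom n x = tmul n x := rfl

theorem matDer_map_single (n : ℤ) (x : Matrix (Fin m) (Fin m) ℂ) :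
    matDer m (x.map (AddMonoidAlgebra.singleAddHom n)) =
      (n : ℂ) • x.map (AddMonoidAlgebra.singleAddHom n) := by
  ext1 i j
  change tDer (AddMonoidAlgebra.single n (x i j)) = (n : ℂ) • AddMonoidAlgebra.single n (x i j)
  rw [tDer, monomialDer_single, AddMonoidAlgebra.smul_single, smul_eq_mul, mul_comm]
  rfl

theorem map_single_mul (a b : ℤ) (x y : Matrix (Fin m) (Fin m) ℂ) :
    x.map (AddMonoidAlgebra.singleAddHom a) * y.map (AddMonoidAlgebra.singleAddHom b) =
      (x * y).map (AddMonoidAlgebra.singleAddHom (a + b)) := by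
  ext1 i j
  simp only [Matrix.mul_apply, Matrix.map_apply, map_sum]
  exact Finset.sum_congr rfl fun k _ => AddMonoidAlgebra.single_mul_single ..

theorem constTerm_single (n : ℤ) (a : ℂ) :
    constTerm (AddMonoidAlgebra.single n a) = if n = 0 then a else 0 := by
  have h1 : AddMonoidAlgebra.single n a = a • (AddMonoidAlgebra.basis ℤ ℂ n) := by
    rw [AddMonoidAlgebra.basis_apply, AddMonoidAlgebra.smul_single, smul_eq_mul, mul_one]
  rw [h1, map_smul, constTerm, Module.Basis.coord_apply, Module.Basis.repr_self]
  simp [Finsupp.single_apply]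

theorem tmul_lie_tmul (a b : ℤ) (x y : 𝔰 m) : ⁅tmul a x, tmul b y⁆ =
    tmul (a + b) ⁅x, y⁆ +
      (if a + b = 0 then (a : ℂ) * Matrix.trace (x.val * y.val) else 0) • central := by
  refine ext_val ?_ ?_ ?_
  · rw [lie_loop_val, add_loop_val, smul_loop_val]
    have h1 : (central : AffineSl m).loop.val = 0 := rfl
    have h2 : (tmul a x).d = 0 := rfl
    have h3 : (tmul b y).d = 0 := rfl
    rw [h1, h2, h3, smul_zero, add_zero, zero_smul, zero_smul, add_zero, sub_zero]
    change x.val.map (AddMonoidAlgebra.singleAddHom a) * y.val.map (AddMonoidAlgebra.singleAddHom b)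
      - y.val.map (AddMonoidAlgebra.singleAddHom b) * x.val.map (AddMonoidAlgebra.singleAddHom a) =
      Matrix.map ⁅x, y⁆.val (AddMonoidAlgebra.singleAddHom (a + b))
    rw [map_single_mul, map_single_mul, add_comm b a, sl_lie_val]
    exact (Matrix.map_sub _ (map_sub (AddMonoidAlgebra.singleAddHom (R := ℂ) (a + b))) _ _).symm
  · rw [lie_c, add_c, smul_c]
    have h1 : (central : AffineSl m).c = 1 := rfl
    have h2 : (tmul (a + b) ⁅x, y⁆).c = 0 := rfl
    rw [h1, h2, zero_add, mul_one]
    change constTerm (Matrix.trace (matDer m (x.val.map (AddMonoidAlgebra.singleAddHom a)) *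
      y.val.map (AddMonoidAlgebra.singleAddHom b))) = _
    rw [matDer_map_single, Matrix.smul_mul, Matrix.trace_smul, map_smul, map_single_mul,
      ← AddMonoidHom.map_trace, AddMonoidAlgebra.singleAddHom_apply, constTerm_single]
    simp
  · rw [lie_d, add_d, smul_d]
    change (0 : ℂ) = 0 + _ * 0
    rw [mul_zero, add_zero]

theorem tmul_lie_unit (a b : ℤ) (x : 𝔰 m) (p q : Fin m) : ⁅tmul a x, unit b p q⁆ =
    tmul (a + b) ⁅x, slUnit p q⁆ + (if a + b = 0 then (a : ℂ) * x.val q p else 0) • central := by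
  rw [unit, tmul_lie_tmul, trace_mul_slUnit]

theorem central_lie (x : AffineSl m) : ⁅(central : AffineSl m), x⁆ = 0 := by
  have h1 : (central : AffineSl m).loop.val = 0 := rfl
  have h2 : (central : AffineSl m).d = 0 := rfl
  refine ext_val ?_ ?_ ?_
  · rw [lie_loop_val, h1, h2, zero_loop_val]; simp
  · rw [lie_c, h1]; simp
  · rw [lie_d]; rfl

theorem tmul_lie_degree (a : ℤ) (x : 𝔰 m) :
    ⁅tmul a x, (degree : AffineSl m)⁆ = -((a : ℂ) • tmul a x) := by
  rw [← neg_smul]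
  have h1 : (degree : AffineSl m).loop.val = 0 := rfl
  have h2 : (degree : AffineSl m).d = 1 := rfl
  have h3 : (tmul a x).d = 0 := rfl
  have h4 : (tmul a x).c = 0 := rfl
  refine ext_val ?_ ?_ ?_
  · rw [lie_loop_val, h1, h2, h3, smul_loop_val]
    change _ - (1 : ℂ) • matDer m (x.val.map (AddMonoidAlgebra.singleAddHom a)) =
      _ • x.val.map (AddMonoidAlgebra.singleAddHom a)
    rw [matDer_map_single]; simp
  · rw [lie_c, h1, smul_c, h4]; simp
  · rw [lie_d, smul_d, h3, mul_zero]

end AffineSl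

/-- The coefficients of the classical `r`-matrix, transposed for `n ≠ 1`. -/
def rSigned {m : ℕ} (n : ℤ) (p q : Fin m) : ℂ := if n = 1 then rCoeff p q else rCoeff q p

/-! ### The Lie cobracket on elements of loop degree one and minus one -/

section Cobracket

variable {m : ℕ} {R : Type} [Ring R] [Algebra ℂ R]

/-- The Lie cobracket of `x ⊗ t^n`, for `n = ±1`, acting through `f` and `g`. -/
def deltaOp (n : ℤ) (x : 𝔰 m) (f g : AffineSl m →ₗ[ℂ] R) : R :=
  (1 / 2 : ℂ) • (f (AffineSl.tmul n x) * g AffineSl.central -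
    f AffineSl.central * g (AffineSl.tmul n x)) +
  (n : ℂ) • ∑ p : Fin m, ∑ q : Fin m, rSigned n p q •
    (f (AffineSl.unit 0 p q) * g (AffineSl.tmul n ⁅x, slUnit q p⁆) -
      f (AffineSl.tmul n ⁅x, slUnit q p⁆) * g (AffineSl.unit 0 p q))

theorem deltaOp_add (n : ℤ) (x : 𝔰 m) (f f' g : AffineSl m →ₗ[ℂ] R) :
    deltaOp n x (f + f') g = deltaOp n x f g + deltaOp n x f' g := by
  have h : ∀ p q : Fin m, rSigned n p q • ((f (AffineSl.unit 0 p q) + f' (AffineSl.unit 0 p q)) *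
      g (AffineSl.tmul n ⁅x, slUnit q p⁆) - (f (AffineSl.tmul n ⁅x, slUnit q p⁆) +
        f' (AffineSl.tmul n ⁅x, slUnit q p⁆)) * g (AffineSl.unit 0 p q)) = rSigned n p q • (f (AffineSl.unit 0 p q) *
      g (AffineSl.tmul n ⁅x, slUnit q p⁆) - f (AffineSl.tmul n ⁅x, slUnit q p⁆) *
        g (AffineSl.unit 0 p q)) + rSigned n p q • (f' (AffineSl.unit 0 p q) *
      g (AffineSl.tmul n ⁅x, slUnit q p⁆) - f' (AffineSl.tmul n ⁅x, slUnit q p⁆) *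
        g (AffineSl.unit 0 p q)) := by
    intro p q
    rw [← smul_add, add_mul, add_mul]
    congr 1; abel
  rw [deltaOp, deltaOp, deltaOp]
  simp only [LinearMap.add_apply, h, Finset.sum_add_distrib]
  rw [add_mul, add_mul]
  module

theorem deltaOp_sum {ι : Type} (s : Finset ι) (n : ℤ) (x : 𝔰 m) (f : ι → AffineSl m →ₗ[ℂ] R)
    (g : AffineSl m →ₗ[ℂ] R) : deltaOp n x (∑ k ∈ s, f k) g = ∑ k ∈ s, deltaOp n x (f k) g :=
  map_sum (AddMonoidHom.mk' (fun f => deltaOp n x f g) fun f f' => deltaOp_add n x f f' g) f s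

/-- Lets all cobrackets at the `i`-th place be written with that place as second leg, so that they
can be added. -/
theorem deltaOp_antisymm (n : ℤ) (x : 𝔰 m) {f g : AffineSl m →ₗ[ℂ] R}
    (hfg : ∀ y z, Commute (f y) (g z)) : deltaOp n x f g = -deltaOp n x g f := by
  rw [deltaOp, deltaOp, neg_add, ← smul_neg, ← smul_neg, neg_sub, (hfg _ _).eq, (hfg _ _).eq]
  congr 2
  simp only [← Finset.sum_neg_distrib, ← smul_neg, neg_sub]
  refine Finset.sum_congr rfl fun p _ => Finset.sum_congr rfl fun q _ => ?_
  rw [(hfg _ _).eq, (hfg _ _).eq]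

end Cobracket

/-! ### Commutators of loop elements with two-point operators and with `ρ^∨` -/

section SlotCommutator

variable {N m : ℕ}

theorem commutator_mul_left {R : Type} [Ring R] {a b c : R} (h : Commute a c) :
    a * (b * c) - b * c * a = (a * b - b * a) * c := by
  rw [mul_assoc b, ← h.eq, sub_mul]; simp only [mul_assoc]

theorem commutator_mul_right {R : Type} [Ring R] {a b c : R} (h : Commute a b) :
    a * (b * c) - b * c * a = b * (a * c - c * a) := by
  rw [← mul_assoc, h.eq, mul_sub]; simp only [mul_assoc]

theorem rCoeff_sub_one (p q : Fin m) : rCoeff p q - 1 = -rCoeff q p := by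
  rw [← rCoeff_add p q]; ring

theorem rCoeff_self (p : Fin m) : rCoeff p p = 1 / 2 := by simp [rCoeff]

theorem rSigned_self (n : ℤ) (p : Fin m) : rSigned n p p = 1 / 2 := by
  simp [rSigned, rCoeff_self]

theorem sum_lie_slUnit_diag (x : 𝔰 m) : ∑ p : Fin m, ⁅x, slUnit p p⁆ = 0 := by
  rw [← lie_sum, sum_slUnit_diag, lie_zero]

variable {R : Type} [Ring R] [Algebra ℂ R]
  {P : Module.End ℂ (MultiLaurent N) →ₐ[ℂ] R} (S : Module.End ℂ (TensorPow N m) →ₐ[ℂ] R)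

/-- The action of matrices on the `i`-th tensor factor, composed with an action of operators. -/
def slotIn (i : Fin N) : Matrix (Fin m) (Fin m) ℂ →ₐ[ℂ] R := S.comp (slotHom i)

theorem slotIn_apply (i : Fin N) (x : Matrix (Fin m) (Fin m) ℂ) :
    slotIn S i x = S (slotHom i x) := rfl

theorem slotIn_commute {i j : Fin N} (hij : i ≠ j) (x y : Matrix (Fin m) (Fin m) ℂ) :
    Commute (slotIn S i x) (slotIn S j y) := (slotHom_commute hij x y).map S

/-- `∑ κ_pq E_pq^(i) E_qp^(j)`. -/
def pairSum (κ : Fin m → Fin m → ℂ) (i j : Fin N) : R := ∑ p : Fin m, ∑ q : Fin m,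
  κ p q • (slotIn S i (Matrix.single p q 1) * slotIn S j (Matrix.single q p 1))

/-- `∑ κ_pq [x, E_pq]^(i) E_qp^(j)`. -/
def adLeft (x : 𝔰 m) (κ : Fin m → Fin m → ℂ) (i j : Fin N) : R :=
  ∑ p : Fin m, ∑ q : Fin m, κ p q •
    (slotIn S i ⁅x, slUnit p q⁆.val * slotIn S j (Matrix.single q p 1))

/-- `∑ κ_pq E_pq^(i) [x, E_qp]^(j)`. -/
def adRight (x : 𝔰 m) (κ : Fin m → Fin m → ℂ) (i j : Fin N) : R :=
  ∑ p : Fin m, ∑ q : Fin m, κ p q •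
    (slotIn S i (Matrix.single p q 1) * slotIn S j ⁅x, slUnit q p⁆.val)

theorem map_rSlot (i j : Fin N) : S (rSlot i j) = pairSum S rCoeff i j := by
  simp only [rSlot, pairSum, map_sum, map_smul, map_mul, slotIn_apply]

theorem map_permHom_swap {i j : Fin N} (hij : i ≠ j) :
    S (permHom (Equiv.swap i j)) = pairSum S (fun _ _ => 1) i j := by
  rw [permHom_swap hij]
  simp only [pairSum, map_sum, one_smul, map_mul, slotIn_apply]

theorem slot_commutator_left (x : 𝔰 m) (κ : Fin m → Fin m → ℂ) {i j : Fin N} (hij : i ≠ j) :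
    slotIn S i x.val * pairSum S κ i j - pairSum S κ i j * slotIn S i x.val =
      adLeft S x κ i j := by
  simp only [adLeft, pairSum, Finset.mul_sum, Finset.sum_mul, ← Finset.sum_sub_distrib]
  refine Finset.sum_congr rfl fun p _ => Finset.sum_congr rfl fun q _ => ?_
  rw [mul_smul_comm, smul_mul_assoc, ← smul_sub, commutator_mul_left (slotIn_commute S hij _ _),
    lie_slUnit_val, map_sub, map_mul, map_mul]

theorem slot_commutator_right (x : 𝔰 m) (κ : Fin m → Fin m → ℂ) {i j : Fin N} (hij : i ≠ j) :
    slotIn S j x.val * pairSum S κ i j - pairSum S κ i j * slotIn S j x.val =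
      adRight S x κ i j := by
  simp only [adRight, pairSum, Finset.mul_sum, Finset.sum_mul, ← Finset.sum_sub_distrib]
  refine Finset.sum_congr rfl fun p _ => Finset.sum_congr rfl fun q _ => ?_
  rw [mul_smul_comm, smul_mul_assoc, ← smul_sub,
    commutator_mul_right (slotIn_commute S hij.symm _ _), lie_slUnit_val, map_sub, map_mul, map_mul]

theorem slotIn_mul_swap (i j k : Fin N) (x : Matrix (Fin m) (Fin m) ℂ) :
    S (permHom (Equiv.swap i j)) * slotIn S k x =
      slotIn S (Equiv.swap i j k) x * S (permHom (Equiv.swap i j)) := by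
  rw [slotIn_apply, slotIn_apply, ← map_mul, permHom_mul_slotHom, map_mul]

theorem slot_sub_slot_mul_swap_left (x : 𝔰 m) {i j : Fin N} (hij : i ≠ j) :
    (slotIn S i x.val - slotIn S j x.val) * S (permHom (Equiv.swap i j)) =
      adLeft S x (fun _ _ => 1) i j := by
  have h := slotIn_mul_swap S i j i x.val
  rw [Equiv.swap_apply_left] at h
  rw [sub_mul, ← h, map_permHom_swap S hij, slot_commutator_left S x (fun _ _ => 1) hij]

theorem slot_sub_slot_mul_swap_right (x : 𝔰 m) {i j : Fin N} (hij : i ≠ j) :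
    (slotIn S j x.val - slotIn S i x.val) * S (permHom (Equiv.swap i j)) =
      adRight S x (fun _ _ => 1) i j := by
  have h := slotIn_mul_swap S i j j x.val
  rw [Equiv.swap_apply_right] at h
  rw [sub_mul, ← h, map_permHom_swap S hij, slot_commutator_right S x (fun _ _ => 1) hij]

/-- Subtracting the whole Casimir tensor turns the coefficients `rCoeff p q` into `-rCoeff q p`. The
flip terms produced by divided differences have this effect. -/
theorem adLeft_sub_one (x : 𝔰 m) (i j : Fin N) :
    adLeft S x rCoeff i j - adLeft S x (fun _ _ => 1) i j =
      -adLeft S x (fun p q => rCoeff q p) i j := by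
  simp only [adLeft, ← Finset.sum_sub_distrib, ← sub_smul, rCoeff_sub_one, neg_smul,
    Finset.sum_neg_distrib]

theorem adRight_sub_one (x : 𝔰 m) (i j : Fin N) :
    adRight S x rCoeff i j - adRight S x (fun _ _ => 1) i j =
      -adRight S x (fun p q => rCoeff q p) i j := by
  simp only [adRight, ← Finset.sum_sub_distrib, ← sub_smul, rCoeff_sub_one, neg_smul,
    Finset.sum_neg_distrib]

theorem slotIn_slUnit (i : Fin N) (p q : Fin m) : slotIn S i (slUnit p q).val =
    slotIn S i (Matrix.single p q 1) - if p = q then (1 / (m : ℂ)) • 1 else 0 := by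
  rw [slUnit_val, map_sub]
  split_ifs
  · rw [map_smul, map_one]
  · rw [map_zero]

/-- Replacing matrix units by their trace-zero parts does not change the tensor. -/
theorem sum_slUnit_left (x : 𝔰 m) (κ : Fin m → Fin m → ℂ) (c : ℂ) (hκ : ∀ p, κ p p = c)
    (i j : Fin N) : ∑ p : Fin m, ∑ q : Fin m, κ p q •
      (slotIn S i (slUnit p q).val * slotIn S j ⁅x, slUnit q p⁆.val) = adRight S x κ i j := by
  have h : ∀ p q : Fin m, κ p q • (slotIn S i (slUnit p q).val * slotIn S j ⁅x, slUnit q p⁆.val) =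
      κ p q • (slotIn S i (Matrix.single p q 1) * slotIn S j ⁅x, slUnit q p⁆.val) -
        if p = q then (c / m) • slotIn S j ⁅x, slUnit p p⁆.val else 0 := by
    intro p q
    rw [slotIn_slUnit]
    split_ifs with hpq
    · subst hpq
      rw [sub_mul, smul_sub, smul_mul_assoc, one_mul, smul_smul, hκ]
      congr 2; ring
    · rw [sub_zero, sub_zero]
  simp only [h, Finset.sum_sub_distrib, Finset.sum_ite_eq, Finset.mem_univ, if_true]
  rw [← Finset.smul_sum, ← map_sum, ← AddSubmonoidClass.coe_finsetSum, sum_lie_slUnit_diag]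
  simp [adRight]

theorem sum_slUnit_right (x : 𝔰 m) (κ : Fin m → Fin m → ℂ) (c : ℂ) (hκ : ∀ p, κ p p = c)
    (i j : Fin N) : ∑ p : Fin m, ∑ q : Fin m, κ p q •
      (slotIn S i ⁅x, slUnit p q⁆.val * slotIn S j (slUnit q p).val) = adLeft S x κ i j := by
  have h : ∀ p q : Fin m, κ p q • (slotIn S i ⁅x, slUnit p q⁆.val * slotIn S j (slUnit q p).val) =
      κ p q • (slotIn S i ⁅x, slUnit p q⁆.val * slotIn S j (Matrix.single q p 1)) -
        if p = q then (c / m) • slotIn S i ⁅x, slUnit p p⁆.val else 0 := by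
    intro p q
    rw [slotIn_slUnit]
    by_cases hpq : p = q
    · subst hpq
      rw [if_pos rfl, if_pos rfl, mul_sub, smul_sub, mul_smul_comm, mul_one, smul_smul, hκ]
      congr 2; ring
    · rw [if_neg hpq, if_neg (Ne.symm hpq), sub_zero, sub_zero]
  simp only [h, Finset.sum_sub_distrib, Finset.sum_ite_eq, Finset.mem_univ, if_true]
  rw [← Finset.smul_sum, ← map_sum, ← AddSubmonoidClass.coe_finsetSum, sum_lie_slUnit_diag]
  simp [adLeft]

variable {S}

theorem evalAct_tmul' (i : Fin N) (n : ℤ) (x : 𝔰 m) :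
    evalAct P S i (AffineSl.tmul n x) = P (mulP (zPow i n)) * slotIn S i x.val :=
  evalAct_tmul P S i n x

theorem evalAct_unit_zero (i : Fin N) (p q : Fin m) :
    evalAct P S i (AffineSl.unit 0 p q) = slotIn S i (slUnit p q).val := by
  rw [slotIn_apply, AffineSl.unit, evalAct_tmul, zPow_zero, map_one, map_one, one_mul]

variable (hPS : ∀ f g, Commute (P f) (S g))
include hPS

theorem slotIn_mul_P (i : Fin N) (x : Matrix (Fin m) (Fin m) ℂ) (f : Module.End ℂ (MultiLaurent N)) :
    slotIn S i x * P f = P f * slotIn S i x := (hPS f _).eq.symm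

theorem deltaOp_evalAct (n : ℤ) (x : 𝔰 m) (i j : Fin N) :
    deltaOp n x (evalAct P S i) (evalAct P S j) =
      (n : ℂ) • (P (mulP (zPow j n)) * adRight S x (rSigned n) i j -
        P (mulP (zPow i n)) * adLeft S x (fun p q => rSigned n q p) i j) := by
  rw [deltaOp, evalAct_central, evalAct_central, mul_zero, zero_mul, sub_zero, smul_zero, zero_add]
  congr 1
  rw [← sum_slUnit_left S x (rSigned n) (1 / 2) (rSigned_self n),
    ← sum_slUnit_right S x (fun p q => rSigned n q p) (1 / 2) (rSigned_self n)]
  rw [Finset.sum_comm (f := fun p q => rSigned n q p •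
      (slotIn S i ⁅x, slUnit p q⁆.val * slotIn S j (slUnit q p).val))]
  simp only [Finset.mul_sum, ← Finset.sum_sub_distrib]
  refine Finset.sum_congr rfl fun p _ => Finset.sum_congr rfl fun q _ => ?_
  rw [evalAct_unit_zero, evalAct_unit_zero, evalAct_tmul', evalAct_tmul', mul_smul_comm,
    mul_smul_comm, ← smul_sub, ← mul_assoc, slotIn_mul_P hPS, mul_assoc, mul_assoc]

/-- The part of the commutator that still contains a divided difference cancels, because the flip
exchanges `i` and `j` in the sum of the two actions. What remains are commutators with the constant
`r`-matrix and the divided differences of `z_i^n` and `z_j^n`. -/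
theorem commutator_exchange_aux (n : ℤ) (x : 𝔰 m) {i j : Fin N} (hij : i ≠ j) :
    (evalAct P S i (AffineSl.tmul n x) + evalAct P S j (AffineSl.tmul n x)) * exchange P S i j -
      exchange P S i j * (evalAct P S i (AffineSl.tmul n x) + evalAct P S j (AffineSl.tmul n x)) =
    P (mulP (zPow i n)) * adLeft S x rCoeff i j + P (mulP (zPow j n)) * adRight S x rCoeff i j +
      P (mulP (divDiff i j (zPow j n))) * (slotIn S i x.val * S (permHom (Equiv.swap i j))) +
      P (mulP (divDiff i j (zPow i n))) * (slotIn S j x.val * S (permHom (Equiv.swap i j))) := by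
  have hdd : ∀ k : Fin N, (divDiff i j * mulP (zPow k n) : Module.End ℂ (MultiLaurent N)) =
      mulP (zPow (Equiv.swap i j k) n) * divDiff i j + mulP (divDiff i j (zPow k n)) := by
    intro k
    refine LinearMap.ext fun f => ?_
    change divDiff i j (zPow k n * f) = zPow _ n * divDiff i j f + divDiff i j (zPow k n) * f
    rw [divDiff_mul hij, permPoly_zPow]
  have hR : ∀ k : Fin N, evalAct P S k (AffineSl.tmul n x) * S (rSlot i j) -
      S (rSlot i j) * evalAct P S k (AffineSl.tmul n x) = P (mulP (zPow k n)) *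
        (slotIn S k x.val * S (rSlot i j) - S (rSlot i j) * slotIn S k x.val) := by
    intro k
    rw [evalAct_tmul', mul_sub, ← mul_assoc (S _) (P _), ← (hPS _ _).eq]
    simp only [mul_assoc]
  have hD : ∀ k : Fin N, evalAct P S k (AffineSl.tmul n x) *
      (P (divDiff i j) * S (permHom (Equiv.swap i j))) =
      P (mulP (zPow k n) * divDiff i j) * (slotIn S k x.val * S (permHom (Equiv.swap i j))) := by
    intro k
    rw [evalAct_tmul', map_mul, mul_assoc, ← mul_assoc (slotIn S _ _) (P _), slotIn_mul_P hPS]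
    simp only [mul_assoc]
  have hD' : ∀ k : Fin N, (P (divDiff i j) * S (permHom (Equiv.swap i j))) *
      evalAct P S k (AffineSl.tmul n x) =
      P (mulP (zPow (Equiv.swap i j k) n) * divDiff i j) *
        (slotIn S (Equiv.swap i j k) x.val * S (permHom (Equiv.swap i j))) +
      P (mulP (divDiff i j (zPow k n))) *
        (slotIn S (Equiv.swap i j k) x.val * S (permHom (Equiv.swap i j))) := by
    intro k
    rw [evalAct_tmul', mul_assoc, ← mul_assoc (S _) (P _), ← (hPS _ _).eq, mul_assoc,
      slotIn_mul_swap, ← add_mul, ← map_add, ← hdd, map_mul]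
    simp only [mul_assoc]
  have hi := hD' i
  have hj := hD' j
  rw [Equiv.swap_apply_left] at hi
  rw [Equiv.swap_apply_right] at hj
  have h1 := hR i
  have h2 := hR j
  rw [map_rSlot, slot_commutator_left S x rCoeff hij, ← map_rSlot] at h1
  rw [map_rSlot, slot_commutator_right S x rCoeff hij, ← map_rSlot] at h2
  rw [exchange, mul_sub, sub_mul, add_mul, mul_add, add_mul, mul_add, hD, hD, hi, hj, ← h1, ← h2]
  abel

/-- For `n = ±1` the divided differences of `z_i^n` and `z_j^n` are opposite monomials, so their
flip terms combine into one commutator with the Casimir tensor. This transposes one leg of the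
`r`-matrix and yields the cobracket. The restriction to degrees `±1` is what keeps the formula this
short. -/
theorem commutator_exchange (n : ℤ) (hn : n = 1 ∨ n = -1) (x : 𝔰 m) {i j : Fin N} (hij : i ≠ j) :
    (evalAct P S i (AffineSl.tmul n x) + evalAct P S j (AffineSl.tmul n x)) * exchange P S i j -
      exchange P S i j * (evalAct P S i (AffineSl.tmul n x) + evalAct P S j (AffineSl.tmul n x)) =
    deltaOp n x (evalAct P S i) (evalAct P S j) := by
  rw [commutator_exchange_aux hPS n x hij, deltaOp_evalAct hPS]
  rcases hn with rfl | rfl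
  · have h2 := adLeft_sub_one S x i j
    rw [← slot_sub_slot_mul_swap_left S x hij, sub_eq_iff_eq_add] at h2
    have h4 : rSigned (m := m) 1 = rCoeff := by funext p q; simp [rSigned]
    rw [divDiff_zPow_left hij, divDiff_zPow_right hij, h4, h2, sub_mul, Int.cast_one, one_smul]
    simp only [map_neg, mul_add, mul_sub, mul_neg, neg_mul]
    abel
  · have h2 := adRight_sub_one S x i j
    rw [← slot_sub_slot_mul_swap_right S x hij, sub_eq_iff_eq_add] at h2
    have h4 : rSigned (m := m) (-1) = fun p q => rCoeff q p := by
      funext p q; simp [rSigned, show ¬ ((-1 : ℤ) = 1) by decide]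
    rw [divDiff_zPow_neg_left hij, divDiff_zPow_neg_right hij, h4, h2, sub_mul, Int.cast_neg,
      Int.cast_one, neg_one_smul]
    simp only [map_neg, mul_add, mul_sub, mul_neg, neg_mul]
    abel

/-- Half the sum of the positive coroots, as a diagonal matrix. -/
def rhoMatrix (m : ℕ) : Matrix (Fin m) (Fin m) ℂ :=
  (1 / 2 : ℂ) • ∑ p : Fin m, ∑ q : Fin m,
    rCoeff p q • (Matrix.single p p (1 : ℂ) - Matrix.single q q 1)

omit hPS in
theorem rhoCheck_eq : rhoCheck m = (1 / 2 : ℂ) • (∑ p : Fin m, ∑ q : Fin m,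
    rCoeff p q • (AffineSl.unit 0 p p - AffineSl.unit 0 q q)) +
      (m : ℂ) • AffineSl.degree := by
  rw [rhoCheck]
  congr 2
  refine Finset.sum_congr rfl fun p _ => Finset.sum_congr rfl fun q _ => ?_
  rcases lt_trichotomy p q with h | h | h
  · simp [rCoeff, h]
  · simp [h]
  · simp [rCoeff, h.not_gt, h.ne']

omit hPS in
theorem evalAct_rhoCheck (i : Fin N) : evalAct P S i (rhoCheck m) =
    slotIn S i (rhoMatrix m) + (m : ℂ) • P (partialXi (Pi.single i 1)) := by
  rw [rhoCheck_eq, map_add, map_smul, map_smul, evalAct_degree, rhoMatrix, map_smul]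
  congr 2
  simp only [map_sum, map_smul, map_sub, evalAct_unit_zero, slotIn_slUnit, if_true,
    sub_sub_sub_cancel_right]

omit hPS in
-- Multiplying out `E_pq [x, E_qp] - [x, E_qp] E_pq` gives terms with diagonal entries of `x`, which
-- disappear since `κ` and its transpose sum to one and `x` is traceless, and one-sided products
-- with diagonal matrices, which remain.
theorem sum_double_commutator (x : Matrix (Fin m) (Fin m) ℂ) (hx : Matrix.trace x = 0)
    (κ : Fin m → Fin m → ℂ) (hκ : ∀ p q, κ p q + κ q p = 1) :
    ∑ p : Fin m, ∑ q : Fin m, κ p q •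
      (Matrix.single p q 1 * (x * Matrix.single q p 1 - Matrix.single q p 1 * x) -
        (x * Matrix.single q p 1 - Matrix.single q p 1 * x) * Matrix.single p q 1) =
      -((∑ p : Fin m, ∑ q : Fin m, κ p q • Matrix.single p p (1 : ℂ)) * x) -
        x * ∑ p : Fin m, ∑ q : Fin m, κ p q • Matrix.single q q (1 : ℂ) := by
  have h1 : ∀ p q : Fin m, Matrix.single p q (1 : ℂ) *
      (x * Matrix.single q p 1 - Matrix.single q p 1 * x) -
        (x * Matrix.single q p 1 - Matrix.single q p 1 * x) * Matrix.single p q 1 =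
      x q q • Matrix.single p p 1 + x p p • Matrix.single q q 1 -
        Matrix.single p p 1 * x - x * Matrix.single q q 1 := by
    intro p q
    have h2 : ∀ p q : Fin m, Matrix.single p q (1 : ℂ) * (x * Matrix.single q p 1) =
        x q q • Matrix.single p p 1 := by
      intro p q
      rw [← mul_assoc, Matrix.single_mul_mul_single, one_mul, mul_one, Matrix.smul_single,
        smul_eq_mul, mul_one]
    rw [mul_sub, sub_mul, h2, mul_assoc (Matrix.single q p 1) x, h2, mul_assoc x, ← mul_assoc,
      Matrix.single_mul_single_same, Matrix.single_mul_single_same, one_mul]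
    abel
  have h3 : ∑ p : Fin m, ∑ q : Fin m, κ p q • (x q q • Matrix.single p p 1 +
      x p p • Matrix.single q q (1 : ℂ)) = 0 := by
    simp only [smul_add, Finset.sum_add_distrib]
    rw [Finset.sum_comm (f := fun p q => κ p q • (x p p • Matrix.single q q (1 : ℂ))),
      ← Finset.sum_add_distrib]
    refine Finset.sum_eq_zero fun p _ => ?_
    rw [← Finset.sum_add_distrib]
    have h4 : ∀ q : Fin m, κ p q • (x q q • Matrix.single p p (1 : ℂ)) +
        κ q p • (x q q • Matrix.single p p 1) = x q q • Matrix.single p p 1 := by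
      intro q
      rw [← add_smul, hκ, one_smul]
    simp only [h4, ← Finset.sum_smul]
    rw [show ∑ q : Fin m, x q q = 0 from hx, zero_smul]
  simp only [h1, smul_sub, Finset.sum_sub_distrib, h3, Finset.sum_mul, Finset.mul_sum,
    smul_mul_assoc, mul_smul_comm, zero_sub]

omit hPS in
-- Row and column sums of `rCoeff` add up to `m` and differ by twice the half sum of positive
-- coroots; solving for them gives this and the companion below.
theorem sum_rCoeff_diag_left : ∑ p : Fin m, ∑ q : Fin m, rCoeff p q • Matrix.single p p (1 : ℂ) =
    ((m : ℂ) / 2) • 1 + rhoMatrix m := by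
  have h : (∑ p : Fin m, ∑ q : Fin m, rCoeff p q • Matrix.single p p (1 : ℂ)) +
      ∑ p : Fin m, ∑ q : Fin m, rCoeff p q • Matrix.single q q (1 : ℂ) = (m : ℂ) • 1 := by
    rw [Finset.sum_comm (f := fun p q => rCoeff p q • Matrix.single q q (1 : ℂ)),
      ← Finset.sum_add_distrib]
    have h1 : ∀ p : Fin m, (∑ q : Fin m, rCoeff p q • Matrix.single p p (1 : ℂ)) +
        ∑ q : Fin m, rCoeff q p • Matrix.single p p (1 : ℂ) = (m : ℂ) • Matrix.single p p 1 := by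
      intro p
      rw [← Finset.sum_add_distrib]
      simp only [← add_smul, rCoeff_add]
      simp
    simp only [h1, ← Finset.smul_sum]
    rw [Matrix.sum_single_one]
  rw [rhoMatrix]
  simp only [smul_sub, Finset.sum_sub_distrib]
  rw [show ((m : ℂ) / 2) • (1 : Matrix (Fin m) (Fin m) ℂ) = (1 / 2 : ℂ) • ((m : ℂ) • 1) by
    rw [smul_smul]; congr 1; ring, ← h]
  module

omit hPS in
theorem eq_sub_of_eq_half_smul {V : Type} [AddCommGroup V] [Module ℂ V] {a b r : V}
    (h : r = (1 / 2 : ℂ) • (a + r - b)) : b = a - r := by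
  have h2 : (2 : ℂ) • r = a + r - b := by
    rw [h, smul_smul, ← h]
    norm_num
  rw [two_smul] at h2
  rw [eq_sub_iff_add_eq]
  rw [eq_sub_iff_add_eq] at h2
  apply add_right_cancel (b := r)
  rw [← h2]
  abel

omit hPS in
theorem sum_rCoeff_diag_right : ∑ p : Fin m, ∑ q : Fin m, rCoeff p q • Matrix.single q q (1 : ℂ) =
    ((m : ℂ) / 2) • 1 - rhoMatrix m := by
  have h : rhoMatrix m = (1 / 2 : ℂ) • ((∑ p : Fin m, ∑ q : Fin m,
      rCoeff p q • Matrix.single p p (1 : ℂ)) -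
        ∑ p : Fin m, ∑ q : Fin m, rCoeff p q • Matrix.single q q (1 : ℂ)) := by
    rw [rhoMatrix]
    simp only [smul_sub, Finset.sum_sub_distrib]
  rw [sum_rCoeff_diag_left] at h
  exact eq_sub_of_eq_half_smul h

/-- Explains the term `ρ^∨` of the connection: when both legs of the cobracket act at the same
place, the result is the commutator with `ρ^∨`. The diagonal sums of the `r`-matrix supply the
commutator with `ρbar^∨`, and their common part `m/2`, counted once on each side of `x`, supplies
the commutator with `m d`. -/
theorem deltaOp_self (n : ℤ) (hn : n = 1 ∨ n = -1) (x : 𝔰 m) (i : Fin N) :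
    deltaOp n x (evalAct P S i) (evalAct P S i) =
      evalAct P S i (AffineSl.tmul n x) * evalAct P S i (rhoCheck m) -
        evalAct P S i (rhoCheck m) * evalAct P S i (AffineSl.tmul n x) := by
  have h1 : deltaOp n x (evalAct P S i) (evalAct P S i) = (n : ℂ) • (P (mulP (zPow i n)) *
      slotIn S i (∑ p : Fin m, ∑ q : Fin m, rSigned n p q •
      (Matrix.single p q 1 * (x.val * Matrix.single q p 1 - Matrix.single q p 1 * x.val) -
        (x.val * Matrix.single q p 1 - Matrix.single q p 1 * x.val) * Matrix.single p q 1))) := by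
    rw [deltaOp, evalAct_central, mul_zero, zero_mul, sub_zero, smul_zero, zero_add]
    simp only [map_sum, Finset.mul_sum]
    congr 1
    refine Finset.sum_congr rfl fun p _ => Finset.sum_congr rfl fun q _ => ?_
    rw [evalAct_unit_zero, evalAct_tmul', map_smul, mul_smul_comm, ← mul_assoc, slotIn_mul_P hPS,
      mul_assoc, mul_assoc, ← mul_sub, ← map_mul, ← map_mul, ← map_sub, lie_slUnit_val, slUnit_val]
    split_ifs
    · congr 3
      rw [sub_mul, mul_sub _ _ ((1 / (m : ℂ)) • 1), Matrix.smul_mul, Matrix.mul_smul, one_mul,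
        mul_one]
      abel
    · rw [sub_zero]
  have h2 : P (mulP (zPow i n)) * P (partialXi (Pi.single i 1)) -
      P (partialXi (Pi.single i 1)) * P (mulP (zPow i n)) = -((n : ℂ) • P (mulP (zPow i n))) := by
    have h3 : partialXi (Pi.single i 1) (zPow i n) = (n : ℂ) • zPow i n := by
      rw [zPow, partialXi_expMon, Finset.sum_eq_single i]
      · simp
      · intro j _ hj; simp [hj]
      · simp
    rw [← map_mul, ← map_mul, partialXi_mulP, h3, map_smul, map_add, map_smul]
    abel
  have h4 : evalAct P S i (AffineSl.tmul n x) * evalAct P S i (rhoCheck m) -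
        evalAct P S i (rhoCheck m) * evalAct P S i (AffineSl.tmul n x) = P (mulP (zPow i n)) *
      slotIn S i (x.val * rhoMatrix m - rhoMatrix m * x.val - ((n : ℂ) * m) • x.val) := by
    have h5 : P (mulP (zPow i n)) * P (partialXi (Pi.single i 1)) * slotIn S i x.val -
        P (partialXi (Pi.single i 1)) * P (mulP (zPow i n)) * slotIn S i x.val =
        -((n : ℂ) • (P (mulP (zPow i n)) * slotIn S i x.val)) := by
      rw [← sub_mul, h2, neg_mul, smul_mul_assoc]
    rw [evalAct_rhoCheck, evalAct_tmul', mul_add, add_mul, mul_smul_comm, smul_mul_assoc,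
      mul_assoc, mul_assoc, ← mul_assoc (slotIn S i (rhoMatrix m)), slotIn_mul_P hPS,
      slotIn_mul_P hPS, mul_assoc, ← mul_assoc (P (partialXi _)), ← mul_assoc _ (P (partialXi _))]
    rw [sub_eq_iff_eq_add] at h5
    rw [h5, map_sub, map_sub, map_smul, map_mul, map_mul, mul_sub, mul_sub, mul_smul_comm]
    module
  rw [h1, h4]
  rcases hn with rfl | rfl
  · have h5 : rSigned (m := m) 1 = rCoeff := by funext p q; simp [rSigned]
    rw [h5, sum_double_commutator _ (sl_trace x) _ rCoeff_add, sum_rCoeff_diag_left,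
      sum_rCoeff_diag_right, Int.cast_one, one_smul]
    congr 2
    rw [add_mul, mul_sub, smul_mul_assoc, mul_smul_comm, one_mul, mul_one]
    module
  · have h5 : rSigned (m := m) (-1) = fun p q => rCoeff q p := by
      funext p q; simp [rSigned, show ¬ ((-1 : ℤ) = 1) by decide]
    rw [h5, sum_double_commutator _ (sl_trace x) (fun p q => rCoeff q p)
      (fun p q => by rw [add_comm, rCoeff_add]),
      Finset.sum_comm (f := fun p q => rCoeff q p • Matrix.single p p (1 : ℂ)),
      Finset.sum_comm (f := fun p q => rCoeff q p • Matrix.single q q (1 : ℂ)),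
      sum_rCoeff_diag_left, sum_rCoeff_diag_right, Int.cast_neg, Int.cast_one, neg_one_smul,
      ← mul_neg, ← map_neg]
    congr 2
    rw [sub_mul, mul_add, smul_mul_assoc, mul_smul_comm, one_mul, mul_one]
    module

end SlotCommutator

/-! ### The universal `r`-matrix on smooth modules -/

section UniversalR

variable {m : ℕ} {E : Type} [AddCommGroup E] [Module ℂ E]

/-- Two actions of the loop algebra are jointly smooth if positive modes of the first and negative
modes of the second eventually annihilate every vector. -/
def JointlySmooth (f g : AffineSl m →ₗ[ℂ] Module.End ℂ E) : Prop :=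
  ∀ v : E, ∃ K : ℕ, ∀ a b : ℤ, K ≤ a → b ≤ -K → ∀ X Y : 𝔰 m,
    f (AffineSl.tmul a X) (g (AffineSl.tmul b Y) v) = 0

/-- The truncation of the universal `r`-matrix. -/
def rTrunc (f g : AffineSl m →ₗ[ℂ] Module.End ℂ E) (K : ℕ) : Module.End ℂ E :=
  rBarOp f g + (1 / 2 : ℂ) • (f AffineSl.central * g AffineSl.degree +
    f AffineSl.degree * g AffineSl.central) +
    ∑ k ∈ Finset.range K, casimirOp ((k : ℤ) + 1) f g

theorem rUnivOp_eq_rTrunc {f g : AffineSl m →ₗ[ℂ] Module.End ℂ E} {v : E} {K : ℕ}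
    (hK : ∀ a b : ℤ, K ≤ a → b ≤ -K → ∀ X Y : 𝔰 m,
      f (AffineSl.tmul a X) (g (AffineSl.tmul b Y) v) = 0) :
    rUnivOp f g v = rTrunc f g K v := by
  -- A `finsum` takes the value `0` when the support is infinite, so finiteness must be established:
  -- all terms from index `K` on vanish on `v`.
  have h : ∑ᶠ n : ℕ, casimirOp ((n : ℤ) + 1) f g v =
      ∑ n ∈ Finset.range K, casimirOp ((n : ℤ) + 1) f g v := by
    refine finsum_eq_sum_of_support_subset _ fun n hn => ?_
    by_contra hn'
    rw [Finset.mem_coe, Finset.mem_range, not_lt] at hn'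
    refine hn ?_
    change casimirOp ((n : ℤ) + 1) f g v = 0
    simp only [casimirOp, LinearMap.sum_apply, Module.End.mul_apply]
    exact Finset.sum_eq_zero fun p _ => Finset.sum_eq_zero fun q _ =>
      hK _ _ (by omega) (by omega) _ _
  rw [rUnivOp, h, rTrunc]
  simp only [LinearMap.add_apply, LinearMap.smul_apply, LinearMap.sum_apply, Module.End.mul_apply]

/-- The universal `r`-matrix as a linear operator. -/
def rUnivLin {f g : AffineSl m →ₗ[ℂ] Module.End ℂ E} (h : JointlySmooth f g) :
    Module.End ℂ E where
  toFun v := rUnivOp f g v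
  map_add' v w := by
    obtain ⟨K, hK⟩ := h v
    obtain ⟨L, hL⟩ := h w
    have h1 : ∀ a b : ℤ, (max K L : ℕ) ≤ a → b ≤ -(max K L : ℕ) → ∀ X Y : 𝔰 m,
        f (AffineSl.tmul a X) (g (AffineSl.tmul b Y) v) = 0 := fun a b ha hb =>
      hK a b (by omega) (by omega)
    have h2 : ∀ a b : ℤ, (max K L : ℕ) ≤ a → b ≤ -(max K L : ℕ) → ∀ X Y : 𝔰 m,
        f (AffineSl.tmul a X) (g (AffineSl.tmul b Y) w) = 0 := fun a b ha hb =>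
      hL a b (by omega) (by omega)
    rw [rUnivOp_eq_rTrunc h1, rUnivOp_eq_rTrunc h2, ← map_add]
    refine rUnivOp_eq_rTrunc fun a b ha hb X Y => ?_
    rw [map_add, map_add, h1 a b ha hb, h2 a b ha hb, add_zero]
  map_smul' c v := by
    obtain ⟨K, hK⟩ := h v
    rw [rUnivOp_eq_rTrunc hK, RingHom.id_apply, ← map_smul]
    refine rUnivOp_eq_rTrunc fun a b ha hb X Y => ?_
    rw [map_smul, map_smul, hK a b ha hb, smul_zero]

theorem rUnivLin_apply {f g : AffineSl m →ₗ[ℂ] Module.End ℂ E} (h : JointlySmooth f g) (v : E) :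
    rUnivLin h v = rUnivOp f g v := rfl

theorem rBarOp_eq (f g : AffineSl m →ₗ[ℂ] Module.End ℂ E) : rBarOp f g =
    ∑ p : Fin m, ∑ q : Fin m,
      rCoeff p q • (f (AffineSl.unit 0 p q) * g (AffineSl.unit 0 q p)) := by
  have h : ∀ p q : Fin m, rCoeff p q • (f (AffineSl.unit 0 p q) * g (AffineSl.unit 0 q p)) =
      (if p = q then (1 / 2 : ℂ) • (f (AffineSl.unit 0 p p) * g (AffineSl.unit 0 p p)) else 0) +
        if p < q then f (AffineSl.unit 0 p q) * g (AffineSl.unit 0 q p) else 0 := by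
    intro p q
    rcases lt_trichotomy p q with h | h | h
    · simp [rCoeff, h, h.ne]
    · simp [rCoeff, h]
    · simp [rCoeff, h.not_gt, h.ne']
  simp only [h, Finset.sum_add_distrib, Finset.sum_ite_eq, Finset.mem_univ, if_true, rBarOp,
    Finset.smul_sum]

/-- `∑ [x, e_pq] t^a ⊗ e_qp t^b`. -/
def casLeft (x : 𝔰 m) (f g : AffineSl m →ₗ[ℂ] Module.End ℂ E) (a b : ℤ) : Module.End ℂ E :=
  ∑ p : Fin m, ∑ q : Fin m, f (AffineSl.tmul a ⁅x, slUnit p q⁆) * g (AffineSl.unit b q p)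

/-- `∑ e_pq t^a ⊗ [x, e_qp] t^b`. -/
def casRight (x : 𝔰 m) (f g : AffineSl m →ₗ[ℂ] Module.End ℂ E) (a b : ℤ) : Module.End ℂ E :=
  ∑ p : Fin m, ∑ q : Fin m, f (AffineSl.unit a p q) * g (AffineSl.tmul b ⁅x, slUnit q p⁆)

theorem casLeft_add_casRight (x : 𝔰 m) (f g : AffineSl m →ₗ[ℂ] Module.End ℂ E) (a b : ℤ) :
    casLeft x f g a b + casRight x f g a b = 0 :=
  casimir_invariant ((LinearMap.mul ℂ (Module.End ℂ E)).compl₁₂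
    (f ∘ₗ AffineSl.tmulHom a) (g ∘ₗ AffineSl.tmulHom b)) x

theorem sum_smul_unit (n : ℤ) (x : 𝔰 m) :
    ∑ p : Fin m, ∑ q : Fin m, x.val p q • AffineSl.unit n p q = AffineSl.tmul n x := by
  conv_rhs => rw [sl_eq_sum x, ← AffineSl.tmulHom_apply]
  simp only [map_sum, map_smul]
  rfl

variable {f g : AffineSl m →ₗ[ℂ] Module.End ℂ E}
  (hf : ∀ x y, f ⁅x, y⁆ = f x * f y - f y * f x) (hg : ∀ x y, g ⁅x, y⁆ = g x * g y - g y * g x)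
  (hfg : ∀ x y, Commute (f x) (g y))
include hf hg hfg

theorem commutator_mul (x y z : AffineSl m) :
    (f x + g x) * (f y * g z) - f y * g z * (f x + g x) = f ⁅x, y⁆ * g z + f y * g ⁅x, z⁆ := by
  have h1 := commutator_mul_left (b := f y) (hfg x z)
  have h2 := commutator_mul_right (c := g z) (hfg y x).symm
  rw [hf, hg, ← h1, ← h2, add_mul, mul_add]
  abel

/-- The bracket raises the degree of one leg or of the other. A central term arises only when a
raised leg lands in degree zero, that is for `k = -n` or `k = n`. -/
theorem commutator_casimirOp (n k : ℤ) (x : 𝔰 m) :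
    (f (AffineSl.tmul n x) + g (AffineSl.tmul n x)) * casimirOp k f g -
      casimirOp k f g * (f (AffineSl.tmul n x) + g (AffineSl.tmul n x)) =
    casLeft x f g (n + k) (-k) + casRight x f g k (n - k) +
      (if n + k = 0 then (n : ℂ) • (f AffineSl.central * g (AffineSl.tmul (-k) x)) else 0) +
      (if n - k = 0 then (n : ℂ) • (f (AffineSl.tmul k x) * g AffineSl.central) else 0) := by
  have h1 : (if n + k = 0 then (n : ℂ) • (f AffineSl.central * g (AffineSl.tmul (-k) x)) else 0) =
      ∑ p : Fin m, ∑ q : Fin m, (if n + k = 0 then (n : ℂ) * x.val q p else 0) •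
        (f AffineSl.central * g (AffineSl.unit (-k) q p)) := by
    split_ifs
    · rw [← sum_smul_unit, Finset.sum_comm]
      simp only [map_sum, map_smul, Finset.mul_sum, Finset.smul_sum, mul_smul_comm, smul_smul]
    · simp
  have h2 : (if n - k = 0 then (n : ℂ) • (f (AffineSl.tmul k x) * g AffineSl.central) else 0) =
      ∑ p : Fin m, ∑ q : Fin m, (if n + -k = 0 then (n : ℂ) * x.val p q else 0) •
        (f (AffineSl.unit k p q) * g AffineSl.central) := by
    rw [← sub_eq_add_neg]
    split_ifs
    · rw [← sum_smul_unit]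
      simp only [map_sum, map_smul, Finset.sum_mul, Finset.smul_sum, smul_mul_assoc, smul_smul]
    · simp
  rw [h1, h2, casLeft, casRight, casimirOp]
  simp only [Finset.mul_sum, Finset.sum_mul, ← Finset.sum_sub_distrib, ← Finset.sum_add_distrib]
  refine Finset.sum_congr rfl fun p _ => Finset.sum_congr rfl fun q _ => ?_
  rw [commutator_mul hf hg hfg, AffineSl.tmul_lie_unit, AffineSl.tmul_lie_unit, map_add, map_add,
    map_smul, map_smul, add_mul, mul_add, smul_mul_assoc, mul_smul_comm, ← sub_eq_add_neg]
  abel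

theorem commutator_rBarOp (n : ℤ) (hn : n ≠ 0) (x : 𝔰 m) :
    (f (AffineSl.tmul n x) + g (AffineSl.tmul n x)) * rBarOp f g -
      rBarOp f g * (f (AffineSl.tmul n x) + g (AffineSl.tmul n x)) =
    (∑ p : Fin m, ∑ q : Fin m, rCoeff p q •
      (f (AffineSl.tmul n ⁅x, slUnit p q⁆) * g (AffineSl.unit 0 q p))) +
    ∑ p : Fin m, ∑ q : Fin m, rCoeff p q •
      (f (AffineSl.unit 0 p q) * g (AffineSl.tmul n ⁅x, slUnit q p⁆)) := by
  rw [rBarOp_eq]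
  simp only [Finset.mul_sum, Finset.sum_mul, mul_smul_comm, smul_mul_assoc,
    ← Finset.sum_sub_distrib, ← Finset.sum_add_distrib, ← smul_sub, ← smul_add,
    commutator_mul hf hg hfg, AffineSl.tmul_lie_unit, add_zero, if_neg hn, zero_smul]

theorem commutator_degree (n : ℤ) (x : 𝔰 m) :
    (f (AffineSl.tmul n x) + g (AffineSl.tmul n x)) * ((1 / 2 : ℂ) •
      (f AffineSl.central * g AffineSl.degree + f AffineSl.degree * g AffineSl.central)) -
    ((1 / 2 : ℂ) • (f AffineSl.central * g AffineSl.degree +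
      f AffineSl.degree * g AffineSl.central)) * (f (AffineSl.tmul n x) + g (AffineSl.tmul n x)) =
    (-(n : ℂ) / 2) • (f AffineSl.central * g (AffineSl.tmul n x) +
      f (AffineSl.tmul n x) * g AffineSl.central) := by
  have hc : ⁅AffineSl.tmul n x, (AffineSl.central : AffineSl m)⁆ = 0 := by
    rw [← lie_skew, AffineSl.central_lie, neg_zero]
  have h1 := commutator_mul hf hg hfg (AffineSl.tmul n x) AffineSl.central AffineSl.degree
  have h2 := commutator_mul hf hg hfg (AffineSl.tmul n x) AffineSl.degree AffineSl.central
  rw [hc, map_zero, zero_mul, zero_add, AffineSl.tmul_lie_degree, map_neg, map_smul] at h1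
  rw [hc, map_zero, mul_zero, add_zero, AffineSl.tmul_lie_degree, map_neg, map_smul] at h2
  rw [mul_smul_comm, smul_mul_assoc, ← smul_sub, mul_add (f _ + g _),
    add_mul (f AffineSl.central * _), add_sub_add_comm, h1, h2, mul_neg, neg_mul, mul_smul_comm, smul_mul_assoc]
  module

omit hf hg hfg in
-- Invariance of the Casimir tensor has already turned `casRight` into `-casLeft`; the summand is
-- then a difference of consecutive terms, with one central contribution at the first index.
theorem casimir_telescope_neg (x : 𝔰 m) (k : ℕ) :
    casLeft x f g (-1 + ((k : ℤ) + 1)) (-((k : ℤ) + 1)) +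
        -casLeft x f g ((k : ℤ) + 1) (-1 - ((k : ℤ) + 1)) +
        (if (-1 : ℤ) + ((k : ℤ) + 1) = 0 then ((-1 : ℤ) : ℂ) • (f AffineSl.central *
          g (AffineSl.tmul (-((k : ℤ) + 1)) x)) else 0) +
        (if (-1 : ℤ) - ((k : ℤ) + 1) = 0 then ((-1 : ℤ) : ℂ) • (f (AffineSl.tmul ((k : ℤ) + 1) x) *
          g AffineSl.central) else 0) =
        (casLeft x f g (k : ℕ) (-1 - (k : ℕ)) - casLeft x f g (k + 1 : ℕ) (-1 - (k + 1 : ℕ))) +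
        if k = 0 then -(f AffineSl.central * g (AffineSl.tmul (-1) x)) else 0 := by
  have e1 : (-1 : ℤ) + ((k : ℤ) + 1) = (k : ℤ) := by ring
  have e2 : -((k : ℤ) + 1) = -1 - (k : ℤ) := by ring
  have e3 : (-1 : ℤ) - ((k : ℤ) + 1) ≠ 0 := by omega
  rw [e1, if_neg e3, add_zero, ← sub_eq_add_neg, e2]
  congr 1
  by_cases hk : k = 0
  · subst hk
    rw [if_pos rfl, if_pos Nat.cast_zero, Nat.cast_zero, sub_zero, Int.cast_neg, Int.cast_one,
      neg_one_smul]
  · rw [if_neg hk, if_neg (by omega)]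

set_option maxHeartbeats 400000 in
-- The Casimir layers telescope, leaving a top boundary term and a bottom one in degree zero. The
-- bottom term is a full Casimir sum that transposes one leg of the coefficients of `rbar`. The
-- central term of the first layer and the contribution of `½ (c ⊗ d + d ⊗ c)` combine into the
-- antisymmetric central part of the cobracket.
theorem commutator_rTrunc (n : ℤ) (hn : n = 1 ∨ n = -1) (x : 𝔰 m) (K : ℕ) (hK : 1 ≤ K) :
    (f (AffineSl.tmul n x) + g (AffineSl.tmul n x)) * rTrunc f g K -
      rTrunc f g K * (f (AffineSl.tmul n x) + g (AffineSl.tmul n x)) =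
    deltaOp n x f g + if n = 1 then casLeft x f g (K + 1) (-K) else
      -casLeft x f g K (-1 - K) := by
  have h0 : n ≠ 0 := by rcases hn with rfl | rfl <;> decide
  have hcas : ∀ a b, casRight x f g a b = -casLeft x f g a b := fun a b =>
    eq_neg_of_add_eq_zero_right (casLeft_add_casRight x f g a b)
  have hsplit : (f (AffineSl.tmul n x) + g (AffineSl.tmul n x)) * rTrunc f g K -
      rTrunc f g K * (f (AffineSl.tmul n x) + g (AffineSl.tmul n x)) =
      (∑ p : Fin m, ∑ q : Fin m, rCoeff p q •
        (f (AffineSl.tmul n ⁅x, slUnit p q⁆) * g (AffineSl.unit 0 q p))) +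
      (∑ p : Fin m, ∑ q : Fin m, rCoeff p q •
        (f (AffineSl.unit 0 p q) * g (AffineSl.tmul n ⁅x, slUnit q p⁆))) +
      (-(n : ℂ) / 2) • (f AffineSl.central * g (AffineSl.tmul n x) +
        f (AffineSl.tmul n x) * g AffineSl.central) +
      ∑ k ∈ Finset.range K,
        ((f (AffineSl.tmul n x) + g (AffineSl.tmul n x)) * casimirOp ((k : ℤ) + 1) f g -
      casimirOp ((k : ℤ) + 1) f g * (f (AffineSl.tmul n x) + g (AffineSl.tmul n x))) := by
    rw [← commutator_rBarOp hf hg hfg n h0 x, ← commutator_degree hf hg hfg n x, rTrunc,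
      mul_add (f _ + g _), mul_add (f _ + g _), add_mul (rBarOp f g + _), add_mul (rBarOp f g),
      Finset.mul_sum, Finset.sum_mul, Finset.sum_sub_distrib]
    abel
  rw [hsplit]
  simp only [commutator_casimirOp hf hg hfg, hcas]
  rcases hn with rfl | rfl
  · have h1 : ∀ k : ℕ, casLeft x f g (1 + ((k : ℤ) + 1)) (-((k : ℤ) + 1)) +
        -casLeft x f g ((k : ℤ) + 1) (1 - ((k : ℤ) + 1)) +
        (if (1 : ℤ) + ((k : ℤ) + 1) = 0 then ((1 : ℤ) : ℂ) • (f AffineSl.central *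
          g (AffineSl.tmul (-((k : ℤ) + 1)) x)) else 0) +
        (if (1 : ℤ) - ((k : ℤ) + 1) = 0 then ((1 : ℤ) : ℂ) • (f (AffineSl.tmul ((k : ℤ) + 1) x) *
          g AffineSl.central) else 0) =
        (casLeft x f g ((k + 1 : ℕ) + 1) (-(k + 1 : ℕ)) - casLeft x f g ((k : ℕ) + 1) (-(k : ℕ))) +
        if k = 0 then f (AffineSl.tmul 1 x) * g AffineSl.central else 0 := by
      intro k
      have e1 : (1 : ℤ) - ((k : ℤ) + 1) = -(k : ℤ) := by ring
      have e2 : (1 : ℤ) + ((k : ℤ) + 1) = ((k + 1 : ℕ) : ℤ) + 1 := by push_cast; ring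
      have e3 : ((k + 1 : ℕ) : ℤ) + 1 ≠ 0 := by omega
      rw [e1, e2, if_neg e3, add_zero, ← sub_eq_add_neg]
      congr 1
      by_cases hk : k = 0
      · simp [hk]
      · rw [if_neg hk, if_neg (by omega)]
    simp only [h1, Finset.sum_add_distrib, Finset.sum_range_sub (fun k : ℕ =>
      casLeft x f g ((k : ℤ) + 1) (-(k : ℤ))), Finset.sum_ite_eq']
    rw [if_pos (Finset.mem_range.mpr hK)]
    simp only [if_true]
    -- The bottom boundary term has all coefficients equal to one; splitting `1 = rCoeff p q +
    -- rCoeff q p` cancels the first part against the commutator with `rbar`.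
    have h2 : casLeft x f g (((0 : ℕ) : ℤ) + 1) (-((0 : ℕ) : ℤ)) = ∑ p : Fin m, ∑ q : Fin m,
        (rCoeff p q + rCoeff q p) • (f (AffineSl.tmul 1 ⁅x, slUnit p q⁆) *
          g (AffineSl.unit 0 q p)) := by
      simp only [rCoeff_add, one_smul]
      rfl
    have h3 : deltaOp 1 x f g = (1 / 2 : ℂ) • (f (AffineSl.tmul 1 x) * g AffineSl.central -
        f AffineSl.central * g (AffineSl.tmul 1 x)) +
        ((∑ p : Fin m, ∑ q : Fin m, rCoeff p q •
          (f (AffineSl.unit 0 p q) * g (AffineSl.tmul 1 ⁅x, slUnit q p⁆))) -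
        ∑ p : Fin m, ∑ q : Fin m, rCoeff q p •
          (f (AffineSl.tmul 1 ⁅x, slUnit p q⁆) * g (AffineSl.unit 0 q p))) := by
      rw [deltaOp, Finset.sum_comm (f := fun p q => rCoeff q p •
          (f (AffineSl.tmul 1 ⁅x, slUnit p q⁆) * g (AffineSl.unit 0 q p)))]
      simp only [rSigned, if_true, Int.cast_one, one_smul, smul_sub, Finset.sum_sub_distrib]
    rw [h2, h3]
    simp only [add_smul, Finset.sum_add_distrib]
    push_cast
    module
  · have h1 := casimir_telescope_neg (f := f) (g := g) x
    simp only [h1, Finset.sum_add_distrib, Finset.sum_range_sub' (fun k : ℕ =>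
      casLeft x f g (k : ℤ) (-1 - (k : ℤ))), Finset.sum_ite_eq']
    rw [if_pos (Finset.mem_range.mpr hK), if_neg (show ¬ (-1 : ℤ) = 1 by decide)]
    -- For `n = -1` the bottom term is rewritten by invariance with the commutator in the second
    -- leg, so it is the other half of the commutator with `rbar` that gets transposed.
    have h2 : casLeft x f g ((0 : ℕ) : ℤ) (-1 - ((0 : ℕ) : ℤ)) = -∑ p : Fin m, ∑ q : Fin m,
        (rCoeff p q + rCoeff q p) • (f (AffineSl.unit 0 p q) *
          g (AffineSl.tmul (-1) ⁅x, slUnit q p⁆)) := by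
      simp only [rCoeff_add, one_smul]
      rw [Nat.cast_zero, sub_zero, ← neg_neg (casLeft x f g 0 (-1)), ← hcas, casRight]
    have h3 : deltaOp (-1) x f g = (1 / 2 : ℂ) • (f (AffineSl.tmul (-1) x) * g AffineSl.central -
        f AffineSl.central * g (AffineSl.tmul (-1) x)) -
        ((∑ p : Fin m, ∑ q : Fin m, rCoeff q p •
          (f (AffineSl.unit 0 p q) * g (AffineSl.tmul (-1) ⁅x, slUnit q p⁆))) -
        ∑ p : Fin m, ∑ q : Fin m, rCoeff p q •
          (f (AffineSl.tmul (-1) ⁅x, slUnit p q⁆) * g (AffineSl.unit 0 q p))) := by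
      rw [deltaOp, Finset.sum_comm (f := fun p q => rCoeff p q •
          (f (AffineSl.tmul (-1) ⁅x, slUnit p q⁆) * g (AffineSl.unit 0 q p)))]
      simp only [rSigned, show ¬ ((-1 : ℤ) = 1) by decide, if_false, Int.cast_neg, Int.cast_one,
        neg_one_smul, smul_sub, Finset.sum_sub_distrib]
      abel
    rw [h2, h3]
    simp only [add_smul, Finset.sum_add_distrib]
    push_cast
    module

/-- The commutator of the coproduct of `x ⊗ t^{±1}` with the universal `r`-matrix is the
cobracket. -/
theorem commutator_rUnivLin (h : JointlySmooth f g) (n : ℤ) (hn : n = 1 ∨ n = -1) (x : 𝔰 m) :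
    (f (AffineSl.tmul n x) + g (AffineSl.tmul n x)) * rUnivLin h -
      rUnivLin h * (f (AffineSl.tmul n x) + g (AffineSl.tmul n x)) = deltaOp n x f g := by
  refine LinearMap.ext fun v => ?_
  obtain ⟨K, hK⟩ := h v
  obtain ⟨L, hL⟩ := h ((f (AffineSl.tmul n x) + g (AffineSl.tmul n x)) v)
  -- One truncation must serve both `v` and its image under the loop element; the extra `1` keeps
  -- the first layer, which carries the central term.
  set M : ℕ := max K L + 1 with hM
  have h1 : ∀ a b : ℤ, M ≤ a → b ≤ -M → ∀ X Y : 𝔰 m,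
      f (AffineSl.tmul a X) (g (AffineSl.tmul b Y) v) = 0 := fun a b ha hb =>
    hK a b (by omega) (by omega)
  have h2 : ∀ a b : ℤ, M ≤ a → b ≤ -M → ∀ X Y : 𝔰 m, f (AffineSl.tmul a X)
      (g (AffineSl.tmul b Y) ((f (AffineSl.tmul n x) + g (AffineSl.tmul n x)) v)) = 0 :=
    fun a b ha hb => hL a b (by omega) (by omega)
  have h3 := LinearMap.congr_fun (commutator_rTrunc hf hg hfg n hn x M (by omega)) v
  rw [LinearMap.sub_apply, Module.End.mul_apply, Module.End.mul_apply, rUnivLin_apply,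
    rUnivLin_apply, rUnivOp_eq_rTrunc h1, rUnivOp_eq_rTrunc h2]
  rw [LinearMap.sub_apply, Module.End.mul_apply, Module.End.mul_apply] at h3
  rw [h3, LinearMap.add_apply]
  -- The top boundary term of the telescoping sum dies on `v` by smoothness.
  have h4 : ∀ a b : ℤ, M ≤ a → b ≤ -M → casLeft x f g a b v = 0 := by
    intro a b ha hb
    simp only [casLeft, LinearMap.sum_apply, Module.End.mul_apply]
    exact Finset.sum_eq_zero fun p _ => Finset.sum_eq_zero fun q _ => h1 a b ha hb _ _
  split_ifs
  · rw [h4 _ _ (by omega) (by omega), add_zero]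
  · rw [LinearMap.neg_apply, h4 _ _ (by omega) (by omega), neg_zero, add_zero]

end UniversalR

/-! ### Operators intertwining two universal `r`-matrices -/

section Intertwine

variable {m : ℕ} {E : Type} [AddCommGroup E] [Module ℂ E]
  {f g f' g' : AffineSl m →ₗ[ℂ] Module.End ℂ E} {T : Module.End ℂ E}

theorem mul_casimirOp (hf : ∀ y, y.d = 0 → T * f y = f' y * T)
    (hg : ∀ y, y.d = 0 → T * g y = g' y * T) (n : ℤ) :
    T * casimirOp n f g = casimirOp n f' g' * T := by
  simp only [casimirOp, Finset.mul_sum, Finset.sum_mul]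
  refine Finset.sum_congr rfl fun p _ => Finset.sum_congr rfl fun q _ => ?_
  rw [← mul_assoc, hf _ rfl, mul_assoc, hg _ rfl, mul_assoc]

theorem mul_rBarOp (hf : ∀ y, y.d = 0 → T * f y = f' y * T)
    (hg : ∀ y, y.d = 0 → T * g y = g' y * T) :
    T * rBarOp f g = rBarOp f' g' * T := by
  simp only [rBarOp_eq, Finset.mul_sum, Finset.sum_mul]
  refine Finset.sum_congr rfl fun p _ => Finset.sum_congr rfl fun q _ => ?_
  rw [mul_smul_comm, smul_mul_assoc, ← mul_assoc, hf _ rfl, mul_assoc, hg _ rfl, mul_assoc]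

/-- An operator intertwining two pairs of actions of the derived algebra intertwines the universal
`r`-matrices, up to the contribution of `c` and `d`. -/
theorem mul_rUnivLin (h : JointlySmooth f g) (h' : JointlySmooth f' g')
    (hf : ∀ y, y.d = 0 → T * f y = f' y * T)
    (hg : ∀ y, y.d = 0 → T * g y = g' y * T) {C : Module.End ℂ E}
    (hcd : T * ((1 / 2 : ℂ) • (f AffineSl.central * g AffineSl.degree +
        f AffineSl.degree * g AffineSl.central)) =
      ((1 / 2 : ℂ) • (f' AffineSl.central * g' AffineSl.degree +
        f' AffineSl.degree * g' AffineSl.central) + C) * T) :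
    T * rUnivLin h = (rUnivLin h' + C) * T := by
  refine LinearMap.ext fun v => ?_
  obtain ⟨K, hK⟩ := h v
  obtain ⟨L, hL⟩ := h' (T v)
  set M : ℕ := max K L
  have h1 : ∀ a b : ℤ, M ≤ a → b ≤ -M → ∀ X Y : 𝔰 m,
      f (AffineSl.tmul a X) (g (AffineSl.tmul b Y) v) = 0 := fun a b ha hb =>
    hK a b (by omega) (by omega)
  have h2 : ∀ a b : ℤ, M ≤ a → b ≤ -M → ∀ X Y : 𝔰 m,
      f' (AffineSl.tmul a X) (g' (AffineSl.tmul b Y) (T v)) = 0 := fun a b ha hb =>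
    hL a b (by omega) (by omega)
  have h3 : T * rTrunc f g M = (rTrunc f' g' M + C) * T := by
    rw [rTrunc, rTrunc, mul_add, mul_add, hcd, mul_rBarOp hf hg, Finset.mul_sum]
    simp only [mul_casimirOp hf hg, ← Finset.sum_mul, ← add_mul]
    congr 1
    abel
  have h4 := LinearMap.congr_fun h3 v
  rw [Module.End.mul_apply, Module.End.mul_apply, LinearMap.add_apply] at h4 ⊢
  rw [rUnivLin_apply, rUnivLin_apply, rUnivOp_eq_rTrunc h1, rUnivOp_eq_rTrunc h2, h4]

end Intertwine

/-- The operators on `A ⊗ ℂ[z^{±1}] ⊗ V^{⊗N} ⊗ B` entering the definition of the Dunkl operators: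
those on polynomials, those on tensors, and the actions on `A` and `B`. -/
structure KZData (N m : ℕ) (ℓ : ℂ) (E : Type) [AddCommGroup E] [Module ℂ E] where
  P : Module.End ℂ (MultiLaurent N) →ₐ[ℂ] Module.End ℂ E
  S : Module.End ℂ (TensorPow N m) →ₐ[ℂ] Module.End ℂ E
  f : AffineSl m →ₗ[ℂ] Module.End ℂ E
  g : AffineSl m →ₗ[ℂ] Module.End ℂ E
  hPS : ∀ a b, Commute (P a) (S b)
  hPf : ∀ a y, Commute (P a) (f y)
  hPg : ∀ a y, Commute (P a) (g y)
  hSf : ∀ a y, Commute (S a) (f y)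
  hSg : ∀ a y, Commute (S a) (g y)
  hfg : ∀ x y, Commute (f x) (g y)
  f_lie : ∀ x y, f ⁅x, y⁆ = f x * f y - f y * f x
  g_lie : ∀ x y, g ⁅x, y⁆ = g x * g y - g y * g x
  f_central : f AffineSl.central = ℓ • 1
  g_central : g AffineSl.central = -(ℓ • 1)
  f_smooth : ∀ v, ∃ K : ℕ, ∀ a : ℤ, K ≤ a → ∀ X : 𝔰 m, f (AffineSl.tmul a X) v = 0
  g_smooth : ∀ v, ∃ K : ℕ, ∀ a : ℤ, a ≤ -K → ∀ X : 𝔰 m, g (AffineSl.tmul a X) v = 0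

/-! ### Abstract Dunkl operators and their relations with permutations -/

namespace KZData

variable {N m : ℕ} {ℓ : ℂ} {E : Type} [AddCommGroup E] [Module ℂ E] (D : KZData N m ℓ E)

/-- The action `θ_i`. -/
abbrev ev (i : Fin N) : AffineSl m →ₗ[ℂ] Module.End ℂ E := evalAct D.P D.S i

/-- Multiplication by a Laurent polynomial. -/
abbrev pmul (a : MultiLaurent N) : Module.End ℂ E := D.P (mulP a)

/-- The action of a permutation. -/
abbrev perm (w : Equiv.Perm (Fin N)) : Module.End ℂ E := tauOp D.P D.S w

abbrev exch (i j : Fin N) : Module.End ℂ E := exchange D.P D.S i j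

theorem f_commute_loopAct (i : Fin N) (x : Matrix (Fin m) (Fin m) Laurent) (y : AffineSl m) :
    Commute (D.f y) (loopAct D.P D.S i x) :=
  Commute.sum_right _ _ _ fun _ _ => Commute.sum_right _ _ _ fun _ _ =>
    (D.hPf _ y).symm.mul_right (D.hSf _ y).symm

theorem g_commute_loopAct (i : Fin N) (x : Matrix (Fin m) (Fin m) Laurent) (y : AffineSl m) :
    Commute (D.g y) (loopAct D.P D.S i x) :=
  Commute.sum_right _ _ _ fun _ _ => Commute.sum_right _ _ _ fun _ _ =>
    (D.hPg _ y).symm.mul_right (D.hSg _ y).symm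

theorem f_commute_ev (i : Fin N) (x y : AffineSl m) : Commute (D.f x) (D.ev i y) :=
  (D.f_commute_loopAct i _ x).add_right ((D.hPf _ x).symm.smul_right _)

theorem g_commute_ev (i : Fin N) (x y : AffineSl m) : Commute (D.g x) (D.ev i y) :=
  (D.g_commute_loopAct i _ x).add_right ((D.hPg _ x).symm.smul_right _)

theorem perm_commute_f (w : Equiv.Perm (Fin N)) (y : AffineSl m) : Commute (D.perm w) (D.f y) :=
  (D.hPf _ y).mul_left (D.hSf _ y)

theorem perm_commute_g (w : Equiv.Perm (Fin N)) (y : AffineSl m) : Commute (D.perm w) (D.g y) :=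
  (D.hPg _ y).mul_left (D.hSg _ y)

theorem exch_commute_f (i j : Fin N) (y : AffineSl m) : Commute (D.exch i j) (D.f y) :=
  (D.hSf _ y).sub_left ((D.hPf _ y).mul_left (D.hSf _ y))

theorem exch_commute_g (i j : Fin N) (y : AffineSl m) : Commute (D.exch i j) (D.g y) :=
  (D.hSg _ y).sub_left ((D.hPg _ y).mul_left (D.hSg _ y))

/-- High positive modes on `A` kill the vector; they can be moved past the evaluation action, with
which they commute. -/
theorem jointlySmooth_f (i : Fin N) : JointlySmooth D.f (D.ev i) := fun v => by
  obtain ⟨K, hK⟩ := D.f_smooth v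
  refine ⟨K, fun a b ha _ X Y => ?_⟩
  rw [← Module.End.mul_apply, (D.f_commute_ev i _ _).eq, Module.End.mul_apply, hK a ha, map_zero]

theorem jointlySmooth_g (i : Fin N) : JointlySmooth (D.ev i) D.g := fun v => by
  obtain ⟨K, hK⟩ := D.g_smooth v
  exact ⟨K, fun a b _ hb X Y => by rw [hK b hb, map_zero]⟩

/-- The part of the connection involving the `i`-th factor and the two modules at the ends. -/
def zOp (i : Fin N) : Module.End ℂ E :=
  rUnivLin (D.jointlySmooth_f i) - rUnivLin (D.jointlySmooth_g i) + D.ev i (rhoCheck m)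

/-- The permutation-equivariant version of the `i`-th Dunkl operator. -/
def eOp (i : Fin N) : Module.End ℂ E := D.zOp i - ∑ j ∈ Finset.univ.erase i, D.exch i j

/-- The `i`-th Dunkl operator. -/
def dOp (i : Fin N) : Module.End ℂ E :=
  D.eOp i + ∑ j : Fin N, if j < i then D.perm (Equiv.swap i j) else 0

theorem perm_mul_rUnivLin_f (w : Equiv.Perm (Fin N)) (i : Fin N) :
    D.perm w * rUnivLin (D.jointlySmooth_f i) = rUnivLin (D.jointlySmooth_f (w i)) * D.perm w := by
  have h := mul_rUnivLin (T := D.perm w) (C := 0) (D.jointlySmooth_f i) (D.jointlySmooth_f (w i))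
    (fun y _ => D.perm_commute_f w y) (fun y _ => tauOp_mul_evalAct D.hPS w i y) ?_
  · rw [h, add_zero]
  · rw [evalAct_central, evalAct_central, mul_zero, add_zero, add_zero, add_zero,
      mul_smul_comm, ← mul_assoc, (D.perm_commute_f w _).eq, mul_assoc, tauOp_mul_evalAct D.hPS,
      smul_mul_assoc, mul_assoc]

theorem perm_mul_rUnivLin_g (w : Equiv.Perm (Fin N)) (i : Fin N) :
    D.perm w * rUnivLin (D.jointlySmooth_g i) = rUnivLin (D.jointlySmooth_g (w i)) * D.perm w := by
  have h := mul_rUnivLin (T := D.perm w) (C := 0) (D.jointlySmooth_g i) (D.jointlySmooth_g (w i))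
    (fun y _ => tauOp_mul_evalAct D.hPS w i y) (fun y _ => D.perm_commute_g w y) ?_
  · rw [h, add_zero]
  · rw [evalAct_central, evalAct_central, zero_mul, zero_add, zero_add, add_zero,
      mul_smul_comm, ← mul_assoc, tauOp_mul_evalAct D.hPS, mul_assoc, (D.perm_commute_g w _).eq,
      smul_mul_assoc, mul_assoc]

theorem perm_mul_zOp (w : Equiv.Perm (Fin N)) (i : Fin N) :
    D.perm w * D.zOp i = D.zOp (w i) * D.perm w := by
  rw [zOp, zOp, mul_add, mul_sub, add_mul, sub_mul, D.perm_mul_rUnivLin_f, D.perm_mul_rUnivLin_g,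
    tauOp_mul_evalAct D.hPS]

theorem perm_mul_eOp (w : Equiv.Perm (Fin N)) (i : Fin N) :
    D.perm w * D.eOp i = D.eOp (w i) * D.perm w := by
  rw [eOp, eOp, mul_sub, sub_mul, perm_mul_zOp, Finset.mul_sum, Finset.sum_mul]
  congr 1
  refine Finset.sum_equiv w (by simp) fun j hj => ?_
  exact tauOp_mul_exchange D.hPS w (Finset.ne_of_mem_erase hj).symm

theorem perm_mul (w w' : Equiv.Perm (Fin N)) : D.perm (w * w') = D.perm w * D.perm w' :=
  tauOp_mul D.hPS w w'

theorem perm_mul_swap (w : Equiv.Perm (Fin N)) (i j : Fin N) :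
    D.perm w * D.perm (Equiv.swap i j) = D.perm (Equiv.swap (w i) (w j)) * D.perm w := by
  rw [← D.perm_mul, ← D.perm_mul, Equiv.mul_swap_eq_swap_mul]

/-- The failure of the Dunkl operators to be permutation-equivariant. -/
theorem perm_mul_dOp (w : Equiv.Perm (Fin N)) (i : Fin N) :
    D.perm w * D.dOp i - D.dOp (w i) * D.perm w =
      ∑ j : Fin N, ((if j < i then (1 : ℂ) else 0) - if w j < w i then 1 else 0) •
        (D.perm w * D.perm (Equiv.swap i j)) := by
  have h1 : (∑ j : Fin N, if j < w i then D.perm (Equiv.swap (w i) j) else 0) * D.perm w =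
      ∑ j : Fin N, (if w j < w i then (1 : ℂ) else 0) • (D.perm w * D.perm (Equiv.swap i j)) := by
    rw [← Equiv.sum_comp w, Finset.sum_mul]
    refine Finset.sum_congr rfl fun j _ => ?_
    rw [D.perm_mul_swap]
    split_ifs <;> simp
  have h2 : D.perm w * (∑ j : Fin N, if j < i then D.perm (Equiv.swap i j) else 0) =
      ∑ j : Fin N, (if j < i then (1 : ℂ) else 0) • (D.perm w * D.perm (Equiv.swap i j)) := by
    rw [Finset.mul_sum]
    refine Finset.sum_congr rfl fun j _ => ?_
    split_ifs <;> simp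
  simp only [dOp, mul_add, add_mul, D.perm_mul_eOp, h1, h2, sub_smul, Finset.sum_sub_distrib]
  abel

theorem perm_swap_mul_swap (i j : Fin N) :
    D.perm (Equiv.swap i j) * D.perm (Equiv.swap i j) = 1 := by
  rw [← D.perm_mul, Equiv.swap_mul_self]
  exact tauOp_one D.P D.S

/-- An adjacent transposition preserves the order of every pair of indices other than the pair it
exchanges, so in the defect of equivariance at most one summand survives, and that one is a squared
transposition. -/
theorem swap_mul_dOp {a b : Fin N} (hab : a.val + 1 = b.val) (i : Fin N) :
    D.perm (Equiv.swap a b) * D.dOp i - D.dOp (Equiv.swap a b i) * D.perm (Equiv.swap a b) =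
      ((if i = b then (1 : ℂ) else 0) - if i = a then 1 else 0) • 1 := by
  have hne : a ≠ b := fun h => by simp [h] at hab
  rw [D.perm_mul_dOp]
  rcases eq_or_ne i a with rfl | hia
  · rw [Finset.sum_eq_single b]
    · rw [D.perm_swap_mul_swap, Equiv.swap_apply_right, Equiv.swap_apply_left,
        if_neg (by simp only [Fin.lt_def]; omega), if_pos (by simp only [Fin.lt_def]; omega), if_neg hne,
        if_pos rfl]
    · intro j _ hj
      rcases eq_or_ne j i with rfl | hji
      · simp
      · rw [Equiv.swap_apply_of_ne_of_ne hji hj, Equiv.swap_apply_left]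
        have h1 : (j < i) ↔ (j < b) := by
          simp only [Fin.lt_def]
          rw [Ne, Fin.ext_iff] at hj hji
          omega
        simp [h1]
    · simp
  · rcases eq_or_ne i b with rfl | hib
    · rw [Finset.sum_eq_single a]
      · rw [Equiv.swap_comm i a, D.perm_swap_mul_swap, Equiv.swap_apply_right, Equiv.swap_apply_left,
          if_pos (by simp only [Fin.lt_def]; omega), if_neg (by simp only [Fin.lt_def]; omega),
          if_pos rfl, if_neg hia]
      · intro j _ hj
        rcases eq_or_ne j i with rfl | hji
        · simp
        · rw [Equiv.swap_apply_of_ne_of_ne hj hji, Equiv.swap_apply_right]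
          have h1 : (j < i) ↔ (j < a) := by
            simp only [Fin.lt_def]
            rw [Ne, Fin.ext_iff] at hj hji
            omega
          simp [h1]
      · simp
    · rw [if_neg hia, if_neg hib, sub_zero, zero_smul]
      refine Finset.sum_eq_zero fun j _ => ?_
      rw [Equiv.swap_apply_of_ne_of_ne hia hib]
      have h1 : (j < i) ↔ (Equiv.swap a b j < i) := by
        rw [Ne, Fin.ext_iff] at hia hib
        rcases eq_or_ne j a with rfl | hja
        · rw [Equiv.swap_apply_left]
          simp only [Fin.lt_def]
          omega
        · rcases eq_or_ne j b with rfl | hjb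
          · rw [Equiv.swap_apply_right]
            simp only [Fin.lt_def]
            omega
          · rw [Equiv.swap_apply_of_ne_of_ne hja hjb]
      simp [h1]

end KZData

/-! ### Conjugation of the Dunkl operators by monomials and by `π` -/

namespace KZData

variable {N m : ℕ} {ℓ : ℂ} {E : Type} [AddCommGroup E] [Module ℂ E] (D : KZData N m ℓ E)

theorem pmul_mul_ev (η : Fin N → ℤ) (i : Fin N) (y : AffineSl m) :
    D.pmul (expMon η) * D.ev i y =
      (D.ev i y - (y.d * η i) • 1) * D.pmul (expMon η) := by
  rw [expMon_mul_evalAct D.hPS, sub_mul, smul_mul_assoc, one_mul]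

theorem pmul_mul_ev_of_d_eq_zero (η : Fin N → ℤ) (i : Fin N) (y : AffineSl m) (hy : y.d = 0) :
    D.pmul (expMon η) * D.ev i y = D.ev i y * D.pmul (expMon η) := by
  rw [pmul_mul_ev, hy, zero_mul, zero_smul, sub_zero]

theorem pmul_mul_degree (η : Fin N → ℤ) (i : Fin N) :
    D.pmul (expMon η) * D.ev i AffineSl.degree =
      (D.ev i AffineSl.degree - (η i : ℂ) • 1) * D.pmul (expMon η) := by
  rw [pmul_mul_ev, show (AffineSl.degree : AffineSl m).d = 1 from rfl, one_mul]

/-- Multiplication by a monomial commutes with the derived algebra at every place. Only `d` at the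
`i`-th place sees it, through `½ c ⊗ d`, and there `c` acts on the first module as `ℓ`. -/
theorem pmul_mul_rUnivLin_f (η : Fin N → ℤ) (i : Fin N) :
    D.pmul (expMon η) * rUnivLin (D.jointlySmooth_f i) =
      (rUnivLin (D.jointlySmooth_f i) + (-(ℓ / 2 * η i)) • 1) * D.pmul (expMon η) := by
  refine mul_rUnivLin _ _ (fun y _ => D.hPf _ y) (fun y hy => D.pmul_mul_ev_of_d_eq_zero η i y hy) ?_
  rw [evalAct_central, mul_zero, add_zero, D.f_central, smul_mul_assoc, one_mul, mul_smul_comm,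
    mul_smul_comm, pmul_mul_degree, sub_mul, add_mul, smul_mul_assoc, smul_mul_assoc,
    smul_mul_assoc, smul_mul_assoc, one_mul]
  module

/-- The level at this end is `-ℓ`, and this `r`-matrix enters `zOp` with a minus sign; the two
shifts of `ℓ/2` therefore add up. -/
theorem pmul_mul_rUnivLin_g (η : Fin N → ℤ) (i : Fin N) :
    D.pmul (expMon η) * rUnivLin (D.jointlySmooth_g i) =
      (rUnivLin (D.jointlySmooth_g i) + (ℓ / 2 * η i) • 1) * D.pmul (expMon η) := by
  refine mul_rUnivLin _ _ (fun y hy => D.pmul_mul_ev_of_d_eq_zero η i y hy) (fun y _ => D.hPg _ y) ?_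
  have h : D.ev i AffineSl.degree * -(ℓ • 1 : Module.End ℂ E) =
      -(ℓ • D.ev i AffineSl.degree) := by rw [mul_neg, mul_smul_comm, mul_one]
  rw [evalAct_central, zero_mul, zero_add, D.g_central, h,
    mul_smul_comm, mul_neg, mul_smul_comm, pmul_mul_degree, sub_mul, add_mul, smul_mul_assoc,
    smul_mul_assoc, smul_mul_assoc, neg_mul, smul_mul_assoc, one_mul]
  module

theorem rhoCheck_d : (rhoCheck m).d = m := by
  have h : ∀ y : AffineSl m, y.d = (AffineSl.toProd m y).2.2 := fun _ => rfl
  have h1 : ∀ (s : Finset (Fin m)) (F : Fin m → AffineSl m), (∀ p, (F p).d = 0) →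
      (∑ p ∈ s, F p).d = 0 := by
    intro s F hF
    induction s using Finset.induction_on with
    | empty => rfl
    | insert a s ha ih => rw [Finset.sum_insert ha, AffineSl.add_d, ih, hF, add_zero]
  rw [rhoCheck, AffineSl.add_d, AffineSl.smul_d, AffineSl.smul_d, h1 _ _ fun p => h1 _ _ fun q => ?_]
  · simp [AffineSl.degree]
  · split_ifs
    · rw [sub_eq_add_neg, AffineSl.add_d, ← neg_one_smul ℂ, AffineSl.smul_d]
      simp [AffineSl.unit, AffineSl.tmul]
    · rfl

/-- Conjugation by a monomial shifts the connection by a multiple of `κ = ℓ + m`. -/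
theorem pmul_mul_zOp (η : Fin N → ℤ) (i : Fin N) :
    D.pmul (expMon η) * D.zOp i =
      (D.zOp i - ((ℓ + m) * η i) • 1) * D.pmul (expMon η) := by
  rw [zOp, mul_add, mul_sub, pmul_mul_rUnivLin_f, pmul_mul_rUnivLin_g, pmul_mul_ev, rhoCheck_d]
  simp only [add_mul, sub_mul, smul_mul_assoc, one_mul]
  module

theorem pmul_mul_swap_of_ne {i j k : Fin N} (hki : k ≠ i) (hkj : k ≠ j) :
    D.pmul (zPow k 1) * D.perm (Equiv.swap i j) = D.perm (Equiv.swap i j) * D.pmul (zPow k 1) := by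
  rw [tauOp_mul_mulP D.hPS, permPoly_zPow, Equiv.swap_apply_of_ne_of_ne hki hkj]

/-- Conjugation of `E_k` by `z_l`, `l ≠ k`. -/
theorem pmul_mul_eOp_of_ne {l k : Fin N} (hlk : l ≠ k) :
    D.pmul (zPow l 1) * D.eOp k =
      (D.eOp k + D.perm (Equiv.swap k l)) * D.pmul (zPow l 1) := by
  have h1 : D.pmul (zPow l 1) * D.zOp k = D.zOp k * D.pmul (zPow l 1) := by
    rw [zPow, pmul_mul_zOp, Pi.single_eq_of_ne hlk.symm, Int.cast_zero, mul_zero, zero_smul,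
      sub_zero]
  have h2 : D.pmul (zPow l 1) * ∑ j ∈ Finset.univ.erase k, D.exch k j =
      ((∑ j ∈ Finset.univ.erase k, D.exch k j) - D.perm (Equiv.swap k l)) * D.pmul (zPow l 1) := by
    have hl : l ∈ Finset.univ.erase k := by simp [hlk]
    rw [← Finset.add_sum_erase _ _ hl, mul_add, zPow_mul_exchange_right D.hPS hlk.symm,
      add_sub_right_comm, add_mul, Finset.mul_sum, Finset.sum_mul]
    congr 1
    refine Finset.sum_congr rfl fun j hj => ?_
    rw [Finset.mem_erase, Finset.mem_erase] at hj
    exact zPow_commute_exchange D.hPS hj.2.1.symm hlk hj.1.symm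
  rw [eOp, mul_sub, h1, h2]
  simp only [add_mul, sub_mul]
  abel

/-- Conjugation of `E_l` by `z_l`. -/
theorem pmul_mul_eOp_self (l : Fin N) :
    D.pmul (zPow l 1) * (D.eOp l + ∑ j ∈ Finset.univ.erase l, D.perm (Equiv.swap l j)) =
      (D.eOp l - (ℓ + m : ℂ) • 1) * D.pmul (zPow l 1) := by
  have h1 : D.pmul (zPow l 1) * D.zOp l = (D.zOp l - (ℓ + m : ℂ) • 1) * D.pmul (zPow l 1) := by
    rw [zPow, pmul_mul_zOp, Pi.single_eq_same, Int.cast_one, mul_one]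
  have h2 : D.pmul (zPow l 1) * ((∑ j ∈ Finset.univ.erase l, D.exch l j) -
      ∑ j ∈ Finset.univ.erase l, D.perm (Equiv.swap l j)) =
      (∑ j ∈ Finset.univ.erase l, D.exch l j) * D.pmul (zPow l 1) := by
    rw [← Finset.sum_sub_distrib, Finset.mul_sum, Finset.sum_mul]
    exact Finset.sum_congr rfl fun j hj =>
      zPow_mul_exchange_left D.hPS (Finset.ne_of_mem_erase hj).symm
  rw [eOp, sub_add, mul_sub, h1, h2]
  simp only [sub_mul]
  abel

theorem sum_lt_eq_of_zero {f : Fin N} (hf : f.val = 0) (F : Fin N → Module.End ℂ E) :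
    (∑ j : Fin N, if j < f then F j else 0) = 0 :=
  Finset.sum_eq_zero fun j _ => if_neg (by simp only [Fin.lt_def]; omega)

/-- The operator of the element `π` of the extended affine Weyl group. -/
def piOp (f : Fin N) : Module.End ℂ E := D.pmul (zPow f 1) * D.perm (finRotate N)

theorem finRotate_apply_last {f l : Fin N} (hf : f.val = 0) (hl : l.val + 1 = N) :
    finRotate N l = f := by
  obtain _ | n := N
  · exact l.elim0
  · rw [show l = Fin.last n from Fin.ext (by simp only [Fin.val_last]; omega), finRotate_last]
    exact Fin.ext hf.symm

theorem finRotate_val {i : Fin N} (hi : i.val + 1 ≠ N) : (finRotate N i).val = i.val + 1 := by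
  obtain _ | n := N
  · exact i.elim0
  · exact coe_finRotate_of_ne_last fun h => hi (by rw [h, Fin.val_last])

/-- The cycle sends the last index to the first one and the sum over all smaller indices to the sum
over all others. That is the sum of permutations absorbed by `pmul_mul_eOp_self`, and the Dunkl
operator of the first index has no permutation terms left over. -/
theorem piOp_mul_dOp_last {f l : Fin N} (hf : f.val = 0) (hl : l.val + 1 = N) :
    D.piOp f * D.dOp l = (D.dOp f - (ℓ + m : ℂ) • 1) * D.piOp f := by
  have hr := finRotate_apply_last hf hl
  have h1 : D.perm (finRotate N) * (∑ j : Fin N, if j < l then D.perm (Equiv.swap l j) else 0) =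
      (∑ j ∈ Finset.univ.erase f, D.perm (Equiv.swap f j)) * D.perm (finRotate N) := by
    rw [Finset.mul_sum, Finset.sum_mul, ← Finset.sum_filter_of_ne (p := fun j => j < l)]
    · refine Finset.sum_equiv (finRotate N) ?_ ?_
      · intro j
        have h2 : j < l ↔ j ≠ l := by
          rw [Ne, Fin.ext_iff, Fin.lt_def]
          omega
        simp only [Finset.mem_filter, Finset.mem_univ, true_and, Finset.mem_erase, and_true, h2]
        rw [← hr, Ne, Ne, (finRotate N).injective.eq_iff]
      · intro j hj
        rw [if_pos (Finset.mem_filter.mp hj).2, D.perm_mul_swap, hr]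
    · intro j _ hj
      by_contra h
      rw [if_neg h, mul_zero] at hj
      exact hj rfl
  have h3 : D.dOp f = D.eOp f := by rw [dOp, sum_lt_eq_of_zero hf, add_zero]
  rw [piOp, mul_assoc, dOp, mul_add, h1, D.perm_mul_eOp, hr, ← add_mul, ← mul_assoc,
    D.pmul_mul_eOp_self, mul_assoc, h3]

/-- After rotation the sum over smaller indices lacks only the first index. The missing
transposition is created by carrying `z_f` across `eOp k`. -/
theorem piOp_mul_dOp_of_ne {f i : Fin N} (hf : f.val = 0) (hi : i.val + 1 ≠ N) :
    D.piOp f * D.dOp i = D.dOp (finRotate N i) * D.piOp f := by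
  set k := finRotate N i with hk
  have hkv : k.val = i.val + 1 := finRotate_val hi
  have hkf : f ≠ k := fun h => by rw [Fin.ext_iff] at h; omega
  have hN : 0 < N := f.pos
  obtain ⟨l, hl⟩ : ∃ l : Fin N, l.val + 1 = N := ⟨⟨N - 1, by omega⟩, by simp only; omega⟩
  have hr := finRotate_apply_last hf hl
  have h1 : D.perm (finRotate N) * (∑ j : Fin N, if j < i then D.perm (Equiv.swap i j) else 0) =
      (∑ j ∈ Finset.univ.erase f, if j < k then D.perm (Equiv.swap k j) else 0) *
        D.perm (finRotate N) := by
    -- The last index is never smaller than `i`, so it can be dropped; the remaining indices rotate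
    -- onto those different from `f`, and there rotation preserves the order.
    rw [Finset.mul_sum, Finset.sum_mul, ← Finset.sum_erase_add _ _ (Finset.mem_univ l),
      if_neg (by rw [Fin.lt_def]; have := i.isLt; omega), mul_zero, add_zero]
    refine Finset.sum_equiv (finRotate N) ?_ ?_
    · intro j
      simp only [Finset.mem_erase, Finset.mem_univ, and_true]
      rw [← hr, Ne, Ne, (finRotate N).injective.eq_iff]
    · intro j hj
      have hjl : j ≠ l := Finset.ne_of_mem_erase hj
      have hj2 : (finRotate N j).val = j.val + 1 :=
        finRotate_val fun h => hjl (Fin.ext (by omega))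
      have h2 : finRotate N j < k ↔ j < i := by
        rw [Fin.lt_def, Fin.lt_def]
        omega
      simp only [h2]
      split_ifs
      · rw [D.perm_mul_swap]
      · rw [mul_zero, zero_mul]
  have h2 : D.pmul (zPow f 1) * (∑ j ∈ Finset.univ.erase f, if j < k then
      D.perm (Equiv.swap k j) else 0) = (∑ j ∈ Finset.univ.erase f, if j < k then
      D.perm (Equiv.swap k j) else 0) * D.pmul (zPow f 1) := by
    rw [Finset.mul_sum, Finset.sum_mul]
    refine Finset.sum_congr rfl fun j hj => ?_
    split_ifs
    · exact D.pmul_mul_swap_of_ne hkf (Finset.ne_of_mem_erase hj).symm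
    · rw [mul_zero, zero_mul]
  have h3 : D.dOp k = D.eOp k + D.perm (Equiv.swap k f) + ∑ j ∈ Finset.univ.erase f, if j < k then
      D.perm (Equiv.swap k j) else 0 := by
    rw [dOp, ← Finset.add_sum_erase _ _ (Finset.mem_univ f), if_pos (by rw [Fin.lt_def]; omega),
      add_assoc]
  rw [piOp, mul_assoc, dOp, mul_add, h1, D.perm_mul_eOp, ← hk, ← add_mul, ← mul_assoc, mul_add,
    h2, D.pmul_mul_eOp_of_ne hkf, ← add_mul, mul_assoc, h3]

/-- The Dunkl operator `D_ξ`. -/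
def dXi : (Fin N → ℂ) →ₗ[ℂ] Module.End ℂ E := Fintype.linearCombination ℂ D.dOp

theorem dXi_apply (ξ : Fin N → ℂ) : D.dXi ξ = ∑ i, ξ i • D.dOp i := rfl

theorem swap_mul_dXi {a b : Fin N} (hab : a.val + 1 = b.val) (ξ : Fin N → ℂ) :
    D.perm (Equiv.swap a b) * D.dXi ξ -
      D.dXi (ξ ∘ (Equiv.swap a b).symm) * D.perm (Equiv.swap a b) = (-(ξ a - ξ b)) • 1 := by
  have h : D.dXi (ξ ∘ (Equiv.swap a b).symm) = ∑ i, ξ i • D.dOp (Equiv.swap a b i) := by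
    rw [dXi_apply, ← Equiv.sum_comp (Equiv.swap a b)]
    simp
  have h1 : ∀ i, D.perm (Equiv.swap a b) * ξ i • D.dOp i -
      ξ i • D.dOp (Equiv.swap a b i) * D.perm (Equiv.swap a b) =
      (ξ i * ((if i = b then (1 : ℂ) else 0) - if i = a then 1 else 0)) • 1 := by
    intro i
    rw [mul_smul_comm, smul_mul_assoc, ← smul_sub, D.swap_mul_dOp hab, smul_smul]
  rw [h, dXi_apply, Finset.mul_sum, Finset.sum_mul, ← Finset.sum_sub_distrib,
    Finset.sum_congr rfl fun i _ => h1 i, ← Finset.sum_smul]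
  congr 1
  simp [mul_sub]

theorem piOp_mul_dXi {f l : Fin N} (hf : f.val = 0) (hl : l.val + 1 = N) (ξ : Fin N → ℂ) :
    D.piOp f * D.dXi ξ =
      (D.dXi (ξ ∘ (finRotate N).symm) - ((ℓ + m) * ξ l) • 1) * D.piOp f := by
  have h : D.dXi (ξ ∘ (finRotate N).symm) = ∑ i, ξ i • D.dOp (finRotate N i) := by
    rw [dXi_apply, ← Equiv.sum_comp (finRotate N)]
    simp only [Function.comp, Equiv.symm_apply_apply]
  have h1 : ∀ i, D.piOp f * D.dOp i = (D.dOp (finRotate N i) -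
      (if i = l then (ℓ + m : ℂ) else 0) • 1) * D.piOp f := by
    intro i
    split_ifs with hi
    · rw [hi, D.piOp_mul_dOp_last hf hl, finRotate_apply_last hf hl]
    · rw [D.piOp_mul_dOp_of_ne hf fun h => hi (Fin.ext (by omega)), zero_smul, sub_zero]
  rw [h, dXi_apply, Finset.mul_sum]
  simp only [mul_smul_comm, h1, sub_mul, smul_mul_assoc, one_mul, smul_sub, Finset.sum_sub_distrib,
    Finset.sum_mul, smul_smul, mul_ite, mul_zero, ← Finset.sum_smul, Finset.sum_ite_eq',
    Finset.mem_univ, if_true]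
  rw [mul_comm (ξ l)]

end KZData

theorem commute_rUnivLin {m : ℕ} {E : Type} [AddCommGroup E] [Module ℂ E]
    {f g : AffineSl m →ₗ[ℂ] Module.End ℂ E} {T : Module.End ℂ E} (h : JointlySmooth f g)
    (hf : ∀ y, Commute T (f y)) (hg : ∀ y, Commute T (g y)) : Commute T (rUnivLin h) := by
  have h1 := mul_rUnivLin (C := 0) h h (fun y _ => hf y) (fun y _ => hg y) ?_
  · rwa [add_zero] at h1
  · rw [add_zero]
    exact (((hf _).mul_right (hg _)).add_right ((hf _).mul_right (hg _))).smul_right _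

/-! ### Generators of the derived affine algebra -/

namespace AffineSl

variable {m : ℕ}

/-- An explicit form of the perfectness of `sl_m`, valid for diagonal and off-diagonal units alike
and also for `m = 1`, where both sides vanish. -/
theorem sum_lie_slUnit (p r : Fin m) :
    ∑ q : Fin m, ⁅slUnit p q, slUnit q r⁆ = (m : ℂ) • slUnit p r := by
  apply Subtype.ext
  have h : ∀ s : Finset (Fin m), (∑ q ∈ s, ⁅slUnit p q, slUnit q r⁆ : 𝔰 m).val =
      ∑ q ∈ s, (⁅slUnit p q, slUnit q r⁆ : 𝔰 m).val := fun s => by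
    induction s using Finset.induction_on with
    | empty => rfl
    | insert a s ha ih => rw [Finset.sum_insert ha, Finset.sum_insert ha, ← ih]; rfl
  have hm : (m : ℂ) ≠ 0 := Nat.cast_ne_zero.mpr (Nat.pos_iff_ne_zero.mp p.pos)
  rw [h]
  change _ = (m : ℂ) • (slUnit p r).val
  have h1 : ∀ q : Fin m, (⁅slUnit p q, slUnit q r⁆ : 𝔰 m).val = Matrix.single p r 1 -
      if p = r then Matrix.single q q 1 else (0 : Matrix (Fin m) (Fin m) ℂ) := by
    intro q
    rw [lie_slUnit_val, slUnit_val]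
    split_ifs with h1 h2 h2 <;>
      simp_all [sub_mul, mul_sub, Matrix.single_mul_single_of_ne, Ne.symm]
  simp only [h1, Finset.sum_sub_distrib, slUnit_val, smul_sub]
  congr 1
  · simp
  · split_ifs
    · rw [Matrix.sum_single_one, smul_smul, mul_one_div_cancel hm, one_smul]
    · simp

/-- The trace-zero part of `E_pq ⊗ a`. -/
def loopUnit (p q : Fin m) (a : Laurent) : AffineSl m :=
  ⟨⟨Matrix.single p q a - if p = q then (1 / (m : ℂ)) • (Matrix.diagonal fun _ => a) else 0, by
    change Matrix.trace (Matrix.single p q a -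
      if p = q then (1 / (m : ℂ)) • (Matrix.diagonal fun _ : Fin m => a) else 0) = 0
    have hm : (m : ℂ) ≠ 0 := Nat.cast_ne_zero.mpr (Nat.pos_iff_ne_zero.mp p.pos)
    rw [Matrix.trace_sub]
    split_ifs with h
    · subst h
      rw [Matrix.trace_smul, Matrix.trace_diagonal, Finset.sum_const, Finset.card_univ,
        Fintype.card_fin, ← Nat.cast_smul_eq_nsmul ℂ, smul_smul, one_div_mul_cancel hm, one_smul,
        Matrix.trace_single_eq_same, sub_self]
    · simp [h]⟩, 0, 0⟩

theorem loopUnit_zero (p q : Fin m) : loopUnit p q 0 = 0 := by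
  refine ext_val ?_ rfl rfl
  simp [loopUnit]

theorem loopUnit_add (p q : Fin m) (a b : Laurent) :
    loopUnit p q (a + b) = loopUnit p q a + loopUnit p q b := by
  refine ext_val ?_ (add_zero _).symm (add_zero _).symm
  rw [add_loop_val]
  simp only [loopUnit]
  rw [Matrix.single_add]
  split_ifs
  · rw [show (Matrix.diagonal fun _ : Fin m => a + b) = (Matrix.diagonal fun _ => a) +
      Matrix.diagonal fun _ => b from (Matrix.diagonal_add _ _).symm, smul_add]
    abel
  · abel

theorem loopUnit_single (p q : Fin m) (n : ℤ) (a : ℂ) :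
    loopUnit p q (AddMonoidAlgebra.single n a) = a • unit n p q := by
  refine ext_val ?_ (mul_zero a).symm (mul_zero a).symm
  rw [smul_loop_val]
  ext i j : 1
  simp only [loopUnit, unit, tmul, slUnit_val, Matrix.smul_apply, Matrix.map_apply,
    Matrix.sub_apply, Matrix.single_apply, map_sub, smul_sub]
  have h1 : ∀ b : ℂ, b • AddMonoidAlgebra.single n a =
      a • (AddMonoidAlgebra.singleAddHom n b : Laurent) := fun b => by
    change b • AddMonoidAlgebra.single n a = a • AddMonoidAlgebra.single n b
    rw [AddMonoidAlgebra.smul_single, AddMonoidAlgebra.smul_single, smul_eq_mul, smul_eq_mul,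
      mul_comm]
  congr 1
  · split_ifs
    · rw [← h1, one_smul]
    · rw [map_zero, smul_zero]
  · split_ifs
    · rw [Matrix.smul_apply, Matrix.smul_apply, Matrix.diagonal_apply, Matrix.one_apply]
      split_ifs
      · rw [smul_eq_mul, mul_one, ← h1]
      · rw [smul_zero, smul_zero, map_zero, smul_zero]
    · rw [Matrix.zero_apply, Matrix.zero_apply, map_zero, smul_zero]

theorem eq_sum_loopUnit (y : AffineSl m) (hd : y.d = 0) :
    y = ∑ p : Fin m, ∑ q : Fin m, loopUnit p q (y.loop.val p q) + y.c • central := by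
  have hs : ∀ (F : Fin m → AffineSl m), (∑ p, F p).loop.val = ∑ p, (F p).loop.val ∧
      (∑ p, F p).c = ∑ p, (F p).c ∧ (∑ p, F p).d = ∑ p, (F p).d := by
    intro F
    induction (Finset.univ : Finset (Fin m)) using Finset.induction_on with
    | empty => exact ⟨rfl, rfl, rfl⟩
    | insert a s ha ih =>
      rw [Finset.sum_insert ha, Finset.sum_insert ha, Finset.sum_insert ha, Finset.sum_insert ha,
        ← ih.1, ← ih.2.1, ← ih.2.2]
      exact ⟨rfl, rfl, rfl⟩
  refine ext_val ?_ ?_ ?_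
  · rw [add_loop_val, (hs _).1]
    simp only [(hs _).1]
    have h1 : ∀ p q, (loopUnit p q (y.loop.val p q)).loop.val =
      Matrix.single p q (y.loop.val p q) -
        if p = q then (1 / (m : ℂ)) • (Matrix.diagonal fun _ => y.loop.val p q) else 0 :=
      fun p q => rfl
    simp only [h1, Finset.sum_sub_distrib]
    have h2 : ∑ p : Fin m, ∑ q : Fin m, (if p = q then (1 / (m : ℂ)) •
        (Matrix.diagonal fun _ : Fin m => y.loop.val p q) else 0) = 0 := by
      simp only [Finset.sum_ite_eq, Finset.mem_univ, if_true]
      rw [← Finset.smul_sum]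
      have h3 : ∑ p : Fin m, (Matrix.diagonal fun _ : Fin m => y.loop.val p p) =
          Matrix.diagonal fun _ : Fin m => Matrix.trace y.loop.val := by
        ext i j : 1
        rw [Matrix.sum_apply, Matrix.diagonal_apply]
        simp only [Matrix.diagonal_apply]
        split_ifs
        · rfl
        · simp
      rw [h3, trace_loop]
      simp
    rw [h2, sub_zero, ← Matrix.matrix_eq_sum_single]
    simp [central]
  · rw [add_c, (hs _).2.1]
    simp only [(hs _).2.1]
    simp [loopUnit, central]
  · rw [add_d, (hs _).2.2]
    simp only [(hs _).2.2]
    simp [loopUnit, central, hd]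

/-- The derived algebra is generated by `c` and `sl_m ⊗ t^{±1}`. -/
theorem mem_of_generators (L : Submodule ℂ (AffineSl m)) (hlie : ∀ x ∈ L, ∀ y ∈ L, ⁅x, y⁆ ∈ L)
    (hc : central ∈ L) (h1 : ∀ x : 𝔰 m, tmul 1 x ∈ L) (h2 : ∀ x : 𝔰 m, tmul (-1) x ∈ L)
    (y : AffineSl m) (hd : y.d = 0) : y ∈ L := by
  -- Brackets of degrees `a` and `b` fill degree `a + b`, since `sl_m` is spanned by commutators;
  -- the cocycle term is removed because `c` already lies in `L`.
  have hadd : ∀ a b : ℤ, (∀ x : 𝔰 m, tmul a x ∈ L) → (∀ x : 𝔰 m, tmul b x ∈ L) →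
      ∀ x : 𝔰 m, tmul (a + b) x ∈ L := by
    intro a b ha hb x
    have h3 : ∀ x y : 𝔰 m, tmul (a + b) ⁅x, y⁆ ∈ L := by
      intro x y
      have h4 := L.sub_mem (hlie _ (ha x) _ (hb y)) (L.smul_mem
        (if a + b = 0 then (a : ℂ) * Matrix.trace (x.val * y.val) else 0) hc)
      rwa [tmul_lie_tmul, add_sub_cancel_right] at h4
    have h4 : ∀ p q : Fin m, tmul (a + b) (slUnit p q) ∈ L := by
      intro p q
      have hm : (m : ℂ) ≠ 0 := Nat.cast_ne_zero.mpr (Nat.pos_iff_ne_zero.mp p.pos)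
      have h5 : tmulHom (a + b) ((m : ℂ)⁻¹ • ∑ r : Fin m, ⁅slUnit p r, slUnit r q⁆) ∈ L := by
        rw [map_smul, map_sum]
        exact L.smul_mem _ (L.sum_mem fun r _ => h3 _ _)
      rwa [sum_lie_slUnit, smul_smul, inv_mul_cancel₀ hm, one_smul] at h5
    rw [sl_eq_sum x, ← tmulHom_apply, map_sum]
    refine L.sum_mem fun p _ => ?_
    rw [map_sum]
    refine L.sum_mem fun q _ => ?_
    rw [map_smul]
    exact L.smul_mem _ (h4 p q)
  have h0 : ∀ x : 𝔰 m, tmul 0 x ∈ L := hadd 1 (-1) h1 h2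
  have hn : ∀ n : ℤ, ∀ x : 𝔰 m, tmul n x ∈ L := by
    intro n
    induction n using Int.induction_on with
    | zero => exact h0
    | succ n ih => exact hadd _ _ ih h1
    | pred n ih => exact hadd _ _ ih h2
  rw [eq_sum_loopUnit y hd]
  refine L.add_mem (L.sum_mem fun p _ => L.sum_mem fun q _ => ?_) (L.smul_mem _ hc)
  induction y.loop.val p q using AddMonoidAlgebra.induction_linear with
  | zero => rw [loopUnit_zero]; exact L.zero_mem
  | add a b ha hb => rw [loopUnit_add]; exact L.add_mem ha hb
  | single n a => rw [loopUnit_single]; exact L.smul_mem _ (hn n _)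

end AffineSl

/-! ### Stability of the coinvariant subspace under the Dunkl operators -/

namespace KZData

variable {N m : ℕ} {ℓ : ℂ} {E : Type} [AddCommGroup E] [Module ℂ E] (D : KZData N m ℓ E)

/-- The diagonal action. -/
def diag : AffineSl m →ₗ[ℂ] Module.End ℂ E := D.f + ∑ i : Fin N, D.ev i + D.g

theorem diag_apply (y : AffineSl m) : D.diag y = D.f y + ∑ i : Fin N, D.ev i y + D.g y := by
  rw [diag, LinearMap.add_apply, LinearMap.add_apply, LinearMap.sum_apply]

theorem diag_central : D.diag AffineSl.central = 0 := by
  rw [diag_apply, D.f_central, D.g_central]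
  simp [evalAct_central]

theorem diag_sub (i : Fin N) (y : AffineSl m) :
    D.diag y = D.f y + D.ev i y + D.g y + ∑ k ∈ Finset.univ.erase i, D.ev k y := by
  rw [diag_apply, ← Finset.add_sum_erase _ _ (Finset.mem_univ i)]
  abel

theorem diag_lie (x y : AffineSl m) :
    D.diag ⁅x, y⁆ = D.diag x * D.diag y - D.diag y * D.diag x := by
  have h1 : ∀ i, (∑ k ∈ Finset.univ.erase i, D.ev k x) * D.ev i y =
      D.ev i y * ∑ k ∈ Finset.univ.erase i, D.ev k x := fun i =>
    Commute.sum_left _ _ _ fun k hk => evalAct_commute D.hPS (Finset.ne_of_mem_erase hk) x y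
  have h2 : ∀ i, D.diag x * D.ev i y - D.ev i y * D.diag x = D.ev i ⁅x, y⁆ := by
    intro i
    rw [D.diag_sub i x, evalAct_lie D.hPS, mul_add (D.ev i y), add_mul _ _ (D.ev i y), h1,
      mul_add, mul_add, add_mul, add_mul, (D.f_commute_ev i x y).eq, (D.g_commute_ev i x y).eq]
    abel
  have h3 : (∑ i, D.ev i x) * D.f y = D.f y * ∑ i, D.ev i x :=
    Commute.sum_left _ _ _ fun k _ => (D.f_commute_ev k y x).symm
  have h4 : (∑ i, D.ev i x) * D.g y = D.g y * ∑ i, D.ev i x :=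
    Commute.sum_left _ _ _ fun k _ => (D.g_commute_ev k y x).symm
  have h5 : D.diag x * D.f y - D.f y * D.diag x = D.f ⁅x, y⁆ := by
    rw [D.diag_apply x, D.f_lie, add_mul, add_mul, mul_add, mul_add, h3, (D.hfg y x).eq]
    abel
  have h6 : D.diag x * D.g y - D.g y * D.diag x = D.g ⁅x, y⁆ := by
    rw [D.diag_apply x, D.g_lie, add_mul, add_mul, mul_add, mul_add, h4, (D.hfg x y).eq]
    abel
  have h7 : D.diag x * (∑ i, D.ev i y) - (∑ i, D.ev i y) * D.diag x = ∑ i, D.ev i ⁅x, y⁆ := by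
    rw [Finset.mul_sum, Finset.sum_mul, ← Finset.sum_sub_distrib]
    exact Finset.sum_congr rfl fun i _ => h2 i
  rw [D.diag_apply y, D.diag_apply ⁅x, y⁆, ← h5, ← h6, ← h7]
  simp only [mul_add, add_mul]
  abel

theorem perm_mul_diag (w : Equiv.Perm (Fin N)) (y : AffineSl m) :
    D.perm w * D.diag y = D.diag y * D.perm w := by
  have h : D.perm w * (∑ i, D.ev i y) = (∑ i, D.ev i y) * D.perm w := by
    rw [Finset.mul_sum, Finset.sum_mul]
    exact Finset.sum_equiv w (by simp) fun i _ => tauOp_mul_evalAct D.hPS w i y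
  rw [diag_apply, mul_add, mul_add, add_mul, add_mul, (D.perm_commute_f w y).eq,
    (D.perm_commute_g w y).eq, h]

theorem pmul_mul_diag (η : Fin N → ℤ) (y : AffineSl m) (hy : y.d = 0) :
    D.pmul (expMon η) * D.diag y = D.diag y * D.pmul (expMon η) := by
  rw [diag_apply, mul_add, mul_add, add_mul, add_mul, (D.hPf _ y).eq, (D.hPg _ y).eq,
    Finset.mul_sum, Finset.sum_mul]
  congr 2
  exact Finset.sum_congr rfl fun i _ => D.pmul_mul_ev_of_d_eq_zero η i y hy

theorem ev_commute_exch {i j k : Fin N} (hij : i ≠ j) (hki : k ≠ i) (hkj : k ≠ j) (n : ℤ)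
    (x : 𝔰 m) : Commute (D.ev k (AffineSl.tmul n x)) (D.exch i j) := by
  have h1 : Commute (D.pmul (zPow k n)) (D.P (divDiff i j)) := by
    refine Commute.map (LinearMap.ext fun a => ?_) D.P
    change zPow k n * divDiff i j a = divDiff i j (zPow k n * a)
    rw [divDiff_mul hij, divDiff_zPow_of_ne hij hki hkj, zero_mul, add_zero, permPoly_zPow,
      Equiv.swap_apply_of_ne_of_ne hki hkj]
  have h2 : Commute (D.S (slotHom k x.val)) (D.S (permHom (Equiv.swap i j))) := by
    refine Commute.map ?_ D.S
    have h := permHom_mul_slotHom (Equiv.swap i j) k x.val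
    rw [Equiv.swap_apply_of_ne_of_ne hki hkj] at h
    exact h.symm
  have h3 : Commute (D.S (slotHom k x.val)) (D.S (rSlot i j)) := by
    refine Commute.map ?_ D.S
    exact Commute.sum_right _ _ _ fun p _ => Commute.sum_right _ _ _ fun q _ =>
      ((slotHom_commute hki _ _).mul_right (slotHom_commute hkj _ _)).smul_right _
  rw [evalAct_tmul]
  exact ((D.hPS _ _).mul_left h3).sub_right
    ((h1.mul_right (D.hPS _ _)).mul_left ((D.hPS _ _).symm.mul_right h2))

theorem diag_commutator_exch (n : ℤ) (hn : n = 1 ∨ n = -1) (x : 𝔰 m) {i j : Fin N} (hij : i ≠ j) :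
    D.diag (AffineSl.tmul n x) * D.exch i j - D.exch i j * D.diag (AffineSl.tmul n x) =
      deltaOp n x (D.ev i) (D.ev j) := by
  rw [← commutator_exchange D.hPS n hn x hij]
  have hj : j ∈ Finset.univ.erase i := by simp [hij.symm]
  set y := AffineSl.tmul n x
  have h1 : D.diag y = (D.ev i y + D.ev j y) + (D.f y + D.g y +
      ∑ k ∈ (Finset.univ.erase i).erase j, D.ev k y) := by
    rw [D.diag_sub i, ← Finset.add_sum_erase _ _ hj]
    abel
  have h2 : Commute (D.f y + D.g y + ∑ k ∈ (Finset.univ.erase i).erase j, D.ev k y)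
      (D.exch i j) := by
    refine ((D.exch_commute_f i j y).symm.add_left (D.exch_commute_g i j y).symm).add_left ?_
    refine Commute.sum_left _ _ _ fun k hk => ?_
    rw [Finset.mem_erase, Finset.mem_erase] at hk
    exact D.ev_commute_exch hij hk.2.1 hk.1 n x
  rw [h1, add_mul _ _ (D.exch i j), mul_add (D.exch i j), h2.eq]
  abel

/-- Each of the three summands of `zOp` sees only the places on which it acts; the rest of the
diagonal action commutes with it. -/
theorem diag_commutator_zOp (n : ℤ) (hn : n = 1 ∨ n = -1) (x : 𝔰 m) (i : Fin N) :
    D.diag (AffineSl.tmul n x) * D.zOp i - D.zOp i * D.diag (AffineSl.tmul n x) =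
      deltaOp n x D.f (D.ev i) - deltaOp n x (D.ev i) D.g + deltaOp n x (D.ev i) (D.ev i) := by
  set y := AffineSl.tmul n x with hy
  set s := ∑ k ∈ Finset.univ.erase i, D.ev k y
  have hs : ∀ z, Commute s (D.ev i z) := fun z =>
    Commute.sum_left _ _ _ fun k hk => evalAct_commute D.hPS (Finset.ne_of_mem_erase hk) y z
  have hsf : ∀ z, Commute s (D.f z) := fun z =>
    Commute.sum_left _ _ _ fun k _ => (D.f_commute_ev k z y).symm
  have hsg : ∀ z, Commute s (D.g z) := fun z =>
    Commute.sum_left _ _ _ fun k _ => (D.g_commute_ev k z y).symm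
  have h1 := commutator_rUnivLin D.f_lie (evalAct_lie D.hPS i) (D.f_commute_ev i)
    (D.jointlySmooth_f i) n hn x
  have h2 := commutator_rUnivLin (evalAct_lie D.hPS i) D.g_lie
    (fun a b => (D.g_commute_ev i b a).symm) (D.jointlySmooth_g i) n hn x
  have h3 := deltaOp_self D.hPS n hn x i
  have h4 : Commute (s + D.g y) (rUnivLin (D.jointlySmooth_f i)) :=
    commute_rUnivLin _ (fun z => (hsf z).add_left (D.hfg z y).symm)
      (fun z => (hs z).add_left (D.g_commute_ev i y z))
  have h5 : Commute (s + D.f y) (rUnivLin (D.jointlySmooth_g i)) :=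
    commute_rUnivLin _ (fun z => (hs z).add_left (D.f_commute_ev i y z))
      (fun z => (hsg z).add_left (D.hfg y z))
  have h6 : Commute (s + D.f y + D.g y) (D.ev i (rhoCheck m)) :=
    ((hs _).add_left (D.f_commute_ev i y _)).add_left (D.g_commute_ev i y _)
  rw [← hy] at h1 h2 h3
  have e1 : D.diag y * rUnivLin (D.jointlySmooth_f i) - rUnivLin (D.jointlySmooth_f i) * D.diag y =
      deltaOp n x D.f (D.ev i) := by
    rw [← h1, show D.diag y = (D.f y + D.ev i y) + (s + D.g y) by rw [D.diag_sub i y]; abel,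
      add_mul (D.f y + _), mul_add, h4.eq]
    abel
  have e2 : D.diag y * rUnivLin (D.jointlySmooth_g i) - rUnivLin (D.jointlySmooth_g i) * D.diag y =
      deltaOp n x (D.ev i) D.g := by
    rw [← h2, show D.diag y = (D.ev i y + D.g y) + (s + D.f y) by rw [D.diag_sub i y]; abel,
      add_mul (D.ev i y + _), mul_add, h5.eq]
    abel
  have e3 : D.diag y * D.ev i (rhoCheck m) - D.ev i (rhoCheck m) * D.diag y =
      deltaOp n x (D.ev i) (D.ev i) := by
    rw [h3, show D.diag y = D.ev i y + (s + D.f y + D.g y) by rw [D.diag_sub i y]; abel,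
      add_mul (D.ev i y), mul_add, h6.eq]
    abel
  rw [← e1, ← e2, ← e3, zOp]
  simp only [mul_add, add_mul, mul_sub, sub_mul]
  abel

/-- Every place, including the `i`-th itself and the two ends, contributes its cobracket with the
`i`-th place as second leg: the two ends and `ρ^∨` through `zOp`, the other places through
`exchange`. By additivity the first leg becomes the full diagonal action. -/
theorem diag_commutator_eOp (n : ℤ) (hn : n = 1 ∨ n = -1) (x : 𝔰 m) (i : Fin N) :
    D.diag (AffineSl.tmul n x) * D.eOp i - D.eOp i * D.diag (AffineSl.tmul n x) =
      deltaOp n x D.diag (D.ev i) := by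
  have h1 : D.diag (AffineSl.tmul n x) * (∑ j ∈ Finset.univ.erase i, D.exch i j) -
      (∑ j ∈ Finset.univ.erase i, D.exch i j) * D.diag (AffineSl.tmul n x) =
      -∑ j ∈ Finset.univ.erase i, deltaOp n x (D.ev j) (D.ev i) := by
    rw [Finset.mul_sum, Finset.sum_mul, ← Finset.sum_sub_distrib, ← Finset.sum_neg_distrib]
    refine Finset.sum_congr rfl fun j hj => ?_
    have hij := (Finset.ne_of_mem_erase hj).symm
    rw [D.diag_commutator_exch n hn x hij,
      deltaOp_antisymm n x fun a b => evalAct_commute D.hPS hij a b]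
  have h2 := D.diag_commutator_zOp n hn x i
  rw [deltaOp_antisymm n x (fun a b => (D.g_commute_ev i b a).symm)] at h2
  have h3 : deltaOp n x D.diag (D.ev i) = deltaOp n x D.f (D.ev i) + (deltaOp n x (D.ev i) (D.ev i) +
      ∑ j ∈ Finset.univ.erase i, deltaOp n x (D.ev j) (D.ev i)) + deltaOp n x D.g (D.ev i) := by
    rw [diag, ← Finset.add_sum_erase _ _ (Finset.mem_univ i), deltaOp_add, deltaOp_add, deltaOp_add,
      deltaOp_sum]
  rw [h3, eOp, mul_sub, sub_mul, sub_sub_sub_comm, h1, h2]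
  abel

/-- The subspace with quotient the space of coinvariants. -/
def coinv : Submodule ℂ E :=
  Submodule.span ℂ {v | ∃ (y : AffineSl m) (u : E), y.d = 0 ∧ v = D.diag y u}

theorem diag_mem (y : AffineSl m) (hy : y.d = 0) (u : E) : D.diag y u ∈ D.coinv :=
  Submodule.subset_span ⟨y, u, hy, rfl⟩

/-- The elements of the affine algebra whose diagonal action lands in `G` are closed under brackets
and contain `c`, which acts by `ℓ - ℓ = 0`. Hence membership need only be checked in loop degrees
`±1`. -/
theorem coinv_le_of_tmul (G : Submodule ℂ E)
    (h : ∀ n : ℤ, n = 1 ∨ n = -1 → ∀ (x : 𝔰 m) (u : E), D.diag (AffineSl.tmul n x) u ∈ G) :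
    D.coinv ≤ G := by
  rw [coinv, Submodule.span_le]
  rintro _ ⟨y, u, hy, rfl⟩
  let L : Submodule ℂ (AffineSl m) :=
    { carrier := {y | ∀ u, D.diag y u ∈ G}
      add_mem' := fun ha hb u => by
        rw [map_add, LinearMap.add_apply]
        exact G.add_mem (ha u) (hb u)
      zero_mem' := fun u => by rw [map_zero, LinearMap.zero_apply]; exact G.zero_mem
      smul_mem' := fun c a ha u => by
        rw [map_smul, LinearMap.smul_apply]
        exact G.smul_mem c (ha u) }
  refine AffineSl.mem_of_generators L (fun a ha b hb u => ?_) (fun u => ?_) (fun x u => ?_)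
    (fun x u => ?_) y hy u
  · rw [D.diag_lie, LinearMap.sub_apply, Module.End.mul_apply, Module.End.mul_apply]
    exact G.sub_mem (ha _) (hb _)
  · rw [D.diag_central, LinearMap.zero_apply]
    exact G.zero_mem
  · exact h 1 (Or.inl rfl) x u
  · exact h (-1) (Or.inr rfl) x u

/-- In `deltaOp` the first action is always applied last, and its arguments lie in the derived
algebra; each term is therefore a diagonal image. -/
theorem deltaOp_diag_mem (n : ℤ) (x : 𝔰 m) (g : AffineSl m →ₗ[ℂ] Module.End ℂ E) (u : E) :
    deltaOp n x D.diag g u ∈ D.coinv := by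
  rw [deltaOp, LinearMap.add_apply, LinearMap.smul_apply, LinearMap.smul_apply,
    LinearMap.sub_apply, LinearMap.sum_apply]
  refine D.coinv.add_mem (D.coinv.smul_mem _ (D.coinv.sub_mem (D.diag_mem _ rfl _)
    (D.diag_mem _ rfl _))) (D.coinv.smul_mem _ (D.coinv.sum_mem fun p _ => ?_))
  rw [LinearMap.sum_apply]
  refine D.coinv.sum_mem fun q _ => D.coinv.smul_mem _ ?_
  exact D.coinv.sub_mem (D.diag_mem _ rfl _) (D.diag_mem _ rfl _)

theorem eOp_mem (i : Fin N) {v : E} (hv : v ∈ D.coinv) : D.eOp i v ∈ D.coinv := by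
  refine D.coinv_le_of_tmul (D.coinv.comap (D.eOp i)) (fun n hn x u => ?_) hv
  have h := LinearMap.congr_fun (D.diag_commutator_eOp n hn x i) u
  rw [LinearMap.sub_apply, Module.End.mul_apply, Module.End.mul_apply, sub_eq_iff_eq_add] at h
  rw [Submodule.mem_comap, ← D.coinv.add_mem_iff_right (D.deltaOp_diag_mem n x (D.ev i) u), ← h]
  exact D.diag_mem _ rfl _

theorem perm_mem (w : Equiv.Perm (Fin N)) {v : E} (hv : v ∈ D.coinv) : D.perm w v ∈ D.coinv := by
  refine D.coinv_le_of_tmul (D.coinv.comap (D.perm w)) (fun n hn x u => ?_) hv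
  rw [Submodule.mem_comap, ← Module.End.mul_apply, D.perm_mul_diag]
  exact D.diag_mem _ rfl _

theorem pmul_mem (η : Fin N → ℤ) {v : E} (hv : v ∈ D.coinv) :
    D.pmul (expMon η) v ∈ D.coinv := by
  refine D.coinv_le_of_tmul (D.coinv.comap (D.pmul (expMon η))) (fun n hn x u => ?_) hv
  rw [Submodule.mem_comap, ← Module.End.mul_apply, D.pmul_mul_diag _ _ rfl]
  exact D.diag_mem _ rfl _

theorem dOp_mem (i : Fin N) {v : E} (hv : v ∈ D.coinv) : D.dOp i v ∈ D.coinv := by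
  rw [dOp, LinearMap.add_apply, LinearMap.sum_apply]
  refine D.coinv.add_mem (D.eOp_mem i hv) (D.coinv.sum_mem fun j _ => ?_)
  split_ifs
  · exact D.perm_mem _ hv
  · exact D.coinv.zero_mem

theorem dXi_mem (ξ : Fin N → ℂ) {v : E} (hv : v ∈ D.coinv) : D.dXi ξ v ∈ D.coinv := by
  rw [dXi_apply, LinearMap.sum_apply]
  exact D.coinv.sum_mem fun i _ => D.coinv.smul_mem _ (D.dOp_mem i hv)

end KZData

/-! ### The tensor product of two smooth modules of opposite levels -/

section Concrete

section

variable (N m : ℕ) (A B : Type) [AddCommGroup A] [Module ℂ A] [AddCommGroup B] [Module ℂ B]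

/-- Operators on Laurent polynomials, acting on `BigSpace`. -/
def polyOp : Module.End ℂ (MultiLaurent N) →ₐ[ℂ] Module.End ℂ (BigSpace N m A B) :=
  Module.End.rTensorAlgHom ℂ (MultiLaurent N) (A ⊗[ℂ] (TensorPow N m ⊗[ℂ] B))

/-- Operators on tensors, acting on `BigSpace`. -/
def tensOp : Module.End ℂ (TensorPow N m) →ₐ[ℂ] Module.End ℂ (BigSpace N m A B) :=
  (Module.End.lTensorAlgHom ℂ (A ⊗[ℂ] (TensorPow N m ⊗[ℂ] B)) (MultiLaurent N)).comp
    ((Module.End.lTensorAlgHom ℂ (TensorPow N m ⊗[ℂ] B) A).comp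
      (Module.End.rTensorAlgHom ℂ (TensorPow N m) B))

/-- Operators on `A`, acting on `BigSpace`. -/
def leftOp : Module.End ℂ A →ₐ[ℂ] Module.End ℂ (BigSpace N m A B) :=
  (Module.End.lTensorAlgHom ℂ (A ⊗[ℂ] (TensorPow N m ⊗[ℂ] B)) (MultiLaurent N)).comp
    (Module.End.rTensorAlgHom ℂ A (TensorPow N m ⊗[ℂ] B))

/-- Operators on `B`, acting on `BigSpace`. -/
def rightOp : Module.End ℂ B →ₐ[ℂ] Module.End ℂ (BigSpace N m A B) :=
  (Module.End.lTensorAlgHom ℂ (A ⊗[ℂ] (TensorPow N m ⊗[ℂ] B)) (MultiLaurent N)).comp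
    ((Module.End.lTensorAlgHom ℂ (TensorPow N m ⊗[ℂ] B) A).comp
      (Module.End.lTensorAlgHom ℂ B (TensorPow N m)))

end

variable {N m : ℕ} {A B : Type} [AddCommGroup A] [Module ℂ A] [AddCommGroup B] [Module ℂ B]

theorem polyOp_tmul (F : Module.End ℂ (MultiLaurent N)) (p : MultiLaurent N)
    (x : A ⊗[ℂ] (TensorPow N m ⊗[ℂ] B)) : polyOp N m A B F (p ⊗ₜ x) = F p ⊗ₜ x := rfl

theorem tensOp_tmul (F : Module.End ℂ (TensorPow N m)) (p : MultiLaurent N) (a : A)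
    (v : TensorPow N m) (b : B) :
    tensOp N m A B F (p ⊗ₜ (a ⊗ₜ (v ⊗ₜ b))) = p ⊗ₜ (a ⊗ₜ (F v ⊗ₜ b)) := rfl

theorem leftOp_tmul (F : Module.End ℂ A) (p : MultiLaurent N) (a : A)
    (v : TensorPow N m) (b : B) :
    leftOp N m A B F (p ⊗ₜ (a ⊗ₜ (v ⊗ₜ b))) = p ⊗ₜ (F a ⊗ₜ (v ⊗ₜ b)) := rfl

theorem rightOp_tmul (F : Module.End ℂ B) (p : MultiLaurent N) (a : A)
    (v : TensorPow N m) (b : B) :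
    rightOp N m A B F (p ⊗ₜ (a ⊗ₜ (v ⊗ₜ b))) = p ⊗ₜ (a ⊗ₜ (v ⊗ₜ F b)) := rfl

/-- Linear maps on `BigSpace` agree if they agree on decomposable tensors. -/
theorem bigSpace_hom_ext {F : Type} [AddCommMonoid F] [Module ℂ F]
    {f g : BigSpace N m A B →ₗ[ℂ] F}
    (h : ∀ p a v b, f (p ⊗ₜ (a ⊗ₜ (v ⊗ₜ b))) = g (p ⊗ₜ (a ⊗ₜ (v ⊗ₜ b)))) : f = g := by
  refine TensorProduct.ext' fun p x => ?_
  induction x using TensorProduct.induction_on with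
  | zero => rw [TensorProduct.tmul_zero, map_zero, map_zero]
  | add x y hx hy => rw [TensorProduct.tmul_add, map_add, map_add, hx, hy]
  | tmul a y =>
    induction y using TensorProduct.induction_on with
    | zero => rw [TensorProduct.tmul_zero, TensorProduct.tmul_zero, map_zero, map_zero]
    | add x y hx hy => rw [TensorProduct.tmul_add, TensorProduct.tmul_add, map_add, map_add, hx, hy]
    | tmul v b => exact h p a v b

theorem polyOp_commute_tensOp (F G) : Commute (polyOp N m A B F) (tensOp N m A B G) :=
  bigSpace_hom_ext fun p a v b => by
    simp only [Module.End.mul_apply, polyOp_tmul, tensOp_tmul]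

theorem polyOp_commute_leftOp (F G) : Commute (polyOp N m A B F) (leftOp N m A B G) :=
  bigSpace_hom_ext fun p a v b => by
    simp only [Module.End.mul_apply, polyOp_tmul, leftOp_tmul]

theorem polyOp_commute_rightOp (F G) : Commute (polyOp N m A B F) (rightOp N m A B G) :=
  bigSpace_hom_ext fun p a v b => by
    simp only [Module.End.mul_apply, polyOp_tmul, rightOp_tmul]

theorem tensOp_commute_leftOp (F G) : Commute (tensOp N m A B F) (leftOp N m A B G) :=
  bigSpace_hom_ext fun p a v b => by
    simp only [Module.End.mul_apply, tensOp_tmul, leftOp_tmul]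

theorem tensOp_commute_rightOp (F G) : Commute (tensOp N m A B F) (rightOp N m A B G) :=
  bigSpace_hom_ext fun p a v b => by
    simp only [Module.End.mul_apply, tensOp_tmul, rightOp_tmul]

theorem leftOp_commute_rightOp (F G) : Commute (leftOp N m A B F) (rightOp N m A B G) :=
  bigSpace_hom_ext fun p a v b => by
    simp only [Module.End.mul_apply, leftOp_tmul, rightOp_tmul]

theorem tauOp_eq_tau (w : Equiv.Perm (Fin N)) :
    tauOp (polyOp N m A B) (tensOp N m A B) w = tau m A B w :=
  bigSpace_hom_ext fun _ _ _ _ => rfl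

theorem polyOp_mulP (a : MultiLaurent N) (v : BigSpace N m A B) :
    polyOp N m A B (mulP a) v = a • v := by
  have h : polyOp N m A B (mulP a) = Algebra.lsmul ℂ ℂ (BigSpace N m A B) a :=
    bigSpace_hom_ext fun _ _ _ _ => rfl
  exact LinearMap.congr_fun h v

theorem evalAct_eq_theta (i : Fin N) (y : AffineSl m) :
    evalAct (polyOp N m A B) (tensOp N m A B) i y = theta A B i y := by
  have h : loopAct (polyOp N m A B) (tensOp N m A B) i y.loop.val = ∑ p : Fin m, ∑ q : Fin m,
      TensorProduct.map (LinearMap.mulLeft ℂ (evalVar i (y.loop.val p q)))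
        (((slotAct i (Matrix.single p q 1)).rTensor B).lTensor A) := by
    change ∑ p : Fin m, ∑ q : Fin m, polyOp N m A B (mulP (evalVar i (y.loop.val p q))) *
      tensOp N m A B (slotHom i (Matrix.single p q 1)) = _
    refine Finset.sum_congr rfl fun p _ => Finset.sum_congr rfl fun q _ => ?_
    exact bigSpace_hom_ext fun _ _ _ _ => rfl
  rw [evalAct_apply, theta, h]
  rfl

variable [LieRingModule (AffineSl m) A] [LieModule ℂ (AffineSl m) A]
  [LieRingModule (AffineSl m) B] [LieModule ℂ (AffineSl m) B]

/-- The action of the affine Lie algebra on a module. -/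
def actEnd (m : ℕ) (A : Type) [AddCommGroup A] [Module ℂ A] [LieRingModule (AffineSl m) A]
    [LieModule ℂ (AffineSl m) A] : AffineSl m →ₗ[ℂ] Module.End ℂ A :=
  LinearMap.mk₂ ℂ (fun y a => ⁅y, a⁆) add_lie (fun c y a => smul_lie c y a) lie_add
    (fun c y a => lie_smul c y a)

theorem actEnd_lie (x y : AffineSl m) :
    actEnd m A ⁅x, y⁆ = actEnd m A x * actEnd m A y - actEnd m A y * actEnd m A x :=
  LinearMap.ext fun a => lie_lie x y a

/-- The data attached to two smooth modules of opposite levels. -/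
def kzData (N : ℕ) {m : ℕ} (ℓ : ℂ) (A B : Type) [AddCommGroup A] [Module ℂ A] [AddCommGroup B]
    [Module ℂ B] [LieRingModule (AffineSl m) A] [LieModule ℂ (AffineSl m) A]
    [LieRingModule (AffineSl m) B] [LieModule ℂ (AffineSl m) B]
    (hA : ∀ a : A, ⁅(AffineSl.central : AffineSl m), a⁆ = ℓ • a)
    (hB : ∀ b : B, ⁅(AffineSl.central : AffineSl m), b⁆ = -(ℓ • b))
    (sA : ∀ a : A, ∃ K : ℕ, ∀ k : ℤ, K ≤ k → ∀ X : 𝔰 m, ⁅AffineSl.tmul k X, a⁆ = 0)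
    (sB : ∀ b : B, ∃ K : ℕ, ∀ k : ℤ, k ≤ -K → ∀ X : 𝔰 m, ⁅AffineSl.tmul k X, b⁆ = 0) :
    KZData N m ℓ (BigSpace N m A B) where
  P := polyOp N m A B
  S := tensOp N m A B
  f := (leftOp N m A B).toLinearMap ∘ₗ actEnd m A
  g := (rightOp N m A B).toLinearMap ∘ₗ actEnd m B
  hPS := polyOp_commute_tensOp
  hPf _ _ := polyOp_commute_leftOp _ _
  hPg _ _ := polyOp_commute_rightOp _ _
  hSf _ _ := tensOp_commute_leftOp _ _
  hSg _ _ := tensOp_commute_rightOp _ _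
  hfg _ _ := leftOp_commute_rightOp _ _
  f_lie x y := by
    change leftOp N m A B (actEnd m A ⁅x, y⁆) = _
    rw [actEnd_lie, map_sub, map_mul, map_mul]
    rfl
  g_lie x y := by
    change rightOp N m A B (actEnd m B ⁅x, y⁆) = _
    rw [actEnd_lie, map_sub, map_mul, map_mul]
    rfl
  f_central := by
    change leftOp N m A B (actEnd m A AffineSl.central) = _
    rw [show actEnd m A AffineSl.central = ℓ • 1 from LinearMap.ext hA,
      map_smul, map_one]
  g_central := by
    change rightOp N m A B (actEnd m B AffineSl.central) = _
    rw [show actEnd m B AffineSl.central = -(ℓ • 1) from LinearMap.ext hB,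
      map_neg, map_smul, map_one]
  f_smooth v := by
    induction v using TensorProduct.induction_on with
    | zero => exact ⟨0, fun a _ X => map_zero _⟩
    | add v w hv hw =>
      obtain ⟨K, hK⟩ := hv
      obtain ⟨L, hL⟩ := hw
      refine ⟨max K L, fun a ha X => ?_⟩
      rw [map_add, hK a (by omega), hL a (by omega), add_zero]
    | tmul p x =>
      induction x using TensorProduct.induction_on with
      | zero => exact ⟨0, fun a _ X => by rw [TensorProduct.tmul_zero, map_zero]⟩
      | add v w hv hw =>
        obtain ⟨K, hK⟩ := hv
        obtain ⟨L, hL⟩ := hw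
        refine ⟨max K L, fun a ha X => ?_⟩
        rw [TensorProduct.tmul_add, map_add, hK a (by omega), hL a (by omega), add_zero]
      | tmul a y =>
        obtain ⟨K, hK⟩ := sA a
        refine ⟨K, fun k hk X => ?_⟩
        change p ⊗ₜ[ℂ] (⁅AffineSl.tmul k X, a⁆ ⊗ₜ[ℂ] y) = 0
        rw [hK k hk, TensorProduct.zero_tmul, TensorProduct.tmul_zero]
  g_smooth v := by
    induction v using TensorProduct.induction_on with
    | zero => exact ⟨0, fun a _ X => map_zero _⟩
    | add v w hv hw =>
      obtain ⟨K, hK⟩ := hv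
      obtain ⟨L, hL⟩ := hw
      refine ⟨max K L, fun a ha X => ?_⟩
      rw [map_add, hK a (by omega), hL a (by omega), add_zero]
    | tmul p x =>
      induction x using TensorProduct.induction_on with
      | zero => exact ⟨0, fun a _ X => by rw [TensorProduct.tmul_zero, map_zero]⟩
      | add v w hv hw =>
        obtain ⟨K, hK⟩ := hv
        obtain ⟨L, hL⟩ := hw
        refine ⟨max K L, fun a ha X => ?_⟩
        rw [TensorProduct.tmul_add, map_add, hK a (by omega), hL a (by omega), add_zero]
      | tmul a y =>
        induction y using TensorProduct.induction_on with
        | zero => exact ⟨0, fun a _ X => by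
            rw [TensorProduct.tmul_zero, TensorProduct.tmul_zero, map_zero]⟩
        | add v w hv hw =>
          obtain ⟨K, hK⟩ := hv
          obtain ⟨L, hL⟩ := hw
          refine ⟨max K L, fun a ha X => ?_⟩
          rw [TensorProduct.tmul_add, TensorProduct.tmul_add, map_add, hK a (by omega),
            hL a (by omega), add_zero]
        | tmul v b =>
          obtain ⟨K, hK⟩ := sB b
          refine ⟨K, fun k hk X => ?_⟩
          change p ⊗ₜ[ℂ] (a ⊗ₜ[ℂ] (v ⊗ₜ[ℂ] ⁅AffineSl.tmul k X, b⁆)) = 0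
          rw [hK k hk, TensorProduct.tmul_zero, TensorProduct.tmul_zero, TensorProduct.tmul_zero]

variable {ℓ : ℂ} (hA : ∀ a : A, ⁅(AffineSl.central : AffineSl m), a⁆ = ℓ • a)
  (hB : ∀ b : B, ⁅(AffineSl.central : AffineSl m), b⁆ = -(ℓ • b))
  (sA : ∀ a : A, ∃ K : ℕ, ∀ k : ℤ, K ≤ k → ∀ X : 𝔰 m, ⁅AffineSl.tmul k X, a⁆ = 0)
  (sB : ∀ b : B, ∃ K : ℕ, ∀ k : ℤ, k ≤ -K → ∀ X : 𝔰 m, ⁅AffineSl.tmul k X, b⁆ = 0)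

theorem kzData_coinv : (kzData N ℓ A B hA hB sA sB).coinv = coinvSub N A B := by
  rw [KZData.coinv, coinvSub]
  congr 1
  ext v
  simp only [KZData.diag_apply, thetaDiag]
  constructor
  · rintro ⟨y, u, hy, rfl⟩
    refine ⟨y, u, hy, ?_⟩
    rw [← Finset.sum_congr rfl fun i _ => evalAct_eq_theta i y]
    rfl
  · rintro ⟨y, u, hy, rfl⟩
    refine ⟨y, u, hy, ?_⟩
    rw [← Finset.sum_congr rfl fun i _ => evalAct_eq_theta i y]
    rfl

end Concrete

theorem sum_sum_eq_sum_lt {N : ℕ} {V : Type} [AddCommMonoid V] (F : Fin N → Fin N → V)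
    (hF : ∀ i, F i i = 0) :
    ∑ i, ∑ j, F i j = ∑ i, ∑ j, if i < j then F i j + F j i else 0 := by
  have h1 : ∀ i j, F i j = (if i < j then F i j else 0) + if j < i then F i j else 0 := by
    intro i j
    rcases lt_trichotomy i j with h | h | h
    · rw [if_pos h, if_neg h.not_gt, add_zero]
    · rw [h, hF]; simp
    · rw [if_pos h, if_neg h.not_gt, zero_add]
  have h2 : ∀ i j, (if i < j then F i j + F j i else 0) =
      (if i < j then F i j else 0) + if i < j then F j i else 0 := by
    intro i j
    split_ifs <;> simp
  rw [Finset.sum_congr rfl fun i _ => Finset.sum_congr rfl fun j _ => h1 i j]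
  simp only [h2, Finset.sum_add_distrib]
  congr 1
  exact Finset.sum_comm

/-! ### Two-point operators with trace-zero units -/

section PairOperators

variable {N m : ℕ} {E : Type} [AddCommGroup E] [Module ℂ E]
  (P : Module.End ℂ (MultiLaurent N) →ₐ[ℂ] Module.End ℂ E)
  (S : Module.End ℂ (TensorPow N m) →ₐ[ℂ] Module.End ℂ E)

/-- Each diagonal term `(E_pp - 1/m)(E_pp - 1/m)` yields two linear corrections summing to `-2c/m`
and a constant one summing to `c/m`. With `c = 1/2` and `c = 1` this gives the scalars that separate
`rbar` and `Ω` from their `gl_m` versions. -/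
theorem sum_unit_evalAct (κ : Fin m → Fin m → ℂ) (c : ℂ) (hκ : ∀ p, κ p p = c) (i j : Fin N) :
    ∑ p : Fin m, ∑ q : Fin m, κ p q • (evalAct P S i (AffineSl.unit 0 p q) *
      evalAct P S j (AffineSl.unit 0 q p)) = pairSum S κ i j - (c / m) • 1 := by
  have h1 : ∀ p q : Fin m, κ p q • (evalAct P S i (AffineSl.unit 0 p q) *
      evalAct P S j (AffineSl.unit 0 q p)) =
      κ p q • (slotIn S i (Matrix.single p q 1) * slotIn S j (Matrix.single q p 1)) +
      if p = q then ((c / m ^ 2) • (1 : Module.End ℂ E) - (c / m) • slotIn S i (Matrix.single p p 1)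
        - (c / m) • slotIn S j (Matrix.single p p 1)) else 0 := by
    intro p q
    rw [evalAct_unit_zero, evalAct_unit_zero, slotIn_slUnit, slotIn_slUnit]
    split_ifs with h1 h2 h2
    · subst h1
      rw [hκ, sub_mul, mul_sub, mul_sub, smul_mul_assoc, smul_mul_assoc, mul_smul_comm,
        one_mul, mul_one, one_mul]
      module
    · exact absurd h1.symm h2
    · exact absurd h2.symm h1
    · rw [sub_zero, sub_zero, add_zero]
  have h2 : ∀ k : Fin N, ∑ p : Fin m, slotIn S k (Matrix.single p p 1) = 1 := fun k => by
    rw [← map_sum, Matrix.sum_single_one, map_one]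
  simp only [h1, Finset.sum_add_distrib, Finset.sum_ite_eq, Finset.mem_univ, if_true,
    Finset.sum_sub_distrib, ← Finset.smul_sum, h2]
  rw [Finset.sum_const, Finset.card_univ, Fintype.card_fin, ← Nat.cast_smul_eq_nsmul ℂ, smul_smul,
    ← pairSum]
  rcases Nat.eq_zero_or_pos m with rfl | hm
  · simp
  · have hm' : (m : ℂ) ≠ 0 := Nat.cast_ne_zero.mpr hm.ne'
    rw [show c / (m : ℂ) ^ 2 * m = c / m by field_simp]
    module

theorem rBarOp_evalAct (i j : Fin N) : rBarOp (evalAct P S i) (evalAct P S j) =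
    S (rSlot i j) - (1 / (2 * m) : ℂ) • 1 := by
  rw [rBarOp_eq, sum_unit_evalAct P S rCoeff (1 / 2) rCoeff_self, map_rSlot, div_div]

theorem casimirOp_evalAct {i j : Fin N} (hij : i ≠ j) :
    casimirOp 0 (evalAct P S i) (evalAct P S j) =
      S (permHom (Equiv.swap i j)) - (1 / m : ℂ) • 1 := by
  rw [map_permHom_swap S hij, ← sum_unit_evalAct P S (fun _ _ => 1) 1 fun _ => rfl]
  simp only [one_smul, casimirOp, neg_zero]

end PairOperators

/-! ### Comparison with the Dunkl operators written with rational functions -/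

section Rational

variable {N m : ℕ} {A B : Type} [AddCommGroup A] [Module ℂ A] [AddCommGroup B] [Module ℂ B]

theorem toRat_smul (a : MultiLaurent N) (v : BigSpace N m A B) :
    toRat N m A B (a • v) = algebraMap (MultiLaurent N) (RatFun N) a • toRat N m A B v := by
  induction v using TensorProduct.induction_on with
  | zero => rw [smul_zero, map_zero, smul_zero]
  | add v w hv hw => rw [smul_add, map_add, hv, hw, map_add, smul_add]
  | tmul p x =>
    change (algebraMap (MultiLaurent N) (RatFun N) (a * p)) ⊗ₜ[ℂ] x =
      (algebraMap (MultiLaurent N) (RatFun N) a * algebraMap (MultiLaurent N) (RatFun N) p) ⊗ₜ[ℂ] x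
    rw [map_mul]

/-- Vector spaces are flat. Consequently the Laurent representative of a Dunkl operator, whose
existence is part of `IsHeckeAction`, is unique. -/
theorem toRat_injective : Function.Injective (toRat N m A B) :=
  Module.Flat.rTensor_preserves_injective_linearMap _
    (IsFractionRing.injective (MultiLaurent N) (RatFun N))

/-- `z_j / z_i`. -/
def ratQ (i j : Fin N) : RatFun N := algebraMap (MultiLaurent N) (RatFun N) (ratio i j)

theorem zVar_ne_zero (i : Fin N) : zVar i ≠ 0 := by
  intro h
  have h1 : algebraMap (MultiLaurent N) (RatFun N) (zPow i 1 * zPow i (-1)) = 0 := by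
    rw [map_mul, show algebraMap (MultiLaurent N) (RatFun N) (zPow i 1) = zVar i from rfl, h,
      zero_mul]
  rw [← zPow_add, add_neg_cancel, zPow_zero, map_one] at h1
  exact one_ne_zero h1

theorem zVar_div (i j : Fin N) : zVar j / zVar i = ratQ i j := by
  rw [div_eq_iff (zVar_ne_zero i), ratQ, zVar, zVar, ← map_mul]
  congr 1
  have h := ratio_mul_zPow i j 0
  rw [zero_add, zPow_zero, one_mul] at h
  exact h.symm

theorem ratQ_mul (i j : Fin N) : ratQ i j * ratQ j i = 1 := by
  rw [ratQ, ratQ, ← map_mul, ratio_mul_ratio, map_one]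

theorem one_sub_ratQ_ne_zero {i j : Fin N} (hij : i ≠ j) : 1 - ratQ i j ≠ 0 := by
  rw [ratQ, ← map_one (algebraMap (MultiLaurent N) (RatFun N)), ← map_sub, Ne,
    map_eq_zero_iff _ (IsFractionRing.injective (MultiLaurent N) (RatFun N))]
  exact one_sub_ratio_ne_zero hij

theorem toRat_divDiff {i j : Fin N} (hij : i ≠ j) (v : BigSpace N m A B) :
    toRat N m A B (polyOp N m A B (divDiff i j) v) = (1 - ratQ i j)⁻¹ •
      (toRat N m A B v - toRat N m A B (polyOp N m A B (permPoly (Equiv.swap i j)).toLinearMap v)) := by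
  rw [eq_inv_smul_iff₀ (one_sub_ratQ_ne_zero hij), ← map_sub, ratQ,
    ← map_one (algebraMap (MultiLaurent N) (RatFun N)), ← map_sub, ← toRat_smul]
  congr 1
  rw [← polyOp_mulP]
  have h : mulP (1 - ratio i j) * divDiff i j = 1 - (permPoly (Equiv.swap i j)).toLinearMap :=
    LinearMap.ext fun f => one_sub_ratio_mul_divDiff hij f
  have h1 : polyOp N m A B (mulP (1 - ratio i j)) * polyOp N m A B (divDiff i j) =
      1 - polyOp N m A B (permPoly (Equiv.swap i j)).toLinearMap := by
    rw [← map_mul, h, map_sub, map_one]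
  exact LinearMap.congr_fun h1 v

/-- The logarithmic derivative. -/
def logDer (ξ : Fin N → ℂ) (a : MultiLaurent N) : RatFun N :=
  algebraMap (MultiLaurent N) (RatFun N) (partialXi ξ a) / algebraMap (MultiLaurent N) (RatFun N) a

theorem partialXi_one (ξ : Fin N → ℂ) : partialXi ξ (1 : MultiLaurent N) = 0 := by
  have h := partialXi_mul ξ 1 1
  rw [mul_one, mul_one, one_mul] at h
  exact left_eq_add.mp h

theorem logDer_prod {ι : Type} (ξ : Fin N → ℂ) (s : Finset ι) (a : ι → MultiLaurent N)
    (ha : ∀ i ∈ s, a i ≠ 0) : logDer ξ (∏ i ∈ s, a i) = ∑ i ∈ s, logDer ξ (a i) := by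
  classical
  induction s using Finset.induction_on with
  | empty => rw [Finset.prod_empty, Finset.sum_empty, logDer, partialXi_one, map_zero, zero_div]
  | insert k s hk ih =>
    have h1 : ∀ i ∈ s, a i ≠ 0 := fun i hi => ha i (Finset.mem_insert_of_mem hi)
    have inj := IsFractionRing.injective (MultiLaurent N) (RatFun N)
    have h2 : algebraMap (MultiLaurent N) (RatFun N) (a k) ≠ 0 :=
      (map_ne_zero_iff _ inj).mpr (ha k (Finset.mem_insert_self k s))
    have h3 : algebraMap (MultiLaurent N) (RatFun N) (∏ i ∈ s, a i) ≠ 0 :=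
      (map_ne_zero_iff _ inj).mpr (Finset.prod_ne_zero_iff.mpr h1)
    rw [Finset.prod_insert hk, Finset.sum_insert hk, ← ih h1, logDer, logDer, logDer,
      partialXi_mul, map_add, map_mul, map_mul, map_mul]
    field_simp

theorem partialXi_ratio (ξ : Fin N → ℂ) (i j : Fin N) :
    partialXi ξ (ratio i j) = (ξ j - ξ i) • ratio i j := by
  rw [ratio, partialXi_expMon]
  congr 1
  simp [sub_mul, Finset.sum_sub_distrib, Pi.single_apply]

theorem logDer_one_sub_ratio (ξ : Fin N → ℂ) (i j : Fin N) :
    logDer ξ (1 - ratio i j) = algebraMap ℂ (RatFun N) (ξ i - ξ j) * (ratQ i j / (1 - ratQ i j)) := by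
  rw [logDer, map_sub (partialXi ξ), partialXi_one, partialXi_ratio, Algebra.smul_def, zero_sub,
    map_neg, map_mul, ← IsScalarTower.algebraMap_apply, ← ratQ, map_sub, map_sub, map_sub, map_one,
    ← ratQ]
  ring

/-- The two factors of `G` attached to a pair combine, with `x = z_j / z_i`, to `(1 + x)/(1 - x) =
2/(1 - x) - 1`. -/
theorem logDer_bigG (ξ : Fin N → ℂ) : logDer ξ (bigG N) = ∑ i : Fin N, ∑ j : Fin N, if i < j then
    (ξ i - ξ j) • (2 * (1 - ratQ i j)⁻¹ - 1) else 0 := by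
  have h1 : ∀ i j : Fin N, (if i = j then (1 : MultiLaurent N) else
      1 - expMon (Pi.single j 1 - Pi.single i 1)) ≠ 0 := by
    intro i j
    split_ifs with h
    · exact one_ne_zero
    · exact one_sub_ratio_ne_zero h
  rw [bigG, logDer_prod _ _ _ fun i _ => Finset.prod_ne_zero_iff.mpr fun j _ => h1 i j,
    Finset.sum_congr rfl fun i _ => logDer_prod _ _ _ fun j _ => h1 i j]
  refine (sum_sum_eq_sum_lt _ ?_).trans ?_
  · intro i
    rw [if_pos rfl, logDer, partialXi_one, map_zero, zero_div]
  · refine Finset.sum_congr rfl fun i _ => Finset.sum_congr rfl fun j _ => ?_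
    split_ifs with h2 h3 h4 h4
    · exact absurd h3 h2.ne
    · exact absurd h3 h2.ne
    · exact absurd h4.symm h3
    · have e1 := logDer_one_sub_ratio ξ i j
      have e2 := logDer_one_sub_ratio ξ j i
      rw [ratio] at e1 e2
      rw [e1, e2, Algebra.smul_def]
      have h5 := one_sub_ratQ_ne_zero h3
      have h6 := one_sub_ratQ_ne_zero h4
      have h7 := ratQ_mul i j
      have h8 : ratQ j i / (1 - ratQ j i) = -(1 - ratQ i j)⁻¹ := by
        rw [div_eq_iff h6, neg_mul, inv_mul_eq_div, ← neg_div, eq_div_iff h5]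
        linear_combination -h7
      have h9 : ratQ i j / (1 - ratQ i j) = (1 - ratQ i j)⁻¹ - 1 := by
        field_simp
        ring
      rw [h8, h9]
      simp only [map_sub]
      ring
    · rfl

/-- The scalar bookkeeping behind `toRat_exchange`: here `x₄` is the vector, `x₁`, `x₂`, `x₃` are
its images under the constant `r`-matrix, the flip and the simultaneous permutation, and `r` stands
for `1/(1 - z_j/z_i)`. The coefficient `(M - 1)/(2M)` is the one that makes the multiples of `x₄`
cancel. -/
theorem exchange_identity {K V : Type} [Field K] [CharZero K] [AddCommGroup V] [Module K V] {M : K}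
    (hM : M ≠ 0) (r : K) (x₁ x₂ x₃ x₄ : V) :
    x₁ - r • (x₂ - x₃) = x₁ - (1 / (2 * M)) • x₄ + (-r) • (x₂ - (1 / M) • x₄) - r • (x₄ - x₃) +
      (1 / 2 : K) • x₄ + ((M - 1) / (2 * M)) • ((2 * r - 1) • x₄) := by
  match_scalars <;> field_simp <;> ring

/-- The contribution of a pair of factors to the Dunkl operators. -/
theorem toRat_exchange {i j : Fin N} (hij : i ≠ j) (hm : (m : ℂ) ≠ 0) (v : BigSpace N m A B) :
    toRat N m A B (exchange (R := Module.End ℂ (BigSpace N m A B)) (polyOp N m A B)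
      (tensOp N m A B) i j v) =
      rRatOp m i j v - (1 - ratQ i j)⁻¹ • toRat N m A B (v - tau m A B (Equiv.swap i j) v) +
      (1 / 2 : ℂ) • toRat N m A B v +
      (((m : ℂ) - 1) / (2 * m)) • ((2 * (1 - ratQ i j)⁻¹ - 1) • toRat N m A B v) := by
  have e1 : rBarOp (theta (m := m) A B i) (theta A B j) v =
      tensOp N m A B (rSlot i j) v - (1 / (2 * m) : ℂ) • v := by
    have h := rBarOp_evalAct (polyOp N m A B) (tensOp N m A B) i j
    simp only [rBarOp, evalAct_eq_theta] at h ⊢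
    rw [h]
    rfl
  have e2 : casimirOp 0 (theta (m := m) A B i) (theta A B j) v =
      tensOp N m A B (permHom (Equiv.swap i j)) v - (1 / m : ℂ) • v := by
    have h := casimirOp_evalAct (polyOp N m A B) (tensOp N m A B) hij
    simp only [casimirOp, evalAct_eq_theta] at h ⊢
    rw [h]
    rfl
  have e3 : exchange (R := Module.End ℂ (BigSpace N m A B)) (polyOp N m A B)
      (tensOp N m A B) i j v = tensOp N m A B (rSlot i j) v -
      polyOp N m A B (divDiff i j) (tensOp N m A B (permHom (Equiv.swap i j)) v) := rfl
  have e4 : polyOp N m A B (permPoly (Equiv.swap i j)).toLinearMap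
      (tensOp N m A B (permHom (Equiv.swap i j)) v) = tau m A B (Equiv.swap i j) v := by
    rw [← tauOp_eq_tau]
    rfl
  have e5 : (zVar i / zVar j) / (1 - zVar i / zVar j) = -(1 - ratQ i j)⁻¹ := by
    rw [zVar_div]
    have h5 := one_sub_ratQ_ne_zero hij
    have h6 := one_sub_ratQ_ne_zero hij.symm
    rw [div_eq_iff h6, neg_mul, inv_mul_eq_div, ← neg_div, eq_div_iff h5]
    linear_combination -ratQ_mul i j
  rw [rRatOp, e1, e2, e3, e5, map_sub, toRat_divDiff hij, e4]
  simp only [map_sub, map_smul]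
  generalize toRat N m A B (tensOp N m A B (rSlot i j) v) = x1
  generalize toRat N m A B (tensOp N m A B (permHom (Equiv.swap i j)) v) = x2
  generalize toRat N m A B (tau m A B (Equiv.swap i j) v) = x3
  generalize toRat N m A B v = x4
  generalize (1 - ratQ i j)⁻¹ = r
  have hc : ∀ (c : ℂ) (x : BigSpaceRat N m A B), c • x = (algebraMap ℂ (RatFun N) c) • x :=
    fun c x => (algebraMap_smul (RatFun N) c x).symm
  have h1 : (algebraMap ℂ (RatFun N) m) ≠ 0 := (map_ne_zero_iff _ (algebraMap ℂ (RatFun N)).injective).mpr hm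
  simp only [hc, map_div₀, map_sub, map_one, map_mul, map_ofNat]
  generalize algebraMap ℂ (RatFun N) m = M at h1
  have : CharZero (RatFun N) :=
    charZero_of_injective_algebraMap (algebraMap ℂ (RatFun N)).injective
  exact exchange_identity h1 r x1 x2 x3 x4

end Rational

/-- For `i < j` the permutation term turns `-exch j i` into `exch i j` by `exchange_add`, so both
places contribute multiples of the same operator. -/
theorem KZData.dXi_eq {N m : ℕ} {ℓ : ℂ} {E : Type} [AddCommGroup E] [Module ℂ E]
    (D : KZData N m ℓ E) (ξ : Fin N → ℂ) : D.dXi ξ = ∑ i, ξ i • D.zOp i +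
      ∑ i : Fin N, ∑ j : Fin N, if i < j then (ξ j - ξ i) • D.exch i j else 0 := by
  have h1 : ∀ i, ξ i • D.dOp i = ξ i • D.zOp i + ∑ j : Fin N, if i = j then 0 else
      ξ i • (-D.exch i j + if j < i then D.perm (Equiv.swap i j) else 0) := by
    intro i
    have e : ∀ F : Fin N → Module.End ℂ E, ∑ j, F j = F i + ∑ j ∈ Finset.univ.erase i, F j :=
      fun F => (Finset.add_sum_erase _ F (Finset.mem_univ i)).symm
    rw [KZData.dOp, KZData.eOp, sub_add, smul_sub, sub_eq_add_neg, ← smul_neg, neg_sub, e, e,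
      if_neg (lt_irrefl i), if_pos rfl, zero_add, zero_add, ← Finset.sum_sub_distrib,
      Finset.smul_sum]
    congr 1
    refine Finset.sum_congr rfl fun j hj => ?_
    rw [if_neg (Finset.ne_of_mem_erase hj).symm, neg_add_eq_sub]
  rw [KZData.dXi_apply, Finset.sum_congr rfl fun i _ => h1 i, Finset.sum_add_distrib]
  congr 1
  refine (sum_sum_eq_sum_lt _ ?_).trans ?_
  · exact fun i => if_pos rfl
  refine Finset.sum_congr rfl fun i _ => Finset.sum_congr rfl fun j _ => ?_
  by_cases h2 : i < j
  · rw [if_pos h2, if_pos h2, if_neg h2.ne, if_neg h2.ne', if_neg h2.not_gt, if_pos h2,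
      Equiv.swap_comm j i, show D.perm (Equiv.swap i j) = D.exch i j + D.exch j i from
        (exchange_add D.P D.S h2.ne).symm]
    module
  · rw [if_neg h2, if_neg h2]

/-- Each `r_(ij)` with `i < j` occurs positively in `∇_j` and negatively in `∇_i`, whence the
coefficient `ξ_j - ξ_i`. -/
theorem sum_nabla {N : ℕ} {V : Type} [AddCommGroup V] [Module ℂ V] (ξ : Fin N → ℂ)
    (a : Fin N → V) (b c : Fin N → V) (r : Fin N → Fin N → V) :
    ∑ i, ξ i • (a i + (∑ j : Fin N, if j < i then r j i else 0) -
      (∑ j : Fin N, if i < j then r i j else 0) - b i + c i) =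
    ∑ i, ξ i • (a i - b i + c i) +
      ∑ i : Fin N, ∑ j : Fin N, if i < j then (ξ j - ξ i) • r i j else 0 := by
  have h1 : ∀ i, ξ i • (a i + (∑ j : Fin N, if j < i then r j i else 0) -
      (∑ j : Fin N, if i < j then r i j else 0) - b i + c i) = ξ i • (a i - b i + c i) +
      ((∑ j : Fin N, if j < i then ξ i • r j i else 0) -
        ∑ j : Fin N, if i < j then ξ i • r i j else 0) := by
    intro i
    simp only [← smul_ite_zero, ← Finset.smul_sum]
    module
  have h2 : ∀ i j : Fin N, (if i < j then (ξ j - ξ i) • r i j else 0) =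
      (if i < j then ξ j • r i j else 0) - if i < j then ξ i • r i j else 0 := by
    intro i j
    split_ifs
    · rw [sub_smul]
    · rw [sub_zero]
  rw [Finset.sum_congr rfl fun i _ => h1 i, Finset.sum_add_distrib, Finset.sum_sub_distrib,
    Finset.sum_comm (f := fun i j => if j < i then ξ i • r j i else 0), ← Finset.sum_sub_distrib]
  congr 1
  refine Finset.sum_congr rfl fun i _ => ?_
  rw [← Finset.sum_sub_distrib]
  exact Finset.sum_congr rfl fun j _ => (h2 i j).symm

section

variable {N m : ℕ} {A B : Type} [AddCommGroup A] [Module ℂ A] [AddCommGroup B] [Module ℂ B]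
  [LieRingModule (AffineSl m) A] [LieModule ℂ (AffineSl m) A]
  [LieRingModule (AffineSl m) B] [LieModule ℂ (AffineSl m) B]
  {ℓ : ℂ} (hA : ∀ a : A, ⁅(AffineSl.central : AffineSl m), a⁆ = ℓ • a)
  (hB : ∀ b : B, ⁅(AffineSl.central : AffineSl m), b⁆ = -(ℓ • b))
  (sA : ∀ a : A, ∃ K : ℕ, ∀ k : ℤ, K ≤ k → ∀ X : 𝔰 m, ⁅AffineSl.tmul k X, a⁆ = 0)
  (sB : ∀ b : B, ∃ K : ℕ, ∀ k : ℤ, k ≤ -K → ∀ X : 𝔰 m, ⁅AffineSl.tmul k X, b⁆ = 0)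

theorem kzData_zOp (i : Fin N) (v : BigSpace N m A B) :
    (kzData N ℓ A B hA hB sA sB).zOp i v = rUnivOp (thetaA (m := m) N A B) (theta A B i) v -
      rUnivOp (theta (m := m) A B i) (thetaB N A B) v + theta A B i (rhoCheck m) v := by
  have h1 : (⇑((kzData N ℓ A B hA hB sA sB).ev i) : AffineSl m → _) = theta A B i :=
    funext fun y => evalAct_eq_theta i y
  rw [← h1]
  rfl

/-- The operators `dXi` are the Dunkl operators. -/
theorem toRat_dXi (hm : (m : ℂ) ≠ 0) (ξ : Fin N → ℂ) (v : BigSpace N m A B) :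
    toRat N m A B ((kzData N ℓ A B hA hB sA sB).dXi ξ v) = dunkl m ξ v := by
  have hG : (algebraMap (MultiLaurent N) (RatFun N) (partialXi ξ (bigG N)) /
      algebraMap (MultiLaurent N) (RatFun N) (bigG N)) = _ := logDer_bigG ξ
  rw [dunkl, hG]
  simp only [nabla]
  rw [sum_nabla, KZData.dXi_eq, LinearMap.add_apply, map_add, LinearMap.sum_apply, map_sum,
    LinearMap.sum_apply, map_sum, add_sub_assoc, add_sub_assoc, add_assoc]
  congr 1
  · refine Finset.sum_congr rfl fun i _ => ?_
    rw [LinearMap.smul_apply, map_smul, kzData_zOp, map_add, map_sub]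
  · rw [Finset.mul_sum, Finset.sum_smul, Finset.sum_smul, Finset.smul_sum,
      ← Finset.sum_sub_distrib, ← Finset.sum_sub_distrib, ← Finset.sum_add_distrib]
    refine Finset.sum_congr rfl fun i _ => ?_
    rw [LinearMap.sum_apply, map_sum, Finset.mul_sum, Finset.sum_smul, Finset.sum_smul,
      Finset.smul_sum, ← Finset.sum_sub_distrib, ← Finset.sum_sub_distrib, ← Finset.sum_add_distrib]
    refine Finset.sum_congr rfl fun j _ => ?_
    split_ifs with hij
    · have h := toRat_exchange (A := A) (B := B) hij.ne hm v
      have h2 : toRat N m A B ((kzData N ℓ A B hA hB sA sB).exch i j v) = _ := h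
      rw [LinearMap.smul_apply, map_smul, h2, zVar_div, smul_assoc (ξ i - ξ j)]
      generalize (1 - ratQ i j)⁻¹ • toRat N m A B (v - tau m A B (Equiv.swap i j) v) = x₁
      generalize (2 * (1 - ratQ i j)⁻¹ - 1) • toRat N m A B v = x₂
      module
    · simp

end

/-! ### Enveloping algebras without PBW -/

section Enveloping

open UniversalEnvelopingAlgebra

attribute [local instance 100] LieRing.ofAssociativeRing LieAlgebra.ofAssociativeAlgebra

variable {L : Type} [LieRing L] [LieAlgebra ℂ L]

theorem uea_ι_lie (x y : L) : ι ℂ ⁅x, y⁆ = ι ℂ x * ι ℂ y - ι ℂ y * ι ℂ x := by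
  rw [LieHom.map_lie, LieRing.of_associative_ring_bracket]

theorem uea_exists_lift {R : Type} [Ring R] [Algebra ℂ R] (f : L →ₗ[ℂ] R)
    (hf : ∀ x y, f ⁅x, y⁆ = f x * f y - f y * f x) :
    ∃ F : UniversalEnvelopingAlgebra ℂ L →ₐ[ℂ] R, ∀ x, F (ι ℂ x) = f x :=
  ⟨lift ℂ { f with map_lie' := fun {x y} => hf x y }, fun x => lift_ι_apply ℂ _ x⟩

/-- The universal property lifts the inclusion of generators to a map into `T`; composed with `T ↪
U` it is the identity on generators, hence everywhere. -/
theorem uea_subalgebra_eq_top (T : Subalgebra ℂ (UniversalEnvelopingAlgebra ℂ L))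
    (hT : ∀ x : L, ι ℂ x ∈ T) (u : UniversalEnvelopingAlgebra ℂ L) : u ∈ T := by
  let f : L →ₗ[ℂ] T := (ι ℂ : L →ₗ⁅ℂ⁆ UniversalEnvelopingAlgebra ℂ L).toLinearMap.codRestrict
    (Subalgebra.toSubmodule T) hT
  obtain ⟨F, hF⟩ := uea_exists_lift f fun x y => Subtype.ext (uea_ι_lie x y)
  have h : T.val.comp F = AlgHom.id ℂ _ := by
    apply UniversalEnvelopingAlgebra.hom_ext
    ext x
    change (F (ι ℂ x)).val = ι ℂ x
    rw [hF]
    rfl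
  have h1 : T.val (F u) = u := AlgHom.congr_fun h u
  rw [← h1]
  exact (F u).property

/-- The elements whose left multiplication preserves `S` form a subalgebra containing the
generators. -/
theorem uea_induction (S : Submodule ℂ (UniversalEnvelopingAlgebra ℂ L)) (h1 : 1 ∈ S)
    (h : ∀ x, ∀ u ∈ S, ι ℂ x * u ∈ S) (u : UniversalEnvelopingAlgebra ℂ L) : u ∈ S := by
  let T : Subalgebra ℂ (UniversalEnvelopingAlgebra ℂ L) :=
    { carrier := {u | ∀ s ∈ S, u * s ∈ S}
      mul_mem' := fun ha hb s hs => by rw [mul_assoc]; exact ha _ (hb _ hs)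
      add_mem' := fun ha hb s hs => by rw [add_mul]; exact S.add_mem (ha _ hs) (hb _ hs)
      algebraMap_mem' := fun c s hs => by rw [← Algebra.smul_def]; exact S.smul_mem c hs }
  have h2 := uea_subalgebra_eq_top T h u 1 h1
  rwa [mul_one] at h2

variable (n : LieSubalgebra ℂ L) (π : L →ₗ[ℂ] n) (χ : L →ₗ[ℂ] ℂ)

/-- The action of `n` on the linear maps from `L` to the enveloping algebra of `n`. -/
def nilAct : n →ₗ[ℂ] Module.End ℂ (L →ₗ[ℂ] UniversalEnvelopingAlgebra ℂ n) :=
  LinearMap.mk₂ ℂ (fun x F => LinearMap.mulLeft ℂ (ι ℂ x) ∘ₗ F -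
      F ∘ₗ (LinearMap.mk₂ ℂ (fun a b : L => ⁅a, b⁆) add_lie smul_lie lie_add lie_smul (x : L)))
    (fun x x' F => by
      ext y
      simp [add_mul]
      abel)
    (fun c x F => by
      ext y
      simp [smul_sub])
    (fun x F F' => by
      ext y
      simp [mul_add]
      abel)
    (fun c x F => by
      ext y
      simp [smul_sub])

theorem nilAct_apply (x : n) (F : L →ₗ[ℂ] UniversalEnvelopingAlgebra ℂ n) (y : L) :
    nilAct n x F y = ι ℂ x * F y - F ⁅(x : L), y⁆ := rfl

theorem nilAct_lie (x x' : n) : nilAct n ⁅x, x'⁆ = nilAct n x * nilAct n x' -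
    nilAct n x' * nilAct n x := by
  ext F y
  rw [LinearMap.sub_apply, LinearMap.sub_apply, Module.End.mul_apply, Module.End.mul_apply]
  simp only [nilAct_apply]
  rw [uea_ι_lie, LieSubalgebra.coe_bracket, lie_lie, map_sub]
  noncomm_ring

/-- The enveloping algebra of a subalgebra `n` with a complementary subalgebra acted on by a
character of the latter is a module over the whole Lie algebra. -/
theorem exists_induced_action (hπ : ∀ x : n, π x = x)
    (hb : ∀ y z, π y = 0 → π z = 0 → π ⁅y, z⁆ = 0) (hχn : ∀ x : n, χ x = 0)
    (hχ : ∀ y z, π y = 0 → π z = 0 → χ ⁅y, z⁆ = 0) :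
    ∃ act : L →ₗ[ℂ] Module.End ℂ (UniversalEnvelopingAlgebra ℂ n),
      (∀ y z, act ⁅y, z⁆ = act y * act z - act z * act y) ∧
      (∀ y, act y 1 = ι ℂ (π y) + χ y • 1) ∧ ∀ (x : n) u, act x u = ι ℂ x * u := by
  -- The action must satisfy `y·(x u) = x (y·u) - [x, y]·u` for `x` in `n`. Read as a recursion for
  -- the function `y ↦ y·u`, this is the action `nilAct` of `x`; the universal property of `U(n)`
  -- makes the recursion well defined, starting from `f₀ y = y·1`.
  obtain ⟨Λ, hΛ⟩ := uea_exists_lift (nilAct n) (nilAct_lie n)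
  let f₀ : L →ₗ[ℂ] UniversalEnvelopingAlgebra ℂ n :=
    (ι ℂ : n →ₗ⁅ℂ⁆ UniversalEnvelopingAlgebra ℂ n).toLinearMap ∘ₗ π + χ.smulRight 1
  let act : L →ₗ[ℂ] Module.End ℂ (UniversalEnvelopingAlgebra ℂ n) :=
    (LinearMap.flip ((LinearMap.applyₗ f₀) ∘ₗ Λ.toLinearMap :
      UniversalEnvelopingAlgebra ℂ n →ₗ[ℂ] L →ₗ[ℂ] UniversalEnvelopingAlgebra ℂ n))
  have a0 : ∀ y u, act y u = Λ u f₀ y := fun y u => rfl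
  have a1 : ∀ y, act y 1 = ι ℂ (π y) + χ y • 1 := fun y => by
    rw [a0, map_one]
    rfl
  have a2 : ∀ y (x : n) u, act y (ι ℂ x * u) = ι ℂ x * act y u - act ⁅(x : L), y⁆ u := by
    intro y x u
    rw [a0, map_mul, hΛ]
    rfl
  have a3 : ∀ (u) (x : n), act x u = ι ℂ x * u := by
    intro u
    let S : Submodule ℂ (UniversalEnvelopingAlgebra ℂ n) :=
      { carrier := {u | ∀ x : n, act x u = ι ℂ x * u}
        add_mem' := fun ha hb x => by rw [map_add, ha x, hb x, mul_add]
        zero_mem' := fun x => by rw [map_zero, mul_zero]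
        smul_mem' := fun c a ha x => by rw [map_smul, ha x, mul_smul_comm] }
    refine uea_induction S (fun x => ?_) (fun x' u hu x => ?_) u
    · rw [a1, hπ, hχn, zero_smul, add_zero, mul_one]
    · rw [a2, hu x, ← LieSubalgebra.coe_bracket, hu, uea_ι_lie]
      noncomm_ring
  have a4 : ∀ (u) (y z : L), act ⁅y, z⁆ u = act y (act z u) - act z (act y u) := by
    intro u
    let S : Submodule ℂ (UniversalEnvelopingAlgebra ℂ n) :=
      { carrier := {u | ∀ y z : L, act ⁅y, z⁆ u = act y (act z u) - act z (act y u)}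
        add_mem' := fun ha hb y z => by
          simp only [map_add, ha y z, hb y z]
          abel
        zero_mem' := fun y z => by simp only [map_zero, sub_zero]
        smul_mem' := fun c a ha y z => by simp only [map_smul, ha y z, smul_sub] }
    refine uea_induction S (fun y z => ?_) (fun x u hu y z => ?_) u
    · have e1 : ∀ y (x : n), act y (ι ℂ x) = ι ℂ x * act y 1 - act ⁅(x : L), y⁆ 1 := by
        intro y x
        have h := a2 y x 1
        rwa [mul_one] at h
      have e2 : ∀ y z, π y = 0 → π z = 0 → act ⁅y, z⁆ 1 = 0 := by
        intro y z hy hz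
        rw [a1, hb y z hy hz, hχ y z hy hz, map_zero, zero_smul, add_zero]
      -- The complement annihilates `1` up to the character `χ`, and `π` and `χ` vanish on its
      -- brackets. Expanding this for the complementary parts of `y` and `z` gives the base case of
      -- the bracket relation.
      have hk : ∀ y, π (y - (π y : L)) = 0 := fun y => by rw [map_sub, hπ, sub_self]
      have e3 := e2 _ _ (hk y) (hk z)
      rw [sub_lie, lie_sub, lie_sub, map_sub, map_sub, map_sub, LinearMap.sub_apply,
        LinearMap.sub_apply, LinearMap.sub_apply, ← LieSubalgebra.coe_bracket, a3 1 ⁅π y, π z⁆,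
        uea_ι_lie, mul_one] at e3
      have e4 : act ⁅y, z⁆ 1 = act ⁅y, (π z : L)⁆ 1 + act ⁅(π y : L), z⁆ 1 -
          (ι ℂ (π y) * ι ℂ (π z) - ι ℂ (π z) * ι ℂ (π y)) := by
        rw [← sub_eq_zero, ← e3]
        abel
      have e5 : act ⁅y, (π z : L)⁆ 1 = -act ⁅(π z : L), y⁆ 1 := by
        rw [← lie_skew, map_neg, LinearMap.neg_apply]
      rw [e4, e5, a1 z, a1 y, map_add, map_add, map_smul, map_smul, e1, e1, a1 y, a1 z]
      simp only [mul_add, mul_smul_comm, mul_one]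
      module
    -- The inductive step is the Jacobi identity, with the hypothesis on `u` applied to the pairs
    -- `(y, z)`, `([x, y], z)` and `(y, [x, z])`.
    · have e1 : ∀ y z : L, act ⁅y, z⁆ (ι ℂ x * u) = ι ℂ x * act ⁅y, z⁆ u -
          (act ⁅⁅(x : L), y⁆, z⁆ u + act ⁅y, ⁅(x : L), z⁆⁆ u) := by
        intro y z
        rw [a2, leibniz_lie, map_add, LinearMap.add_apply]
      have e2 : ∀ y z, act y (act z (ι ℂ x * u)) = ι ℂ x * act y (act z u) - act ⁅(x : L), y⁆ (act z u) -
          act y (act ⁅(x : L), z⁆ u) := by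
        intro y z
        rw [a2, map_sub, a2]
      rw [e1, e2, e2, hu y z, hu ⁅(x : L), y⁆ z, hu y ⁅(x : L), z⁆, mul_sub]
      abel
  exact ⟨act, fun y z => LinearMap.ext fun u => a4 u y z, a1, fun x u => a3 u x⟩

end Enveloping

/-! ### Generation and universal property of Verma modules -/

namespace VermaModule

variable {m : ℕ} {n : Submodule ℂ (AffineSl m)} {χ : Weight m}

theorem smul_vac_surjective (v : VermaModule n χ) : ∃ u : UAffine m, u • vac n χ = v := by
  obtain ⟨u, rfl⟩ := (vermaIdeal n χ).mkQ_surjective v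
  refine ⟨u, ?_⟩
  change u • (vermaIdeal n χ).mkQ 1 = _
  rw [← map_smul, smul_eq_mul, mul_one]

/-- A Verma module is generated by its vacuum vector. -/
theorem induction (S : Submodule ℂ (VermaModule n χ)) (h1 : vac n χ ∈ S)
    (h : ∀ y : AffineSl m, ∀ v ∈ S, ⁅y, v⁆ ∈ S) (v : VermaModule n χ) : v ∈ S := by
  obtain ⟨u, rfl⟩ := smul_vac_surjective v
  let f : UAffine m →ₗ[ℂ] VermaModule n χ :=
    { toFun := fun u => u • vac n χ
      map_add' := fun a b => add_smul a b _
      map_smul' := fun c a => smul_assoc c a _ }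
  refine uea_induction (S.comap f) ?_ (fun x u hu => ?_) u
  · change (1 : UAffine m) • vac n χ ∈ S
    rwa [one_smul]
  · change (UniversalEnvelopingAlgebra.ι ℂ x * u) • vac n χ ∈ S
    rw [mul_smul]
    exact h x _ hu

theorem lie_vac_of_mem {y : AffineSl m} (hy : y ∈ n) : ⁅y, vac n χ⁆ = 0 := by
  change UniversalEnvelopingAlgebra.ι ℂ y • (vermaIdeal n χ).mkQ 1 = 0
  rw [← map_smul, smul_eq_mul, mul_one]
  exact (Submodule.Quotient.mk_eq_zero _).mpr (Submodule.subset_span (Or.inl ⟨y, hy, rfl⟩))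

theorem lie_vac_incl (h : Cartan m) : ⁅h.incl, vac n χ⁆ = χ h • vac n χ := by
  change UniversalEnvelopingAlgebra.ι ℂ h.incl • (vermaIdeal n χ).mkQ 1 =
    χ h • (vermaIdeal n χ).mkQ 1
  rw [← algebraMap_smul (UAffine m) (χ h) ((vermaIdeal n χ).mkQ 1), ← map_smul, ← map_smul,
    smul_eq_mul, smul_eq_mul, mul_one, mul_one, ← sub_eq_zero, ← map_sub]
  exact (Submodule.Quotient.mk_eq_zero _).mpr (Submodule.subset_span (Or.inr ⟨h, rfl⟩))

/-- The universal property of a Verma module. -/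
theorem exists_lift {X : Type} [AddCommGroup X] [Module ℂ X]
    (act : AffineSl m →ₗ[ℂ] Module.End ℂ X)
    (hact : ∀ y z, act ⁅y, z⁆ = act y * act z - act z * act y) (x₀ : X)
    (hn : ∀ y ∈ n, act y x₀ = 0) (hh : ∀ h : Cartan m, act h.incl x₀ = χ h • x₀) :
    ∃ F : VermaModule n χ →ₗ[ℂ] X, F (vac n χ) = x₀ ∧ ∀ y v, F ⁅y, v⁆ = act y (F v) := by
  obtain ⟨Λ, hΛ⟩ := uea_exists_lift act hact
  let I : Submodule (UAffine m) (UAffine m) :=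
    { carrier := {u | Λ u x₀ = 0}
      add_mem' := fun {a b} ha hb => by
        change Λ (a + b) x₀ = 0
        rw [map_add, LinearMap.add_apply, ha, hb, add_zero]
      zero_mem' := by
        change Λ 0 x₀ = 0
        rw [map_zero, LinearMap.zero_apply]
      smul_mem' := fun c a ha => by
        change Λ (c * a) x₀ = 0
        rw [map_mul, Module.End.mul_apply, ha, map_zero] }
  have hI : vermaIdeal n χ ≤ I := by
    rw [vermaIdeal, Submodule.span_le]
    rintro _ (⟨y, hy, rfl⟩ | ⟨h, rfl⟩)
    · change Λ _ x₀ = 0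
      rw [hΛ, hn y hy]
    · change Λ _ x₀ = 0
      rw [map_sub, hΛ, AlgHom.commutes, LinearMap.sub_apply, hh, Module.algebraMap_end_apply,
        sub_self]
  let f : UAffine m →ₗ[ℂ] X := LinearMap.applyₗ x₀ ∘ₗ Λ.toLinearMap
  let F : VermaModule n χ →ₗ[ℂ] X := ((vermaIdeal n χ).restrictScalars ℂ).liftQ f
    (fun u hu => hI hu) ∘ₗ (Submodule.Quotient.restrictScalarsEquiv ℂ (vermaIdeal n χ)).symm.toLinearMap
  have hF : ∀ u : UAffine m, F ((vermaIdeal n χ).mkQ u) = Λ u x₀ := fun u => rfl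
  refine ⟨F, ?_, fun y v => ?_⟩
  · change F ((vermaIdeal n χ).mkQ 1) = x₀
    rw [hF, map_one, Module.End.one_apply]
  · obtain ⟨u, rfl⟩ := (vermaIdeal n χ).mkQ_surjective v
    change F (UniversalEnvelopingAlgebra.ι ℂ y • (vermaIdeal n χ).mkQ u) = _
    rw [← map_smul, hF, hF, smul_eq_mul, map_mul, hΛ, Module.End.mul_apply]

end VermaModule

/-! ### Triangular decomposition by principal degree -/

namespace AffineSl

variable {m : ℕ}

/-- The affine Lie algebra is spanned by the `e_pq ⊗ t^n`, `c` and `d`. -/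
theorem mem_of_units (S : Submodule ℂ (AffineSl m)) (hu : ∀ n p q, unit n p q ∈ S)
    (hc : central ∈ S) (hd : degree ∈ S) (y : AffineSl m) : y ∈ S := by
  have h0 : (y - y.d • degree).d = 0 := by
    rw [sub_eq_add_neg, add_d, ← neg_smul, smul_d]
    simp [degree]
  have h1 : y = (y - y.d • degree) + y.d • degree := by rw [sub_add_cancel]
  rw [h1]
  refine S.add_mem ?_ (S.smul_mem _ hd)
  rw [eq_sum_loopUnit _ h0]
  refine S.add_mem (S.sum_mem fun p _ => S.sum_mem fun q _ => ?_) (S.smul_mem _ hc)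
  generalize (y - y.d • degree).loop.val p q = f
  induction f using AddMonoidAlgebra.induction_linear with
  | zero => rw [loopUnit_zero]; exact S.zero_mem
  | add f g hf hg => rw [loopUnit_add]; exact S.add_mem hf hg
  | single n a => rw [loopUnit_single]; exact S.smul_mem _ (hu n p q)

/-- The principal degree of `e_pq ⊗ t^n`. -/
def deg (n : ℤ) (p q : Fin m) : ℤ := m * n + q.val - p.val

/-- Since `|q - p| < m`, the loop degree is determined by the principal degree once the latter
vanishes. -/
theorem deg_eq_zero {n : ℤ} {p q : Fin m} (h : deg n p q = 0) : n = 0 ∧ p = q := by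
  have h1 := p.isLt
  have h2 := q.isLt
  rw [deg] at h
  have hn : n = 0 := by
    by_contra hn
    rcases lt_or_gt_of_ne hn with h3 | h3 <;> nlinarith
  subst hn
  exact ⟨rfl, Fin.ext (by omega)⟩

theorem deg_pos_of_pos {n : ℤ} (p q : Fin m) (hn : 0 < n) : 0 < deg n p q := by
  have h1 := p.isLt
  rw [deg]
  nlinarith

theorem deg_neg_of_neg {n : ℤ} (p q : Fin m) (hn : n < 0) : deg n p q < 0 := by
  have h1 := q.isLt
  rw [deg]
  nlinarith

/-- The span of the root vectors whose principal degree has the sign `ε`. -/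
def nil (m : ℕ) (ε : ℤ) : Submodule ℂ (AffineSl m) :=
  Submodule.span ℂ {y | ∃ n p q, 0 < ε * deg n p q ∧ y = unit n p q}

/-- The span of `nil m ε` and the Cartan subalgebra. -/
def borel (m : ℕ) (ε : ℤ) : Submodule ℂ (AffineSl m) :=
  Submodule.span ℂ ({y | ∃ n p q, 0 ≤ ε * deg n p q ∧ y = unit n p q} ∪ {central, degree})

theorem unit_mem_nil {ε n : ℤ} {p q : Fin m} (h : 0 < ε * deg n p q) : unit n p q ∈ nil m ε :=
  Submodule.subset_span ⟨n, p, q, h, rfl⟩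

theorem unit_mem_borel {ε n : ℤ} {p q : Fin m} (h : 0 ≤ ε * deg n p q) :
    unit n p q ∈ borel m ε :=
  Submodule.subset_span (Or.inl ⟨n, p, q, h, rfl⟩)

theorem central_mem_borel (ε : ℤ) : central ∈ borel m ε :=
  Submodule.subset_span (Or.inr (Or.inl rfl))

theorem degree_mem_borel (ε : ℤ) : degree ∈ borel m ε :=
  Submodule.subset_span (Or.inr (Or.inr rfl))

theorem nil_le_borel (ε : ℤ) : nil m ε ≤ borel m ε := by
  rw [nil, Submodule.span_le]
  rintro _ ⟨n, p, q, h, rfl⟩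
  exact unit_mem_borel h.le

theorem tmul_eq_sum (n : ℤ) (x : 𝔰 m) : tmul n x = ∑ p, ∑ q, x.val p q • unit n p q := by
  conv_lhs => rw [sl_eq_sum x]
  rw [← tmulHom_apply, map_sum]
  refine Finset.sum_congr rfl fun p _ => ?_
  rw [map_sum]
  refine Finset.sum_congr rfl fun q _ => ?_
  rw [map_smul]
  rfl

/-- The principal grading describes the two nilpotent subalgebras uniformly, by the sign `ε = ±1`,
so that later statements need one proof for both. -/
theorem nPos_eq_nil : nPos m = nil m 1 := by
  refine le_antisymm (Submodule.span_le.2 ?_) (Submodule.span_le.2 ?_)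
  · rintro _ (⟨p, q, h, rfl⟩ | ⟨n, x, h, rfl⟩)
    · exact unit_mem_nil (by rw [deg]; have : p.val < q.val := h; omega)
    · rw [tmul_eq_sum]
      exact Submodule.sum_mem _ fun p _ => Submodule.sum_mem _ fun q _ => Submodule.smul_mem _ _
        (unit_mem_nil (by rw [one_mul]; exact deg_pos_of_pos p q h))
  · rintro _ ⟨n, p, q, h, rfl⟩
    rw [one_mul] at h
    rcases lt_trichotomy n 0 with hn | rfl | hn
    · exact absurd (deg_neg_of_neg p q hn) h.not_gt
    · refine Submodule.subset_span (Or.inl ⟨p, q, ?_, rfl⟩)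
      rw [deg] at h
      exact Fin.lt_def.2 (by omega)
    · exact Submodule.subset_span (Or.inr ⟨n, _, hn, rfl⟩)

theorem nNeg_eq_nil : nNeg m = nil m (-1) := by
  refine le_antisymm (Submodule.span_le.2 ?_) (Submodule.span_le.2 ?_)
  · rintro _ (⟨p, q, h, rfl⟩ | ⟨n, x, h, rfl⟩)
    · exact unit_mem_nil (by rw [deg]; have : q.val < p.val := h; omega)
    · rw [tmul_eq_sum]
      refine Submodule.sum_mem _ fun p _ => Submodule.sum_mem _ fun q _ => Submodule.smul_mem _ _
        (unit_mem_nil ?_)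
      have := deg_neg_of_neg p q h
      omega
  · rintro _ ⟨n, p, q, h, rfl⟩
    rcases lt_trichotomy n 0 with hn | rfl | hn
    · exact Submodule.subset_span (Or.inr ⟨n, _, hn, rfl⟩)
    · refine Submodule.subset_span (Or.inl ⟨p, q, ?_, rfl⟩)
      rw [deg] at h
      exact Fin.lt_def.2 (by omega)
    · have := deg_pos_of_pos p q hn
      omega

/-- The scalar correction of a diagonal unit stays on the diagonal; so trace-zero units are still
homogeneous for the principal grading. -/
theorem slUnit_val_ne {p q k r : Fin m} (h : (slUnit p q).val k r ≠ 0) :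
    (r.val : ℤ) - k.val = q.val - p.val := by
  rw [slUnit_val] at h
  rw [Matrix.sub_apply, Matrix.single_apply] at h
  by_cases hpq : p = q
  · subst hpq
    by_cases hk : k = r
    · subst hk; simp
    · rw [if_neg (by rintro ⟨rfl, rfl⟩; exact hk rfl), if_pos rfl, Matrix.smul_apply,
        Matrix.one_apply_ne hk, smul_zero, sub_zero] at h
      exact absurd rfl h
  · rw [if_neg hpq, Matrix.zero_apply, sub_zero] at h
    by_cases hk : p = k ∧ q = r
    · obtain ⟨rfl, rfl⟩ := hk; rfl
    · rw [if_neg hk] at h; exact absurd rfl h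

theorem unit_lie_unit (a b : ℤ) (p q r s : Fin m) : ⁅(unit a p q : AffineSl m), unit b r s⁆ =
    (∑ k, (slUnit p q).val k r • unit (a + b) k s - ∑ k, (slUnit p q).val s k • unit (a + b) r k) +
      (if a + b = 0 then (a : ℂ) * (slUnit p q).val s r else 0) • central := by
  rw [unit, tmul_lie_unit, lie_slUnit, ← tmulHom_apply, map_sub, map_sum, map_sum]
  simp only [map_smul]
  rfl

theorem diag_lie_diag (p r : Fin m) : ⁅(unit 0 p p : AffineSl m), unit 0 r r⁆ = 0 := by
  rw [unit_lie_unit]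
  have h : ∀ k l : Fin m, k ≠ l → (slUnit p p).val k l = 0 := by
    intro k l hkl
    by_contra hne
    have := slUnit_val_ne hne
    exact hkl (Fin.ext (by omega))
  rw [Finset.sum_eq_single r (fun k _ hk => by rw [h k r hk, zero_smul])
    (fun hr => absurd (Finset.mem_univ r) hr), Finset.sum_eq_single r
    (fun k _ hk => by rw [h r k hk.symm, zero_smul]) (fun hr => absurd (Finset.mem_univ r) hr)]
  simp

theorem lie_unit_degree (a : ℤ) (p q : Fin m) :
    ⁅(unit a p q : AffineSl m), degree⁆ = -((a : ℂ) • unit a p q) := tmul_lie_degree a _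

/-- Principal degrees add under the bracket, so a degree of sign `ε` in either argument suffices.
Two units of degree zero commute. A cocycle term requires total degree zero, which is excluded by
then. -/
theorem lie_mem_nil {ε : ℤ} {y z : AffineSl m} (hε : ε ≠ 0) (hy : y ∈ borel m ε)
    (hz : z ∈ borel m ε) : ⁅y, z⁆ ∈ nil m ε := by
  have hzero : ∀ {n p q}, ε * deg (m := m) n p q = 0 → n = 0 ∧ p = q := fun h =>
    deg_eq_zero ((mul_eq_zero.1 h).resolve_left hε)
  have hud : ∀ n p q, 0 ≤ ε * deg (m := m) n p q → ⁅(unit n p q : AffineSl m), degree⁆ ∈ nil m ε := by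
    intro n p q h
    rw [lie_unit_degree]
    rcases h.lt_or_eq with h | h
    · exact Submodule.neg_mem _ (Submodule.smul_mem _ _ (unit_mem_nil h))
    · rw [(hzero h.symm).1]
      simp
  refine Submodule.span_induction₂ (p := fun y z _ _ => ⁅y, z⁆ ∈ nil m ε) ?_ ?_ ?_ ?_ ?_ ?_ ?_ hy hz
  · rintro _ _ (⟨n, p, q, h, rfl⟩ | rfl | rfl) (⟨n', p', q', h', rfl⟩ | rfl | rfl)
    · by_cases h0 : ε * deg n p q = 0 ∧ ε * deg n' p' q' = 0
      · obtain ⟨rfl, rfl⟩ := hzero h0.1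
        obtain ⟨rfl, rfl⟩ := hzero h0.2
        rw [diag_lie_diag]
        exact Submodule.zero_mem _
      · have hs : 0 < ε * (deg n p q + deg n' p' q') := by
          rw [mul_add]
          omega
        rw [unit_lie_unit]
        refine Submodule.add_mem _ (Submodule.sub_mem _ (Submodule.sum_mem _ fun k _ => ?_)
          (Submodule.sum_mem _ fun k _ => ?_)) ?_
        · by_cases hk : (slUnit p q).val k p' = 0
          · rw [hk, zero_smul]; exact Submodule.zero_mem _
          · refine Submodule.smul_mem _ _ (unit_mem_nil ?_)
            have := slUnit_val_ne hk
            have e : deg (n + n') k q' = deg n p q + deg n' p' q' := by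
              simp only [deg]; linear_combination this
            rwa [e]
        · by_cases hk : (slUnit p q).val q' k = 0
          · rw [hk, zero_smul]; exact Submodule.zero_mem _
          · refine Submodule.smul_mem _ _ (unit_mem_nil ?_)
            have := slUnit_val_ne hk
            have e : deg (n + n') p' k = deg n p q + deg n' p' q' := by
              simp only [deg]; linear_combination this
            rwa [e]
        · split_ifs with hn
          · by_cases hk : (slUnit p q).val q' p' = 0
            · rw [hk, mul_zero, zero_smul]; exact Submodule.zero_mem _
            · have := slUnit_val_ne hk
              have e : deg n p q + deg n' p' q' = 0 := by
                simp only [deg]; linear_combination (m : ℤ) * hn - this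
              rw [e, mul_zero] at hs
              exact absurd hs (lt_irrefl _)
          · rw [zero_smul]; exact Submodule.zero_mem _
    · rw [← lie_skew, central_lie, neg_zero]; exact Submodule.zero_mem _
    · exact hud _ _ _ h
    · rw [central_lie]; exact Submodule.zero_mem _
    · rw [central_lie]; exact Submodule.zero_mem _
    · rw [central_lie]; exact Submodule.zero_mem _
    · rw [← lie_skew]; exact Submodule.neg_mem _ (hud _ _ _ h')
    · rw [← lie_skew, central_lie, neg_zero]; exact Submodule.zero_mem _
    · rw [lie_self]; exact Submodule.zero_mem _
  · intro y _; rw [zero_lie]; exact Submodule.zero_mem _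
  · intro y _; rw [lie_zero]; exact Submodule.zero_mem _
  · intro x y z _ _ _ h1 h2; rw [add_lie]; exact Submodule.add_mem _ h1 h2
  · intro x y z _ _ _ h1 h2; rw [lie_add]; exact Submodule.add_mem _ h1 h2
  · intro c x y _ _ h; rw [smul_lie]; exact Submodule.smul_mem _ _ h
  · intro c x y _ _ h; rw [lie_smul]; exact Submodule.smul_mem _ _ h

/-- `nil m ε` as a Lie subalgebra. -/
def nilSub (m : ℕ) {ε : ℤ} (hε : ε ≠ 0) : LieSubalgebra ℂ (AffineSl m) where
  __ := nil m ε
  lie_mem' hy hz := lie_mem_nil hε (nil_le_borel ε hy) (nil_le_borel ε hz)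

/-- Multiplication of the coefficient of `t^n` by `χ n`. -/
def coeffMul (χ : ℤ → ℂ) : Laurent →ₗ[ℂ] Laurent :=
  (AddMonoidAlgebra.basis ℤ ℂ).constr ℂ fun n => AddMonoidAlgebra.single n (χ n)

theorem coeffMul_single (χ : ℤ → ℂ) (n : ℤ) (a : ℂ) :
    coeffMul χ (AddMonoidAlgebra.single n a) = AddMonoidAlgebra.single n (a * χ n) := by
  have h := (AddMonoidAlgebra.basis ℤ ℂ).constr_basis ℂ (fun n => AddMonoidAlgebra.single n (χ n)) n
  have h1 : AddMonoidAlgebra.single n a = a • (AddMonoidAlgebra.basis ℤ ℂ n) := by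
    rw [AddMonoidAlgebra.basis_apply, AddMonoidAlgebra.smul_single, smul_eq_mul, mul_one]
  rw [h1, map_smul, coeffMul, h, AddMonoidAlgebra.smul_single, smul_eq_mul]

/-- The operator multiplying root vectors of principal degree `k` by `χ k`, and killing `c`
and `d`. -/
def degMul (χ : ℤ → ℂ) : AffineSl m →ₗ[ℂ] AffineSl m where
  toFun y := ⟨⟨Matrix.of fun p q => coeffMul (fun n => χ (deg n p q)) (y.loop.val p q), by
    change ∑ p, coeffMul (fun n => χ (deg n p p)) (y.loop.val p p) = 0
    -- On the diagonal the principal degree is `m n`, independent of the row; hence the trace stays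
    -- zero.
    have h : ∀ p : Fin m, coeffMul (fun n => χ (deg n p p)) (y.loop.val p p) =
        coeffMul (fun n => χ (m * n)) (y.loop.val p p) := fun p => by
      simp only [deg, add_sub_cancel_right]
    simp only [h]
    rw [← map_sum]
    have := trace_loop y.loop
    rw [Matrix.trace] at this
    simp only [Matrix.diag_apply] at this
    rw [this, map_zero]⟩, 0, 0⟩
  map_add' x y := ext_val (by ext p q : 1; simp) (add_zero _).symm (add_zero _).symm
  map_smul' a x := ext_val (by ext p q : 1; simp) (mul_zero a).symm
    (mul_zero a).symm

theorem unit_val (n : ℤ) (p q i j : Fin m) : (unit n p q : AffineSl m).loop.val i j =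
    AddMonoidAlgebra.single n ((slUnit p q).val i j) := rfl

theorem degMul_unit (χ : ℤ → ℂ) (n : ℤ) (p q : Fin m) :
    degMul χ (unit n p q) = χ (deg n p q) • unit n p q := by
  refine ext_val ?_ (mul_zero _).symm (mul_zero _).symm
  ext i j : 1
  rw [smul_loop_val, Matrix.smul_apply, unit_val, AddMonoidAlgebra.smul_single]
  change coeffMul _ ((unit n p q : AffineSl m).loop.val i j) = _
  rw [unit_val, coeffMul_single]
  by_cases h : (slUnit p q).val i j = 0
  · rw [h, zero_mul, smul_zero]
  · have := slUnit_val_ne h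
    rw [show deg n i j = deg n p q by simp only [deg]; linear_combination this, smul_eq_mul,
      mul_comm]

theorem degMul_central (χ : ℤ → ℂ) : degMul χ (central : AffineSl m) = 0 := by
  refine ext_val ?_ rfl rfl
  ext i j : 1
  exact map_zero (coeffMul fun n => χ (deg n i j))

theorem degMul_degree (χ : ℤ → ℂ) : degMul χ (degree : AffineSl m) = 0 := by
  refine ext_val ?_ rfl rfl
  ext i j : 1
  exact map_zero (coeffMul fun n => χ (deg n i j))

/-- The projection to `nil m ε`. -/
def nilProj (ε : ℤ) : AffineSl m →ₗ[ℂ] AffineSl m := degMul fun k => if 0 < ε * k then 1 else 0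

theorem nilProj_unit (ε n : ℤ) (p q : Fin m) :
    nilProj ε (unit n p q) = if 0 < ε * deg n p q then unit n p q else 0 := by
  rw [nilProj, degMul_unit]
  split_ifs <;> simp

theorem nilProj_mem (ε : ℤ) (y : AffineSl m) : nilProj ε y ∈ nil m ε := by
  refine mem_of_units ((nil m ε).comap (nilProj ε)) (fun n p q => ?_) ?_ ?_ y
  · rw [Submodule.mem_comap, nilProj_unit]
    split_ifs with h
    · exact unit_mem_nil h
    · exact Submodule.zero_mem _
  · rw [Submodule.mem_comap, nilProj, degMul_central]; exact Submodule.zero_mem _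
  · rw [Submodule.mem_comap, nilProj, degMul_degree]; exact Submodule.zero_mem _

theorem nilProj_of_mem {ε : ℤ} {y : AffineSl m} (hy : y ∈ nil m ε) : nilProj ε y = y := by
  have h : nil m ε ≤ LinearMap.ker (nilProj (m := m) ε - LinearMap.id) := by
    rw [nil, Submodule.span_le]
    rintro _ ⟨n, p, q, h, rfl⟩
    simp [nilProj_unit, h]
  exact sub_eq_zero.1 (h hy)

/-- Each homogeneous unit has principal degree either of sign `ε`, and is then reproduced by the
projection, or in the opposite Borel subalgebra. -/
theorem sub_nilProj_mem (ε : ℤ) (y : AffineSl m) : y - nilProj ε y ∈ borel m (-ε) := by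
  refine mem_of_units ((borel m (-ε)).comap (LinearMap.id - nilProj ε)) (fun n p q => ?_) ?_ ?_ y
  · rw [Submodule.mem_comap, LinearMap.sub_apply, nilProj_unit, LinearMap.id_apply]
    split_ifs with h
    · rw [sub_self]; exact Submodule.zero_mem _
    · rw [sub_zero]; exact unit_mem_borel (by linarith)
  · rw [Submodule.mem_comap, LinearMap.sub_apply, nilProj, degMul_central, sub_zero]
    exact central_mem_borel _
  · rw [Submodule.mem_comap, LinearMap.sub_apply, nilProj, degMul_degree, sub_zero]
    exact degree_mem_borel _

/-- The projection to the Cartan subalgebra. -/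
def cartanPart : AffineSl m →ₗ[ℂ] Cartan m where
  toFun y := (⟨⟨Matrix.diagonal fun p => constTerm (y.loop.val p p), by
    change Matrix.trace (Matrix.diagonal fun p => constTerm (y.loop.val p p)) = 0
    rw [Matrix.trace_diagonal, ← map_sum]
    have := trace_loop y.loop
    rw [Matrix.trace] at this
    simp only [Matrix.diag_apply] at this
    rw [this, map_zero]⟩, Matrix.isDiag_diagonal _⟩, y.c, y.d)
  map_add' x y := by
    refine Prod.ext (Subtype.ext (Subtype.ext ?_)) rfl
    ext i j : 1
    simp [Matrix.diagonal_apply]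
  map_smul' a x := by
    refine Prod.ext (Subtype.ext (Subtype.ext ?_)) rfl
    ext i j : 1
    simp [Matrix.diagonal_apply]

theorem cartanPart_incl (h : Cartan m) : cartanPart h.incl = h := by
  have h1 : h.incl.loop.val = h.1.val.val.map (AddMonoidAlgebra.singleAddHom 0) := by
    rw [Cartan.incl, add_loop_val, add_loop_val, smul_loop_val, smul_loop_val]
    simp [central, degree, tmul]
  refine Prod.ext (Subtype.ext (Subtype.ext ?_)) (Prod.ext ?_ ?_)
  · change Matrix.diagonal (fun p => constTerm (h.incl.loop.val p p)) = _
    ext i j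
    rw [h1, Matrix.diagonal_apply]
    split_ifs with hij
    · subst hij
      rw [Matrix.map_apply]
      exact (constTerm_single 0 _).trans (if_pos rfl)
    · exact (h.1.property hij).symm
  · change h.incl.c = _
    simp [Cartan.incl, tmul, central, degree]
  · change h.incl.d = _
    simp [Cartan.incl, tmul, central, degree]

theorem cartanPart_unit_of_ne {n : ℤ} {p q : Fin m} (h : deg n p q ≠ 0) :
    cartanPart (unit n p q) = 0 := by
  refine Prod.ext (Subtype.ext (Subtype.ext ?_)) rfl
  change Matrix.diagonal (fun i => constTerm ((unit n p q : AffineSl m).loop.val i i)) = 0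
  rw [← Matrix.diagonal_zero]
  congr 1
  ext i
  rw [unit_val, constTerm_single]
  split_ifs with hn
  · by_contra hne
    have := slUnit_val_ne hne
    apply h
    rw [deg, hn]
    omega
  · rfl

theorem cartanPart_of_mem_nil {ε : ℤ} {y : AffineSl m} (hy : y ∈ nil m ε) :
    cartanPart y = 0 := by
  have h : nil m ε ≤ LinearMap.ker (cartanPart (m := m)) := by
    rw [nil, Submodule.span_le]
    rintro _ ⟨n, p, q, h, rfl⟩
    exact cartanPart_unit_of_ne fun h0 => by rw [h0, mul_zero] at h; exact lt_irrefl _ h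
  exact h hy

/-- The inclusion of the Cartan subalgebra as a linear map. -/
def cartanIncl (m : ℕ) : Cartan m →ₗ[ℂ] AffineSl m where
  toFun := Cartan.incl
  map_add' h h' := by
    simp only [Cartan.incl, ← tmulHom_apply, Prod.fst_add, Prod.snd_add, Submodule.coe_add, map_add,
      add_smul]
    abel
  map_smul' a h := by
    simp only [Cartan.incl, ← tmulHom_apply, Prod.smul_fst, Prod.smul_snd, Submodule.coe_smul,
      map_smul, smul_add, smul_smul, smul_eq_mul, RingHom.id_apply]

theorem slUnit_diag_mem (p : Fin m) : slUnit p p ∈ CartanBar m := by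
  intro i j hij
  by_contra h
  have := slUnit_val_ne h
  exact hij (Fin.ext (by omega))

/-- The element of the Cartan subalgebra dual to the `p`-th weight of `ℂ^m`. -/
def cartanUnit (p : Fin m) : CartanBar m := ⟨slUnit p p, slUnit_diag_mem p⟩

theorem incl_cartanUnit (p : Fin m) : Cartan.incl ((cartanUnit p, 0, 0) : Cartan m) = unit 0 p p := by
  simp [Cartan.incl, cartanUnit, unit]

theorem incl_central : Cartan.incl ((0, 1, 0) : Cartan m) = central := by
  simp [Cartan.incl, ← tmulHom_apply]

theorem incl_degree : Cartan.incl ((0, 0, 1) : Cartan m) = degree := by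
  simp [Cartan.incl, ← tmulHom_apply]

theorem sub_cartanPart_mem {ε : ℤ} (hε : ε ≠ 0) {y : AffineSl m} (hy : y ∈ borel m ε) :
    y - (cartanPart y).incl ∈ nil m ε := by
  have h : borel m ε ≤ (nil m ε).comap (LinearMap.id - cartanIncl m ∘ₗ cartanPart) := by
    rw [borel, Submodule.span_le]
    have h1 : ∀ h : Cartan m, h.incl - (cartanPart h.incl).incl ∈ nil m ε := fun h => by
      rw [cartanPart_incl, sub_self]; exact Submodule.zero_mem _
    rintro _ (⟨n, p, q, h, rfl⟩ | rfl | rfl)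
    · change unit n p q - (cartanPart (unit n p q)).incl ∈ nil m ε
      rcases h.lt_or_eq with h | h
      · rw [cartanPart_of_mem_nil (unit_mem_nil h), show Cartan.incl (0 : Cartan m) = 0 from
          map_zero (cartanIncl m), sub_zero]
        exact unit_mem_nil h
      · obtain ⟨rfl, rfl⟩ := deg_eq_zero ((mul_eq_zero.1 h.symm).resolve_left hε)
        rw [← incl_cartanUnit]
        exact h1 _
    · have := h1 (0, 1, 0)
      rwa [incl_central] at this
    · have := h1 (0, 0, 1)
      rwa [incl_degree] at this
  exact h hy

theorem incl_mem_borel (ε : ℤ) (h : Cartan m) : h.incl ∈ borel m ε := by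
  have h0 : ∀ x : CartanBar m, tmul 0 x.val ∈ borel m ε := by
    intro x
    rw [tmul_eq_sum]
    refine Submodule.sum_mem _ fun p _ => Submodule.sum_mem _ fun q _ => ?_
    by_cases hpq : p = q
    · subst hpq
      exact Submodule.smul_mem _ _ (unit_mem_borel (by simp [deg]))
    · rw [x.property hpq, zero_smul]; exact Submodule.zero_mem _
  exact Submodule.add_mem _ (Submodule.add_mem _ (h0 _) (Submodule.smul_mem _ _
    (central_mem_borel ε))) (Submodule.smul_mem _ _ (degree_mem_borel ε))

end AffineSl

/-! ### Verma modules over the opposite nilpotent subalgebra -/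

namespace VermaModule

open AffineSl UniversalEnvelopingAlgebra

variable {m : ℕ} {n : Submodule ℂ (AffineSl m)} {χ : Weight m}

/-- A Verma module is generated by its vacuum vector under the opposite nilpotent subalgebra. -/
theorem nil_induction {ε : ℤ} (hε : ε ≠ 0) (hn : n = nil m ε) (S : Submodule ℂ (VermaModule n χ))
    (h1 : vac n χ ∈ S) (h : ∀ y ∈ nil m (-ε), ∀ v ∈ S, ⁅y, v⁆ ∈ S) (v : VermaModule n χ) :
    v ∈ S := by
  -- The smallest subspace containing the vacuum and stable under the opposite nilpotent subalgebra.
  -- It is enough that `Q` be stable under the whole Lie algebra.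
  let Q : Submodule ℂ (VermaModule n χ) := sInf {T | vac n χ ∈ T ∧
    ∀ y ∈ nil m (-ε), ∀ v ∈ T, ⁅y, v⁆ ∈ T}
  have q1 : vac n χ ∈ Q := Submodule.mem_sInf.2 fun T hT => hT.1
  have q2 : ∀ y ∈ nil m (-ε), ∀ v ∈ Q, ⁅y, v⁆ ∈ Q := fun y hy v hv =>
    Submodule.mem_sInf.2 fun T hT => hT.2 y hy v (Submodule.mem_sInf.1 hv T hT)
  -- `Q'` collects the vectors of `Q` that the whole algebra maps into `Q`. It contains the vacuum
  -- by the triangular decomposition and is stable under the opposite nilpotent subalgebra by the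
  -- Leibniz rule, so minimality gives `Q ≤ Q'`.
  let Q' : Submodule ℂ (VermaModule n χ) :=
    { carrier := {v | v ∈ Q ∧ ∀ z : AffineSl m, ⁅z, v⁆ ∈ Q}
      add_mem' := fun {a b} ha hb => ⟨Q.add_mem ha.1 hb.1, fun z => by
        rw [lie_add]; exact Q.add_mem (ha.2 z) (hb.2 z)⟩
      zero_mem' := ⟨Q.zero_mem, fun z => by rw [lie_zero]; exact Q.zero_mem⟩
      smul_mem' := fun c a ha => ⟨Q.smul_mem c ha.1, fun z => by
        rw [lie_smul]; exact Q.smul_mem c (ha.2 z)⟩ }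
  have q3 : Q ≤ Q' := sInf_le (show Q' ∈ {T | _ ∧ _} from by
    refine ⟨⟨q1, fun z => ?_⟩, fun y hy v hv => ⟨q2 y hy v hv.1, fun z => ?_⟩⟩
    · have h2 : z - nilProj (-ε) z ∈ borel m ε := by
        have := sub_nilProj_mem (-ε) z
        rwa [neg_neg] at this
      have h3 := sub_cartanPart_mem hε h2
      have e1 : z = nilProj (-ε) z + ((z - nilProj (-ε) z - (cartanPart (z - nilProj (-ε) z)).incl) +
          (cartanPart (z - nilProj (-ε) z)).incl) := by abel
      have h4 : ⁅z - nilProj (-ε) z - (cartanPart (z - nilProj (-ε) z)).incl, vac n χ⁆ = 0 :=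
        lie_vac_of_mem (by rw [hn]; exact h3)
      rw [e1, add_lie, add_lie, h4, lie_vac_incl, zero_add]
      exact Q.add_mem (q2 _ (nilProj_mem _ _) _ q1) (Q.smul_mem _ q1)
    · rw [leibniz_lie]
      exact Q.add_mem (hv.2 _) (q2 y hy _ (hv.2 z)))
  have q4 : v ∈ Q := induction Q q1 (fun y v hv => (q3 hv).2 y) v
  exact Submodule.mem_sInf.1 q4 S ⟨h1, h⟩

/-- The central element acts on a Verma module as a scalar. -/
theorem central_lie_eq (v : VermaModule n χ) :
    ⁅(central : AffineSl m), v⁆ = χ (0, 1, 0) • v := by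
  let S : Submodule ℂ (VermaModule n χ) :=
    LinearMap.ker (actEnd m (VermaModule n χ) central - χ (0, 1, 0) • LinearMap.id)
  have hS : ∀ v, v ∈ S ↔ ⁅(central : AffineSl m), v⁆ = χ (0, 1, 0) • v := fun v => by
    rw [LinearMap.mem_ker, LinearMap.sub_apply, sub_eq_zero]
    rfl
  rw [← hS]
  refine induction S ?_ (fun y v hv => ?_) v
  · rw [hS, ← incl_central, lie_vac_incl]
  · rw [hS] at hv ⊢
    rw [leibniz_lie, central_lie, zero_lie, zero_add, hv, lie_smul]

/-- Verma modules are smooth. -/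
theorem smooth {ε : ℤ} (hε : ε = 1 ∨ ε = -1) (hn : n = nil m ε) (v : VermaModule n χ) :
    ∃ K : ℕ, ∀ k : ℤ, K ≤ k → ∀ X : 𝔰 m, ⁅tmul (ε * k) X, v⁆ = 0 := by
  have hεε : ε * ε = 1 := by rcases hε with rfl | rfl <;> rfl
  let S : Submodule ℂ (VermaModule n χ) :=
    { carrier := {v | ∃ K : ℕ, ∀ k : ℤ, K ≤ k → ∀ X : 𝔰 m, ⁅tmul (ε * k) X, v⁆ = 0}
      add_mem' := fun {a b} ⟨K, hK⟩ ⟨L, hL⟩ => ⟨max K L, fun k hk X => by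
        rw [lie_add, hK k (by omega), hL k (by omega), add_zero]⟩
      zero_mem' := ⟨0, fun k _ X => lie_zero _⟩
      smul_mem' := fun c a ⟨K, hK⟩ => ⟨K, fun k hk X => by rw [lie_smul, hK k hk, smul_zero]⟩ }
  refine induction S ⟨1, fun k hk X => ?_⟩ (fun y v hv => ?_) v
  · refine lie_vac_of_mem ?_
    rw [hn, tmul_eq_sum]
    refine Submodule.sum_mem _ fun p _ => Submodule.sum_mem _ fun q _ => Submodule.smul_mem _ _
      (unit_mem_nil ?_)
    rcases hε with rfl | rfl
    · rw [one_mul, one_mul]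
      exact deg_pos_of_pos p q (by omega)
    · have := deg_neg_of_neg p q (n := -1 * k) (by omega)
      omega
  · let T : Submodule ℂ (AffineSl m) :=
      { carrier := {y | ⁅y, v⁆ ∈ S}
        add_mem' := fun {a b} ha hb => by
          change ⁅a + b, v⁆ ∈ S
          rw [add_lie]; exact S.add_mem ha hb
        zero_mem' := by
          change ⁅(0 : AffineSl m), v⁆ ∈ S
          rw [zero_lie]; exact S.zero_mem
        smul_mem' := fun c a ha => by
          change ⁅c • a, v⁆ ∈ S
          rw [smul_lie]; exact S.smul_mem c ha }
    obtain ⟨K, hK⟩ := hv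
    refine mem_of_units T (fun b p q => ?_) ?_ ?_ y
    · refine ⟨K + b.natAbs + 1, fun k hk X => ?_⟩
      have h0 : ε * k + b = ε * (k + ε * b) := by rw [mul_add, ← mul_assoc, hεε, one_mul]
      -- Beyond `K + |b| + 1` the shifted degree still exceeds `K`, and it is nonzero, so the
      -- commutator has no central term.
      have h1 : (K : ℤ) ≤ k + ε * b ∧ ε * k + b ≠ 0 := by
        rcases hε with rfl | rfl <;> omega
      rw [leibniz_lie, hK k (by omega) X, lie_zero, add_zero, tmul_lie_unit, if_neg h1.2, zero_smul,
        add_zero, h0]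
      exact hK _ h1.1 _
    · refine ⟨K, fun k hk X => ?_⟩
      rw [leibniz_lie, hK k hk X, lie_zero, add_zero, ← lie_skew, central_lie, neg_zero, zero_lie]
    · refine ⟨K, fun k hk X => ?_⟩
      rw [leibniz_lie, hK k hk X, lie_zero, add_zero, tmul_lie_degree, neg_lie, smul_lie, hK k hk X,
        smul_zero, neg_zero]

/-- A Verma module maps to the enveloping algebra of the opposite nilpotent subalgebra. -/
theorem exists_hom_enveloping {ε : ℤ} (hε : -ε ≠ 0) (hn : n = nil m ε) :
    ∃ Θ : VermaModule n χ →ₗ[ℂ] UniversalEnvelopingAlgebra ℂ (nilSub m hε),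
      Θ (vac n χ) = 1 ∧ ∀ (x : nilSub m hε) v, Θ ⁅(x : AffineSl m), v⁆ = ι ℂ x * Θ v := by
  have hε' : ε ≠ 0 := fun h => hε (by rw [h, neg_zero])
  let π : AffineSl m →ₗ[ℂ] nilSub m hε := (nilProj (-ε)).codRestrict (nil m (-ε)) (nilProj_mem (-ε))
  have hπ : ∀ y, ((π y : nilSub m hε) : AffineSl m) = nilProj (-ε) y := fun y => rfl
  have hπ0 : ∀ y, π y = 0 ↔ nilProj (-ε) y = 0 := fun y => Subtype.ext_iff
  have hb : ∀ y, π y = 0 → y ∈ borel m ε := fun y hy => by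
    have := sub_nilProj_mem (-ε) y
    rwa [(hπ0 y).1 hy, sub_zero, neg_neg] at this
  have hnn : ∀ y ∈ nil m ε, π y = 0 := fun y hy => by
    rw [hπ0]
    have h : nil m ε ≤ LinearMap.ker (nilProj (m := m) (-ε)) := by
      rw [nil, Submodule.span_le]
      rintro _ ⟨k, p, q, h, rfl⟩
      change nilProj (-ε) _ = 0
      rw [nilProj_unit, if_neg (by linarith)]
    exact h hy
  have hlie : ∀ y z, π y = 0 → π z = 0 → ⁅y, z⁆ ∈ nil m ε := fun y z hy hz =>
    lie_mem_nil hε' (hb y hy) (hb z hz)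
  obtain ⟨act, a1, a2, a3⟩ := exists_induced_action (nilSub m hε) π (χ ∘ₗ cartanPart)
    (fun x => Subtype.ext (nilProj_of_mem x.property))
    (fun y z hy hz => hnn _ (hlie y z hy hz))
    (fun x => by rw [LinearMap.comp_apply, cartanPart_of_mem_nil (ε := -ε) x.property, map_zero])
    (fun y z hy hz => by
      rw [LinearMap.comp_apply, cartanPart_of_mem_nil (hlie y z hy hz), map_zero])
  have hincl : ∀ h : Cartan m, π h.incl = 0 := fun h => by
    rw [hπ0]
    have e : ∀ h : CartanBar m, nilProj (-ε) (tmul 0 h.val) = 0 := fun h => by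
      rw [tmul_eq_sum, map_sum]
      refine Finset.sum_eq_zero fun p _ => ?_
      rw [map_sum]
      refine Finset.sum_eq_zero fun q _ => ?_
      rw [map_smul]
      by_cases hpq : p = q
      · subst hpq
        rw [nilProj_unit, if_neg (by simp [deg]), smul_zero]
      · rw [h.property hpq, zero_smul]
    rw [Cartan.incl, map_add, map_add, map_smul, map_smul, e, nilProj, degMul_central, degMul_degree,
      smul_zero, smul_zero, add_zero, add_zero]
  -- In the module structure just built on the enveloping algebra, `1` is a vacuum vector of weight
  -- `χ`.
  obtain ⟨Θ, h1, h2⟩ := exists_lift (n := n) (χ := χ) act a1 1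
    (fun y hy => by
      rw [hn] at hy
      rw [a2, hnn y hy, map_zero, zero_add, LinearMap.comp_apply, cartanPart_of_mem_nil hy, map_zero,
        zero_smul])
    (fun h => by rw [a2, hincl, map_zero, zero_add, LinearMap.comp_apply, cartanPart_incl])
  exact ⟨Θ, h1, fun x v => by rw [h2, a3]⟩

end VermaModule

/-! ### Invariant trilinear forms on two Verma modules and a third module -/

section Pairing

open AffineSl UniversalEnvelopingAlgebra

attribute [local instance 100] LieRing.ofAssociativeRing LieAlgebra.ofAssociativeAlgebra

variable {m : ℕ} {W : Type} [AddCommGroup W] [Module ℂ W] (ω : AffineSl m →ₗ[ℂ] Module.End ℂ W)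
  (hω : ∀ x y, ω ⁅x, y⁆ = ω x * ω y - ω y * ω x) (lam mu : Weight m) (p : W →ₗ[ℂ] ℂ)
  (hp : ∀ (h : Cartan m) w, p (ω h.incl w) = (lam h - mu h) * p w)

include hω in
/-- The contragredient action on functionals. -/
theorem exists_dual_action (k : LieSubalgebra ℂ (AffineSl m)) :
    ∃ Λ : UniversalEnvelopingAlgebra ℂ k →ₐ[ℂ] Module.End ℂ (W →ₗ[ℂ] ℂ),
      ∀ (x : k) q w, Λ (ι ℂ x) q w = -q (ω x w) := by
  let f : k →ₗ[ℂ] Module.End ℂ (W →ₗ[ℂ] ℂ) :=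
    LinearMap.mk₂ ℂ (fun x q => -(q ∘ₗ ω x))
      (fun x y q => by ext w; simp [add_comm]) (fun c x q => by ext w; simp)
      (fun x q r => by ext w; simp [add_comm]) (fun c x q => by ext w; simp)
  obtain ⟨Λ, hΛ⟩ := uea_exists_lift f fun x y => by
    ext q w
    change -q (ω ⁅(x : AffineSl m), (y : AffineSl m)⁆ w) =
      -(-(q (ω y (ω x w)))) - -(-(q (ω x (ω y w))))
    rw [hω, LinearMap.sub_apply, map_sub, Module.End.mul_apply, Module.End.mul_apply]
    ring
  exact ⟨Λ, fun x q w => by rw [hΛ]; rfl⟩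

include hω hp in
/-- Extension of a functional of weight `λ - μ` to an invariant trilinear form. -/
theorem exists_invariant_form :
    ∃ ψ : HighestVerma mu →ₗ[ℂ] LowestVerma lam →ₗ[ℂ] W →ₗ[ℂ] ℂ,
      ψ (VermaModule.vac _ _) (VermaModule.vac _ _) = p ∧
      ∀ (y : AffineSl m) a b w, ψ ⁅y, a⁆ b w + ψ a ⁅y, b⁆ w + ψ a b (ω y w) = 0 := by
  have h1 : -(-1 : ℤ) ≠ 0 := by norm_num
  obtain ⟨Θ, t1, t2⟩ := VermaModule.exists_hom_enveloping (χ := -lam) h1 (nNeg_eq_nil (m := m))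
  obtain ⟨Λ, hΛ⟩ := exists_dual_action ω hω (nilSub m h1)
  -- The lowest weight Verma module is sent to `U(𝔫_+)`, which acts contragrediently on `p`. So `φ`
  -- is the only candidate for the form with `v(μ)` as first argument, and it is invariant under
  -- `𝔫_+` by construction.
  let φ : LowestVerma lam →ₗ[ℂ] W →ₗ[ℂ] ℂ := LinearMap.applyₗ p ∘ₗ Λ.toLinearMap ∘ₗ Θ
  have φ1 : φ (VermaModule.vac _ _) = p := by
    change Λ (Θ _) p = p
    rw [t1, map_one]
    rfl
  have φ2 : ∀ x ∈ nil m 1, ∀ b w, φ ⁅x, b⁆ w = -φ b (ω x w) := by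
    intro x hx b w
    have hx' : x ∈ nilSub m h1 := by
      change x ∈ nil m (-(-1))
      rwa [neg_neg]
    change Λ (Θ ⁅((⟨x, hx'⟩ : nilSub m h1) : AffineSl m), b⁆) p w = _
    rw [t2, map_mul, Module.End.mul_apply, hΛ]
    rfl
  -- Weight condition for `φ`: on the vacuum it is the hypothesis on `p`, and it propagates along
  -- `𝔫_+`, which the Cartan subalgebra normalises.
  have φ3 : ∀ (h : Cartan m) b w, φ ⁅h.incl, b⁆ w = -φ b (ω h.incl w) - mu h * φ b w := by
    intro h b
    let S : Submodule ℂ (LowestVerma lam) :=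
      { carrier := {b | ∀ w, φ ⁅h.incl, b⁆ w = -φ b (ω h.incl w) - mu h * φ b w}
        add_mem' := fun {a b} ha hb w => by
          simp only [lie_add, map_add, LinearMap.add_apply, ha w, hb w]
          ring
        zero_mem' := fun w => by simp
        smul_mem' := fun c a ha w => by
          simp only [lie_smul, map_smul, LinearMap.smul_apply, ha w, smul_eq_mul]
          ring }
    refine VermaModule.nil_induction (by norm_num) nNeg_eq_nil S (fun w => ?_) (fun x hx b hb w => ?_) b
    · rw [VermaModule.lie_vac_incl, map_smul, LinearMap.smul_apply, φ1, hp, LinearMap.neg_apply,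
        smul_eq_mul]
      ring
    · rw [neg_neg] at hx
      have h2 : ⁅h.incl, x⁆ ∈ nil m 1 :=
        lie_mem_nil one_ne_zero (incl_mem_borel _ _) (nil_le_borel _ hx)
      rw [leibniz_lie, map_add, LinearMap.add_apply, φ2 _ h2, φ2 x hx, hb, φ2 x hx, φ2 x hx, hω,
        LinearMap.sub_apply, map_sub, Module.End.mul_apply, Module.End.mul_apply]
      ring
  -- For the contragredient action on bilinear forms, `φ` is a highest weight vector of weight `μ`;
  -- the universal property of the highest weight Verma module then defines the trilinear form, and
  -- equivariance is its invariance.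
  let act : AffineSl m →ₗ[ℂ] Module.End ℂ (LowestVerma lam →ₗ[ℂ] W →ₗ[ℂ] ℂ) :=
    LinearMap.mk₂ ℂ (fun y ψ => -(ψ ∘ₗ actEnd m (LowestVerma lam) y) - ψ.compl₂ (ω y))
      (fun x y q => by ext b w; simp; ring) (fun c x q => by ext b w; simp; ring)
      (fun x q r => by ext b w; simp; ring) (fun c x q => by ext b w; simp; ring)
  have hact : ∀ y ψ b w, act y ψ b w = -ψ ⁅y, b⁆ w - ψ b (ω y w) := fun y ψ b w => rfl
  obtain ⟨F, f1, f2⟩ := VermaModule.exists_lift (n := nPos m) (χ := mu) act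
    (fun y z => by
      ext ψ b w
      rw [LinearMap.sub_apply, LinearMap.sub_apply, LinearMap.sub_apply, Module.End.mul_apply,
        Module.End.mul_apply]
      simp only [hact, hω, lie_lie, map_sub, LinearMap.sub_apply, Module.End.mul_apply]
      ring) φ
    (fun y hy => by
      rw [nPos_eq_nil] at hy
      ext b w
      rw [hact, φ2 y hy, neg_neg, sub_self]
      rfl)
    (fun h => by
      ext b w
      rw [hact, φ3]
      simp)
  exact ⟨F, by rw [f1, φ1], fun y a b w => by rw [f2, hact]; ring⟩

end Pairing

/-! ### The middle factor and its monomial basis -/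

section SlotSpace

variable (N m : ℕ)

/-- `ℂ[z_1^{±1}, …, z_N^{±1}] ⊗ (ℂ^m)^{⊗N}`. -/
abbrev SlotSpace : Type := MultiLaurent N ⊗[ℂ] TensorPow N m

/-- The basis of `(ℂ^m)^{⊗N}` made of tensor products of basis vectors. -/
def tensorBasis : Module.Basis (Fin N → Fin m) ℂ (TensorPow N m) :=
  Basis.piTensorProduct fun _ => Pi.basisFun ℂ (Fin m)

/-- The basis of `SlotSpace` made of the `z^η ⊗ e_J`. -/
def slotBasis : Module.Basis ((Fin N → ℤ) × (Fin N → Fin m)) ℂ (SlotSpace N m) :=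
  (AddMonoidAlgebra.basis (Fin N → ℤ) ℂ).tensorProduct (tensorBasis N m)

variable {N m}

theorem tensorBasis_apply (J : Fin N → Fin m) :
    tensorBasis N m J = PiTensorProduct.tprod ℂ fun k => Pi.single (J k) 1 := by
  rw [tensorBasis, Basis.piTensorProduct_apply]
  simp

theorem slotBasis_apply (x : (Fin N → ℤ) × (Fin N → Fin m)) :
    slotBasis N m x = expMon x.1 ⊗ₜ tensorBasis N m x.2 := by
  rw [slotBasis, Module.Basis.tensorProduct_apply, AddMonoidAlgebra.basis_apply]
  rfl

/-- Operators on polynomials, acting on `SlotSpace`. -/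
def slotPoly (N m : ℕ) : Module.End ℂ (MultiLaurent N) →ₐ[ℂ] Module.End ℂ (SlotSpace N m) :=
  Module.End.rTensorAlgHom ℂ (MultiLaurent N) (TensorPow N m)

/-- Operators on tensors, acting on `SlotSpace`. -/
def slotTens (N m : ℕ) : Module.End ℂ (TensorPow N m) →ₐ[ℂ] Module.End ℂ (SlotSpace N m) :=
  Module.End.lTensorAlgHom ℂ (TensorPow N m) (MultiLaurent N)

/-- The action of matrices of Laurent polynomials in `z_i` on `SlotSpace`. -/
def slotEval (N m : ℕ) (i : Fin N) : AffineSl m →ₗ[ℂ] Module.End ℂ (SlotSpace N m) :=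
  evalAct (R := Module.End ℂ (SlotSpace N m)) (slotPoly N m) (slotTens N m) i

/-- The diagonal action of matrices of Laurent polynomials on `SlotSpace`. -/
def slotEnd (N m : ℕ) : AffineSl m →ₗ[ℂ] Module.End ℂ (SlotSpace N m) :=
  ∑ i : Fin N, slotEval N m i

theorem slotPoly_commute_slotTens (f : Module.End ℂ (MultiLaurent N))
    (g : Module.End ℂ (TensorPow N m)) : Commute (slotPoly N m f) (slotTens N m g) :=
  TensorProduct.ext' fun _ _ => rfl

theorem sum_commutator {R : Type} [Ring R] {a b c : Fin N → R}
    (h : ∀ i, c i = a i * b i - b i * a i) (hc : ∀ i j, i ≠ j → Commute (a i) (b j)) :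
    ∑ i, c i = (∑ i, a i) * (∑ i, b i) - (∑ i, b i) * ∑ i, a i := by
  rw [Finset.sum_mul_sum, Finset.sum_mul_sum, Finset.sum_comm (f := fun i j => b i * a j),
    ← Finset.sum_sub_distrib]
  refine Finset.sum_congr rfl fun i _ => ?_
  rw [← Finset.sum_sub_distrib, Finset.sum_eq_single i]
  · exact h i
  · intro j _ hj
    rw [(hc i j hj.symm).eq, sub_self]
  · exact fun h => absurd (Finset.mem_univ i) h

theorem slotEnd_lie (x y : AffineSl m) :
    slotEnd N m ⁅x, y⁆ = slotEnd N m x * slotEnd N m y - slotEnd N m y * slotEnd N m x := by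
  have h : ∀ y, slotEnd N m y = ∑ i : Fin N, (slotEval N m i y : Module.End ℂ (SlotSpace N m)) :=
    fun y => LinearMap.sum_apply _ _ _
  rw [h, h, h]
  exact sum_commutator (fun i => evalAct_lie slotPoly_commute_slotTens i x y)
    fun i j hij => evalAct_commute slotPoly_commute_slotTens hij x y

theorem slotHom_diag (i : Fin N) (x : Matrix (Fin m) (Fin m) ℂ) (hx : x.IsDiag)
    (J : Fin N → Fin m) : slotHom i x (tensorBasis N m J) = x (J i) (J i) • tensorBasis N m J := by
  rw [tensorBasis_apply, slotHom_tprod]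
  have h : x.mulVec (Pi.single (J i) 1) = x (J i) (J i) • Pi.single (J i) 1 := by
    ext k
    rw [Matrix.mulVec_single_one, Matrix.col_apply, Pi.smul_apply, smul_eq_mul, Pi.single_apply]
    split_ifs with hk
    · rw [hk, mul_one]
    · rw [mul_zero]; exact hx hk
  rw [h, MultilinearMap.map_update_smul, Function.update_eq_self]

theorem slotEval_incl (i : Fin N) (h : Cartan m) (x : (Fin N → ℤ) × (Fin N → Fin m)) :
    slotEval N m i h.incl (slotBasis N m x) =
      (eBar (x.2 i) h.1 + (x.1 i : ℂ) * h.2.2) • slotBasis N m x := by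
  rw [slotEval, Cartan.incl, map_add, map_add, map_smul, map_smul, evalAct_central, evalAct_degree,
    evalAct_tmul', zPow_zero, map_one, map_one, one_mul, smul_zero, add_zero, LinearMap.add_apply,
    LinearMap.smul_apply, slotBasis_apply, add_smul]
  congr 1
  · change expMon x.1 ⊗ₜ slotHom i h.1.val.val (tensorBasis N m x.2) = _
    rw [slotHom_diag i _ h.1.property, TensorProduct.tmul_smul]
    rfl
  · change h.2.2 • (partialXi (Pi.single i 1) (expMon x.1) ⊗ₜ tensorBasis N m x.2) = _
    rw [partialXi_expMon, ← TensorProduct.smul_tmul', smul_smul]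
    simp [Pi.single_apply, mul_comm]

theorem slotEnd_incl (h : Cartan m) (x : (Fin N → ℤ) × (Fin N → Fin m)) :
    slotEnd N m h.incl (slotBasis N m x) =
      (∑ i, (eBar (x.2 i) h.1 + (x.1 i : ℂ) * h.2.2)) • slotBasis N m x := by
  rw [slotEnd, LinearMap.sum_apply, LinearMap.sum_apply, Finset.sum_smul]
  exact Finset.sum_congr rfl fun i _ => slotEval_incl i h x

end SlotSpace

/-! ### Coinvariants as a quotient of trilinear data -/

section Coinvariants

variable {N m : ℕ} {A B : Type} [AddCommGroup A] [Module ℂ A] [AddCommGroup B] [Module ℂ B]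

/-- The map `p ⊗ v ↦ p ⊗ (a ⊗ (v ⊗ b))`. -/
def slotIncl (N m : ℕ) (a : A) (b : B) : SlotSpace N m →ₗ[ℂ] BigSpace N m A B :=
  LinearMap.lTensor (MultiLaurent N) (TensorProduct.mk ℂ A (TensorPow N m ⊗[ℂ] B) a ∘ₗ
    (TensorProduct.mk ℂ (TensorPow N m) B).flip b)

theorem slotIncl_tmul (a : A) (b : B) (p : MultiLaurent N) (v : TensorPow N m) :
    slotIncl N m a b (p ⊗ₜ v) = p ⊗ₜ (a ⊗ₜ (v ⊗ₜ b)) := rfl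

theorem slotIncl_evalAct (a : A) (b : B) (i : Fin N) (y : AffineSl m) (w : SlotSpace N m) :
    slotIncl N m a b (slotEval N m i y w) =
      theta A B i y (slotIncl N m a b w) := by
  rw [← evalAct_eq_theta]
  induction w using TensorProduct.induction_on with
  | zero => simp only [map_zero]
  | add v w hv hw => simp only [map_add, hv, hw]
  | tmul p v =>
    rw [slotEval, evalAct_apply, evalAct_apply, LinearMap.add_apply, LinearMap.add_apply, map_add]
    congr 1
    change slotIncl N m a b ((∑ p : Fin m, ∑ q : Fin m, _ * _ : Module.End ℂ _) _) =
      (∑ p : Fin m, ∑ q : Fin m, _ * _ : Module.End ℂ (BigSpace N m A B)) _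
    simp only [LinearMap.sum_apply, map_sum]
    rfl

variable [LieRingModule (AffineSl m) A] [LieModule ℂ (AffineSl m) A]
  [LieRingModule (AffineSl m) B] [LieModule ℂ (AffineSl m) B]

theorem thetaDiag_slotIncl (a : A) (b : B) (y : AffineSl m) (w : SlotSpace N m) :
    thetaDiag N A B y (slotIncl N m a b w) = slotIncl N m ⁅y, a⁆ b w + slotIncl N m a ⁅y, b⁆ w +
      slotIncl N m a b (slotEnd N m y w) := by
  have h1 : ∀ w, thetaA N A B y (slotIncl N m a b w) = slotIncl N m ⁅y, a⁆ b w := fun w => by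
    induction w using TensorProduct.induction_on with
    | zero => simp only [map_zero]
    | add v w hv hw => simp only [map_add, hv, hw]
    | tmul p v => rfl
  have h2 : ∀ w, thetaB N A B y (slotIncl N m a b w) = slotIncl N m a ⁅y, b⁆ w := fun w => by
    induction w using TensorProduct.induction_on with
    | zero => simp only [map_zero]
    | add v w hv hw => simp only [map_add, hv, hw]
    | tmul p v => rfl
  rw [thetaDiag, LinearMap.add_apply, LinearMap.add_apply, h1, h2, LinearMap.sum_apply, slotEnd,
    LinearMap.sum_apply, LinearMap.sum_apply, map_sum]
  simp only [slotIncl_evalAct]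
  abel

/-- The class of `p ⊗ (a ⊗ (v ⊗ b))` as a trilinear map. -/
def slotMk (N m : ℕ) (A B : Type) [AddCommGroup A] [Module ℂ A] [LieRingModule (AffineSl m) A]
    [LieModule ℂ (AffineSl m) A] [AddCommGroup B] [Module ℂ B] [LieRingModule (AffineSl m) B]
    [LieModule ℂ (AffineSl m) B] : A →ₗ[ℂ] B →ₗ[ℂ] SlotSpace N m →ₗ[ℂ] Coinv (m := m) N A B :=
  LinearMap.mk₂ ℂ (fun a b => (coinvSub N A B).mkQ ∘ₗ slotIncl N m a b)
    (fun a a' b => TensorProduct.ext' fun p v => by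
      simp only [LinearMap.comp_apply, LinearMap.add_apply, slotIncl_tmul, TensorProduct.add_tmul,
        TensorProduct.tmul_add, map_add])
    (fun c a b => TensorProduct.ext' fun p v => by
      simp only [LinearMap.comp_apply, LinearMap.smul_apply, slotIncl_tmul,
        ← TensorProduct.smul_tmul', TensorProduct.tmul_smul, map_smul])
    (fun a b b' => TensorProduct.ext' fun p v => by
      simp only [LinearMap.comp_apply, LinearMap.add_apply, slotIncl_tmul,
        TensorProduct.tmul_add, map_add])
    (fun c a b => TensorProduct.ext' fun p v => by
      simp only [LinearMap.comp_apply, LinearMap.smul_apply, slotIncl_tmul,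
        TensorProduct.tmul_smul, map_smul])

theorem slotMk_lie {y : AffineSl m} (hy : y.d = 0) (a : A) (b : B) (w : SlotSpace N m) :
    slotMk N m A B ⁅y, a⁆ b w + slotMk N m A B a ⁅y, b⁆ w +
      slotMk N m A B a b (slotEnd N m y w) = 0 := by
  have h : coinvMk (thetaDiag N A B y (slotIncl N m a b w)) = 0 :=
    (Submodule.Quotient.mk_eq_zero _).mpr (Submodule.subset_span ⟨y, _, hy, rfl⟩)
  rw [thetaDiag_slotIncl, coinvMk, map_add, map_add] at h
  exact h

theorem mem_of_slotMk (R : Submodule ℂ (Coinv (m := m) N A B))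
    (h : ∀ a b w, slotMk N m A B a b w ∈ R) (x : Coinv (m := m) N A B) : x ∈ R := by
  obtain ⟨u, rfl⟩ := (coinvSub N A B).mkQ_surjective x
  have h0 : R.mkQ ∘ₗ (coinvSub N A B).mkQ = 0 := bigSpace_hom_ext fun p a v b =>
    (Submodule.Quotient.mk_eq_zero R).mpr (h a b (p ⊗ₜ v))
  exact (Submodule.Quotient.mk_eq_zero R).mp (LinearMap.congr_fun h0 u)

/-- An invariant trilinear form gives a functional on the coinvariants. -/
theorem exists_coinv_functional (ψ : A →ₗ[ℂ] B →ₗ[ℂ] SlotSpace N m →ₗ[ℂ] ℂ)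
    (hψ : ∀ (y : AffineSl m), y.d = 0 → ∀ a b w,
      ψ ⁅y, a⁆ b w + ψ a ⁅y, b⁆ w + ψ a b (slotEnd N m y w) = 0) :
    ∃ F : Coinv (m := m) N A B →ₗ[ℂ] ℂ, ∀ a b w, F (slotMk N m A B a b w) = ψ a b w := by
  let G₁ : MultiLaurent N → A → TensorPow N m →ₗ[ℂ] B →ₗ[ℂ] ℂ := fun p a =>
    LinearMap.mk₂ ℂ (fun v b => ψ a b (p ⊗ₜ v))
      (fun v w b => by rw [TensorProduct.tmul_add, map_add])
      (fun c v b => by rw [TensorProduct.tmul_smul, map_smul])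
      (fun v b c => by rw [map_add, LinearMap.add_apply])
      (fun c v b => by rw [map_smul, LinearMap.smul_apply])
  have hG₁ : ∀ p a v b, G₁ p a v b = ψ a b (p ⊗ₜ v) := fun p a v b => rfl
  let G₂ : MultiLaurent N →ₗ[ℂ] A →ₗ[ℂ] (TensorPow N m ⊗[ℂ] B) →ₗ[ℂ] ℂ :=
    LinearMap.mk₂ ℂ (fun p a => TensorProduct.lift (G₁ p a))
      (fun p q a => TensorProduct.ext' fun v b => by
        simp only [TensorProduct.lift.tmul, LinearMap.add_apply, hG₁, TensorProduct.add_tmul, map_add])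
      (fun c p a => TensorProduct.ext' fun v b => by
        simp only [TensorProduct.lift.tmul, LinearMap.smul_apply, hG₁, ← TensorProduct.smul_tmul', map_smul])
      (fun p a a' => TensorProduct.ext' fun v b => by
        simp only [TensorProduct.lift.tmul, LinearMap.add_apply, hG₁, map_add])
      (fun c p a => TensorProduct.ext' fun v b => by
        simp only [TensorProduct.lift.tmul, LinearMap.smul_apply, hG₁, map_smul])
  let G₃ : MultiLaurent N →ₗ[ℂ] (A ⊗[ℂ] (TensorPow N m ⊗[ℂ] B)) →ₗ[ℂ] ℂ :=
    { toFun := fun p => TensorProduct.lift (G₂ p)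
      map_add' := fun p q => TensorProduct.ext' fun a x => by
        simp only [TensorProduct.lift.tmul, LinearMap.add_apply, map_add]
      map_smul' := fun c p => TensorProduct.ext' fun a x => by
        simp only [TensorProduct.lift.tmul, LinearMap.smul_apply, map_smul, RingHom.id_apply] }
  let G : BigSpace N m A B →ₗ[ℂ] ℂ := TensorProduct.lift G₃
  have hG : ∀ a b w, G (slotIncl N m a b w) = ψ a b w := fun a b w => by
    induction w using TensorProduct.induction_on with
    | zero => simp only [map_zero]
    | add v w hv hw => simp only [map_add, hv, hw]
    | tmul p v =>
      rw [slotIncl_tmul]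
      change TensorProduct.lift (G₁ p a) (v ⊗ₜ b) = _
      rw [TensorProduct.lift.tmul]
      rfl
  have hker : coinvSub N A B ≤ LinearMap.ker G := by
    rw [coinvSub, Submodule.span_le]
    rintro _ ⟨y, u, hy, rfl⟩
    have h0 : G ∘ₗ thetaDiag N A B y = 0 := bigSpace_hom_ext fun p a v b => by
      rw [LinearMap.comp_apply, ← slotIncl_tmul, thetaDiag_slotIncl, map_add, map_add, hG, hG, hG,
        hψ y hy]
      rfl
    exact LinearMap.congr_fun h0 u
  exact ⟨(coinvSub N A B).liftQ G hker, fun a b w => hG a b w⟩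

open AffineSl in
theorem nil_d {ε : ℤ} {y : AffineSl m} (hy : y ∈ nil m ε) : y.d = 0 := by
  induction hy using Submodule.span_induction with
  | mem x h => obtain ⟨_, _, _, _, rfl⟩ := h; rfl
  | zero => rfl
  | add x y _ _ hx hy => rw [add_d, hx, hy, add_zero]
  | smul a x _ hx => rw [smul_d, hx, mul_zero]

open AffineSl in
-- Modulo the diagonal action, `𝔫_+` can be moved from the second module to the middle factor,
-- because it kills `a₀`; this reduces `b` to `b₀`. Then `𝔫_-` is moved off the first module, at the
-- cost of acting on the other factors, which are already arbitrary.
theorem slotMk_surjective (a₀ : A) (b₀ : B)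
    (hA : ∀ S : Submodule ℂ A, a₀ ∈ S → (∀ y ∈ nil m (-1), ∀ v ∈ S, ⁅y, v⁆ ∈ S) → ∀ v, v ∈ S)
    (hB : ∀ S : Submodule ℂ B, b₀ ∈ S → (∀ y ∈ nil m (-(-1)), ∀ v ∈ S, ⁅y, v⁆ ∈ S) → ∀ v, v ∈ S)
    (h₀ : ∀ y ∈ nil m 1, ⁅y, a₀⁆ = 0) : Function.Surjective (slotMk N m A B a₀ b₀) := by
  let Φ := slotMk N m A B
  let R : Submodule ℂ (Coinv (m := m) N A B) := LinearMap.range (Φ a₀ b₀)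
  have s1 : ∀ (b : B) (w : SlotSpace N m), Φ a₀ b w ∈ R := by
    intro b
    let S : Submodule ℂ B :=
      { carrier := {b | ∀ w, Φ a₀ b w ∈ R}
        add_mem' := fun {b b'} hb hb' w => by
          rw [map_add, LinearMap.add_apply]; exact R.add_mem (hb w) (hb' w)
        zero_mem' := fun w => by rw [map_zero, LinearMap.zero_apply]; exact R.zero_mem
        smul_mem' := fun c b hb w => by
          rw [map_smul, LinearMap.smul_apply]; exact R.smul_mem c (hb w) }
    refine hB S (fun w => ⟨w, rfl⟩) (fun y hy b hb w => ?_) b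
    rw [neg_neg] at hy
    have h := slotMk_lie (nil_d hy) a₀ b w
    rw [h₀ y hy, map_zero, LinearMap.zero_apply,
      LinearMap.zero_apply, zero_add, add_eq_zero_iff_eq_neg] at h
    have h2 := R.neg_mem (hb (slotEnd N m y w))
    rwa [← h] at h2
  have s2 : ∀ (a : A) (b : B) (w : SlotSpace N m), Φ a b w ∈ R := by
    intro a
    let S : Submodule ℂ A :=
      { carrier := {a | ∀ b w, Φ a b w ∈ R}
        add_mem' := fun {a a'} ha ha' b w => by
          rw [map_add, LinearMap.add_apply, LinearMap.add_apply]
          exact R.add_mem (ha b w) (ha' b w)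
        zero_mem' := fun b w => by
          rw [map_zero, LinearMap.zero_apply, LinearMap.zero_apply]; exact R.zero_mem
        smul_mem' := fun c a ha b w => by
          rw [map_smul, LinearMap.smul_apply, LinearMap.smul_apply]; exact R.smul_mem c (ha b w) }
    refine hA S s1 (fun y hy a ha b w => ?_) a
    have h := slotMk_lie (nil_d hy) a b w
    rw [add_assoc, add_eq_zero_iff_eq_neg] at h
    have h2 := R.neg_mem (R.add_mem (ha ⁅y, b⁆ w) (ha b (slotEnd N m y w)))
    rwa [← h] at h2
  exact fun x => mem_of_slotMk R s2 x

/-- The weight of `e_J`. -/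
def tensorWeight (J : Fin N → Fin m) : Module.Dual ℂ (CartanBar m) := ∑ i, eBar (J i)

open AffineSl in
-- Elements of `𝔥bar` lie in the derived algebra, so the invariance relation multiplies this class
-- by the difference between the weight of `e_J` and `λ - μ`.
theorem slotMk_slotBasis_eq_zero {lam mu : Weight m} (a₀ : A) (b₀ : B)
    (ha : ∀ h : Cartan m, ⁅h.incl, a₀⁆ = mu h • a₀)
    (hb : ∀ h : Cartan m, ⁅h.incl, b₀⁆ = (-lam) h • b₀) (x : (Fin N → ℤ) × (Fin N → Fin m))
    (hx : lam.bar - mu.bar ≠ tensorWeight x.2) :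
    slotMk N m A B a₀ b₀ (slotBasis N m x) = 0 := by
  obtain ⟨h, hh⟩ : ∃ h, (lam.bar - mu.bar) h ≠ tensorWeight x.2 h := by
    by_contra hc
    push Not at hc
    exact hx (LinearMap.ext hc)
  have h3 := slotMk_lie (N := N) (y := Cartan.incl (h, 0, 0)) (by
    simp [Cartan.incl, tmul]) a₀ b₀ (slotBasis N m x)
  rw [ha, hb, slotEnd_incl, map_smul, map_smul, map_smul,
    LinearMap.smul_apply, LinearMap.smul_apply, LinearMap.smul_apply, ← add_smul, ← add_smul] at h3
  refine (smul_eq_zero.mp h3).resolve_left fun h4 => hh ?_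
  simp only [tensorWeight, LinearMap.sum_apply]
  simp only [mul_zero, add_zero, LinearMap.neg_apply] at h4
  rw [LinearMap.sub_apply]
  change lam (h, 0, 0) - mu (h, 0, 0) = _
  linear_combination -h4

end Coinvariants

/-! ### A basis of the coinvariants of two Verma modules -/

section MModule

open AffineSl

variable {N m : ℕ} (lam mu : Weight m)

/-- The map from `SlotSpace` to `M(λ, μ)` given by the two vacuum vectors. -/
def vacMk (N : ℕ) : SlotSpace N m →ₗ[ℂ] MModule N lam mu :=
  slotMk N m (HighestVerma mu) (LowestVerma lam) (VermaModule.vac (nPos m) mu)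
    (VermaModule.vac (nNeg m) (-lam))

theorem vacMk_surjective : Function.Surjective (vacMk lam mu N) :=
  slotMk_surjective (VermaModule.vac (nPos m) mu) (VermaModule.vac (nNeg m) (-lam))
    (VermaModule.nil_induction one_ne_zero nPos_eq_nil)
    (VermaModule.nil_induction (ε := -1) (by norm_num) nNeg_eq_nil)
    fun _ hy => VermaModule.lie_vac_of_mem (nPos_eq_nil.symm ▸ hy)

theorem vacMk_eq_zero (x : (Fin N → ℤ) × (Fin N → Fin m))
    (hx : lam.bar - mu.bar ≠ tensorWeight x.2) : vacMk lam mu N (slotBasis N m x) = 0 :=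
  slotMk_slotBasis_eq_zero _ _ (fun h => VermaModule.lie_vac_incl h)
    (fun h => VermaModule.lie_vac_incl h) x hx

/-- The classes of the `z^η ⊗ e_J` of the right weight are linearly independent. -/
theorem exists_vacMk_functional (hl : lam.level = mu.level) (x : (Fin N → ℤ) × (Fin N → Fin m))
    (hx : lam.bar - mu.bar = tensorWeight x.2) :
    ∃ F : MModule N lam mu →ₗ[ℂ] ℂ, ∀ w, F (vacMk lam mu N w) = (slotBasis N m).repr w x := by
  -- The coinvariants involve only the derived algebra, so the action of `d` on the middle factor
  -- may be shifted by a scalar. This `κ` makes `z^η ⊗ e_J` of weight `λ - μ` for `d` too, so that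
  -- its coordinate functional extends to a form invariant under the whole affine algebra.
  let κ : ℂ := lam (0, 0, 1) - mu (0, 0, 1) - ∑ i, (x.1 i : ℂ)
  let dmap : AffineSl m →ₗ[ℂ] ℂ :=
    { toFun := fun y => y.d
      map_add' := fun _ _ => rfl
      map_smul' := fun _ _ => rfl }
  let ω : AffineSl m →ₗ[ℂ] Module.End ℂ (SlotSpace N m) :=
    slotEnd N m + dmap.smulRight (κ • (1 : Module.End ℂ (SlotSpace N m)))
  have hω0 : ∀ y w, ω y w = slotEnd N m y w + (y.d * κ) • w := fun y w => by
    change slotEnd N m y w + y.d • κ • w = _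
    rw [smul_smul]
  have hω : ∀ y z, ω ⁅y, z⁆ = ω y * ω z - ω z * ω y := fun y z => by
    refine LinearMap.ext fun w => ?_
    rw [LinearMap.sub_apply, Module.End.mul_apply, Module.End.mul_apply]
    simp only [hω0, lie_d, slotEnd_lie, map_add, map_smul, LinearMap.sub_apply, Module.End.mul_apply,
      smul_add, smul_smul]
    module
  let p : SlotSpace N m →ₗ[ℂ] ℂ := (slotBasis N m).coord x
  have hp : ∀ (h : Cartan m) w, p (ω h.incl w) = (lam h - mu h) * p w := by
    intro h w
    have e : p ∘ₗ ω h.incl = (lam h - mu h) • p := by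
      refine (slotBasis N m).ext fun x' => ?_
      rw [LinearMap.comp_apply, hω0, slotEnd_incl, ← add_smul, map_smul, LinearMap.smul_apply,
        show p (slotBasis N m x') = Finsupp.single x' 1 x from by
          rw [← (slotBasis N m).repr_self]; rfl, Finsupp.single_apply]
      split_ifs with hxx
      · subst hxx
        have hd : h.incl.d = h.2.2 := by simp [Cartan.incl, tmul, central, degree]
        have hdec : h = (h.1, 0, 0) + h.2.1 • ((0, 1, 0) : Cartan m) + h.2.2 • ((0, 0, 1) : Cartan m) := by
          refine Prod.ext ?_ (Prod.ext ?_ ?_) <;> simp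
        -- The levels agree, so `c` contributes nothing, in accordance with its zero action on the
        -- middle factor.
        have e1 : lam h - mu h = (lam.bar - mu.bar) h.1 + h.2.2 * (lam (0, 0, 1) - mu (0, 0, 1)) := by
          have e2 : ∀ ν : Weight m, ν h = ν.bar h.1 + h.2.1 * ν.level + h.2.2 * ν (0, 0, 1) := fun ν => by
            conv_lhs => rw [hdec]
            rw [map_add, map_add, map_smul, map_smul]
            rfl
          rw [e2 lam, e2 mu, hl, LinearMap.sub_apply]
          ring
        rw [hd, e1, hx, tensorWeight, LinearMap.sum_apply, Finset.sum_add_distrib, ← Finset.sum_mul]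
        simp only [κ, smul_eq_mul]
        ring
      · simp
    exact LinearMap.congr_fun e w
  obtain ⟨ψ, h1, h2⟩ := exists_invariant_form ω hω lam mu p hp
  obtain ⟨F, hF⟩ := exists_coinv_functional (N := N) ψ (fun y hy a b w => by
    have h3 := h2 y a b w
    rwa [hω0, hy, zero_mul, zero_smul, add_zero] at h3)
  exact ⟨F, fun w => (hF _ _ w).trans (by rw [h1]; rfl)⟩

end MModule

/-! ### Coordinates of classical weights -/

section Weights

open AffineSl

variable {m : ℕ}

theorem cartan_eq_sum (h : CartanBar m) : h = ∑ p, h.val.val p p • cartanUnit p := by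
  refine Subtype.ext ?_
  rw [AddSubmonoidClass.coe_finsetSum]
  conv_lhs => rw [sl_eq_sum h.val]
  refine Finset.sum_congr rfl fun p _ => ?_
  rw [Finset.sum_eq_single p (fun q _ hq => by rw [h.property hq.symm, zero_smul])
    (fun hp => absurd (Finset.mem_univ p) hp)]
  rfl

theorem Weight.bar_apply (mu : Weight m) (h : CartanBar m) :
    mu.bar h = ∑ p, h.val.val p p * mu.coord p := by
  conv_lhs => rw [cartan_eq_sum h]
  rw [map_sum]
  refine Finset.sum_congr rfl fun p _ => ?_
  rw [map_smul, smul_eq_mul]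
  rfl

theorem slUnit_diag (p a : Fin m) :
    (slUnit p p).val a a = (if p = a then 1 else 0) - 1 / (m : ℂ) := by
  rw [slUnit_val, if_pos rfl, Matrix.sub_apply, Matrix.smul_apply, Matrix.one_apply_eq,
    Matrix.single_apply]
  simp

/-- The diagonal entries of the units `slUnit p p` form the matrix `δ - 1/m`, which is symmetric; so
this is the expansion of `μ` at `cartanUnit a`. It turns `½ ∑ e_pp ⊗ e_pp` into half a coordinate of
the weight. -/
theorem sum_slUnit_mul_coord (mu : Weight m) (a : Fin m) :
    ∑ p, (slUnit p p).val a a * mu.coord p = mu.coord a := by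
  have h := mu.bar_apply (cartanUnit a)
  rw [show mu.coord a = mu.bar (cartanUnit a) from rfl, h]
  refine Finset.sum_congr rfl fun p _ => ?_
  change _ = (slUnit a a).val p p * _
  rw [slUnit_diag, slUnit_diag]
  simp [eq_comm]

end Weights

section TensorBasis

variable {N m : ℕ}

theorem slotHom_single_tensorBasis (j : Fin N) (p q : Fin m) (J : Fin N → Fin m) :
    slotHom j (Matrix.single q p 1) (tensorBasis N m J) =
      if p = J j then tensorBasis N m (Function.update J j q) else 0 := by
  rw [tensorBasis_apply, slotHom_tprod, single_mulVec_single]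
  split_ifs with h
  · rw [tensorBasis_apply]
    congr 1
    ext k : 1
    rcases eq_or_ne k j with rfl | hk
    · rw [Function.update_self, Function.update_self]
    · rw [Function.update_of_ne hk, Function.update_of_ne hk]
  · exact MultilinearMap.map_coord_zero _ j (Function.update_self _ _ _)

theorem permHom_tensorBasis (w : Equiv.Perm (Fin N)) (J : Fin N → Fin m) :
    permHom w (tensorBasis N m J) = tensorBasis N m (J ∘ w.symm) := by
  rw [tensorBasis_apply, tensorBasis_apply, permHom_tprod]
  rfl

end TensorBasis

/-! ### Eigenvalues of the Dunkl operators on vacuum vectors -/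

namespace KZData

open AffineSl

variable {N m : ℕ} {ℓ : ℂ} {E : Type} [AddCommGroup E] [Module ℂ E] (D : KZData N m ℓ E)

/-- An embedding of `SlotSpace` in `E` as the space of vectors which are highest weight vectors for
one end and lowest weight vectors for the other end. -/
structure IsVacuum (lam mu : Weight m) (inc : SlotSpace N m →ₗ[ℂ] E) : Prop where
  P_inc : ∀ F w, D.P F (inc w) = inc (slotPoly N m F w)
  S_inc : ∀ F w, D.S F (inc w) = inc (slotTens N m F w)
  f_pos : ∀ y ∈ nPos m, ∀ w, D.f y (inc w) = 0
  g_neg : ∀ y ∈ nNeg m, ∀ w, D.g y (inc w) = 0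
  f_incl : ∀ (h : Cartan m) w, D.f h.incl (inc w) = mu h • inc w
  g_incl : ∀ (h : Cartan m) w, D.g h.incl (inc w) = -(lam h • inc w)

namespace IsVacuum

variable {D} {lam mu : Weight m} {inc : SlotSpace N m →ₗ[ℂ] E} (V : D.IsVacuum lam mu inc)

include V

theorem ev_inc (i : Fin N) (y : AffineSl m) (w : SlotSpace N m) :
    D.ev i y (inc w) = inc (slotEval N m i y w) := by
  rw [ev, slotEval, evalAct_apply, evalAct_apply, LinearMap.add_apply, LinearMap.add_apply, map_add,
    LinearMap.smul_apply, LinearMap.smul_apply, map_smul, V.P_inc]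
  congr 1
  change (∑ p : Fin m, ∑ q : Fin m, D.P _ * D.S _ : Module.End ℂ E) (inc w) =
    inc ((∑ p : Fin m, ∑ q : Fin m, slotPoly N m _ * slotTens N m _ :
      Module.End ℂ (SlotSpace N m)) w)
  simp only [LinearMap.sum_apply, map_sum, Module.End.mul_apply, V.P_inc, V.S_inc]

theorem ev_incl (i : Fin N) (h : Cartan m) (J : Fin N → Fin m) :
    D.ev i h.incl (inc (slotBasis N m (0, J))) =
      eBar (J i) h.1 • inc (slotBasis N m (0, J)) := by
  rw [V.ev_inc, slotEval_incl, map_smul]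
  simp

theorem ev_diag (i : Fin N) (p : Fin m) (J : Fin N → Fin m) :
    D.ev i (unit 0 p p) (inc (slotBasis N m (0, J))) =
      (slUnit p p).val (J i) (J i) • inc (slotBasis N m (0, J)) := by
  rw [← incl_cartanUnit, V.ev_incl]
  rfl

theorem ev_degree (i : Fin N) (J : Fin N → Fin m) :
    D.ev i degree (inc (slotBasis N m (0, J))) = 0 := by
  rw [← incl_degree, V.ev_incl, map_zero, zero_smul]

theorem f_diag (p : Fin m) (w : SlotSpace N m) :
    D.f (unit 0 p p) (inc w) = mu.coord p • inc w := by
  rw [← incl_cartanUnit, V.f_incl]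
  rfl

theorem g_diag (p : Fin m) (w : SlotSpace N m) :
    D.g (unit 0 p p) (inc w) = -(lam.coord p • inc w) := by
  rw [← incl_cartanUnit, V.g_incl]
  rfl

/-- Every term with a first leg in `𝔫_+` kills the highest weight vector. The terms with `c` and `d`
vanish as well, since `d` kills constant polynomials and `c` acts by zero at an inner place. The
diagonal half of `rbar` remains. -/
theorem rUnivLin_f (i : Fin N) (J : Fin N → Fin m) :
    rUnivLin (D.jointlySmooth_f i) (inc (slotBasis N m (0, J))) =
      (1 / 2 * mu.coord (J i)) • inc (slotBasis N m (0, J)) := by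
  set u := inc (slotBasis N m (0, J)) with hu
  have hpos : ∀ y ∈ nil m 1, ∀ z, D.f y (D.ev i z u) = 0 := fun y hy z => by
    rw [hu, V.ev_inc, V.f_pos y (by rwa [nPos_eq_nil])]
  change rUnivOp D.f (D.ev i) u = _
  have h1 : ∀ n : ℕ, casimirOp ((n : ℤ) + 1) D.f (D.ev i) u = 0 := fun n => by
    simp only [casimirOp, LinearMap.sum_apply, Module.End.mul_apply]
    refine Finset.sum_eq_zero fun p _ => Finset.sum_eq_zero fun q _ => hpos _ (unit_mem_nil ?_) _
    rw [one_mul]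
    exact deg_pos_of_pos p q (by omega)
  have h2 : rBarOp D.f (D.ev i) u = (1 / 2 * mu.coord (J i)) • u := by
    rw [rBarOp, LinearMap.add_apply, LinearMap.smul_apply, LinearMap.sum_apply]
    have h3 : (∑ p : Fin m, ∑ q : Fin m,
        if p < q then D.f (unit 0 p q) * D.ev i (unit 0 q p) else 0) u = 0 := by
      simp only [LinearMap.sum_apply]
      refine Finset.sum_eq_zero fun p _ => Finset.sum_eq_zero fun q _ => ?_
      split_ifs with hpq
      · refine hpos _ (unit_mem_nil ?_) _
        rw [deg]
        have : p.val < q.val := hpq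
        omega
      · rfl
    rw [h3, add_zero, mul_smul, ← sum_slUnit_mul_coord mu (J i), Finset.sum_smul]
    congr 1
    refine Finset.sum_congr rfl fun p _ => ?_
    rw [Module.End.mul_apply, hu, V.ev_diag, map_smul, V.f_diag, smul_smul]
  rw [rUnivOp, h2, finsum_congr h1, finsum_zero, hu, V.ev_degree, map_zero, ev, evalAct_central,
    LinearMap.zero_apply, map_zero, add_zero, add_zero, smul_zero, add_zero]

/-- Mirror image of the previous computation: the second legs lie in `𝔫_-` and kill the lowest
weight vector, whose weight is `-λ`. -/
theorem rUnivLin_g (i : Fin N) (J : Fin N → Fin m) :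
    rUnivLin (D.jointlySmooth_g i) (inc (slotBasis N m (0, J))) =
      -((1 / 2 * lam.coord (J i)) • inc (slotBasis N m (0, J))) := by
  set u := inc (slotBasis N m (0, J)) with hu
  have hneg : ∀ y ∈ nil m (-1), D.g y u = 0 := fun y hy => by
    rw [hu, V.g_neg y (by rwa [nNeg_eq_nil])]
  change rUnivOp (D.ev i) D.g u = _
  have h1 : ∀ n : ℕ, casimirOp ((n : ℤ) + 1) (D.ev i) D.g u = 0 := fun n => by
    simp only [casimirOp, LinearMap.sum_apply, Module.End.mul_apply]
    refine Finset.sum_eq_zero fun p _ => Finset.sum_eq_zero fun q _ => ?_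
    rw [hneg, map_zero]
    refine unit_mem_nil ?_
    have := deg_neg_of_neg q p (n := -((n : ℤ) + 1)) (by omega)
    omega
  have h2 : rBarOp (D.ev i) D.g u = -((1 / 2 * lam.coord (J i)) • u) := by
    rw [rBarOp, LinearMap.add_apply, LinearMap.smul_apply, LinearMap.sum_apply]
    have h3 : (∑ p : Fin m, ∑ q : Fin m,
        if p < q then D.ev i (unit 0 p q) * D.g (unit 0 q p) else 0) u = 0 := by
      simp only [LinearMap.sum_apply]
      refine Finset.sum_eq_zero fun p _ => Finset.sum_eq_zero fun q _ => ?_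
      split_ifs with hpq
      · rw [Module.End.mul_apply, hneg, map_zero]
        refine unit_mem_nil ?_
        rw [deg]
        have : p.val < q.val := hpq
        omega
      · rfl
    rw [h3, add_zero, mul_smul, ← sum_slUnit_mul_coord lam (J i), Finset.sum_smul, ← smul_neg,
      ← Finset.sum_neg_distrib]
    congr 1
    refine Finset.sum_congr rfl fun p _ => ?_
    rw [Module.End.mul_apply, hu, V.g_diag, map_neg, map_smul, V.ev_diag, smul_smul, mul_comm]
  rw [rUnivOp, h2, finsum_congr h1, finsum_zero, ev, evalAct_central,
    LinearMap.zero_apply, D.g_central, LinearMap.neg_apply, LinearMap.smul_apply,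
    Module.End.one_apply, map_neg, map_smul, hu, V.ev_degree]
  simp

/-- The value of `ρbar^∨` on the weight of the `a`-th basis vector is half the number of larger
indices minus half the number of smaller ones; `d` gives nothing on constants. -/
theorem ev_rhoCheck (i : Fin N) (J : Fin N → Fin m) :
    D.ev i (rhoCheck m) (inc (slotBasis N m (0, J))) =
      (((m : ℂ) - 1) / 2 - (J i).val) • inc (slotBasis N m (0, J)) := by
  have h : ∀ p q : Fin m, D.ev i (if p < q then unit 0 p p - unit 0 q q else 0)
      (inc (slotBasis N m (0, J))) = ((if p = J i then if J i < q then (1 : ℂ) else 0 else 0) -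
        if q = J i then if p < J i then (1 : ℂ) else 0 else 0) • inc (slotBasis N m (0, J)) := by
    intro p q
    by_cases hpq : p < q
    · rw [if_pos hpq, map_sub, LinearMap.sub_apply, V.ev_diag, V.ev_diag, slUnit_diag, slUnit_diag,
        ← sub_smul]
      congr 1
      by_cases h1 : p = J i
      · subst h1; simp [hpq, hpq.ne']
      · by_cases h2 : q = J i
        · subst h2; simp [hpq, hpq.ne]; ring
        · simp [h1, h2]
    · rw [if_neg hpq, map_zero, LinearMap.zero_apply, eq_comm]
      convert zero_smul ℂ _
      by_cases h1 : p = J i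
      · subst h1
        simp [hpq]
      · by_cases h2 : q = J i
        · subst h2; simp [hpq, h1]
        · simp [h1, h2]
  rw [rhoCheck, map_add, map_smul, map_smul, map_sum, LinearMap.add_apply, LinearMap.smul_apply,
    LinearMap.smul_apply, V.ev_degree, smul_zero, add_zero, LinearMap.sum_apply]
  simp only [map_sum, LinearMap.sum_apply, h]
  simp only [← Finset.sum_smul, smul_smul]
  congr 1
  simp only [Finset.sum_sub_distrib]
  rw [Finset.sum_comm (f := fun p q => if p = J i then if J i < q then (1 : ℂ) else 0 else 0)]
  simp only [Finset.sum_ite_eq', Finset.mem_univ, if_true]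
  rw [Finset.sum_boole, Finset.sum_boole, Finset.filter_lt_eq_Ioi, Finset.filter_gt_eq_Iio, Fin.card_Ioi,
    Fin.card_Iio]
  have : ((m - 1 - (J i).val : ℕ) : ℂ) = (m : ℂ) - 1 - (J i).val := by
    have := (J i).isLt
    rw [Nat.cast_sub (by omega), Nat.cast_sub (by omega), Nat.cast_one]
  rw [this]
  ring

/-- Divided differences kill constants, and on `e_J` the only surviving term of the `r`-matrix is
the one that exchanges the two entries. -/
theorem exch_inc {i j : Fin N} (hij : i ≠ j) (J : Fin N → Fin m) :
    D.exch i j (inc (slotBasis N m (0, J))) =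
      rCoeff (J j) (J i) • D.perm (Equiv.swap i j) (inc (slotBasis N m (0, J))) := by
  have h1 : permHom (Equiv.swap i j) (tensorBasis N m J) =
      tensorBasis N m (Function.update (Function.update J j (J i)) i (J j)) := by
    rw [permHom_tensorBasis]
    congr 1
    ext k
    rw [Function.comp_apply, Equiv.symm_swap]
    rcases eq_or_ne k i with rfl | hk
    · rw [Equiv.swap_apply_left, Function.update_self]
    · rw [Function.update_of_ne hk]
      rcases eq_or_ne k j with rfl | hk'
      · rw [Equiv.swap_apply_right, Function.update_self]
      · rw [Equiv.swap_apply_of_ne_of_ne hk hk', Function.update_of_ne hk']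
  have h2 : rSlot i j (tensorBasis N m J) =
      rCoeff (J j) (J i) • permHom (Equiv.swap i j) (tensorBasis N m J) := by
    rw [h1, rSlot]
    simp only [LinearMap.sum_apply, LinearMap.smul_apply, Module.End.mul_apply,
      slotHom_single_tensorBasis]
    rw [Finset.sum_eq_single (J j) (fun p _ hp => Finset.sum_eq_zero fun q _ => by
      rw [if_neg hp, map_zero, smul_zero]) (fun h => absurd (Finset.mem_univ _) h)]
    rw [Finset.sum_eq_single (J i) (fun q _ hq => by
      rw [if_pos rfl, slotHom_single_tensorBasis, Function.update_of_ne hij, if_neg hq, smul_zero])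
      (fun h => absurd (Finset.mem_univ _) h)]
    rw [if_pos rfl, slotHom_single_tensorBasis, Function.update_of_ne hij, if_pos rfl]
  have h3 : slotBasis N m (0, J) = 1 ⊗ₜ tensorBasis N m J := slotBasis_apply _
  rw [exch, exchange, LinearMap.sub_apply, perm, tauOp, Module.End.mul_apply, Module.End.mul_apply,
    V.S_inc, V.S_inc, V.P_inc, V.P_inc, h3]
  change inc (1 ⊗ₜ rSlot i j _) - inc (divDiff i j 1 ⊗ₜ _) = _ • inc (permPoly _ 1 ⊗ₜ permHom _ _)
  rw [divDiff_one hij, TensorProduct.zero_tmul, map_zero, sub_zero, h2, map_one,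
    TensorProduct.tmul_smul, map_smul]

theorem perm_inc (w : Equiv.Perm (Fin N)) (η : Fin N → ℤ) (J : Fin N → Fin m) :
    D.perm w (inc (slotBasis N m (η, J))) =
      inc (slotBasis N m (η ∘ w.symm, J ∘ w.symm)) := by
  rw [perm, tauOp, Module.End.mul_apply, V.S_inc, V.P_inc, slotBasis_apply, slotBasis_apply]
  change inc (permPoly w (expMon η) ⊗ₜ permHom w (tensorBasis N m J)) = _
  rw [permPoly_expMon, permHom_tensorBasis]
  rfl

theorem pmul_inc (θ η : Fin N → ℤ) (J : Fin N → Fin m) :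
    D.pmul (expMon θ) (inc (slotBasis N m (η, J))) = inc (slotBasis N m (θ + η, J)) := by
  rw [pmul, V.P_inc, slotBasis_apply, slotBasis_apply, expMon_add]
  rfl

/-- The eigenvalues of the Dunkl operators on the vacuum vector. -/
theorem dOp_inc (k : Fin N) {J : Fin N → Fin m} (hJ : Monotone J) :
    D.dOp k (inc (slotBasis N m (0, J))) =
      (1 / 2 * (mu.coord (J k) + lam.coord (J k)) + (((m : ℂ) - 1) / 2 - (J k).val) +
        ∑ j ∈ Finset.univ.erase k, if J j = J k then if j < k then (1 / 2 : ℂ) else -(1 / 2) else 0) •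
        inc (slotBasis N m (0, J)) := by
  have h1 : (∑ j : Fin N, if j < k then D.perm (Equiv.swap k j) else 0) =
      ∑ j ∈ Finset.univ.erase k, if j < k then D.perm (Equiv.swap k j) else 0 := by
    rw [← Finset.sum_erase_add _ _ (Finset.mem_univ k), if_neg (lt_irrefl k), add_zero]
  rw [dOp, eOp, zOp, h1]
  simp only [LinearMap.add_apply, LinearMap.sub_apply]
  rw [V.rUnivLin_f, V.rUnivLin_g, V.ev_rhoCheck, add_smul, Finset.sum_smul]
  -- Monotonicity of `J` does the work. If `J j < J k` then `j < k`, and the permutation from `exch`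
  -- cancels the one added in `dOp`. If `J j > J k` both are absent. If they agree the permutation
  -- acts trivially and `±1/2` is left.
  have h2 : (∑ j ∈ Finset.univ.erase k, if j < k then D.perm (Equiv.swap k j) else 0)
      (inc (slotBasis N m (0, J))) - (∑ j ∈ Finset.univ.erase k, D.exch k j)
      (inc (slotBasis N m (0, J))) = ∑ j ∈ Finset.univ.erase k,
        (if J j = J k then if j < k then (1 / 2 : ℂ) else -(1 / 2) else 0) •
          inc (slotBasis N m (0, J)) := by
    rw [LinearMap.sum_apply, LinearMap.sum_apply, ← Finset.sum_sub_distrib]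
    refine Finset.sum_congr rfl fun j hj => ?_
    have hjk : j ≠ k := Finset.ne_of_mem_erase hj
    rw [V.exch_inc hjk.symm]
    rcases lt_trichotomy (J j) (J k) with h | h | h
    · have hlt : j < k := lt_of_not_ge fun hle => absurd (hJ hle) h.not_ge
      simp [hlt, h.ne, rCoeff, h]
    · have hs : D.perm (Equiv.swap k j) (inc (slotBasis N m (0, J))) = inc (slotBasis N m (0, J)) := by
        rw [V.perm_inc]
        congr 3
        ext i
        simp only [Function.comp_apply, Equiv.symm_swap]
        rcases eq_or_ne i k with rfl | hik
        · rw [Equiv.swap_apply_left, h]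
        · rcases eq_or_ne i j with rfl | hij
          · rw [Equiv.swap_apply_right, h]
          · rw [Equiv.swap_apply_of_ne_of_ne hik hij]
      rw [hs, h]
      by_cases hlt : j < k
      · simp only [hlt, if_true, hs, rCoeff, lt_irrefl, if_false]
        module
      · simp only [hlt, if_true, LinearMap.zero_apply, rCoeff, lt_irrefl, if_false]
        module
    · have hlt : ¬ j < k := fun hlt => absurd (hJ hlt.le) h.not_ge
      simp [hlt, h.ne', rCoeff, h.not_gt]
  rw [← h2]
  module

end IsVacuum

end KZData

/-! ### The extended affine Weyl group -/

namespace AffWeyl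

variable {N : ℕ}

theorem transl_mul_perm (x : AffWeyl N) :
    transl (Multiplicative.toAdd x.left) * perm x.right = x :=
  SemidirectProduct.inl_left_mul_inr_right x

theorem transl_add (η θ : Fin N → ℤ) : transl (η + θ) = transl η * transl θ :=
  map_mul (SemidirectProduct.inl (φ := permMulAut N)) (Multiplicative.ofAdd η)
    (Multiplicative.ofAdd θ)

theorem transl_zero : transl (0 : Fin N → ℤ) = 1 :=
  map_one (SemidirectProduct.inl (φ := permMulAut N))

theorem transl_neg (η : Fin N → ℤ) : transl (-η) = (transl η)⁻¹ :=
  map_inv (SemidirectProduct.inl (φ := permMulAut N)) (Multiplicative.ofAdd η)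

theorem perm_mul (w w' : Equiv.Perm (Fin N)) : perm (w * w') = perm w * perm w' :=
  map_mul SemidirectProduct.inr w w'

theorem perm_one : perm (1 : Equiv.Perm (Fin N)) = 1 := map_one SemidirectProduct.inr

theorem perm_inv (w : Equiv.Perm (Fin N)) : perm w⁻¹ = (perm w)⁻¹ :=
  map_inv SemidirectProduct.inr w

theorem perm_mul_transl (w : Equiv.Perm (Fin N)) (η : Fin N → ℤ) :
    perm w * transl η = transl (permLattice w η) * perm w := by
  have h := SemidirectProduct.inl_aut (φ := permMulAut N) w (Multiplicative.ofAdd η)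
  rw [eq_comm, map_inv, mul_inv_eq_iff_eq_mul] at h
  exact h

theorem permLattice_swap_single (i j : Fin N) :
    permLattice (Equiv.swap i j) (Pi.single i 1) = Pi.single j 1 := by
  ext k
  change (Pi.single i 1 : Fin N → ℤ) ((Equiv.swap i j).symm k) = _
  rw [Equiv.symm_swap, Pi.single_apply, Pi.single_apply]
  refine if_congr ?_ rfl rfl
  rw [Equiv.swap_apply_eq_iff, Equiv.swap_apply_left]

theorem act_perm (w : Equiv.Perm (Fin N)) (ξ : TPrime N) : (perm w).act ξ = (ξ.1 ∘ w.symm, ξ.2) := by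
  refine Prod.ext rfl ?_
  change ξ.2 - ∑ j : Fin N, (((0 : Fin N → ℤ) j : ℤ) : ℂ) * _ = ξ.2
  simp

theorem act_piElt (f : Fin N) (ξ : TPrime N) : (piElt f).act ξ =
    (ξ.1 ∘ (finRotate N).symm, ξ.2 - ξ.1 ((finRotate N).symm f)) := by
  have h1 : (piElt f).right = finRotate N := by simp [piElt, transl, perm]
  have h2 : (piElt f).left = Multiplicative.ofAdd (Pi.single f 1) := by simp [piElt, transl, perm]
  rw [act, h1, h2]
  refine Prod.ext rfl ?_
  simp [Pi.single_apply]

theorem act_one (ξ : TPrime N) : (1 : AffWeyl N).act ξ = ξ := by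
  rw [← perm_one, act_perm]
  rfl

theorem act_mul (x y : AffWeyl N) (ξ : TPrime N) : (x * y).act ξ = x.act (y.act ξ) := by
  refine Prod.ext rfl ?_
  simp only [act, SemidirectProduct.mul_left, SemidirectProduct.mul_right]
  have h : ∑ j : Fin N, (Multiplicative.toAdd y.left j : ℂ) * ξ.1 (y.right.symm j) =
      ∑ j : Fin N, (Multiplicative.toAdd y.left (x.right.symm j) : ℂ) *
        ξ.1 (y.right.symm (x.right.symm j)) :=
    (Equiv.sum_comp x.right.symm fun j =>
      (Multiplicative.toAdd y.left j : ℂ) * ξ.1 (y.right.symm j)).symm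
  have h2 : ∀ j, Multiplicative.toAdd (x.left * (permMulAut N x.right) y.left) j =
      Multiplicative.toAdd x.left j + Multiplicative.toAdd y.left (x.right.symm j) := fun j => rfl
  have h3 : ∀ j, (x.right * y.right).symm j = y.right.symm (x.right.symm j) := fun j => rfl
  simp only [h2, h3, Int.cast_add, add_mul, Finset.sum_add_distrib, h, Function.comp_apply]
  ring

theorem act_inv_act (x : AffWeyl N) (ξ : TPrime N) : x⁻¹.act (x.act ξ) = ξ := by
  rw [← act_mul, inv_mul_cancel, act_one]

theorem act_act_inv (x : AffWeyl N) (ξ : TPrime N) : x.act (x⁻¹.act ξ) = ξ := by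
  rw [← act_mul, mul_inv_cancel, act_one]

theorem perm_mem_closure {G : Subgroup (AffWeyl N)}
    (hs : ∀ i j : Fin N, i.val + 1 = j.val → perm (Equiv.swap i j) ∈ G)
    (w : Equiv.Perm (Fin N)) : perm w ∈ G := by
  cases N with
  | zero =>
    rw [Subsingleton.elim w 1, perm_one]
    exact G.one_mem
  | succ n =>
    have h : (⊤ : Submonoid (Equiv.Perm (Fin (n + 1)))) ≤
        G.toSubmonoid.comap (SemidirectProduct.inr : _ →* AffWeyl (n + 1)) := by
      rw [← Equiv.Perm.mclosure_swap_castSucc_succ, Submonoid.closure_le]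
      rintro _ ⟨i, rfl⟩
      exact hs _ _ (by simp)
    exact h (Submonoid.mem_top w)

/-- The extended affine Weyl group is generated by the simple reflections of the finite Weyl group
and `π`. -/
theorem mem_of_generators {G : Subgroup (AffWeyl N)}
    (hs : ∀ i j : Fin N, i.val + 1 = j.val → perm (Equiv.swap i j) ∈ G) (f : Fin N)
    (hpi : piElt f ∈ G) (x : AffWeyl N) : x ∈ G := by
  have hp := perm_mem_closure hs
  have h1 : transl (Pi.single f 1) ∈ G := by
    have := G.mul_mem hpi (G.inv_mem (hp (finRotate N)))
    rwa [piElt, mul_inv_cancel_right] at this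
  have h2 : ∀ i, transl (Pi.single i 1) ∈ G := fun i => by
    have h3 := G.mul_mem (G.mul_mem (hp (Equiv.swap f i)) h1) (G.inv_mem (hp (Equiv.swap f i)))
    rw [perm_mul_transl, mul_inv_cancel_right] at h3
    rwa [permLattice_swap_single] at h3
  let A : AddSubgroup (Fin N → ℤ) :=
    { carrier := {η | transl η ∈ G}
      add_mem' := fun {a b} ha hb => by
        change transl (a + b) ∈ G
        rw [transl_add]; exact G.mul_mem ha hb
      zero_mem' := by
        change transl 0 ∈ G
        rw [transl_zero]; exact G.one_mem
      neg_mem' := fun {a} ha => by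
        change transl (-a) ∈ G
        rw [transl_neg]; exact G.inv_mem ha }
  have h3 : ∀ η, η ∈ A := fun η => by
    rw [← Finset.univ_sum_single η]
    refine A.sum_mem fun i _ => ?_
    have h4 : (Pi.single i (η i) : Fin N → ℤ) = η i • Pi.single i 1 := by
      rw [← Pi.single_smul, smul_eq_mul, mul_one]
    rw [h4]
    exact A.zsmul_mem (h2 i) _
  rw [← transl_mul_perm x]
  exact G.mul_mem (h3 _) (hp _)

/-- `s_0 = π s_{N-1} π⁻¹`. -/
theorem sZero_mul_piElt {f k l : Fin N} (hf : f.val = 0) (hl : l.val + 1 = N)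
    (hk : k.val + 1 = l.val) :
    sZero f l * piElt f = piElt f * perm (Equiv.swap k l) := by
  have h1 : finRotate N l = f := KZData.finRotate_apply_last hf hl
  have h2 : finRotate N k = l := Fin.ext (by rw [KZData.finRotate_val (by omega), hk])
  have h3 : finRotate N * Equiv.swap k l = Equiv.swap f l * finRotate N := by
    rw [Equiv.mul_swap_eq_swap_mul, h1, h2, Equiv.swap_comm]
  rw [sZero, piElt, mul_assoc, ← mul_assoc (perm _), perm_mul_transl, permLattice_swap_single, mul_assoc, ← mul_assoc
    (transl _), ← transl_add, sub_add_cancel, ← perm_mul, ← h3, perm_mul, mul_assoc]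

end AffWeyl

/-- Operators satisfying the relations of the degenerate double affine Hecke algebra between its
two subalgebras, for the simple reflections of the finite Weyl group and for `π`. -/
structure HeckePair (N : ℕ) (R : Type) [Ring R] [Algebra ℂ R] where
  W : AffWeyl N →* R
  T : TPrime N →ₗ[ℂ] R
  simple : ∀ i j : Fin N, i.val + 1 = j.val → ∀ ξ : TPrime N,
    W (AffWeyl.perm (Equiv.swap i j)) * T ξ - T ((AffWeyl.perm (Equiv.swap i j)).act ξ) *
      W (AffWeyl.perm (Equiv.swap i j)) = algebraMap ℂ R (-(ξ.1 i - ξ.1 j))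
  pi : ∀ f : Fin N, f.val = 0 → ∀ ξ : TPrime N,
    W (AffWeyl.piElt f) * T ξ = T ((AffWeyl.piElt f).act ξ) * W (AffWeyl.piElt f)

/-! ### Consequences of the relations for simple reflections and `π` -/

namespace HeckePair

variable {N : ℕ} {R : Type} [Ring R] [Algebra ℂ R] (H : HeckePair N R)

theorem W_inv_mul (x : AffWeyl N) : H.W x⁻¹ * H.W x = 1 := by rw [← map_mul, inv_mul_cancel, map_one]

theorem W_mul_inv (x : AffWeyl N) : H.W x * H.W x⁻¹ = 1 := by rw [← map_mul, mul_inv_cancel, map_one]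

theorem T_mul_pi {f : Fin N} (hf : f.val = 0) (ξ : TPrime N) :
    H.T ξ * H.W (AffWeyl.piElt f) = H.W (AffWeyl.piElt f) * H.T ((AffWeyl.piElt f)⁻¹.act ξ) := by
  rw [H.pi f hf, AffWeyl.act_act_inv]

theorem T_mul_pi_inv {f : Fin N} (hf : f.val = 0) (ξ : TPrime N) :
    H.T ξ * H.W (AffWeyl.piElt f)⁻¹ =
      H.W (AffWeyl.piElt f)⁻¹ * H.T ((AffWeyl.piElt f).act ξ) := by
  have h : H.W (AffWeyl.piElt f)⁻¹ * (H.W (AffWeyl.piElt f) * H.T ξ) * H.W (AffWeyl.piElt f)⁻¹ =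
      H.W (AffWeyl.piElt f)⁻¹ * (H.T ((AffWeyl.piElt f).act ξ) * H.W (AffWeyl.piElt f)) *
        H.W (AffWeyl.piElt f)⁻¹ := by rw [H.pi f hf]
  rwa [← mul_assoc, H.W_inv_mul, one_mul, mul_assoc, mul_assoc (H.T _), H.W_mul_inv, mul_one] at h

theorem swap_inv (i j : Fin N) : (AffWeyl.perm (Equiv.swap i j))⁻¹ = AffWeyl.perm (Equiv.swap i j) := by
  rw [← AffWeyl.perm_inv, Equiv.swap_inv]

theorem T_mul_swap {i j : Fin N} (hij : i.val + 1 = j.val) (ξ : TPrime N) :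
    H.T ξ * H.W (AffWeyl.perm (Equiv.swap i j)) =
      H.W (AffWeyl.perm (Equiv.swap i j)) * H.T ((AffWeyl.perm (Equiv.swap i j)).act ξ) -
        algebraMap ℂ R (ξ.1 i - ξ.1 j) := by
  have h := H.simple i j hij ((AffWeyl.perm (Equiv.swap i j)).act ξ)
  have h2 : (AffWeyl.perm (Equiv.swap i j)).act ((AffWeyl.perm (Equiv.swap i j)).act ξ) = ξ := by
    have := AffWeyl.act_inv_act (AffWeyl.perm (Equiv.swap i j)) ξ
    rwa [swap_inv] at this
  rw [h2, AffWeyl.act_perm] at h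
  simp only [Function.comp_apply, Equiv.symm_swap, Equiv.swap_apply_left, Equiv.swap_apply_right,
    neg_sub] at h
  rw [AffWeyl.act_perm, ← h, Equiv.symm_swap, sub_sub_cancel]

/-- The relation for the affine reflection. -/
theorem affine {f l : Fin N} (hf : f.val = 0) (hl : l.val + 1 = N) (ξ : TPrime N) :
    H.W (AffWeyl.sZero f l) * H.T ξ -
      H.T ((AffWeyl.sZero f l).act ξ) * H.W (AffWeyl.sZero f l) =
        algebraMap ℂ R (-(-(ξ.1 f - ξ.1 l))) := by
  -- For `N = 1` the first and last index coincide, `s_0` is the identity and both sides vanish.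
  rcases Nat.eq_zero_or_pos l.val with h0 | h0
  · have hfl : f = l := Fin.ext (by omega)
    have hs : AffWeyl.sZero f l = 1 := by
      rw [AffWeyl.sZero, hfl, sub_self, AffWeyl.transl_zero, Equiv.swap_self, one_mul]
      exact AffWeyl.perm_one
    rw [hs, AffWeyl.act_one, map_one, one_mul, mul_one, sub_self, hfl, sub_self, neg_zero, neg_zero,
      map_zero]
  · obtain ⟨k, hk⟩ : ∃ k : Fin N, k.val + 1 = l.val :=
      ⟨⟨l.val - 1, by omega⟩, by simp only; omega⟩
    set x := AffWeyl.piElt f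
    set s := AffWeyl.perm (Equiv.swap k l)
    -- The relation for `s_0` is the one for the last simple reflection, conjugated by `π`.
    have hz : AffWeyl.sZero f l = x * s * x⁻¹ := by
      rw [eq_mul_inv_iff_mul_eq]
      exact AffWeyl.sZero_mul_piElt hf hl hk
    set ζ := x⁻¹.act ξ with hζ
    have hξ : x.act ζ = ξ := AffWeyl.act_act_inv x ξ
    have h1 := H.simple k l hk ζ
    have h2 : x⁻¹.act ξ = ζ := rfl
    have h3 : ζ.1 k = ξ.1 l := by
      rw [← hξ, AffWeyl.act_piElt]
      refine congrArg ζ.1 ?_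
      rw [Equiv.eq_symm_apply]
      exact Fin.ext (by rw [KZData.finRotate_val (by omega), hk])
    have h4 : ζ.1 l = ξ.1 f := by
      rw [← hξ, AffWeyl.act_piElt]
      refine congrArg ζ.1 ?_
      rw [Equiv.eq_symm_apply]
      exact KZData.finRotate_apply_last hf hl
    rw [h3, h4] at h1
    have h5 : H.W x⁻¹ * H.T ξ = H.T ζ * H.W x⁻¹ := by
      rw [H.T_mul_pi_inv hf, hξ]
    rw [hz, AffWeyl.act_mul, AffWeyl.act_mul, h2, map_mul, map_mul, mul_assoc, h5,
      ← mul_assoc (H.T _), ← mul_assoc (H.T _), ← H.pi f hf, ← mul_assoc, mul_assoc (H.W x),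
      mul_assoc (H.W x) (H.T _), ← sub_mul, ← mul_sub, h1,
      ← Algebra.commutes _ (H.W x), mul_assoc, H.W_mul_inv, mul_one]
    congr 1
    ring

/-- The commutators `[T ξ, T η]` are equivariant. -/
theorem commutator_mul_W {f : Fin N} (hf : f.val = 0) (x : AffWeyl N) (ξ η : TPrime N) :
    (H.T ξ * H.T η - H.T η * H.T ξ) * H.W x =
      H.W x * (H.T (x⁻¹.act ξ) * H.T (x⁻¹.act η) - H.T (x⁻¹.act η) * H.T (x⁻¹.act ξ)) := by
  let c : TPrime N → TPrime N → R := fun ξ η => H.T ξ * H.T η - H.T η * H.T ξ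
  let G : Subgroup (AffWeyl N) :=
    { carrier := {x | ∀ ξ η, c ξ η * H.W x = H.W x * c (x⁻¹.act ξ) (x⁻¹.act η)}
      mul_mem' := fun {x y} hx hy ξ η => by
        rw [map_mul, ← mul_assoc, hx, mul_assoc, hy, ← mul_assoc, mul_inv_rev, AffWeyl.act_mul,
          AffWeyl.act_mul]
      one_mem' := fun ξ η => by
        rw [map_one, mul_one, one_mul, inv_one, AffWeyl.act_one, AffWeyl.act_one]
      inv_mem' := fun {x} hx ξ η => by
        have h := hx (x.act ξ) (x.act η)
        rw [AffWeyl.act_inv_act, AffWeyl.act_inv_act] at h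
        calc c ξ η * H.W x⁻¹ = H.W x⁻¹ * (H.W x * c ξ η) * H.W x⁻¹ := by
              rw [← mul_assoc, H.W_inv_mul, one_mul]
          _ = _ := by rw [← h, mul_assoc, mul_assoc, H.W_mul_inv, mul_one, inv_inv] }
  refine AffWeyl.mem_of_generators (G := G) (fun i j hij ξ η => ?_) f (fun ξ η => ?_) x ξ η
  · set s := AffWeyl.perm (Equiv.swap i j) with hs
    rw [swap_inv]
    -- The difference between `ξ` and its reflection is a multiple of the coroot. Thus the
    -- correction terms in the two products are multiples of `T` of one and the same coroot, and
    -- they cancel in the commutator.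
    have hT : ∀ ξ : TPrime N, H.T ξ = H.T (s.act ξ) + (ξ.1 i - ξ.1 j) •
        H.T (Pi.single i 1 - Pi.single j 1, 0) := by
      intro ξ
      rw [← map_smul, ← map_add, hs, AffWeyl.act_perm]
      congr 1
      refine Prod.ext (funext fun k => ?_) (by simp)
      have hne : i ≠ j := fun h => by rw [h] at hij; omega
      simp only [Prod.smul_mk, Prod.fst_add, Pi.add_apply, Function.comp_apply, Equiv.symm_swap,
        Pi.smul_apply, Pi.sub_apply, smul_eq_mul, Pi.single_apply]
      rcases eq_or_ne k i with rfl | hki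
      · simp [hne]
      · rcases eq_or_ne k j with rfl | hkj
        · simp [hne.symm]
        · simp [hki, hkj, Equiv.swap_apply_of_ne_of_ne]
    change (H.T ξ * H.T η - H.T η * H.T ξ) * H.W s = H.W s *
      (H.T (s.act ξ) * H.T (s.act η) - H.T (s.act η) * H.T (s.act ξ))
    have e : ∀ ξ η, H.T ξ * H.T η * H.W s = H.W s * (H.T (s.act ξ) * H.T (s.act η)) -
        (ξ.1 i - ξ.1 j) • H.T (s.act η) - (η.1 i - η.1 j) • H.T ξ := by
      intro ξ η
      rw [mul_assoc, H.T_mul_swap hij, mul_sub, ← mul_assoc, H.T_mul_swap hij, sub_mul, mul_assoc,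
        ← Algebra.commutes, ← Algebra.smul_def, ← Algebra.smul_def]
    rw [sub_mul, e, e, hT ξ, hT η, mul_sub]
    module
  · have e : ∀ ξ η, H.T ξ * H.T η * H.W (AffWeyl.piElt f) = H.W (AffWeyl.piElt f) *
        (H.T ((AffWeyl.piElt f)⁻¹.act ξ) * H.T ((AffWeyl.piElt f)⁻¹.act η)) := by
      intro ξ η
      rw [mul_assoc, H.T_mul_pi hf, ← mul_assoc, H.T_mul_pi hf, mul_assoc]
    change (H.T ξ * H.T η - H.T η * H.T ξ) * _ = _
    rw [sub_mul, e, e, ← mul_sub]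

end HeckePair

/-- The span of the `W`-orbit of a joint eigenvector of the `T ξ` is stable under the `T ξ`. -/
theorem HeckePair.T_mem_span {N : ℕ} {X : Type} [AddCommGroup X] [Module ℂ X]
    (H : HeckePair N (Module.End ℂ X)) {f : Fin N} (hf : f.val = 0) {v₀ : X} {ζ : TPrime N → ℂ}
    (hv : ∀ ξ, H.T ξ v₀ = ζ ξ • v₀) (ξ : TPrime N) {v : X}
    (hvS : v ∈ Submodule.span ℂ (Set.range fun x => H.W x v₀)) :
    H.T ξ v ∈ Submodule.span ℂ (Set.range fun x => H.W x v₀) := by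
  set S := Submodule.span ℂ (Set.range fun x => H.W x v₀) with hS
  have hW : ∀ x, ∀ v ∈ S, H.W x v ∈ S := fun x v hv => by
    have h : S ≤ S.comap (H.W x) := by
      rw [hS, Submodule.span_le]
      rintro _ ⟨y, rfl⟩
      refine Submodule.subset_span ⟨x * y, ?_⟩
      simp only [map_mul, Module.End.mul_apply]
    exact h hv
  -- The vectors of `S` that every `T ξ` maps into `S`. It contains the eigenvector, and stability
  -- under `W` makes it all of `S`.
  let S' : Submodule ℂ X :=
    { carrier := {v | v ∈ S ∧ ∀ ξ, H.T ξ v ∈ S}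
      add_mem' := fun ha hb => ⟨S.add_mem ha.1 hb.1, fun ξ => by
        rw [map_add]; exact S.add_mem (ha.2 ξ) (hb.2 ξ)⟩
      zero_mem' := ⟨S.zero_mem, fun ξ => by rw [map_zero]; exact S.zero_mem⟩
      smul_mem' := fun c a ha => ⟨S.smul_mem c ha.1, fun ξ => by
        rw [map_smul]; exact S.smul_mem c (ha.2 ξ)⟩ }
  -- Inverses are included in the condition so that `G` is a subgroup and only generators of `W`
  -- have to be checked.
  let G : Subgroup (AffWeyl N) :=
    { carrier := {x | (∀ v ∈ S', H.W x v ∈ S') ∧ ∀ v ∈ S', H.W x⁻¹ v ∈ S'}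
      mul_mem' := fun {x y} hx hy => ⟨fun v hv => by
          rw [map_mul, Module.End.mul_apply]; exact hx.1 _ (hy.1 _ hv),
        fun v hv => by
          rw [mul_inv_rev, map_mul, Module.End.mul_apply]; exact hy.2 _ (hx.2 _ hv)⟩
      one_mem' := ⟨fun v hv => by rwa [map_one], fun v hv => by rwa [inv_one, map_one]⟩
      inv_mem' := fun {x} hx => ⟨hx.2, by rw [inv_inv]; exact hx.1⟩ }
  have hG : ∀ x, x ∈ G := by
    refine AffWeyl.mem_of_generators (fun i j hij => ?_) f ?_
    · have h : ∀ v ∈ S', H.W (AffWeyl.perm (Equiv.swap i j)) v ∈ S' := fun v hv =>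
        ⟨hW _ _ hv.1, fun ξ => by
          rw [← Module.End.mul_apply, H.T_mul_swap hij, LinearMap.sub_apply, Module.End.mul_apply,
            Module.algebraMap_end_apply]
          exact S.sub_mem (hW _ _ (hv.2 _)) (S.smul_mem _ hv.1)⟩
      exact ⟨h, by rw [swap_inv]; exact h⟩
    · refine ⟨fun v hv => ⟨hW _ _ hv.1, fun ξ => ?_⟩, fun v hv => ⟨hW _ _ hv.1, fun ξ => ?_⟩⟩
      · rw [← Module.End.mul_apply, H.T_mul_pi hf, Module.End.mul_apply]
        exact hW _ _ (hv.2 _)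
      · rw [← Module.End.mul_apply, H.T_mul_pi_inv hf, Module.End.mul_apply]
        exact hW _ _ (hv.2 _)
  have h0 : v₀ ∈ S := Submodule.subset_span ⟨1, by simp only [map_one, Module.End.one_apply]⟩
  have h1 : v₀ ∈ S' := ⟨h0, fun ξ => by rw [hv]; exact S.smul_mem _ h0⟩
  have h2 : S ≤ S' := by
    conv_lhs => rw [hS]
    rw [Submodule.span_le]
    rintro _ ⟨x, rfl⟩
    exact (hG x).1 _ h1
  exact (h2 hvS).2 ξ

/-! ### The degenerate double affine Hecke algebra and its representations -/

namespace DDAHA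

variable {N : ℕ}

theorem w_one : (w 1 : DDAHA N) = 1 := by
  rw [w, RingQuot.mkAlgHom_rel ℂ HeckeRel.w_one, map_one]

theorem w_mul (x y : AffWeyl N) : w (x * y) = w x * w y := by
  rw [w, RingQuot.mkAlgHom_rel ℂ (HeckeRel.w_mul x y), map_mul]
  rfl

theorem t_add (ξ η : TPrime N) : t (ξ + η) = t ξ + t η := by
  rw [t, RingQuot.mkAlgHom_rel ℂ (HeckeRel.t_add ξ η), map_add]
  rfl

theorem t_smul (a : ℂ) (ξ : TPrime N) : t (a • ξ) = a • t ξ := by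
  rw [t, RingQuot.mkAlgHom_rel ℂ (HeckeRel.t_smul a ξ), map_smul]
  rfl

theorem algHom_ext {R : Type} [Ring R] [Algebra ℂ R] {ρ ρ' : DDAHA N →ₐ[ℂ] R}
    (hw : ∀ x, ρ (w x) = ρ' (w x)) (ht : ∀ ξ, ρ (t ξ) = ρ' (t ξ)) : ρ = ρ' := by
  refine RingQuot.ringQuot_ext' ℂ _ _ (FreeAlgebra.hom_ext (funext fun s => ?_))
  rcases s with x | ξ
  · exact hw x
  · exact ht ξ

/-- A submodule containing `v` and stable under the generators contains the orbit of `v`. -/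
theorem smul_mem_of_generators {X : Type} [AddCommGroup X] [Module ℂ X]
    (ρ : DDAHA N →ₐ[ℂ] Module.End ℂ X) (S : Submodule ℂ X)
    (hw : ∀ x, ∀ v ∈ S, ρ (w x) v ∈ S) (ht : ∀ ξ, ∀ v ∈ S, ρ (t ξ) v ∈ S) (h : DDAHA N) :
    ∀ v ∈ S, ρ h v ∈ S := by
  obtain ⟨a, rfl⟩ := RingQuot.mkAlgHom_surjective ℂ HeckeRel h
  induction a using FreeAlgebra.induction with
  | grade0 r =>
    intro v hv
    rw [AlgHom.commutes, AlgHom.commutes, Module.algebraMap_end_apply]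
    exact S.smul_mem r hv
  | grade1 s =>
    rcases s with x | ξ
    · exact hw x
    · exact ht ξ
  | mul a b ha hb =>
    intro v hv
    rw [map_mul, map_mul]
    exact ha _ (hb v hv)
  | add a b ha hb =>
    intro v hv
    rw [map_add, map_add]
    exact S.add_mem (ha v hv) (hb v hv)

end DDAHA

namespace HeckePair

variable {N : ℕ} {R : Type} [Ring R] [Algebra ℂ R]

/-- The generators of the degenerate double affine Hecke algebra. -/
def universal (N : ℕ) : HeckePair N (DDAHA N) where
  W := { toFun := DDAHA.w, map_one' := DDAHA.w_one, map_mul' := DDAHA.w_mul }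
  T := { toFun := DDAHA.t, map_add' := DDAHA.t_add, map_smul' := DDAHA.t_smul }
  simple i j hij ξ := by
    have h := RingQuot.mkAlgHom_rel ℂ (HeckeRel.simple i j hij ξ)
    rwa [map_sub, map_mul, map_mul, AlgHom.commutes] at h
  pi f hf ξ := by
    have h := RingQuot.mkAlgHom_rel ℂ (HeckeRel.pi f hf ξ)
    rwa [map_mul, map_mul] at h

/-- The image of a pair under a homomorphism of algebras. -/
def map {R' : Type} [Ring R'] [Algebra ℂ R'] (φ : R →ₐ[ℂ] R') (H : HeckePair N R) :
    HeckePair N R' where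
  W := φ.toRingHom.toMonoidHom.comp H.W
  T := φ.toLinearMap ∘ₗ H.T
  simple i j hij ξ := by
    have h := congrArg φ (H.simple i j hij ξ)
    rwa [map_sub, map_mul, map_mul, AlgHom.commutes] at h
  pi f hf ξ := by
    have h := congrArg φ (H.pi f hf ξ)
    rwa [map_mul, map_mul] at h

variable (H : HeckePair N R)

/-- The homomorphism from the free algebra attached to a pair. -/
def freeHom : HeckeFree N →ₐ[ℂ] R := FreeAlgebra.lift ℂ (Sum.elim H.W H.T)

theorem freeHom_w (x : AffWeyl N) : H.freeHom (HeckeFree.w x) = H.W x :=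
  FreeAlgebra.lift_ι_apply _ _

theorem freeHom_t (ξ : TPrime N) : H.freeHom (HeckeFree.t ξ) = H.T ξ :=
  FreeAlgebra.lift_ι_apply _ _

/-- The homomorphism from the degenerate double affine Hecke algebra attached to a pair with
commuting `T ξ`. -/
def toAlgHom (hT : ∀ ξ η, H.T ξ * H.T η = H.T η * H.T ξ) : DDAHA N →ₐ[ℂ] R :=
  RingQuot.liftAlgHom ℂ ⟨H.freeHom, fun a b hab => by
    cases hab with
    | w_one => rw [freeHom_w, map_one, map_one]
    | w_mul x y => rw [map_mul, freeHom_w, freeHom_w, freeHom_w, map_mul]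
    | t_add ξ η => rw [map_add, freeHom_t, freeHom_t, freeHom_t, map_add]
    | t_smul a ξ => rw [map_smul, freeHom_t, freeHom_t, map_smul]
    | t_comm ξ η => rw [map_mul, map_mul, freeHom_t, freeHom_t, hT]
    | simple i j hij ξ =>
      rw [map_sub, map_mul, map_mul, freeHom_w, freeHom_t, freeHom_t, H.simple i j hij,
        AlgHom.commutes]
    | affine f l hf hl ξ =>
      rw [map_sub, map_mul, map_mul, freeHom_w, freeHom_t, freeHom_t, H.affine hf hl,
        AlgHom.commutes]
    | pi f hf ξ => rw [map_mul, map_mul, freeHom_w, freeHom_t, freeHom_t, H.pi f hf]⟩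

theorem toAlgHom_w (hT : ∀ ξ η, H.T ξ * H.T η = H.T η * H.T ξ) (x : AffWeyl N) :
    H.toAlgHom hT (DDAHA.w x) = H.W x :=
  (RingQuot.liftAlgHom_mkAlgHom_apply ℂ _ _ _).trans (H.freeHom_w x)

theorem toAlgHom_t (hT : ∀ ξ η, H.T ξ * H.T η = H.T η * H.T ξ) (ξ : TPrime N) :
    H.toAlgHom hT (DDAHA.t ξ) = H.T ξ :=
  (RingQuot.liftAlgHom_mkAlgHom_apply ℂ _ _ _).trans (H.freeHom_t ξ)

section End

variable {X : Type} [AddCommGroup X] [Module ℂ X] (H : HeckePair N (Module.End ℂ X))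

/-- The induced pair of operators on a quotient. -/
def descend (Q : Submodule ℂ X) (hW : ∀ x, ∀ v ∈ Q, H.W x v ∈ Q) (hT : ∀ ξ, ∀ v ∈ Q, H.T ξ v ∈ Q) :
    HeckePair N (Module.End ℂ (X ⧸ Q)) where
  W :=
    { toFun := fun x => Q.mapQ Q (H.W x) (hW x)
      map_one' := Submodule.linearMap_qext _ (LinearMap.ext fun v => by
        change Q.mkQ (H.W 1 v) = Q.mkQ v
        rw [map_one]
        rfl)
      map_mul' := fun x y => Submodule.linearMap_qext _ (LinearMap.ext fun v => by
        change Q.mkQ (H.W (x * y) v) = Q.mkQ (H.W x (H.W y v))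
        rw [map_mul]
        rfl) }
  T :=
    { toFun := fun ξ => Q.mapQ Q (H.T ξ) (hT ξ)
      map_add' := fun ξ η => Submodule.linearMap_qext _ (LinearMap.ext fun v => by
        change Q.mkQ (H.T (ξ + η) v) = Q.mkQ (H.T ξ v) + Q.mkQ (H.T η v)
        rw [map_add, LinearMap.add_apply, map_add])
      map_smul' := fun a ξ => Submodule.linearMap_qext _ (LinearMap.ext fun v => by
        change Q.mkQ (H.T (a • ξ) v) = a • Q.mkQ (H.T ξ v)
        rw [map_smul, LinearMap.smul_apply, map_smul]) }
  simple i j hij ξ := Submodule.linearMap_qext _ (LinearMap.ext fun v => by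
    have h := congrArg Q.mkQ (LinearMap.congr_fun (H.simple i j hij ξ) v)
    rw [LinearMap.sub_apply, map_sub] at h
    exact h)
  pi f hf ξ := Submodule.linearMap_qext _ (LinearMap.ext fun v =>
    congrArg Q.mkQ (LinearMap.congr_fun (H.pi f hf ξ) v))

/-- The `T ξ` commute if the module is generated under `W` by joint eigenvectors. -/
theorem T_comm_of_span {f : Fin N} (hf : f.val = 0) {ι : Type} (b : ι → X)
    (hb : ∀ i ξ, ∃ c : ℂ, H.T ξ (b i) = c • b i)
    (hspan : ∀ v, v ∈ Submodule.span ℂ (Set.range fun p : AffWeyl N × ι => H.W p.1 (b p.2)))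
    (ξ η : TPrime N) : H.T ξ * H.T η = H.T η * H.T ξ := by
  rw [← sub_eq_zero]
  refine LinearMap.ext fun v => ?_
  refine Submodule.span_induction (p := fun v _ => (H.T ξ * H.T η - H.T η * H.T ξ) v = 0)
    ?_ (map_zero _) (fun _ _ _ _ h h' => by rw [map_add, h, h', add_zero])
    (fun a _ _ h => by rw [map_smul, h, smul_zero]) (hspan v)
  rintro _ ⟨⟨x, i⟩, rfl⟩
  change ((H.T ξ * H.T η - H.T η * H.T ξ) * H.W x) (b i) = 0
  rw [H.commutator_mul_W hf]
  obtain ⟨c, hc⟩ := hb i (x⁻¹.act ξ)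
  obtain ⟨d, hd⟩ := hb i (x⁻¹.act η)
  rw [Module.End.mul_apply, LinearMap.sub_apply, Module.End.mul_apply, Module.End.mul_apply, hc, hd,
    map_smul, map_smul, hc, hd, smul_comm c d, sub_self, map_zero]

end End

end HeckePair

/-! ### The Dunkl operators as a representation on the coinvariants -/

namespace KZData

variable {N m : ℕ} {ℓ : ℂ} {E : Type} [AddCommGroup E] [Module ℂ E] (D : KZData N m ℓ E)

theorem pmul_add (η θ : Fin N → ℤ) :
    D.pmul (expMon (η + θ)) = D.pmul (expMon η) * D.pmul (expMon θ) := by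
  rw [pmul, expMon_add, map_mul, map_mul]

theorem perm_mul_pmul (w : Equiv.Perm (Fin N)) (η : Fin N → ℤ) :
    D.perm w * D.pmul (expMon η) = D.pmul (expMon (permLattice w η)) * D.perm w := by
  rw [← permPoly_expMon]
  exact tauOp_mul_mulP D.hPS w _

/-- The action of `W` and `𝔱'` by permutations, multiplications and Cherednik-Dunkl operators. -/
def heckePair (D : KZData N m ℓ E) : HeckePair N (Module.End ℂ E) where
  W :=
    { toFun := fun x => D.pmul (expMon (Multiplicative.toAdd x.left)) * D.perm x.right
      map_one' := by
        change D.pmul (expMon 0) * D.perm 1 = 1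
        rw [perm, tauOp_one, pmul, expMon_zero, map_one, map_one, one_mul]
      map_mul' := fun x y => by
        change D.pmul (expMon (Multiplicative.toAdd x.left +
          permLattice x.right (Multiplicative.toAdd y.left))) * D.perm (x.right * y.right) = _
        rw [pmul_add, perm_mul, mul_assoc, mul_assoc, ← mul_assoc (D.pmul (expMon (permLattice _ _))),
          ← perm_mul_pmul, mul_assoc] }
  T := D.dXi ∘ₗ LinearMap.fst ℂ (Fin N → ℂ) ℂ +
    (LinearMap.toSpanSingleton ℂ (Module.End ℂ E) ((ℓ + m : ℂ) • 1)) ∘ₗ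
      LinearMap.snd ℂ (Fin N → ℂ) ℂ
  simple i j hij ξ := by
    change D.pmul (expMon 0) * D.perm (Equiv.swap i j) * (D.dXi ξ.1 + ξ.2 • (ℓ + m : ℂ) • 1) -
      (D.dXi (AffWeyl.act (AffWeyl.perm (Equiv.swap i j)) ξ).1 +
        (AffWeyl.act (AffWeyl.perm (Equiv.swap i j)) ξ).2 • (ℓ + m : ℂ) • 1) *
        (D.pmul (expMon 0) * D.perm (Equiv.swap i j)) = _
    rw [AffWeyl.act_perm, pmul, expMon_zero, map_one, map_one, one_mul, mul_add, add_mul,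
      add_sub_add_comm, swap_mul_dXi D hij, Algebra.algebraMap_eq_smul_one, smul_smul, mul_smul_comm,
      smul_mul_assoc, mul_one, one_mul, sub_self, add_zero]
  pi f hf ξ := by
    obtain ⟨l, hl⟩ : ∃ l : Fin N, l.val + 1 = N :=
      ⟨⟨N - 1, by have := f.isLt; omega⟩, by have := f.isLt; simp only; omega⟩
    have e1 : (AffWeyl.piElt f).left = Multiplicative.ofAdd (Pi.single f 1) := by
      simp [AffWeyl.piElt, AffWeyl.transl, AffWeyl.perm]
    have e2 : (AffWeyl.piElt f).right = finRotate N := by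
      simp [AffWeyl.piElt, AffWeyl.transl, AffWeyl.perm]
    have e3 : D.pmul (expMon (Multiplicative.toAdd (AffWeyl.piElt f).left)) *
        D.perm (AffWeyl.piElt f).right = D.piOp f := by
      rw [e1, e2]
      rfl
    have e4 : (finRotate N).symm f = l := by
      rw [Equiv.symm_apply_eq, finRotate_apply_last hf hl]
    change D.pmul (expMon (Multiplicative.toAdd (AffWeyl.piElt f).left)) *
        D.perm (AffWeyl.piElt f).right * (D.dXi ξ.1 + ξ.2 • (ℓ + m : ℂ) • 1) =
      (D.dXi (AffWeyl.act (AffWeyl.piElt f) ξ).1 +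
        (AffWeyl.act (AffWeyl.piElt f) ξ).2 • (ℓ + m : ℂ) • 1) *
        (D.pmul (expMon (Multiplicative.toAdd (AffWeyl.piElt f).left)) *
        D.perm (AffWeyl.piElt f).right)
    rw [e3, AffWeyl.act_piElt, e4, mul_add, piOp_mul_dXi D hf hl, smul_smul, smul_smul, mul_smul_comm,
      mul_one, sub_mul, smul_mul_assoc, one_mul, add_mul (D.dXi _), smul_mul_assoc, one_mul]
    simp only
    module

theorem heckePair_T (ξ : TPrime N) : D.heckePair.T ξ = D.dXi ξ.1 + ξ.2 • (ℓ + m : ℂ) • 1 := rfl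

theorem heckePair_perm (w : Equiv.Perm (Fin N)) : D.heckePair.W (AffWeyl.perm w) = D.perm w := by
  change D.pmul (expMon 0) * D.perm w = _
  rw [pmul, expMon_zero, map_one, map_one, one_mul]

theorem heckePair_transl (η : Fin N → ℤ) :
    D.heckePair.W (AffWeyl.transl η) = D.pmul (expMon η) := by
  change D.pmul (expMon η) * D.perm 1 = _
  rw [perm, tauOp_one, mul_one]

theorem heckePair_W_mem (x : AffWeyl N) (v : E) (hv : v ∈ D.coinv) : D.heckePair.W x v ∈ D.coinv :=
  D.pmul_mem _ (D.perm_mem _ hv)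

theorem heckePair_T_mem (ξ : TPrime N) (v : E) (hv : v ∈ D.coinv) : D.heckePair.T ξ v ∈ D.coinv :=
  D.coinv.add_mem (D.dXi_mem _ hv) (D.coinv.smul_mem _ (D.coinv.smul_mem _ hv))

/-- The pair of operators on the coinvariants. -/
def coinvPair {Q : Submodule ℂ E} (hQ : D.coinv = Q) : HeckePair N (Module.End ℂ (E ⧸ Q)) :=
  D.heckePair.descend Q (hQ ▸ D.heckePair_W_mem) (hQ ▸ D.heckePair_T_mem)

namespace IsVacuum

variable {D} {lam mu : Weight m} {inc : SlotSpace N m →ₗ[ℂ] E} (V : D.IsVacuum lam mu inc)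

include V

theorem W_inc (η : Fin N → ℤ) (w : Equiv.Perm (Fin N)) (J : Fin N → Fin m) :
    D.heckePair.W (AffWeyl.transl η * AffWeyl.perm w) (inc (slotBasis N m (0, J))) =
      inc (slotBasis N m (η, J ∘ w.symm)) := by
  rw [map_mul, heckePair_perm, heckePair_transl, Module.End.mul_apply, V.perm_inc, V.pmul_inc]
  congr 3
  exact add_zero η

/-- The eigenvalue of the `k`-th Cherednik-Dunkl operator on `inc (slotBasis (0, J))`. -/
theorem T_inc (ξ : TPrime N) {J : Fin N → Fin m} (hJ : Monotone J) :
    D.heckePair.T ξ (inc (slotBasis N m (0, J))) =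
      (∑ k, (1 / 2 * (mu.coord (J k) + lam.coord (J k)) + (((m : ℂ) - 1) / 2 - (J k).val) +
        ∑ j ∈ Finset.univ.erase k, if J j = J k then if j < k then (1 / 2 : ℂ) else -(1 / 2) else 0) *
        ξ.1 k + (ℓ + m) * ξ.2) • inc (slotBasis N m (0, J)) := by
  rw [heckePair_T, LinearMap.add_apply, dXi_apply, LinearMap.sum_apply,
    add_smul (∑ k, _), Finset.sum_smul]
  congr 1
  · refine Finset.sum_congr rfl fun k _ => ?_
    rw [LinearMap.smul_apply, V.dOp_inc k hJ, smul_smul, mul_comm]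
  · rw [LinearMap.smul_apply, LinearMap.smul_apply, Module.End.one_apply, smul_smul, mul_comm]

/-- Replaces the proof that the connection is flat: the classes with nondecreasing `J` are joint
eigenvectors, and translations and permutations carry them to all classes of monomial basis vectors,
which span. -/
theorem T_comm {Q : Submodule ℂ E} (hQ : D.coinv = Q) {f : Fin N} (hf : f.val = 0)
    (hs : Function.Surjective (Q.mkQ ∘ₗ inc)) (ξ η : TPrime N) :
    (D.coinvPair hQ).T ξ * (D.coinvPair hQ).T η = (D.coinvPair hQ).T η * (D.coinvPair hQ).T ξ := by
  refine HeckePair.T_comm_of_span _ hf (ι := {J : Fin N → Fin m // Monotone J})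
    (fun J => Q.mkQ (inc (slotBasis N m (0, J.1)))) (fun J ξ => ⟨_,
    (congrArg Q.mkQ (V.T_inc ξ J.2)).trans (map_smul Q.mkQ _ _)⟩) (fun v => ?_) ξ η
  · obtain ⟨w, rfl⟩ := hs v
    refine Submodule.span_induction (p := fun w _ => (Q.mkQ ∘ₗ inc) w ∈ _) ?_ ?_
      (fun a b _ _ ha hb => ?_) (fun c a _ ha => ?_) ((slotBasis N m).mem_span w)
    · rintro _ ⟨⟨θ, J⟩, rfl⟩
      -- Sorting `J` produces the monotone sequence, and the sorting permutation carries it back to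
      -- `J`.
      refine Submodule.subset_span ⟨(AffWeyl.transl θ * AffWeyl.perm (Tuple.sort J),
        ⟨J ∘ Tuple.sort J, Tuple.monotone_sort J⟩), ?_⟩
      change Q.mkQ (D.heckePair.W _ (inc (slotBasis N m (0, J ∘ Tuple.sort J)))) = _
      rw [V.W_inc, Function.comp_assoc, Equiv.self_comp_symm]
      rfl
    · rw [map_zero]
      exact Submodule.zero_mem _
    · rw [map_add]
      exact Submodule.add_mem _ ha hb
    · rw [map_smul]
      exact Submodule.smul_mem _ _ ha

end IsVacuum

end KZData

/-! ### Existence and uniqueness of the Hecke action -/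

section HeckeAction

variable {N m : ℕ} {A B : Type} [AddCommGroup A] [Module ℂ A] [AddCommGroup B] [Module ℂ B]
  [LieRingModule (AffineSl m) A] [LieModule ℂ (AffineSl m) A]
  [LieRingModule (AffineSl m) B] [LieModule ℂ (AffineSl m) B]
  {ℓ : ℂ} (hA : ∀ a : A, ⁅(AffineSl.central : AffineSl m), a⁆ = ℓ • a)
  (hB : ∀ b : B, ⁅(AffineSl.central : AffineSl m), b⁆ = -(ℓ • b))
  (sA : ∀ a : A, ∃ K : ℕ, ∀ k : ℤ, K ≤ k → ∀ X : 𝔰 m, ⁅AffineSl.tmul k X, a⁆ = 0)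
  (sB : ∀ b : B, ∃ K : ℕ, ∀ k : ℤ, k ≤ -K → ∀ X : 𝔰 m, ⁅AffineSl.tmul k X, b⁆ = 0)

theorem slotIncl_isVacuum {lam mu : Weight m} (a₀ : A) (b₀ : B)
    (ha : ∀ y ∈ nPos m, ⁅y, a₀⁆ = 0) (hb : ∀ y ∈ nNeg m, ⁅y, b₀⁆ = 0)
    (ha' : ∀ h : Cartan m, ⁅h.incl, a₀⁆ = mu h • a₀)
    (hb' : ∀ h : Cartan m, ⁅h.incl, b₀⁆ = (-lam) h • b₀) :
    (kzData N ℓ A B hA hB sA sB).IsVacuum lam mu (slotIncl N m a₀ b₀) where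
  P_inc F w := LinearMap.congr_fun (f := (polyOp N m A B F) ∘ₗ slotIncl N m a₀ b₀)
    (g := slotIncl N m a₀ b₀ ∘ₗ slotPoly N m F) (TensorProduct.ext' fun _ _ => rfl) w
  S_inc F w := LinearMap.congr_fun (f := (tensOp N m A B F) ∘ₗ slotIncl N m a₀ b₀)
    (g := slotIncl N m a₀ b₀ ∘ₗ slotTens N m F) (TensorProduct.ext' fun _ _ => rfl) w
  f_pos y hy w := LinearMap.congr_fun
    (f := (leftOp N m A B (actEnd m A y)) ∘ₗ slotIncl N m a₀ b₀) (g := 0)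
    (TensorProduct.ext' fun p v => by
      change p ⊗ₜ[ℂ] (⁅y, a₀⁆ ⊗ₜ[ℂ] (v ⊗ₜ[ℂ] b₀)) = 0
      rw [ha y hy, TensorProduct.zero_tmul, TensorProduct.tmul_zero]) w
  g_neg y hy w := LinearMap.congr_fun
    (f := (rightOp N m A B (actEnd m B y)) ∘ₗ slotIncl N m a₀ b₀) (g := 0)
    (TensorProduct.ext' fun p v => by
      change p ⊗ₜ[ℂ] (a₀ ⊗ₜ[ℂ] (v ⊗ₜ[ℂ] ⁅y, b₀⁆)) = 0
      rw [hb y hy, TensorProduct.tmul_zero, TensorProduct.tmul_zero, TensorProduct.tmul_zero]) w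
  f_incl h w := LinearMap.congr_fun
    (f := (leftOp N m A B (actEnd m A h.incl)) ∘ₗ slotIncl N m a₀ b₀)
    (g := mu h • slotIncl N m a₀ b₀)
    (TensorProduct.ext' fun p v => by
      change p ⊗ₜ[ℂ] (⁅h.incl, a₀⁆ ⊗ₜ[ℂ] (v ⊗ₜ[ℂ] b₀)) = mu h • p ⊗ₜ[ℂ] (a₀ ⊗ₜ[ℂ] (v ⊗ₜ[ℂ] b₀))
      rw [ha' h, ← TensorProduct.smul_tmul', TensorProduct.tmul_smul]) w
  g_incl h w := LinearMap.congr_fun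
    (f := (rightOp N m A B (actEnd m B h.incl)) ∘ₗ slotIncl N m a₀ b₀)
    (g := -(lam h • slotIncl N m a₀ b₀))
    (TensorProduct.ext' fun p v => by
      change p ⊗ₜ[ℂ] (a₀ ⊗ₜ[ℂ] (v ⊗ₜ[ℂ] ⁅h.incl, b₀⁆)) =
        -(lam h • p ⊗ₜ[ℂ] (a₀ ⊗ₜ[ℂ] (v ⊗ₜ[ℂ] b₀)))
      rw [hb' h, TensorProduct.tmul_smul, TensorProduct.tmul_smul, TensorProduct.tmul_smul,
        LinearMap.neg_apply]
      exact neg_smul (lam h) (p ⊗ₜ[ℂ] (a₀ ⊗ₜ[ℂ] (v ⊗ₜ[ℂ] b₀)))) w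

theorem IsHeckeAction.w_apply {ρ : DDAHA N →ₐ[ℂ] Module.End ℂ (Coinv (m := m) N A B)}
    (hρ : IsHeckeAction ℓ A B ρ) (x : AffWeyl N) (v : BigSpace N m A B) :
    ρ (DDAHA.w x) (coinvMk v) = coinvMk ((kzData N ℓ A B hA hB sA sB).heckePair.W x v) := by
  rw [← AffWeyl.transl_mul_perm x, DDAHA.w_mul, map_mul, Module.End.mul_apply, hρ.perm, hρ.transl,
    map_mul, KZData.heckePair_transl, KZData.heckePair_perm, Module.End.mul_apply]
  exact congrArg coinvMk ((polyOp_mulP _ _).symm.trans (congrArg _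
    (LinearMap.congr_fun (tauOp_eq_tau _).symm v)))

theorem IsHeckeAction.t_apply {ρ : DDAHA N →ₐ[ℂ] Module.End ℂ (Coinv (m := m) N A B)}
    (hρ : IsHeckeAction ℓ A B ρ) (hm : (m : ℂ) ≠ 0) (ξ : TPrime N) (v : BigSpace N m A B) :
    ρ (DDAHA.t ξ) (coinvMk v) = coinvMk ((kzData N ℓ A B hA hB sA sB).heckePair.T ξ v) := by
  obtain ⟨u, hu, h⟩ := hρ.dunkl ξ.1 v
  -- The vector provided by `IsHeckeAction` is only known through its rational image; injectivity of
  -- `toRat` identifies it.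
  have h1 : u = (kzData N ℓ A B hA hB sA sB).dXi ξ.1 v :=
    toRat_injective (hu.trans (toRat_dXi hA hB sA sB hm ξ.1 v).symm)
  have h2 : ξ = (ξ.1, 0) + ξ.2 • ((0, 1) : TPrime N) := by ext <;> simp
  have h3 : DDAHA.t ξ = DDAHA.t (ξ.1, 0) + ξ.2 • DDAHA.t (0, 1) := by
    rw [← DDAHA.t_smul, ← DDAHA.t_add, ← h2]
  rw [h3, map_add, map_smul, hρ.central, LinearMap.add_apply, h, h1, KZData.heckePair_T]
  exact (map_add (coinvSub N A B).mkQ _ _).symm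

theorem exists_heckeAction (hm : (m : ℂ) ≠ 0)
    (hT : ∀ ξ η, ((kzData N ℓ A B hA hB sA sB).coinvPair (kzData_coinv hA hB sA sB)).T ξ *
      ((kzData N ℓ A B hA hB sA sB).coinvPair (kzData_coinv hA hB sA sB)).T η =
      ((kzData N ℓ A B hA hB sA sB).coinvPair (kzData_coinv hA hB sA sB)).T η *
      ((kzData N ℓ A B hA hB sA sB).coinvPair (kzData_coinv hA hB sA sB)).T ξ) :
    ∃ ρ : DDAHA N →ₐ[ℂ] Module.End ℂ (Coinv (m := m) N A B), IsHeckeAction ℓ A B ρ := by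
  set H := (kzData N ℓ A B hA hB sA sB).coinvPair (kzData_coinv hA hB sA sB)
  have hW : ∀ x v, H.toAlgHom hT (DDAHA.w x) (coinvMk v) =
      coinvMk ((kzData N ℓ A B hA hB sA sB).heckePair.W x v) := fun x v =>
    LinearMap.congr_fun (H.toAlgHom_w hT x) (coinvMk v)
  have hT' : ∀ ξ v, H.toAlgHom hT (DDAHA.t ξ) (coinvMk v) =
      coinvMk ((kzData N ℓ A B hA hB sA sB).heckePair.T ξ v) := fun ξ v =>
    LinearMap.congr_fun (H.toAlgHom_t hT ξ) (coinvMk v)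
  refine ⟨H.toAlgHom hT, ⟨?_, fun w v => ?_, fun η v => ?_, fun ξ v =>
    ⟨(kzData N ℓ A B hA hB sA sB).dXi ξ v, toRat_dXi hA hB sA sB hm ξ v, ?_⟩⟩⟩
  · refine Submodule.linearMap_qext _ (LinearMap.ext fun v => (hT' _ v).trans ?_)
    rw [KZData.heckePair_T, map_zero, one_smul, zero_add]
    exact map_smul (coinvSub N A B).mkQ _ _
  · rw [hW, KZData.heckePair_perm]
    exact congrArg coinvMk (LinearMap.congr_fun (tauOp_eq_tau w) v)
  · rw [hW, KZData.heckePair_transl]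
    exact congrArg coinvMk (polyOp_mulP _ _)
  · rw [hT', KZData.heckePair_T]
    congr 1
    rw [zero_smul, add_zero]

/-- Uniqueness holds since the algebra is generated by `W` and `𝔱'`, and `IsHeckeAction` prescribes
these operators on every class. -/
theorem exists_unique_heckeAction_of_vacuum (hm : (m : ℂ) ≠ 0) {f : Fin N} (hf : f.val = 0)
    {lam mu : Weight m} (a₀ : A) (b₀ : B)
    (V : (kzData N ℓ A B hA hB sA sB).IsVacuum lam mu (slotIncl N m a₀ b₀))
    (hs : Function.Surjective (slotMk N m A B a₀ b₀)) :
    ∃! ρ : DDAHA N →ₐ[ℂ] Module.End ℂ (Coinv (m := m) N A B), IsHeckeAction ℓ A B ρ := by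
  obtain ⟨ρ, hρ⟩ := exists_heckeAction hA hB sA sB hm
    (V.T_comm (kzData_coinv hA hB sA sB) hf hs)
  refine ⟨ρ, hρ, fun ρ' hρ' => DDAHA.algHom_ext (fun x => ?_) (fun ξ => ?_)⟩
  · exact Submodule.linearMap_qext _ (LinearMap.ext fun v =>
      (hρ'.w_apply hA hB sA sB x v).trans (hρ.w_apply hA hB sA sB x v).symm)
  · exact Submodule.linearMap_qext _ (LinearMap.ext fun v =>
      (hρ'.t_apply hA hB sA sB hm ξ v).trans (hρ.t_apply hA hB sA sB hm ξ v).symm)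

/-- The eigenvalue of `ξ` on the class of the basis vector attached to a monotone sequence. -/
def vacEigenvalue (ℓ : ℂ) (lam mu : Weight m) (J : Fin N → Fin m) (ξ : TPrime N) : ℂ :=
  ∑ k, (1 / 2 * (mu.coord (J k) + lam.coord (J k)) + (((m : ℂ) - 1) / 2 - (J k).val) +
    ∑ j ∈ Finset.univ.erase k, if J j = J k then if j < k then (1 / 2 : ℂ) else -(1 / 2) else 0) *
    ξ.1 k + (ℓ + m) * ξ.2

theorem IsHeckeAction.w_slotMk {ρ : DDAHA N →ₐ[ℂ] Module.End ℂ (Coinv (m := m) N A B)}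
    (hρ : IsHeckeAction ℓ A B ρ) {lam mu : Weight m} {a₀ : A} {b₀ : B}
    (V : (kzData N ℓ A B hA hB sA sB).IsVacuum lam mu (slotIncl N m a₀ b₀))
    (η : Fin N → ℤ) (w : Equiv.Perm (Fin N)) (J : Fin N → Fin m) :
    ρ (DDAHA.w (AffWeyl.transl η * AffWeyl.perm w)) (slotMk N m A B a₀ b₀ (slotBasis N m (0, J))) =
      slotMk N m A B a₀ b₀ (slotBasis N m (η, J ∘ w.symm)) :=
  (hρ.w_apply hA hB sA sB _ _).trans (congrArg coinvMk (V.W_inc η w J))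

theorem IsHeckeAction.t_slotMk {ρ : DDAHA N →ₐ[ℂ] Module.End ℂ (Coinv (m := m) N A B)}
    (hρ : IsHeckeAction ℓ A B ρ) (hm : (m : ℂ) ≠ 0) {lam mu : Weight m} {a₀ : A} {b₀ : B}
    (V : (kzData N ℓ A B hA hB sA sB).IsVacuum lam mu (slotIncl N m a₀ b₀))
    (ξ : TPrime N) {J : Fin N → Fin m} (hJ : Monotone J) :
    ρ (DDAHA.t ξ) (slotMk N m A B a₀ b₀ (slotBasis N m (0, J))) =
      vacEigenvalue ℓ lam mu J ξ • slotMk N m A B a₀ b₀ (slotBasis N m (0, J)) :=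
  (hρ.t_apply hA hB sA sB hm _ _).trans ((congrArg coinvMk (V.T_inc ξ hJ)).trans
    (map_smul (coinvSub N A B).mkQ _ _))

end HeckeAction

/-! ### Verma modules satisfy the hypotheses -/

section MModule

variable {N m : ℕ} {ℓ : ℂ} {lam mu : Weight m}

theorem highestVerma_central (hmu : mu.level = ℓ) (a : HighestVerma mu) :
    ⁅(AffineSl.central : AffineSl m), a⁆ = ℓ • a :=
  hmu ▸ VermaModule.central_lie_eq a

theorem lowestVerma_central (hlam : lam.level = ℓ) (b : LowestVerma lam) :
    ⁅(AffineSl.central : AffineSl m), b⁆ = -(ℓ • b) :=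
  (VermaModule.central_lie_eq b).trans (hlam ▸ neg_smul (lam (0, 1, 0)) b)

theorem highestVerma_smooth (a : HighestVerma mu) :
    ∃ K : ℕ, ∀ k : ℤ, K ≤ k → ∀ X : 𝔰 m, ⁅AffineSl.tmul k X, a⁆ = 0 := by
  obtain ⟨K, hK⟩ := VermaModule.smooth (Or.inl rfl) AffineSl.nPos_eq_nil a
  exact ⟨K, fun k hk X => (congrArg (fun n => ⁅AffineSl.tmul n X, a⁆) (one_mul k).symm).trans
    (hK k hk X)⟩

theorem lowestVerma_smooth (b : LowestVerma lam) :
    ∃ K : ℕ, ∀ k : ℤ, k ≤ -K → ∀ X : 𝔰 m, ⁅AffineSl.tmul k X, b⁆ = 0 := by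
  obtain ⟨K, hK⟩ := VermaModule.smooth (Or.inr rfl) AffineSl.nNeg_eq_nil b
  exact ⟨K, fun k hk X => (congrArg (fun n => ⁅AffineSl.tmul n X, b⁆)
    (by ring : k = -1 * -k)).trans (hK (-k) (by omega) X)⟩

theorem vac_isVacuum (hlam : lam.level = ℓ) (hmu : mu.level = ℓ) :
    (kzData N ℓ (HighestVerma mu) (LowestVerma lam) (highestVerma_central hmu)
      (lowestVerma_central hlam) highestVerma_smooth lowestVerma_smooth).IsVacuum lam mu
      (slotIncl N m (VermaModule.vac (nPos m) mu) (VermaModule.vac (nNeg m) (-lam))) :=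
  slotIncl_isVacuum _ _ _ _ _ _ (fun _ => VermaModule.lie_vac_of_mem)
    (fun _ => VermaModule.lie_vac_of_mem) VermaModule.lie_vac_incl VermaModule.lie_vac_incl

theorem exists_unique_heckeAction (hm : (m : ℂ) ≠ 0) {f : Fin N} (hf : f.val = 0)
    (hlam : lam.level = ℓ) (hmu : mu.level = ℓ) :
    ∃! ρ : DDAHA N →ₐ[ℂ] Module.End ℂ (MModule N lam mu),
      IsHeckeAction ℓ (HighestVerma mu) (LowestVerma lam) ρ :=
  exists_unique_heckeAction_of_vacuum _ _ _ _ hm hf _ _ (vac_isVacuum hlam hmu)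
    (vacMk_surjective lam mu)

variable {ρ : DDAHA N →ₐ[ℂ] Module.End ℂ (MModule N lam mu)}
  (hρ : IsHeckeAction ℓ (HighestVerma mu) (LowestVerma lam) ρ)
  (hlam : lam.level = ℓ) (hmu : mu.level = ℓ)

include hρ hlam hmu

theorem IsHeckeAction.w_vacMk (η : Fin N → ℤ) (w : Equiv.Perm (Fin N)) (J : Fin N → Fin m) :
    ρ (DDAHA.w (AffWeyl.transl η * AffWeyl.perm w)) (vacMk lam mu N (slotBasis N m (0, J))) =
      vacMk lam mu N (slotBasis N m (η, J ∘ w.symm)) :=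
  hρ.w_slotMk _ _ _ _ (vac_isVacuum hlam hmu) η w J

theorem IsHeckeAction.t_vacMk (hm : (m : ℂ) ≠ 0) (ξ : TPrime N) {J : Fin N → Fin m}
    (hJ : Monotone J) :
    ρ (DDAHA.t ξ) (vacMk lam mu N (slotBasis N m (0, J))) =
      vacEigenvalue ℓ lam mu J ξ • vacMk lam mu N (slotBasis N m (0, J)) :=
  hρ.t_slotMk _ _ _ _ hm (vac_isVacuum hlam hmu) ξ hJ

end MModule

/-! ### Block functions of ordered partitions and parabolic subgroups -/

section Blocks

variable {N m : ℕ} {β : Fin m → ℕ}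

theorem blockStart_add_le {a b : Fin m} (hab : a < b) : blockStart β a + β a ≤ blockStart β b := by
  have h : β a = ∑ c, if c = a then β c else 0 := by simp
  rw [h, blockStart, blockStart, ← Finset.sum_add_distrib]
  refine Finset.sum_le_sum fun c _ => ?_
  rcases lt_trichotomy c a with hc | rfl | hc
  · rw [if_pos hc, if_neg hc.ne, if_pos (hc.trans hab), add_zero]
  · rw [if_neg (lt_irrefl c), if_pos rfl, if_pos hab, zero_add]
  · rw [if_neg hc.not_gt, if_neg hc.ne', zero_add]
    exact Nat.zero_le _

theorem blockStart_add_le_sum (a : Fin m) : blockStart β a + β a ≤ ∑ c, β c := by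
  have h : β a = ∑ c, if c = a then β c else 0 := by simp
  rw [h, blockStart, ← Finset.sum_add_distrib]
  refine Finset.sum_le_sum fun c _ => ?_
  rcases lt_trichotomy c a with hc | rfl | hc
  · rw [if_pos hc, if_neg hc.ne, add_zero]
  · rw [if_neg (lt_irrefl c), if_pos rfl, zero_add]
  · rw [if_neg hc.not_gt, if_neg hc.ne', zero_add]
    exact Nat.zero_le _

theorem exists_inBlock (hβ : ∑ a, β a = N) (k : Fin N) : ∃ a, InBlock β a k := by
  let c : ℕ → ℕ := fun n => ∑ b : Fin m, if b.val < n then β b else 0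
  have h : ∃ n, k.val < c n := ⟨m, by
    have : c m = N := by
      rw [← hβ]
      exact Finset.sum_congr rfl fun b _ => if_pos b.isLt
    rw [this]
    exact k.isLt⟩
  classical
  -- `Nat.find h` is the first partial sum of `β` exceeding `k`; its predecessor is the block of
  -- `k`. Empty blocks are skipped automatically.
  obtain ⟨n, hn⟩ : ∃ n, Nat.find h = n + 1 := Nat.exists_eq_succ_of_ne_zero fun h0 => by
    have := Nat.find_spec h
    rw [h0] at this
    simp [c] at this
  have h1 : c n ≤ k.val := not_lt.1 (Nat.find_min h (by omega))
  have h2 : k.val < c (n + 1) := hn ▸ Nat.find_spec h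
  have hnm : n < m := by
    by_contra hm
    have : c (n + 1) = c n := Finset.sum_congr rfl fun b _ => by
      rw [if_pos (by omega), if_pos (by omega)]
    omega
  refine ⟨⟨n, hnm⟩, h1, h2.trans_le (le_of_eq ?_)⟩
  have h : β ⟨n, hnm⟩ = ∑ c : Fin m, if c = ⟨n, hnm⟩ then β c else 0 := by simp
  rw [h, blockStart, ← Finset.sum_add_distrib]
  refine Finset.sum_congr rfl fun b _ => ?_
  rcases lt_trichotomy b.val n with hb | hb | hb
  · rw [if_pos (by omega), if_pos (show b < ⟨n, hnm⟩ from hb),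
      if_neg (fun e => by rw [e] at hb; exact lt_irrefl _ hb), add_zero]
  · rw [if_pos (by omega), if_neg (show ¬ b < ⟨n, hnm⟩ from hb.not_lt), if_pos (Fin.ext hb), zero_add]
  · rw [if_neg (by omega), if_neg (show ¬ b < ⟨n, hnm⟩ from hb.not_gt),
      if_neg (fun e => by rw [e] at hb; exact lt_irrefl _ hb)]

/-- `J` sends each index to its block. -/
def IsBlockFun (β : Fin m → ℕ) (J : Fin N → Fin m) : Prop := ∀ k, InBlock β (J k) k

theorem exists_isBlockFun (hβ : ∑ a, β a = N) : ∃ J : Fin N → Fin m, IsBlockFun β J :=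
  ⟨fun k => (exists_inBlock hβ k).choose, fun k => (exists_inBlock hβ k).choose_spec⟩

namespace IsBlockFun

variable {J : Fin N → Fin m} (hJ : IsBlockFun β J)

include hJ

theorem monotone : Monotone J := fun k l hkl => by
  by_contra! h
  have h1 := blockStart_add_le (β := β) h
  have h2 := (hJ k).1
  have h3 := (hJ l).2
  have : k.val ≤ l.val := hkl
  omega

theorem inBlock_iff {k : Fin N} {a : Fin m} : InBlock β a k ↔ J k = a := by
  refine ⟨fun h => ?_, fun h => h ▸ hJ k⟩
  have h1 := hJ k
  rcases lt_trichotomy (J k) a with h2 | h2 | h2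
  · have := blockStart_add_le (β := β) h2
    have := h1.2
    have := h.1
    omega
  · exact h2
  · have := blockStart_add_le (β := β) h2
    have := h1.1
    have := h.2
    omega

theorem sum_fiber (hβ : ∑ a, β a = N) {M : Type} [AddCommMonoid M] (F : ℕ → M) (a : Fin m) :
    ∑ j : Fin N with J j = a, F j.val = ∑ q ∈ Finset.range (β a), F (blockStart β a + q) := by
  have hN := blockStart_add_le_sum (β := β) a
  rw [hβ] at hN
  symm
  refine Finset.sum_bij (fun q hq => ⟨blockStart β a + q, by
    have := Finset.mem_range.1 hq
    omega⟩) (fun q hq => ?_) (fun q _ q' _ h => ?_) (fun k hk => ?_) (fun _ _ => rfl)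
  · rw [Finset.mem_filter, ← hJ.inBlock_iff]
    have := Finset.mem_range.1 hq
    exact ⟨Finset.mem_univ _, by simp only [InBlock]; omega⟩
  · have := congrArg Fin.val h
    simp only at this
    omega
  · rw [Finset.mem_filter, ← hJ.inBlock_iff] at hk
    exact ⟨k.val - blockStart β a, Finset.mem_range.2 (by have := hk.2.1; have := hk.2.2; omega),
      Fin.ext (by have := hk.2.1; simp only; omega)⟩

theorem card_fiber (hβ : ∑ a, β a = N) (a : Fin m) :
    (Finset.univ.filter fun j : Fin N => J j = a).card = β a := by
  rw [Finset.card_eq_sum_ones, hJ.sum_fiber hβ (fun _ => 1) a]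
  simp

/-- Induction on the distance by `(k j)(i k)(k j) = (i j)` with `k` next to `j`. Blocks are
intervals, so `k` lies in the same block. -/
theorem swap_mem_parabolic (d : ℕ) : ∀ {i j : Fin N}, i.val + d + 1 = j.val → J i = J j →
    Equiv.swap i j ∈ parabolic N β := by
  induction d with
  | zero =>
    intro i j hd hij
    exact Subgroup.subset_closure ⟨i, j, ⟨hd, J i, hJ i, hij ▸ hJ j⟩, rfl⟩
  | succ d ih =>
    intro i j hd hij
    obtain ⟨k, hk⟩ : ∃ k : Fin N, k.val = i.val + d + 1 :=
      ⟨⟨i.val + d + 1, by have := j.isLt; omega⟩, rfl⟩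
    have h1 : J i ≤ J k := hJ.monotone (Fin.le_def.2 (by omega))
    have h2 : J k ≤ J j := hJ.monotone (Fin.le_def.2 (by omega))
    have h3 : J i = J k := le_antisymm h1 (hij ▸ h2)
    have hik : i ≠ k := fun e => by rw [e] at hk; omega
    have hij' : i ≠ j := fun e => by rw [e] at hd; omega
    have h4 : Equiv.swap k j ∈ parabolic N β :=
      Subgroup.subset_closure ⟨k, j, ⟨by omega, J k, hJ k, h3 ▸ hij ▸ hJ j⟩, rfl⟩
    rw [Equiv.swap_comm i j, ← Equiv.swap_mul_swap_mul_swap hik hij']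
    exact Subgroup.mul_mem _ (Subgroup.mul_mem _ h4 (ih hk.symm h3)) h4

/-- Identifies cosets of the parabolic subgroup with rearrangements of the block function, which
label the basis of the coinvariants. -/
theorem mem_parabolic_iff (σ : Equiv.Perm (Fin N)) : σ ∈ parabolic N β ↔ J ∘ σ = J := by
  constructor
  · intro h
    induction h using Subgroup.closure_induction with
    | mem s hs =>
      obtain ⟨i, j, ⟨-, a, hi, hj⟩, rfl⟩ := hs
      rw [hJ.inBlock_iff] at hi hj
      funext k
      rw [Function.comp_apply, Equiv.swap_apply_def]
      split_ifs with h1 h2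
      · rw [h1, hi, hj]
      · rw [h2, hi, hj]
      · rfl
    | one => rfl
    | mul x y _ _ hx hy => rw [Equiv.Perm.coe_mul, ← Function.comp_assoc, hx, hy]
    | inv x _ hx =>
      conv_lhs => rw [← hx]
      funext k
      simp
  -- Conversely, multiplying by the transposition of `i` and `σ i`, two indices of the same block,
  -- reduces the support.
  · generalize hn : σ.support.card = n
    induction n using Nat.strong_induction_on generalizing σ with
    | _ n ih =>
      intro h
      by_cases h1 : σ = 1
      · rw [h1]
        exact Subgroup.one_mem _
      · obtain ⟨i, hi⟩ : ∃ i, σ i ≠ i := by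
          by_contra! h2
          exact h1 (Equiv.ext h2)
        have hJi : J (σ i) = J i := congrFun h i
        have hs : Equiv.swap i (σ i) ∈ parabolic N β := by
          rcases lt_trichotomy i (σ i) with h2 | h2 | h2
          · have : i.val < (σ i).val := h2
            exact hJ.swap_mem_parabolic ((σ i).val - i.val - 1) (by omega) hJi.symm
          · exact absurd h2.symm hi
          · have : (σ i).val < i.val := h2
            rw [Equiv.swap_comm]
            exact hJ.swap_mem_parabolic (i.val - (σ i).val - 1) (by omega) hJi
        have hk := ih _ (hn ▸ Equiv.Perm.card_support_swap_mul hi) (Equiv.swap i (σ i) * σ) rfl (by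
          funext k
          rw [Function.comp_apply, Equiv.Perm.mul_apply, Equiv.swap_apply_def]
          have hk : J (σ k) = J k := congrFun h k
          split_ifs with h2 h3
          · rw [hJi, ← hk, h2]
          · rw [← hk, h3, hJi]
          · exact hk)
        have := Subgroup.mul_mem _ hs hk
        rwa [← mul_assoc, Equiv.swap_mul_self, one_mul] at this

theorem exists_perm {J' : Fin N → Fin m} (hβ : ∑ a, β a = N)
    (h : ∀ a, (Finset.univ.filter fun j : Fin N => J' j = a).card = β a) :
    ∃ σ : Equiv.Perm (Fin N), J ∘ σ.symm = J' := by
  have e : ∀ a, Nonempty ({k // J' k = a} ≃ {k // J k = a}) := fun a => by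
    rw [← Fintype.card_eq, Fintype.card_subtype, Fintype.card_subtype, h, hJ.card_fiber hβ]
  refine ⟨(Equiv.ofFiberEquiv fun a => (e a).some).symm, funext fun k => ?_⟩
  exact Equiv.ofFiberEquiv_map _ k

theorem blockVector_eq : blockVector N β = tensorBasis N m J := by
  rw [tensorBasis_apply, blockVector]
  congr 1
  funext k a
  rw [Pi.single_apply]
  split_ifs with h1 h2 h2
  · rfl
  · exact absurd (hJ.inBlock_iff.1 h1).symm h2
  · exact absurd (hJ.inBlock_iff.2 h2.symm) h1
  · rfl

theorem zetaBar_eq (mu : Weight m) (k : Fin N) :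
    zetaBar N mu β k = mu.coord (J k) + ((k.val - blockStart β (J k) : ℕ) : ℂ) - (J k).val +
      ((m : ℂ) ^ 2 - N) / (2 * m) := by
  have hk := hJ k
  rw [zetaBar, Finset.sum_eq_single (J k), Finset.sum_eq_single (k.val - blockStart β (J k)),
    if_pos (by have := hk.1; omega)]
  · ring
  · intro q _ hq
    exact if_neg (by have := hk.1; omega)
  · intro h
    exact absurd (Finset.mem_range.2 (by have := hk.1; have := hk.2; omega)) h
  · intro a _ ha
    refine Finset.sum_eq_zero fun q hq => if_neg fun e => ha ?_
    rw [eq_comm, ← hJ.inBlock_iff]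
    have := Finset.mem_range.1 hq
    exact ⟨by omega, by omega⟩
  · exact fun h => absurd (Finset.mem_univ _) h

/-- Two consecutive indices of one block have the same `a` and positions differing by one. -/
theorem zeta_mem_dualBeta (ℓ : ℂ) (mu : Weight m) : zeta N ℓ mu β ∈ dualBeta N β := by
  rintro i j ⟨hij, a, hi, hj⟩
  change ∑ k, zetaBar N mu β k * (Pi.single i (1 : ℂ) - Pi.single j (1 : ℂ) : Fin N → ℂ) k +
    (ℓ + m) * 0 = -1
  have h : ∀ k, zetaBar N mu β k * (Pi.single i (1 : ℂ) - Pi.single j (1 : ℂ) : Fin N → ℂ) k =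
      (if k = i then zetaBar N mu β k else 0) - if k = j then zetaBar N mu β k else 0 := by
    intro k
    simp only [Pi.sub_apply, Pi.single_apply, mul_sub, mul_ite, mul_one, mul_zero]
  have hi1 := hi.1
  have e : j.val - blockStart β a = (i.val - blockStart β a) + 1 := by omega
  rw [hJ.inBlock_iff] at hi hj
  rw [Finset.sum_congr rfl fun k _ => h k, Finset.sum_sub_distrib, Finset.sum_ite_eq',
    Finset.sum_ite_eq', if_pos (Finset.mem_univ _), if_pos (Finset.mem_univ _), hJ.zetaBar_eq,
    hJ.zetaBar_eq, hi, hj, e]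
  push_cast
  ring

end IsBlockFun

theorem sum_range_half (n q : ℕ) (hq : q < n) :
    ∑ i ∈ (Finset.range n).erase q, (if i < q then (1 / 2 : ℂ) else -(1 / 2)) =
      q - ((n : ℂ) - 1) / 2 := by
  have h : ∀ n, q < n → ∑ i ∈ Finset.range n, (if i < q then (1 / 2 : ℂ) else -(1 / 2)) =
      q - (n : ℂ) / 2 := by
    intro n hn
    rw [← Finset.sum_filter_add_sum_filter_not _ (fun i => i < q),
      Finset.sum_congr rfl (g := fun _ => (1 / 2 : ℂ)) (fun i hi => if_pos (Finset.mem_filter.1 hi).2),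
      Finset.sum_congr (s₁ := (Finset.range n).filter fun i => ¬ i < q) rfl
        (g := fun _ => (-(1 / 2) : ℂ)) (fun i hi => if_neg (Finset.mem_filter.1 hi).2),
      Finset.sum_const, Finset.sum_const]
    have h1 : (Finset.range n).filter (fun i => i < q) = Finset.range q := by
      ext i
      simp only [Finset.mem_filter, Finset.mem_range]
      omega
    have h2 := Finset.card_filter_add_card_filter_not (s := Finset.range n) (fun i => i < q)
    rw [h1, Finset.card_range, Finset.card_range] at h2
    rw [h1, Finset.card_range]
    have h3 : ((((Finset.range n).filter fun i => ¬ i < q).card : ℕ) : ℂ) = n - q := by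
      rw [eq_sub_iff_add_eq', ← Nat.cast_add, h2]
    simp only [nsmul_eq_mul]
    rw [h3]
    ring
  have h1 := Finset.sum_erase_add (Finset.range n) (fun i => if i < q then (1 / 2 : ℂ) else -(1 / 2))
    (Finset.mem_range.2 hq)
  rw [h n hq, if_neg (lt_irrefl q)] at h1
  linear_combination h1

end Blocks

/-! ### Weights of the tensor power and the eigenvalue formula -/

section Weights

variable {N m : ℕ} {lam mu : Weight m} {β : Fin m → ℕ}

/-- The Gram matrix of the weights `ebar_a` is `δ - 1/m`, and the parts of `β` add up to `N`. -/
theorem IsBeta.coord (h : IsBeta N lam mu β) (a : Fin m) :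
    lam.coord a - mu.coord a = β a - (N : ℂ) / m := by
  have h1 := LinearMap.congr_fun h.2 (AffineSl.cartanUnit a)
  have h2 : ∀ b : Fin m, ((β b : ℂ) • eBar b) (AffineSl.cartanUnit a) =
      β b * ((if a = b then 1 else 0) - 1 / (m : ℂ)) := fun b => by
    rw [← slUnit_diag]
    rfl
  rw [LinearMap.sum_apply, Finset.sum_congr rfl fun b _ => h2 b] at h1
  refine (h1 : lam.coord a - mu.coord a = _).trans ?_
  simp only [mul_sub, mul_ite, mul_one, mul_zero, Finset.sum_sub_distrib]
  rw [Finset.sum_ite_eq, if_pos (Finset.mem_univ _), ← Finset.sum_mul, ← Nat.cast_sum, h.1,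
    mul_one_div]

/-- The weights `ebar_a` satisfy one linear relation, that their sum is zero; prescribing the total
`N` removes this ambiguity, as the coordinates show. -/
theorem IsBeta.unique {β' : Fin m → ℕ} (h : IsBeta N lam mu β) (h' : IsBeta N lam mu β') :
    β = β' := funext fun a => by
  have h1 := (h.coord a).symm.trans (h'.coord a)
  exact_mod_cast (sub_left_injective h1 : (β a : ℂ) = β' a)

theorem tensorWeight_eq (J : Fin N → Fin m) : tensorWeight J =
    ∑ a, (((Finset.univ.filter fun j : Fin N => J j = a).card : ℕ) : ℂ) • eBar a := by
  rw [tensorWeight, ← Finset.sum_fiberwise (s := Finset.univ) (g := J)]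
  refine Finset.sum_congr rfl fun a _ => ?_
  rw [Finset.sum_congr rfl (g := fun _ => eBar a) (fun i hi => by rw [(Finset.mem_filter.1 hi).2]),
    Finset.sum_const, Nat.cast_smul_eq_nsmul]

theorem isBeta_of_tensorWeight {J : Fin N → Fin m} (h : lam.bar - mu.bar = tensorWeight J) :
    IsBeta N lam mu fun a => (Finset.univ.filter fun j : Fin N => J j = a).card := by
  refine ⟨?_, h.trans (tensorWeight_eq J)⟩
  rw [← Finset.card_eq_sum_card_fiberwise (fun _ _ => Finset.mem_univ _), Finset.card_univ,
    Fintype.card_fin]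

theorem IsBeta.eq_tensorWeight (h : IsBeta N lam mu β) {J : Fin N → Fin m} (hJ : IsBlockFun β J) :
    lam.bar - mu.bar = tensorWeight J := by
  rw [h.2, tensorWeight_eq]
  exact Finset.sum_congr rfl fun a _ => by rw [hJ.card_fiber h.1]

theorem slotAct_sum_tensorBasis (h : CartanBar m) (J : Fin N → Fin m) :
    (∑ i : Fin N, slotAct i h.val.val) (tensorBasis N m J) = tensorWeight J h • tensorBasis N m J := by
  rw [LinearMap.sum_apply, tensorWeight, LinearMap.sum_apply, Finset.sum_smul]
  exact Finset.sum_congr rfl fun i _ => slotHom_diag i _ h.2 J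

/-- The `e_J` form a basis of weight vectors, so the weights are read off from any nonzero
coordinate. -/
theorem mem_wtTensorPow_iff {χ : Module.Dual ℂ (CartanBar m)} :
    χ ∈ wtTensorPow N m ↔ ∃ J : Fin N → Fin m, χ = tensorWeight J := by
  constructor
  · rintro ⟨v, hv, h⟩
    obtain ⟨J, hJ⟩ : ∃ J, (tensorBasis N m).repr v J ≠ 0 := by
      by_contra! h0
      exact hv ((tensorBasis N m).repr.map_eq_zero_iff.1 (Finsupp.ext h0))
    refine ⟨J, LinearMap.ext fun x => ?_⟩
    have h1 : (tensorBasis N m).coord J ∘ₗ (∑ i : Fin N, slotAct i x.val.val) =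
        tensorWeight J x • (tensorBasis N m).coord J := (tensorBasis N m).ext fun J' => by
      rw [LinearMap.comp_apply, slotAct_sum_tensorBasis, map_smul, LinearMap.smul_apply,
        Module.Basis.coord_apply, Module.Basis.repr_self, Finsupp.single_apply]
      split_ifs with e
      · rw [e]
      · rw [smul_zero, smul_zero]
    have h2 := LinearMap.congr_fun h1 v
    rw [LinearMap.comp_apply, h, map_smul] at h2
    exact mul_right_cancel₀ hJ h2
  · rintro ⟨J, rfl⟩
    exact ⟨tensorBasis N m J, (tensorBasis N m).ne_zero J, fun h => slotAct_sum_tensorBasis h J⟩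

/-- At position `q` (from `0`) of block `a` (from `0`), the mean of `λ_a` and `μ_a` is `μ_a + β_a/2
- N/(2m)`, the signs `±1/2` within the block give `q - (β_a - 1)/2`, and `ρ^∨` gives `(m - 1)/2 -
a`. The terms in `β_a` cancel and the constants add up to `(m² - N)/(2m)`. Counting both `q` and `a`
from `1` leaves `q - a` unchanged. -/
theorem IsBeta.vacEigenvalue_eq (h : IsBeta N lam mu β) (ℓ : ℂ) {J : Fin N → Fin m}
    (hJ : IsBlockFun β J) (ξ : TPrime N) : vacEigenvalue ℓ lam mu J ξ = zeta N ℓ mu β ξ := by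
  refine congrArg (· + (ℓ + m) * ξ.2) (Finset.sum_congr rfl fun k _ => congrArg (· * ξ.1 k) ?_)
  have hm : (m : ℂ) ≠ 0 := Nat.cast_ne_zero.2 (Nat.pos_iff_ne_zero.1 (J k).pos)
  have h1 := h.coord (J k)
  have hk := hJ k
  have h2 : ∑ j ∈ Finset.univ.erase k, (if J j = J k then if j < k then (1 / 2 : ℂ) else -(1 / 2)
      else 0) = ((k.val - blockStart β (J k) : ℕ) : ℂ) - ((β (J k) : ℂ) - 1) / 2 := by
    rw [← sum_range_half (β (J k)) (k.val - blockStart β (J k)) (by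
      have := hk.1; have := hk.2; omega)]
    -- The value `0` at `k` itself stands for erasing `k`, so that the sum over the fibre becomes a
    -- sum over positions in the block.
    have h3 := hJ.sum_fiber h.1 (fun j => if j = k.val then (0 : ℂ) else if j < k.val then 1 / 2
      else -(1 / 2)) (J k)
    rw [Finset.sum_filter] at h3
    rw [← Finset.filter_ne', Finset.sum_filter]
    refine (Finset.sum_congr rfl fun j _ => ?_).trans (h3.trans ?_)
    · rcases eq_or_ne j k with rfl | hj
      · simp
      · rw [if_pos hj, if_neg (Fin.val_ne_of_ne hj)]
        rfl
    · rw [← Finset.filter_ne', Finset.sum_filter]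
      refine Finset.sum_congr rfl fun q _ => ?_
      have := hk.1
      by_cases e : q = k.val - blockStart β (J k)
      · rw [if_pos (by omega), if_neg (by omega)]
      · rw [if_neg (by omega), if_pos e]
        exact if_congr (by omega) rfl rfl
  rw [h2, hJ.zetaBar_eq]
  field_simp at h1 ⊢
  linear_combination h1

end Weights

/-! ### Recognising the induced module by a basis -/

namespace InducedModule

variable {N m : ℕ} {β : Fin m → ℕ} {ζ : Module.Dual ℂ (TPrime N)}

theorem smul_one_eq_mkQ (h : DDAHA N) : h • one β ζ = (inducedIdeal β ζ).mkQ h := by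
  rw [one, ← map_smul, smul_eq_mul, mul_one]

theorem exists_smul_one (y : InducedModule β ζ) : ∃ h : DDAHA N, h • one β ζ = y := by
  obtain ⟨h, rfl⟩ := (inducedIdeal β ζ).mkQ_surjective y
  exact ⟨h, smul_one_eq_mkQ h⟩

theorem perm_smul_one {w : Equiv.Perm (Fin N)} (hw : w ∈ parabolic N β) :
    DDAHA.w (AffWeyl.perm w) • one β ζ = one β ζ := by
  rw [smul_one_eq_mkQ, one, ← sub_eq_zero, ← map_sub]
  exact (Submodule.Quotient.mk_eq_zero _).2 (Submodule.subset_span (Or.inl ⟨w, hw, rfl⟩))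

theorem t_smul_one (ξ : TPrime N) : DDAHA.t ξ • one β ζ = ζ ξ • one β ζ := by
  rw [← algebraMap_smul (DDAHA N) (ζ ξ) (one β ζ), smul_one_eq_mkQ, smul_one_eq_mkQ, ← sub_eq_zero,
    ← map_sub]
  exact (Submodule.Quotient.mk_eq_zero _).2 (Submodule.subset_span (Or.inr ⟨ξ, rfl⟩))

/-- The universal property of the induced module. -/
theorem exists_lift {M : Type} [AddCommGroup M] [Module ℂ M] (ρ : DDAHA N →ₐ[ℂ] Module.End ℂ M)
    (u : M) (hw : ∀ w ∈ parabolic N β, ρ (DDAHA.w (AffWeyl.perm w)) u = u)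
    (ht : ∀ ξ, ρ (DDAHA.t ξ) u = ζ ξ • u) :
    ∃ κ : InducedModule β ζ →ₗ[ℂ] M, ∀ h : DDAHA N, κ (h • one β ζ) = ρ h u := by
  let f : DDAHA N →ₗ[ℂ] M := LinearMap.applyₗ u ∘ₗ ρ.toLinearMap
  have hf : ∀ h, f h = ρ h u := fun _ => rfl
  have h0 : ∀ h ∈ inducedIdeal β ζ, f h = 0 := fun h hh => by
    refine Submodule.span_induction ?_ (map_zero f) (fun a b _ _ ha hb => by
      rw [map_add, ha, hb, add_zero]) (fun a b _ hb => ?_) hh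
    · rintro _ (⟨w, hw', rfl⟩ | ⟨ξ, rfl⟩)
      · rw [hf, map_sub, map_one, LinearMap.sub_apply, hw w hw', Module.End.one_apply, sub_self]
      · rw [hf, map_sub, AlgHom.commutes, LinearMap.sub_apply, ht, Module.algebraMap_end_apply,
          sub_self]
    · rw [hf, smul_eq_mul, map_mul, Module.End.mul_apply, ← hf b, hb, map_zero]
  refine ⟨((inducedIdeal β ζ).restrictScalars ℂ).liftQ f h0, fun h => ?_⟩
  rw [smul_one_eq_mkQ]
  rfl

/-- The induced module is spanned by the vectors `t_η w ⋅ 1_ζ`. -/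
theorem mem_span_orbit {f : Fin N} (hf : f.val = 0) (y : InducedModule β ζ) :
    y ∈ Submodule.span ℂ (Set.range fun x : AffWeyl N => DDAHA.w x • one β ζ) := by
  let φ : DDAHA N →ₐ[ℂ] Module.End ℂ (InducedModule β ζ) := Algebra.lsmul ℂ ℂ _
  let H : HeckePair N (Module.End ℂ (InducedModule β ζ)) := (HeckePair.universal N).map φ
  set S := Submodule.span ℂ (Set.range fun x : AffWeyl N => DDAHA.w x • one β ζ) with hS
  obtain ⟨h, rfl⟩ := exists_smul_one y
  refine DDAHA.smul_mem_of_generators φ S (fun x v hv => ?_) (fun ξ v hv => ?_) h _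
    (Submodule.subset_span ⟨1, by
      change DDAHA.w 1 • one β ζ = one β ζ
      rw [DDAHA.w_one, one_smul]⟩)
  · have h1 : S ≤ S.comap (φ (DDAHA.w x)) := Submodule.span_le.2 (by
      rintro _ ⟨x', rfl⟩
      refine Submodule.subset_span ⟨x * x', ?_⟩
      change DDAHA.w (x * x') • one β ζ = DDAHA.w x • DDAHA.w x' • one β ζ
      rw [DDAHA.w_mul, mul_smul])
    exact h1 hv
  · exact H.T_mem_span hf (v₀ := one β ζ) (ζ := ζ) t_smul_one ξ hv

/-- A module with a basis labelled by translations and rearrangements of the block function is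
isomorphic to the induced module. -/
theorem exists_unique_equiv {M : Type} [AddCommGroup M] [Module ℂ M]
    (ρ : DDAHA N →ₐ[ℂ] Module.End ℂ M) {f : Fin N} (hf : f.val = 0) {J : Fin N → Fin m}
    (hJ : IsBlockFun β J) (b : (Fin N → ℤ) × (Fin N → Fin m) → M)
    (hw : ∀ η w, ρ (DDAHA.w (AffWeyl.transl η * AffWeyl.perm w)) (b (0, J)) = b (η, J ∘ w.symm))
    (ht : ∀ ξ, ρ (DDAHA.t ξ) (b (0, J)) = ζ ξ • b (0, J))
    (hspan : ∀ v, v ∈ Submodule.span ℂ (Set.range b))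
    (hzero : ∀ x, (¬ ∃ σ : Equiv.Perm (Fin N), J ∘ σ.symm = x.2) → b x = 0)
    (hind : ∀ x, (∃ σ : Equiv.Perm (Fin N), J ∘ σ.symm = x.2) →
      ∃ F : M →ₗ[ℂ] ℂ, ∀ y, F (b y) = if y = x then 1 else 0) {u : M}
    (hu : u = b (0, J)) :
    ∃! e : M ≃ₗ[ℂ] InducedModule β ζ, (∀ h x, e (ρ h x) = h • e x) ∧ e u = one β ζ := by
  subst hu
  have hb : ∀ w ∈ parabolic N β, ρ (DDAHA.w (AffWeyl.perm w)) (b (0, J)) = b (0, J) := fun w hw' => by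
    have h1 := hw 0 w
    have h2 : J ∘ w.symm = J := (hJ.mem_parabolic_iff w⁻¹).1 (Subgroup.inv_mem _ hw')
    rwa [AffWeyl.transl_zero, one_mul, h2] at h1
  obtain ⟨κ, hκ⟩ := exists_lift ρ (b (0, J)) hb ht
  have hκs : ∀ h y, κ (h • y) = ρ h (κ y) := fun h y => by
    obtain ⟨h', rfl⟩ := exists_smul_one y
    rw [smul_smul, hκ, hκ, map_mul, Module.End.mul_apply]
  have hκ1 : κ (one β ζ) = b (0, J) := by
    have := hκ 1
    rwa [one_smul, map_one, Module.End.one_apply] at this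
  have hsurj : Function.Surjective κ := fun v => by
    rw [← LinearMap.mem_range]
    refine (Submodule.span_le.2 ?_ : Submodule.span ℂ (Set.range b) ≤ LinearMap.range κ) (hspan v)
    rintro _ ⟨⟨η, J'⟩, rfl⟩
    by_cases h : ∃ σ : Equiv.Perm (Fin N), J ∘ σ.symm = J'
    · obtain ⟨σ, rfl⟩ := h
      exact ⟨_, (hκ _).trans (hw η σ)⟩
    · rw [hzero _ h]
      exact Submodule.zero_mem _
  let ι : Type := {x : (Fin N → ℤ) × (Fin N → Fin m) // ∃ σ : Equiv.Perm (Fin N), J ∘ σ.symm = x.2}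
  -- A permutation is chosen for each rearrangement of `J`; by `hcw` below the vector does not
  -- depend on the choice, since two choices differ by an element of the parabolic subgroup fixing
  -- `1_ζ`.
  let c : ι → InducedModule β ζ := fun x =>
    DDAHA.w (AffWeyl.transl x.1.1 * AffWeyl.perm x.2.choose) • one β ζ
  have hc : ∀ x : ι, κ (c x) = b x.1 := fun x => by
    rw [hκ, hw, x.2.choose_spec]
  have hcw : ∀ η σ, DDAHA.w (AffWeyl.transl η * AffWeyl.perm σ) • one β ζ =
      c ⟨(η, J ∘ σ.symm), σ, rfl⟩ := fun η σ => by
    have h : ∃ σ' : Equiv.Perm (Fin N), J ∘ σ'.symm = J ∘ σ.symm := ⟨σ, rfl⟩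
    change _ = DDAHA.w (AffWeyl.transl η * AffWeyl.perm h.choose) • one β ζ
    have h1 := h.choose_spec
    set σ' := h.choose
    have h2 : σ'⁻¹ * σ ∈ parabolic N β := by
      rw [hJ.mem_parabolic_iff, Equiv.Perm.coe_mul, ← Function.comp_assoc]
      change (J ∘ σ'.symm) ∘ σ = J
      rw [h1, Function.comp_assoc, Equiv.symm_comp_self, Function.comp_id]
    have h3 : σ = σ' * (σ'⁻¹ * σ) := by rw [mul_inv_cancel_left]
    rw [h3, AffWeyl.perm_mul, ← mul_assoc, DDAHA.w_mul, mul_smul, perm_smul_one h2]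
  have hcspan : ∀ y, y ∈ Submodule.span ℂ (Set.range c) := fun y => by
    refine (Submodule.span_le.2 ?_ : Submodule.span ℂ (Set.range fun x : AffWeyl N =>
      DDAHA.w x • one β ζ) ≤ _) (mem_span_orbit hf y)
    rintro _ ⟨x, rfl⟩
    refine Submodule.subset_span ⟨_, (hcw (Multiplicative.toAdd x.left) x.right).symm.trans ?_⟩
    rw [AffWeyl.transl_mul_perm]
  have hinj : Function.Injective κ := by
    rw [← LinearMap.ker_eq_bot, LinearMap.ker_eq_bot']
    intro y hy
    -- An element of the kernel is a combination of the spanning vectors `c x`, whose images `b x`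
    -- are separated by functionals; so all coefficients vanish.
    obtain ⟨a, rfl⟩ := Finsupp.mem_span_range_iff_exists_finsupp.1 (hcspan y)
    have ha : a = 0 := by
      refine Finsupp.ext fun x => ?_
      obtain ⟨F, hF⟩ := hind x.1 x.2
      have h1 := congrArg F hy
      rw [map_finsuppSum, map_finsuppSum, map_zero, Finsupp.sum, Finset.sum_congr rfl
        (g := fun i => if i = x then a i else 0) fun i _ => by
          rw [map_smul, map_smul, hc, hF, smul_eq_mul, mul_ite, mul_one, mul_zero]
          exact if_congr Subtype.ext_iff.symm rfl rfl] at h1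
      rw [Finset.sum_ite_eq'] at h1
      split_ifs at h1 with h2
      · exact h1
      · exact Finsupp.notMem_support_iff.1 h2
    rw [ha, Finsupp.sum_zero_index]
  let e := (LinearEquiv.ofBijective κ ⟨hinj, hsurj⟩).symm
  have he : ∀ y, e (κ y) = y := fun y => LinearEquiv.ofBijective_symm_apply_apply κ y
  have he' : ∀ v, κ (e v) = v := fun v =>
    (LinearEquiv.ofBijective κ ⟨hinj, hsurj⟩).apply_symm_apply v
  refine ⟨e, ⟨fun h x => ?_, ?_⟩, fun e' ⟨h1, h2⟩ => LinearEquiv.ext fun v => ?_⟩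
  · refine hinj ?_
    rw [he', hκs, he']
  · rw [← hκ1, he]
  · obtain ⟨y, rfl⟩ := hsurj v
    obtain ⟨h, rfl⟩ := exists_smul_one y
    rw [he, hκ, h1, h2]

end InducedModule

/-! ### Proof of the isomorphism -/

section Main

variable {N m : ℕ} {ℓ : ℂ} {lam mu : Weight m}

theorem vacMk_mem_span (v : MModule N lam mu) :
    v ∈ Submodule.span ℂ (Set.range fun x => vacMk lam mu N (slotBasis N m x)) := by
  obtain ⟨w, rfl⟩ := vacMk_surjective lam mu v
  rw [Set.range_comp', ← Submodule.map_span, (slotBasis N m).span_eq]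
  exact Submodule.mem_map_of_mem Submodule.mem_top

theorem uVector_eq {β : Fin m → ℕ} {J : Fin N → Fin m} (hJ : IsBlockFun β J) :
    uVector N lam mu β = vacMk lam mu N (slotBasis N m (0, J)) := by
  rw [uVector, hJ.blockVector_eq, slotBasis_apply, expMon_zero]
  rfl

theorem subsingleton_of_not_mem (h : lam.bar - mu.bar ∉ wtTensorPow N m) :
    Subsingleton (MModule N lam mu) := by
  refine subsingleton_of_forall_eq 0 fun v => ?_
  have h1 : Submodule.span ℂ (Set.range fun x => vacMk lam mu N (slotBasis N m x)) ≤ ⊥ :=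
    Submodule.span_le.2 (by
      rintro _ ⟨x, rfl⟩
      exact vacMk_eq_zero lam mu x fun e => h (mem_wtTensorPow_iff.2 ⟨x.2, e⟩))
  exact h1 (vacMk_mem_span v)

theorem exists_unique_isBeta (h : lam.bar - mu.bar ∈ wtTensorPow N m) :
    ∃! β : Fin m → ℕ, IsBeta N lam mu β := by
  obtain ⟨J, hJ⟩ := mem_wtTensorPow_iff.1 h
  exact ⟨_, isBeta_of_tensorWeight hJ, fun β hβ => hβ.unique (isBeta_of_tensorWeight hJ)⟩

theorem IsBeta.exists_unique_equiv {ρ : DDAHA N →ₐ[ℂ] Module.End ℂ (MModule N lam mu)}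
    (hρ : IsHeckeAction ℓ (HighestVerma mu) (LowestVerma lam) ρ) (hm : (m : ℂ) ≠ 0) {f : Fin N}
    (hf : f.val = 0) (hlam : lam.level = ℓ) (hmu : mu.level = ℓ) {β : Fin m → ℕ}
    (hβ : IsBeta N lam mu β) {J : Fin N → Fin m} (hJ : IsBlockFun β J) :
    ∃! e : MModule N lam mu ≃ₗ[ℂ] InducedModule β (zeta N ℓ mu β),
      (∀ (h : DDAHA N) (x : MModule N lam mu), e (ρ h x) = h • e x) ∧
      e (uVector N lam mu β) = InducedModule.one β (zeta N ℓ mu β) := by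
  -- A sequence of weight `λ - μ` has the multiplicities of `β`, hence is a rearrangement of the
  -- block function; so the nonzero classes are exactly those labelled by cosets of the parabolic
  -- subgroup.
  have hperm : ∀ {J' : Fin N → Fin m}, lam.bar - mu.bar = tensorWeight J' →
      ∃ σ : Equiv.Perm (Fin N), J ∘ σ.symm = J' := fun {J'} h =>
    hJ.exists_perm hβ.1 fun a => congrFun ((isBeta_of_tensorWeight h).unique hβ) a
  exact InducedModule.exists_unique_equiv ρ hf hJ (fun x => vacMk lam mu N (slotBasis N m x))
    (fun η w => hρ.w_vacMk hlam hmu η w J)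
    (fun ξ => (hρ.t_vacMk hlam hmu hm ξ hJ.monotone).trans
      (congrArg (· • _) (hβ.vacEigenvalue_eq ℓ hJ ξ)))
    vacMk_mem_span (fun x hx => vacMk_eq_zero lam mu x fun h => hx (hperm h))
    (fun x ⟨σ, hσ⟩ => by
      obtain ⟨F, hF⟩ := exists_vacMk_functional lam mu (hlam.trans hmu.symm) x (by
        rw [hβ.eq_tensorWeight hJ, ← hσ]
        exact (Equiv.sum_comp σ.symm fun i => eBar (J i)).symm)
      exact ⟨F, fun y => (hF _).trans (by rw [Module.Basis.repr_self, Finsupp.single_apply])⟩)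
    (uVector_eq hJ)

end Main

end KZHecke

end

theorem mainTheorem7 (m N : ℕ) (hm : 1 ≤ m) (hN : 1 ≤ N) (ℓ : ℂ) (lam mu : KZHecke.Weight m)
    (hlam : lam.level = ℓ) (hmu : mu.level = ℓ) :
    (∃! ρ : KZHecke.DDAHA N →ₐ[ℂ] Module.End ℂ (KZHecke.MModule N lam mu),
      KZHecke.IsHeckeAction ℓ (KZHecke.HighestVerma mu) (KZHecke.LowestVerma lam) ρ) ∧
    ∀ ρ : KZHecke.DDAHA N →ₐ[ℂ] Module.End ℂ (KZHecke.MModule N lam mu),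
      KZHecke.IsHeckeAction ℓ (KZHecke.HighestVerma mu) (KZHecke.LowestVerma lam) ρ →
      (lam.bar - mu.bar ∈ KZHecke.wtTensorPow N m →
        (∃! β : Fin m → ℕ, KZHecke.IsBeta N lam mu β) ∧
        ∀ β : Fin m → ℕ, KZHecke.IsBeta N lam mu β →
          KZHecke.zeta N ℓ mu β ∈ KZHecke.dualBeta N β ∧
          ∃! e : KZHecke.MModule N lam mu ≃ₗ[ℂ]
              KZHecke.InducedModule β (KZHecke.zeta N ℓ mu β),
            (∀ (h : KZHecke.DDAHA N) (x : KZHecke.MModule N lam mu), e (ρ h x) = h • e x) ∧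
            e (KZHecke.uVector N lam mu β) =
              KZHecke.InducedModule.one β (KZHecke.zeta N ℓ mu β)) ∧
      (lam.bar - mu.bar ∉ KZHecke.wtTensorPow N m → Subsingleton (KZHecke.MModule N lam mu)) := by
  have hm' : (m : ℂ) ≠ 0 := Nat.cast_ne_zero.2 (by omega)
  have hf : (⟨0, hN⟩ : Fin N).val = 0 := rfl
  refine ⟨KZHecke.exists_unique_heckeAction hm' hf hlam hmu, fun ρ hρ => ⟨fun h =>
    ⟨KZHecke.exists_unique_isBeta h, fun β hβ => ?_⟩, KZHecke.subsingleton_of_not_mem⟩⟩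
  obtain ⟨J, hJ⟩ := KZHecke.exists_isBlockFun hβ.1
  exact ⟨hJ.zeta_mem_dualBeta ℓ mu, hβ.exists_unique_equiv hρ hm' hf hlam hmu hJ⟩
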